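/- Throughout, 2-categories and 2-functors are strict, and all 2-categories are small (relative to a fixed universe). Composites of 1-cells are described in words: "$p$ followed by $q$". **Gray tensor product.** For 2-categories $A,B$ the Gray tensor product $A\otimes B$ is the 2-category with objects the pairs $a\otimes b$; with 1-cells generated by $f\otimes 1:a\otimes b\to a'\otimes b$ and $1\otimes g:a\otimes b\to a\otimes b'$, subject to functoriality in $f$ (for fixed $b$) and in $g$ (for fixed $a$); and with 2-cells generated by $\alpha\otimes 1$, $1\otimes\delta$ and invertible interchange 2-cells $\Sigma_{f,g}$ between the two composites of $f\otimes1$ and $1\otimes g$ from $a\otimes b$ to $a'\otimes b'$, subject to functoriality of $\alpha\otimes1$ and $1\otimes\delta$, to naturality of $\Sigma_{f,g}$ in 2-cells and to compatibility of $\Sigma_{f,g}$ with composition and identities in $f$ and in $g$. It makes the category $\mathbf{2Cat}$ of 2-categories and 2-functors a symmetric monoidal category, with symmetry $\tau:A\otimes B\to B\otimes A$, $\tau(a\otimes b)=b\otimes a$, $\tau(f\otimes 1)=1\otimes f$, $\tau(1\otimes g)=g\otimes1$, $\tau(\Sigma_{f,g})=\Sigma_{g,f}^{-1}$. A *Gray-monoid*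 is a monoid $(C,\oplus,e)$ in $(\mathbf{2Cat},\otimes)$. **Permutative Gray-monoids.** A permutative Gray-monoid is a Gray-monoid $(C,\oplus:C\otimes C\to C,e)$ with a 2-natural isomorphism $\beta:\oplus\Rightarrow\oplus\circ\tau$ such that 1. $\beta$ followed by $\beta\tau$ is the identity of $\oplus$; 2. the restriction of $\beta$ to $\{e\}\otimes C$ is the identity transformation of $\mathrm{id}_C$; 3. $\beta_{x,\,y\oplus z}$ is $\beta_{x,y}\oplus z$ followed by $y\oplus\beta_{x,z}$; as an equality of transformations between 2-functors on $C\otimes C\otimes C$: $\beta\circ(\mathrm{id}\otimes\oplus)$ is the pasting of $\oplus\circ(\beta\otimes\mathrm{id})$ with $(\oplus\circ(\mathrm{id}\otimes\beta))\circ(\tau\otimes\mathrm{id})$. A *strict functor* of permutative Gray-monoids $C\to D$ is a 2-functor $F:C\to D$ with $F(e)=e$, $\oplus\circ(F\otimes F)=F\circ\oplus$ and $F\beta=\beta(F\otimes F)$. These form a category $\mathbf{PGM}$. **Cubical functors.** A pseudofunctor $F:A\times B\to D$ is *cubical* if its unit comparison 2-cells are identities and, for composable $(f_1,f_2)$ followed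 by $(g_1,g_2)$, the comparison 2-cell between the composite of $F(f_1,f_2)$ followed by $F(g_1,g_2)$ and the value of $F$ on the composite is an identity whenever $f_2$ or $g_1$ is an identity. It has interchange isomorphisms $\Sigma_{f,g}$, obtained from the comparison 2-cells, from $F(1,g)$ followed by $F(f,1)$ to $F(f,1)$ followed by $F(1,g)$. **Quasi-strict symmetric monoidal 2-categories.** Such an object consists of a 2-category $C$, a cubical functor $+:C\times C\to C$ and an object $e$ which are strictly associative and unital (a Gray-monoid with cubical multiplication), together with a strict symmetric structure in the sense of Crans: * a pseudonatural equivalence $b$ with components $b_{x,y}:x+y\to y+x$; * an invertible modification $R_{-|--}$ from $b_{x,y+z}$ to "$b_{x,y}+z$ followed by $y+b_{x,z}$", an invertible modification $R_{--|-}$ from $b_{x+y,z}$ to "$x+b_{y,z}$ followed by $b_{x,z}+y$", and an invertible modification $v$ from "$b_{x,y}$ followed by $b_{y,x}$" to the identity; * subject to Crans' axioms for a braiding (coherence of $R_{-|--}$ for $b_{x,y+z+w}$, of $R_{--|-}$ for $b_{x+y+z,w}$, of both for $b_{x+y,z+w}$, and equality of the two Yang–Baxter 2-cells for $x,y,z$),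 for a syllepsis (compatibility of $v_{x,y+z}$ and $v_{x+y,z}$ with $R_{-|--}$, $R_{--|-}$ and the cells $v_{x,y},v_{x,z}$, respectively $v_{x,z},v_{y,z}$), for a symmetry (the 2-cells $v_{x,y}$ followed by the 1-cell $b_{x,y}$, and $b_{x,y}$ followed by $v_{y,x}$, are equal), and to the strict unit conditions ($b$ restricted to $\{e\}\times C$ and to $C\times\{e\}$ is the identity transformation, and components of $R_{-|--},R_{--|-},v$ with an argument equal to $e$ are identities); such that * (QS1) the modifications $R_{-|--}$, $R_{--|-}$ and $v$ are identities; * (QS2) the naturality 2-cells $b_{f,\mathrm{id}}$ and $b_{\mathrm{id},g}$ are identities for all 1-cells $f,g$; * (QS3) the interchange 2-cells $\Sigma_{b_{x,y},g}$ and $\Sigma_{f,b_{x,y}}$ are identities for all objects $x,y$ and 1-cells $f,g$. A *strict functor* between such objects is a 2-functor $F$ which strictly preserves all of the structure: $F(e)=e$, $+\circ(F\times F)=F\circ +$ as pseudofunctors, $Fb=b(F\times F)$, and $F$ sends the components of $R_{-|--},R_{--|-},v$ to the corresponding components. These form a category $\mathbf{qsSM2Cat}$. **Theorem.** There is an isomorphism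 of categories $$\mathbf{PGM}\;\cong\;\mathbf{qsSM2Cat}$$ which commutes with the forgetful functors to $\mathbf{2Cat}$, that is, which leaves the underlying 2-categories and 2-functors unchanged. -/

import Mathlib

open CategoryTheory Bicategory

universe u
set_option linter.unusedVariables false
set_option linter.unusedSectionVars false

namespace GrayPerm

/-! ### Generalities on strict 2-categories -/

section Strict2

variable {D : Type u} [Bicategory.{u, u} D] [Strict D]

lemma id_whisker {a b : D} {i : a ⟶ a} (hi : i = 𝟙 a) {f g : a ⟶ b} (η : f ⟶ g) :
    i ◁ η = eqToHom (by rw [hi, Strict.id_comp]) ≫ η ≫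
      eqToHom (by rw [hi, Strict.id_comp]) := by
  subst hi; simp [Strict.leftUnitor_eqToIso]

lemma whisker_id {a b : D} {i : b ⟶ b} (hi : i = 𝟙 b) {f g : a ⟶ b} (η : f ⟶ g) :
    η ▷ i = eqToHom (by rw [hi, Strict.comp_id]) ≫ η ≫
      eqToHom (by rw [hi, Strict.comp_id]) := by
  subst hi; simp [Strict.rightUnitor_eqToIso]

lemma comp_whisker {a b c d : D} {i : a ⟶ b} {j : b ⟶ c} {k : a ⟶ c} (hk : k = i ≫ j)
    {f g : c ⟶ d} (η : f ⟶ g) :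
    k ◁ η = eqToHom (by rw [hk, Strict.assoc]) ≫ i ◁ j ◁ η ≫
      eqToHom (by rw [hk, Strict.assoc]) := by
  subst hk; simp [Strict.associator_eqToIso]

lemma whisker_comp {a b c d : D} {i : a ⟶ b} {j : b ⟶ c} {k : a ⟶ c} (hk : k = i ≫ j)
    {f g : d ⟶ a} (η : f ⟶ g) :
    η ▷ k = eqToHom (by rw [hk, Strict.assoc]) ≫ (η ▷ i) ▷ j ≫
      eqToHom (by rw [hk, Strict.assoc]) := by
  subst hk; simp [Strict.associator_eqToIso]

variable {E : Type u} [Bicategory.{u, u} E]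

lemma strict_map₂_left (S : StrictPseudofunctor D E) {a b c : D} (f : a ⟶ b) {g g' : b ⟶ c}
    (η : g ⟶ g') {k k' : a ⟶ c} (h : k = f ≫ g) (h' : f ≫ g' = k') :
    S.map₂ (eqToHom h ≫ f ◁ η ≫ eqToHom h') =
      eqToHom ((congrArg S.map h).trans (S.map_comp f g)) ≫ S.map f ◁ S.map₂ η ≫
        eqToHom ((S.map_comp f g').symm.trans (congrArg S.map h')) := by
  subst h h'
  simp [StrictPseudofunctor.mapComp_eq_eqToIso]

lemma strict_map₂_right (S : StrictPseudofunctor D E) {a b c : D} {f f' : a ⟶ b}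
    (η : f ⟶ f') (g : b ⟶ c) {k k' : a ⟶ c} (h : k = f ≫ g) (h' : f' ≫ g = k') :
    S.map₂ (eqToHom h ≫ η ▷ g ≫ eqToHom h') =
      eqToHom ((congrArg S.map h).trans (S.map_comp f g)) ≫ S.map₂ η ▷ S.map g ≫
        eqToHom ((S.map_comp f' g).symm.trans (congrArg S.map h')) := by
  subst h h'
  simp [StrictPseudofunctor.mapComp_eq_eqToIso]

lemma strict_left (S : StrictPseudofunctor D E) {a b c : D} (f : a ⟶ b) {g g' : b ⟶ c}
    (η : g ⟶ g') :
    S.map₂ (f ◁ η) = eqToHom (S.map_comp f g) ≫ S.map f ◁ S.map₂ η ≫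
      eqToHom (S.map_comp f g').symm := by
  simp [StrictPseudofunctor.mapComp_eq_eqToIso]

lemma strict_right (S : StrictPseudofunctor D E) {a b c : D} {f f' : a ⟶ b}
    (η : f ⟶ f') (g : b ⟶ c) :
    S.map₂ (η ▷ g) = eqToHom (S.map_comp f g) ≫ S.map₂ η ▷ S.map g ≫
      eqToHom (S.map_comp f' g).symm := by
  simp [StrictPseudofunctor.mapComp_eq_eqToIso]

open scoped Pseudofunctor.StrongTrans in
/-- A constructor of transformations between 2-functors of strict 2-categories. -/
def strictTrans [Strict E] (S T : StrictPseudofunctor D E) (app : ∀ x, S.obj x ⟶ T.obj x)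
    (nat : ∀ {x y : D} (f : x ⟶ y), S.map f ≫ app y ≅ app x ≫ T.map f)
    (nat_nat : ∀ {x y : D} {f g : x ⟶ y} (η : f ⟶ g),
      S.map₂ η ▷ app y ≫ (nat g).hom = (nat f).hom ≫ app x ◁ T.map₂ η)
    (nat_id : ∀ x, (nat (𝟙 x)).hom = eqToHom (by simp only [S.map_id, T.map_id,
      Strict.id_comp, Strict.comp_id]))
    (nat_comp : ∀ {x y z : D} (f : x ⟶ y) (g : y ⟶ z), (nat (f ≫ g)).hom =
      eqToHom (by rw [S.map_comp, Strict.assoc]) ≫ S.map f ◁ (nat g).hom ≫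
        eqToHom (Strict.assoc _ _ _).symm ≫ (nat f).hom ▷ T.map g ≫
          eqToHom (by rw [T.map_comp, Strict.assoc])) :
    S.toPseudofunctor ⟶ T.toPseudofunctor where
  app := app
  naturality := nat
  naturality_naturality := nat_nat
  naturality_id x := by
    simp [nat_id, S.mapId_eq_eqToIso, T.mapId_eq_eqToIso, Strict.leftUnitor_eqToIso,
      Strict.rightUnitor_eqToIso]
  naturality_comp f g := by
    simp [nat_comp, S.mapComp_eq_eqToIso, T.mapComp_eq_eqToIso, Strict.associator_eqToIso]

lemma conj_nat {a b c d : D} {l l' m m' : a ⟶ b} {n n' o o' : c ⟶ d} {s s' : a ⟶ c}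
    {t t' : b ⟶ d} {η : l ⟶ m} {θ : n ⟶ o} {p : l ≫ t ≅ s ≫ n} {q : m ≫ t ≅ s ≫ o}
    (h : η ▷ t ≫ q.hom = p.hom ≫ s ◁ θ) (hl : l' = l) (hm : m' = m) (hn : n' = n) (ho : o' = o)
    (hs : s' = s) (ht : t' = t) {k₁ k₂ k₃ k₄ : a ⟶ d} (h₁ : k₁ = l' ≫ t') (h₂ : m' ≫ t' = k₂)
    (h₃ : k₃ = s' ≫ n') (h₄ : s' ≫ o' = k₄) (i₁ : k₂ = m ≫ t) (i₂ : s ≫ o = k₄) (i₃ : k₁ = l ≫ t)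
    (i₄ : s ≫ n = k₃) :
    (eqToHom h₁ ≫ (eqToHom hl ≫ η ≫ eqToHom hm.symm) ▷ t' ≫ eqToHom h₂) ≫
      eqToHom i₁ ≫ q.hom ≫ eqToHom i₂ = (eqToHom i₃ ≫ p.hom ≫ eqToHom i₄) ≫
      (eqToHom h₃ ≫ s' ◁ (eqToHom hn ≫ θ ≫ eqToHom ho.symm) ≫ eqToHom h₄) := by
  subst hl hm hn ho hs ht h₁ h₂ h₃ h₄
  simp [h]

lemma conj_comp {a b c a' b' c' : D} {l l' : a ⟶ b} {m m' : b ⟶ c} {n n' : a' ⟶ b'}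
    {o o' : b' ⟶ c'} {s s' : a ⟶ a'} {t t' : b ⟶ b'} {r r' : c ⟶ c'}
    {k : a ⟶ c} {j : a' ⟶ c'} (p : l ≫ t ≅ s ≫ n) (q : m ≫ r ≅ t ≫ o) (w : k ≫ r ≅ s ≫ j)
    (hk : k = l ≫ m) (hj : j = n ≫ o)
    (h : w.hom = eqToHom (by rw [hk, Strict.assoc]) ≫ l ◁ q.hom ≫
      eqToHom (Strict.assoc _ _ _).symm ≫ p.hom ▷ o ≫ eqToHom (by rw [hj, Strict.assoc]))
    (hl : l' = l) (hm : m' = m) (hn : n' = n) (ho : o' = o) (hs : s' = s) (ht : t' = t)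
    (hr : r' = r) {u₀ u₁ u₂ u₃ u₄ u₅ : a ⟶ c'} {v₁ v₂ : b ⟶ c'} {v₃ v₄ : a ⟶ b'}
    (i₀ : u₀ = k ≫ r) (i₅ : s ≫ j = u₅) (i₁ : u₀ = u₁) (i₂ : u₁ = l' ≫ v₁) (i₃ : v₁ = m ≫ r)
    (i₄ : t ≫ o = v₂) (i₆ : l' ≫ v₂ = u₂) (i₇ : u₂ = u₃) (i₈ : u₃ = v₃ ≫ o') (i₉ : v₃ = l ≫ t)
    (j₁ : s ≫ n = v₄) (j₂ : v₄ ≫ o' = u₄) (j₃ : u₄ = u₅) :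
    eqToHom i₀ ≫ w.hom ≫ eqToHom i₅ = eqToHom i₁ ≫
      (eqToHom i₂ ≫ l' ◁ (eqToHom i₃ ≫ q.hom ≫ eqToHom i₄) ≫ eqToHom i₆) ≫ eqToHom i₇ ≫
      (eqToHom i₈ ≫ (eqToHom i₉ ≫ p.hom ≫ eqToHom j₁) ▷ o' ≫ eqToHom j₂) ≫ eqToHom j₃ := by
  subst hk hj hl hm hn ho hs ht hr i₃ i₄ i₉ j₁ i₁ i₆ j₂ i₅ i₀
  simp [h]

end Strict2

/-! ### The locally fully faithful factorisation

Given a category `W`, a strict 2-category `D` and a functor `P` from `W` to the underlying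
category of `D`, the 2-category `Factor P` has the objects and the 1-cells of `W`, and its 2-cells
from `f` to `g` are the 2-cells of `D` from `P f` to `P g`. -/

section Factor

variable {W : Type u} [Category.{u} W] {D : Type u} [Bicategory.{u, u} D] [Strict D]

/-- Objects of the factorisation. -/
structure Factor (P : W ⥤ D) where
  base : W

namespace Factor

/-- 1-cells of the factorisation: the morphisms of `W`. -/
structure Hom₁ {P : W ⥤ D} (x y : Factor P) where
  word : x.base ⟶ y.base

variable {P : W ⥤ D}

/-- 2-cells of the factorisation: the 2-cells of `D` between the images. -/
structure Hom₂ {x y : Factor P} (f g : Hom₁ x y) where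
  val : P.map f.word ⟶ P.map g.word

instance : CategoryStruct (Factor P) where
  Hom x y := Hom₁ x y
  id x := ⟨𝟙 x.base⟩
  comp f g := ⟨f.word ≫ g.word⟩

instance homCat (x y : Factor P) : Category (x ⟶ y) where
  Hom f g := Hom₂ f g
  id f := ⟨𝟙 _⟩
  comp η θ := ⟨η.val ≫ θ.val⟩

section
variable {x y z w : Factor P}

@[simp] lemma id_word (x : Factor P) : (𝟙 x : x ⟶ x).word = 𝟙 x.base := rfl
@[simp] lemma comp_word (f : x ⟶ y) (g : y ⟶ z) : (f ≫ g).word = f.word ≫ g.word := rfl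
@[ext] lemma hom_ext {f g : x ⟶ y} {η θ : f ⟶ g} (h : η.val = θ.val) : η = θ :=
  congrArg Hom₂.mk h
@[simp] lemma id_val (f : x ⟶ y) : (𝟙 f : f ⟶ f).val = 𝟙 (P.map f.word) := rfl
@[simp] lemma comp_val {f g h : x ⟶ y} (η : f ⟶ g) (θ : g ⟶ h) :
    (η ≫ θ).val = η.val ≫ θ.val := rfl
@[simp] lemma eqToHom_val {f g : x ⟶ y} (h : f = g) :
    (eqToHom h).val = eqToHom (by rw [h]) := by
  cases h; rfl

lemma id_comp' (f : x ⟶ y) : 𝟙 x ≫ f = f := congrArg Hom₁.mk (Category.id_comp f.word)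
lemma comp_id' (f : x ⟶ y) : f ≫ 𝟙 y = f := congrArg Hom₁.mk (Category.comp_id f.word)
lemma assoc' (f : x ⟶ y) (g : y ⟶ z) (h : z ⟶ w) : (f ≫ g) ≫ h = f ≫ g ≫ h :=
  congrArg Hom₁.mk (Category.assoc f.word g.word h.word)

end

instance : Bicategory (Factor P) where
  homCategory := homCat
  whiskerLeft f g h η := Hom₂.mk (eqToHom (P.map_comp _ _) ≫ P.map f.word ◁ η.val ≫
    eqToHom (P.map_comp _ _).symm)
  whiskerRight η h := Hom₂.mk (eqToHom (P.map_comp _ _) ≫ η.val ▷ P.map h.word ≫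
    eqToHom (P.map_comp _ _).symm)
  leftUnitor f := eqToIso (id_comp' f)
  rightUnitor f := eqToIso (comp_id' f)
  associator f g h := eqToIso (assoc' f g h)
  id_whiskerLeft η := by ext; simp [id_whisker (P.map_id _)]
  comp_whiskerLeft f g _ _ η := by ext; simp [comp_whisker (P.map_comp _ _)]
  whiskerRight_id η := by ext; simp [whisker_id (P.map_id _)]
  whiskerRight_comp η g h := by ext; simp [whisker_comp (P.map_comp _ _)]
  whisker_assoc f _ _ η h := by ext; simp [Strict.associator_eqToIso]
  whisker_exchange η θ := by ext; simp [whisker_exchange_assoc]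

instance : Strict (Factor P) where
  id_comp := id_comp'
  comp_id := comp_id'
  assoc := assoc'

@[simp] lemma whiskerLeft_val {x y z : Factor P} (f : x ⟶ y) {g h : y ⟶ z} (η : g ⟶ h) :
    (f ◁ η).val = eqToHom (P.map_comp _ _) ≫ P.map f.word ◁ η.val ≫
      eqToHom (P.map_comp _ _).symm := rfl

@[simp] lemma whiskerRight_val {x y z : Factor P} {f g : x ⟶ y} (η : f ⟶ g) (h : y ⟶ z) :
    (η ▷ h).val = eqToHom (P.map_comp _ _) ≫ η.val ▷ P.map h.word ≫
      eqToHom (P.map_comp _ _).symm := rfl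

variable (P) in
/-- The canonical 2-functor from the factorisation. -/
def proj : StrictPseudofunctor (Factor P) D := StrictPseudofunctor.mk''
  { obj := fun x => P.obj x.base
    map := fun f => P.map f.word
    map₂ := fun η => η.val
    map₂_id := fun _ => rfl
    map₂_comp := fun _ _ => rfl
    map_id := fun x => P.map_id x.base
    map_comp := fun f g => P.map_comp f.word g.word
    map₂_whisker_left := fun _ _ _ _ => rfl
    map₂_whisker_right := fun _ _ => rfl }

variable {X : Type u} [Bicategory.{u, u} X] [Strict X]

variable (P X) in
/-- The data of a 2-functor from `X` into the factorisation: its values `word` on 1-cells and its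
composite, given by `map` and `map₂`, with the canonical 2-functor to `D`. -/
structure Lift where
  obj : X → W
  word {x y : X} : (x ⟶ y) → (obj x ⟶ obj y)
  word_id (x : X) : word (𝟙 x) = 𝟙 (obj x)
  word_comp {x y z : X} (f : x ⟶ y) (g : y ⟶ z) : word (f ≫ g) = word f ≫ word g
  map {x y : X} : (x ⟶ y) → (P.obj (obj x) ⟶ P.obj (obj y))
  map_eq {x y : X} (f : x ⟶ y) : P.map (word f) = map f
  map₂ {x y : X} {f g : x ⟶ y} : (f ⟶ g) → (map f ⟶ map g)
  map_comp {x y z : X} (f : x ⟶ y) (g : y ⟶ z) : map (f ≫ g) = map f ≫ map g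
  map₂_id {x y : X} (f : x ⟶ y) : map₂ (𝟙 f) = 𝟙 (map f)
  map₂_comp {x y : X} {f g h : x ⟶ y} (η : f ⟶ g) (θ : g ⟶ h) :
    map₂ (η ≫ θ) = map₂ η ≫ map₂ θ
  map₂_left {x y z : X} (f : x ⟶ y) {g g' : y ⟶ z} (η : g ⟶ g') :
    map₂ (f ◁ η) = eqToHom (map_comp f g) ≫ map f ◁ map₂ η ≫ eqToHom (map_comp f g').symm
  map₂_right {x y z : X} {f f' : x ⟶ y} (η : f ⟶ f') (g : y ⟶ z) :
    map₂ (η ▷ g) = eqToHom (map_comp f g) ≫ map₂ η ▷ map g ≫ eqToHom (map_comp f' g).symm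

lemma Lift.map_id' (L : Lift P X) (x : X) : L.map (𝟙 x) = 𝟙 _ := by
  rw [← L.map_eq, L.word_id, P.map_id]

/-- The 2-functor into the factorisation with the given data. -/
def Lift.functor (L : Lift P X) : StrictPseudofunctor X (Factor P) := StrictPseudofunctor.mk''
  { obj := fun x => ⟨L.obj x⟩
    map := fun f => ⟨L.word f⟩
    map₂ := fun η => ⟨eqToHom (L.map_eq _) ≫ L.map₂ η ≫ eqToHom (L.map_eq _).symm⟩
    map₂_id := fun f => by ext; simp [L.map₂_id]
    map₂_comp := fun η θ => by ext; simp [L.map₂_comp]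
    map_id := fun x => congrArg Hom₁.mk (L.word_id x)
    map_comp := fun f g => congrArg Hom₁.mk (L.word_comp f g)
    map₂_whisker_left := fun f _ _ η => by
      ext; simp [L.map₂_left, congr_whiskerLeft (L.map_eq f)]
    map₂_whisker_right := fun η g => by
      ext; simp [L.map₂_right, whiskerRight_congr (L.map_eq g)] }

/-- An invertible 2-cell of the factorisation. -/
def isoMk {x y : Factor P} {f g : x ⟶ y} (e : P.map f.word ≅ P.map g.word) : f ≅ g where
  hom := Hom₂.mk e.hom
  inv := Hom₂.mk e.inv
  hom_inv_id := hom_ext e.hom_inv_id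
  inv_hom_id := hom_ext e.inv_hom_id

/-- The data of a transformation between 2-functors into the factorisation: the components `word`,
and the image in `D`. -/
structure Lift.Trans (L M : Lift P X) where
  word (x : X) : L.obj x ⟶ M.obj x
  app (x : X) : P.obj (L.obj x) ⟶ P.obj (M.obj x)
  app_eq (x : X) : P.map (word x) = app x
  nat {x y : X} (f : x ⟶ y) : L.map f ≫ app y ≅ app x ≫ M.map f
  nat_nat {x y : X} {f g : x ⟶ y} (η : f ⟶ g) :
    L.map₂ η ▷ app y ≫ (nat g).hom = (nat f).hom ≫ app x ◁ M.map₂ η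
  nat_id (x : X) (h : L.map (𝟙 x) ≫ app x = app x ≫ M.map (𝟙 x)) : (nat (𝟙 x)).hom = eqToHom h
  nat_comp {x y z : X} (f : x ⟶ y) (g : y ⟶ z) : (nat (f ≫ g)).hom =
    eqToHom (by rw [L.map_comp, Category.assoc]) ≫ L.map f ◁ (nat g).hom ≫
      eqToHom (Category.assoc _ _ _).symm ≫ (nat f).hom ▷ M.map g ≫
        eqToHom (by rw [M.map_comp, Category.assoc])

lemma conj_id {a b : D} {p q p' q' : a ⟶ b} {n : p ≅ q} {h : p = q} (hn : n.hom = eqToHom h)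
    (i : p' = p) (j : q = q') : (eqToIso i ≪≫ n ≪≫ eqToIso j).hom =
      eqToHom (i.trans (h.trans j)) := by
  subst i h j
  simp [hn]

lemma Lift.Trans.src_eq {L M : Lift P X} (T : L.Trans M) {x y : X} (f : x ⟶ y) :
    P.map (L.word f ≫ T.word y) = L.map f ≫ T.app y := by
  rw [P.map_comp, L.map_eq, T.app_eq]

lemma Lift.Trans.tgt_eq {L M : Lift P X} (T : L.Trans M) {x y : X} (f : x ⟶ y) :
    T.app x ≫ M.map f = P.map (T.word x ≫ M.word f) := by
  rw [P.map_comp, M.map_eq, T.app_eq]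

/-- The naturality 2-cells of the transformation with the given data. -/
def Lift.Trans.cell {L M : Lift P X} (T : L.Trans M) {x y : X} (f : x ⟶ y) :
    P.map (L.word f ≫ T.word y) ≅ P.map (T.word x ≫ M.word f) :=
  eqToIso (T.src_eq f) ≪≫ T.nat f ≪≫ eqToIso (T.tgt_eq f)

lemma Lift.Trans.cell_comp {L M : Lift P X} (T : L.Trans M) {x y z : X} (f : x ⟶ y) (g : y ⟶ z)
    (i₁ : P.map (L.word (f ≫ g) ≫ T.word z) = P.map (L.word f ≫ L.word g ≫ T.word z))
    (i₂ : P.map (L.word f ≫ T.word y ≫ M.word g) = P.map ((L.word f ≫ T.word y) ≫ M.word g))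
    (i₃ : P.map ((T.word x ≫ M.word f) ≫ M.word g) = P.map (T.word x ≫ M.word (f ≫ g))) :
    (T.cell (f ≫ g)).hom =
      eqToHom i₁ ≫
        (eqToHom (P.map_comp _ _) ≫ P.map (L.word f) ◁ (T.cell g).hom ≫
          eqToHom (P.map_comp _ _).symm) ≫
        eqToHom i₂ ≫
        (eqToHom (P.map_comp _ _) ≫ (T.cell f).hom ▷ P.map (M.word g) ≫
          eqToHom (P.map_comp _ _).symm) ≫ eqToHom i₃ :=
  conj_comp (T.nat f) (T.nat g) (T.nat (f ≫ g)) (L.map_comp f g) (M.map_comp f g)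
    (T.nat_comp f g) (L.map_eq f) (L.map_eq g) (M.map_eq f) (M.map_eq g)
    (T.app_eq _) (T.app_eq _) (T.app_eq _) (T.src_eq _) (T.tgt_eq _) _ _ (T.src_eq _) (T.tgt_eq _)
    _ _ _ (T.src_eq _) (T.tgt_eq _) _ _

open scoped Pseudofunctor.StrongTrans in
/-- The transformation with the given data. -/
def Lift.Trans.toTrans {L M : Lift P X} (T : L.Trans M) :
    L.functor.toPseudofunctor ⟶ M.functor.toPseudofunctor :=
  strictTrans L.functor M.functor (fun x => Hom₁.mk (T.word x)) (fun f => isoMk (T.cell f))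
    (fun {x y f g} η => hom_ext (conj_nat (T.nat_nat η) (L.map_eq f) (L.map_eq g)
      (M.map_eq f) (M.map_eq g) (T.app_eq x) (T.app_eq y) _ _ _ _
      (T.src_eq _) (T.tgt_eq _) (T.src_eq _) (T.tgt_eq _)))
    (fun x => hom_ext ((conj_id (T.nat_id x (by
      rw [L.map_id', M.map_id', Category.id_comp, Category.comp_id])) _ _).trans
        (eqToHom_val _).symm))
    (fun f g => hom_ext (by
      rw [comp_val, comp_val, comp_val, comp_val, eqToHom_val, eqToHom_val, eqToHom_val]
      exact T.cell_comp f g _ _ _))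

end Factor

end Factor

/-! ### Words -/

section Words

/-- Pairs of objects. -/
structure Vertex (A B : Type u) where
  fst : A
  snd : B

variable {A B : Type u} [Bicategory.{u, u} A] [Bicategory.{u, u} B]

/-- The basic 1-cells `f ⊗ 1` and `1 ⊗ g`. -/
inductive Edge : Vertex A B → Vertex A B → Type u
  | left {a a' : A} (f : a ⟶ a') (b : B) : Edge ⟨a, b⟩ ⟨a', b⟩
  | right (a : A) {b b' : B} (g : b ⟶ b') : Edge ⟨a, b⟩ ⟨a, b'⟩

instance : Quiver (Vertex A B) := ⟨Edge⟩

/-- The word of length one `f ⊗ 1`. -/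
def pathLeft {a a' : A} (f : a ⟶ a') (b : B) :
    (Paths.of (Vertex A B)).obj ⟨a, b⟩ ⟶ (Paths.of (Vertex A B)).obj ⟨a', b⟩ :=
  (Paths.of (Vertex A B)).map (Edge.left f b)

/-- The word of length one `1 ⊗ g`. -/
def pathRight (a : A) {b b' : B} (g : b ⟶ b') :
    (Paths.of (Vertex A B)).obj ⟨a, b⟩ ⟶ (Paths.of (Vertex A B)).obj ⟨a, b'⟩ :=
  (Paths.of (Vertex A B)).map (Edge.right a g)

/-- The relations between words: `- ⊗ 1` and `1 ⊗ -` preserve identities and composition. -/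
inductive Rel : HomRel (Paths (Vertex A B))
  | left_id (a : A) (b : B) : Rel (pathLeft (𝟙 a) b) (𝟙 _)
  | left_comp {a a' a'' : A} (f : a ⟶ a') (f' : a' ⟶ a'') (b : B) :
      Rel (pathLeft (f ≫ f') b) (pathLeft f b ≫ pathLeft f' b)
  | right_id (a : A) (b : B) : Rel (pathRight a (𝟙 b)) (𝟙 _)
  | right_comp (a : A) {b b' b'' : B} (g : b ⟶ b') (g' : b' ⟶ b'') :
      Rel (pathRight a (g ≫ g')) (pathRight a g ≫ pathRight a g')

variable (A B) in
/-- The category of pairs of objects and words in the basic 1-cells modulo the relations. -/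
abbrev Words := CategoryTheory.Quotient (Rel (A := A) (B := B))

/-- The object `a ⊗ b`. -/
abbrev wPt (a : A) (b : B) : Words A B := ⟨⟨a, b⟩⟩

/-- The class of the word `f ⊗ 1`. -/
def wLeft {a a' : A} (f : a ⟶ a') (b : B) : wPt a b ⟶ wPt a' b :=
  (CategoryTheory.Quotient.functor _).map (pathLeft f b)

/-- The class of the word `1 ⊗ g`. -/
def wRight (a : A) {b b' : B} (g : b ⟶ b') : wPt a b ⟶ wPt a b' :=
  (CategoryTheory.Quotient.functor _).map (pathRight a g)

lemma wLeft_id (a : A) (b : B) : wLeft (𝟙 a) b = 𝟙 (wPt a b) :=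
  CategoryTheory.Quotient.sound _ (Rel.left_id a b)
lemma wRight_id (a : A) (b : B) : wRight a (𝟙 b) = 𝟙 (wPt a b) :=
  CategoryTheory.Quotient.sound _ (Rel.right_id a b)
lemma wLeft_comp {a a' a'' : A} (f : a ⟶ a') (f' : a' ⟶ a'') (b : B) :
    wLeft (f ≫ f') b = wLeft f b ≫ wLeft f' b :=
  CategoryTheory.Quotient.sound _ (Rel.left_comp f f' b)
lemma wRight_comp (a : A) {b b' b'' : B} (g : b ⟶ b') (g' : b' ⟶ b'') :
    wRight a (g ≫ g') = wRight a g ≫ wRight a g' :=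
  CategoryTheory.Quotient.sound _ (Rel.right_comp a g g')

/-- The data of a functor out of the category of words. -/
structure WordsData (A B : Type u) [Bicategory.{u, u} A] [Bicategory.{u, u} B]
    (D : Type u) [Category.{u} D] where
  obj : A → B → D
  left {a a' : A} (f : a ⟶ a') (b : B) : obj a b ⟶ obj a' b
  right (a : A) {b b' : B} (g : b ⟶ b') : obj a b ⟶ obj a b'
  left_id (a : A) (b : B) : left (𝟙 a) b = 𝟙 (obj a b)
  left_comp {a a' a'' : A} (f : a ⟶ a') (f' : a' ⟶ a'') (b : B) :
    left (f ≫ f') b = left f b ≫ left f' b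
  right_id (a : A) (b : B) : right a (𝟙 b) = 𝟙 (obj a b)
  right_comp (a : A) {b b' b'' : B} (g : b ⟶ b') (g' : b' ⟶ b'') :
    right a (g ≫ g') = right a g ≫ right a g'

namespace WordsData

variable {D : Type u} [Category.{u} D] (φ : WordsData A B D)

/-- The values on the basic 1-cells. -/
def prefunctor : Vertex A B ⥤q D where
  obj x := φ.obj x.fst x.snd
  map {x y} e := match x, y, e with
    | _, _, Edge.left f b => φ.left f b
    | _, _, Edge.right a g => φ.right a g

lemma lift_pathLeft {a a' : A} (f : a ⟶ a') (b : B) :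
    (Paths.lift φ.prefunctor).map (pathLeft f b) = φ.left f b :=
  Paths.lift_toPath φ.prefunctor (Edge.left f b)

lemma lift_pathRight (a : A) {b b' : B} (g : b ⟶ b') :
    (Paths.lift φ.prefunctor).map (pathRight a g) = φ.right a g :=
  Paths.lift_toPath φ.prefunctor (Edge.right a g)

/-- The functor out of the category of words with the given values. -/
def functor : Words A B ⥤ D :=
  CategoryTheory.Quotient.lift _ (Paths.lift φ.prefunctor) (by
    intro x y p q h
    cases h with
    | left_id a b => exact (φ.lift_pathLeft _ _).trans (φ.left_id a b)
    | left_comp f f' b =>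
      rw [Functor.map_comp, lift_pathLeft, lift_pathLeft, lift_pathLeft, left_comp]; rfl
    | right_id a b => exact (φ.lift_pathRight _ _).trans (φ.right_id a b)
    | right_comp a g g' =>
      rw [Functor.map_comp, lift_pathRight, lift_pathRight, lift_pathRight, right_comp]; rfl)

@[simp] lemma functor_obj (x : Words A B) : φ.functor.obj x = φ.obj x.as.fst x.as.snd := rfl
@[simp] lemma functor_left {a a' : A} (f : a ⟶ a') (b : B) :
    φ.functor.map (wLeft f b) = φ.left f b := φ.lift_pathLeft f b
@[simp] lemma functor_right (a : A) {b b' : B} (g : b ⟶ b') :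
    φ.functor.map (wRight a g) = φ.right a g := φ.lift_pathRight a g

end WordsData

lemma words_induction {P : ∀ {x y : Words A B}, (x ⟶ y) → Prop}
    (id : ∀ x, P (𝟙 x))
    (left : ∀ {x : Words A B} {a a' : A} {b : B} (w : x ⟶ wPt a b) (f : a ⟶ a'),
      P w → P (w ≫ wLeft f b))
    (right : ∀ {x : Words A B} {a : A} {b b' : B} (w : x ⟶ wPt a b) (g : b ⟶ b'),
      P w → P (w ≫ wRight a g))
    {x y : Words A B} (w : x ⟶ y) : P w := by
  revert w
  refine fun w => CategoryTheory.Quotient.induction _ (P := P) (fun {x y} p => ?_) w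
  refine Paths.induction (P := fun {x y} p => P ((CategoryTheory.Quotient.functor Rel).map p))
    ?_ ?_ p
  · intro v
    exact id ⟨v⟩
  · intro u v w p (e : Edge v w) ih
    cases e with
    | left f b => exact left _ f ih
    | right a g => exact right _ g ih

lemma words_eq {D : Type u} [Category.{u} D] (obj : Words A B → D)
    (m n : ∀ {x y : Words A B}, (x ⟶ y) → (obj x ⟶ obj y))
    (m_id : ∀ x, m (𝟙 x) = 𝟙 (obj x)) (n_id : ∀ x, n (𝟙 x) = 𝟙 (obj x))
    (m_comp : ∀ {x y z : Words A B} (v : x ⟶ y) (w : y ⟶ z), m (v ≫ w) = m v ≫ m w)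
    (n_comp : ∀ {x y z : Words A B} (v : x ⟶ y) (w : y ⟶ z), n (v ≫ w) = n v ≫ n w)
    (left : ∀ {a a' : A} (f : a ⟶ a') (b : B), m (wLeft f b) = n (wLeft f b))
    (right : ∀ (a : A) {b b' : B} (g : b ⟶ b'), m (wRight a g) = n (wRight a g))
    {x y : Words A B} (w : x ⟶ y) : m w = n w := by
  induction w using words_induction with
  | id x => rw [m_id, n_id]
  | left w f ih => rw [m_comp, n_comp, ih, left]
  | right w g ih => rw [m_comp, n_comp, ih, right]

end Words

/-! ### The Gray tensor product -/

section Gray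

variable (A B : Type u) [Bicategory.{u, u} A] [Bicategory.{u, u} B] [Strict A] [Strict B]

/-- The underlying category of a product of 2-categories. -/
instance (priority := 10000) prodCategory (A B : Type u) [Bicategory.{u, u} A]
    [Bicategory.{u, u} B] [Strict A] [Strict B] : Category (A × B) :=
  StrictBicategory.category (A × B)

/-- The values of the projection from words to the cartesian product on the basic 1-cells. -/
def wordsProjData : WordsData A B (A × B) where
  obj a b := (a, b)
  left f b := (f, 𝟙 b)
  right a _ _ g := (𝟙 a, g)
  left_id _ _ := rfl
  left_comp _ _ b := Prod.ext rfl (Category.id_comp (𝟙 b)).symm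
  right_id _ _ := rfl
  right_comp a _ _ _ _ _ := Prod.ext (Category.id_comp (𝟙 a)).symm rfl

/-- The projection from words to the cartesian product. -/
def wordsProj : Words A B ⥤ A × B := (wordsProjData A B).functor

/-- The Gray tensor product of two 2-categories. Its objects are the pairs `a ⊗ b`, its 1-cells are
the words in the basic 1-cells `f ⊗ 1` and `1 ⊗ g` modulo the relations that `- ⊗ 1` and `1 ⊗ -`
preserve identities and composition, and its 2-cells between two words are the 2-cells of the
cartesian product between their images: every 2-cell is a composite of cells `α ⊗ 1`, `1 ⊗ δ` and
interchange cells `Σ_{f,g}`, where `Σ_{f,g}` is the invertible 2-cell lying over the identity, and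
two such composites are equal if and only if they have the same image in the cartesian product.
The universal property with respect to cubical functors is proved in `Gray.cub_bijective`. -/
abbrev Gray := Factor (wordsProj A B)


variable {A B}

@[simp] lemma prod_comp_fst {x y z : A × B} (f : x ⟶ y) (g : y ⟶ z) : (f ≫ g).1 = f.1 ≫ g.1 := rfl
@[simp] lemma prod_comp_snd {x y z : A × B} (f : x ⟶ y) (g : y ⟶ z) : (f ≫ g).2 = f.2 ≫ g.2 := rfl
@[simp] lemma prod_id_fst (x : A × B) : (𝟙 x : x ⟶ x).1 = 𝟙 x.1 := rfl
@[simp] lemma prod_id_snd (x : A × B) : (𝟙 x : x ⟶ x).2 = 𝟙 x.2 := rfl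
@[simp] lemma prod_comp₂_fst {x y : A × B} {f g h : x ⟶ y} (η : f ⟶ g) (θ : g ⟶ h) :
    (η ≫ θ).1 = η.1 ≫ θ.1 := rfl
@[simp] lemma prod_comp₂_snd {x y : A × B} {f g h : x ⟶ y} (η : f ⟶ g) (θ : g ⟶ h) :
    (η ≫ θ).2 = η.2 ≫ θ.2 := rfl
@[simp] lemma prod_eqToHom₂_fst {x y : A × B} {f g : x ⟶ y} (h : f = g) :
    (eqToHom h).1 = eqToHom (by rw [h]) := by cases h; rfl
@[simp] lemma prod_eqToHom₂_snd {x y : A × B} {f g : x ⟶ y} (h : f = g) :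
    (eqToHom h).2 = eqToHom (by rw [h]) := by cases h; rfl

lemma proj_left {a a' : A} (f : a ⟶ a') (b : B) :
    (wordsProj A B).map (wLeft f b) = ((f, 𝟙 b) : (a, b) ⟶ (a', b)) :=
  (wordsProjData A B).functor_left f b

lemma proj_right (a : A) {b b' : B} (g : b ⟶ b') :
    (wordsProj A B).map (wRight a g) = ((𝟙 a, g) : (a, b) ⟶ (a, b')) :=
  (wordsProjData A B).functor_right a g

namespace Gray

/-- The object `a ⊗ b`. -/
def pt (a : A) (b : B) : Gray A B := ⟨wPt a b⟩
/-- The 1-cell `f ⊗ 1`. -/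
def left {a a' : A} (f : a ⟶ a') (b : B) : pt a b ⟶ pt a' b := ⟨wLeft f b⟩
/-- The 1-cell `1 ⊗ g`. -/
def right (a : A) {b b' : B} (g : b ⟶ b') : pt a b ⟶ pt a b' := ⟨wRight a g⟩

/-- The 2-functor `- ⊗ b`. -/
def inclLeft (A : Type u) [Bicategory.{u, u} A] [Strict A] (b : B) :
    StrictPseudofunctor A (Gray A B) :=
  (Factor.Lift.mk (P := wordsProj A B) (fun a => wPt a b) (fun f => wLeft f b)
    (fun a => wLeft_id a b) (fun f f' => wLeft_comp f f' b)
    (fun f => (f, 𝟙 b)) (fun f => (wordsProjData A B).functor_left f b)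
    (fun η => (η, 𝟙 (𝟙 b)))
    (fun f f' => Prod.ext rfl (Category.id_comp (𝟙 b)).symm)
    (fun f => rfl) (fun η θ => Prod.ext rfl (Category.id_comp _).symm)
    (fun f _ _ η => Prod.ext
      (by simp only [prod_comp₂_fst, prod_eqToHom₂_fst]; change f ◁ η = 𝟙 _ ≫ f ◁ η ≫ 𝟙 _; simp)
      (by
        simp only [prod_comp₂_snd, prod_eqToHom₂_snd]
        change 𝟙 (𝟙 b) = eqToHom (Category.id_comp (𝟙 b)).symm ≫ 𝟙 b ◁ 𝟙 (𝟙 b) ≫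
          eqToHom (Category.id_comp (𝟙 b))
        simp))
    (fun η f => Prod.ext
      (by simp only [prod_comp₂_fst, prod_eqToHom₂_fst]; change η ▷ f = 𝟙 _ ≫ η ▷ f ≫ 𝟙 _; simp)
      (by
        simp only [prod_comp₂_snd, prod_eqToHom₂_snd]
        change 𝟙 (𝟙 b) = eqToHom (Category.id_comp (𝟙 b)).symm ≫ 𝟙 (𝟙 b) ▷ 𝟙 b ≫
          eqToHom (Category.id_comp (𝟙 b))
        simp)) :
    Factor.Lift (wordsProj A B) A).functor

/-- The 2-functor `a ⊗ -`. -/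
def inclRight (a : A) (B : Type u) [Bicategory.{u, u} B] [Strict B] :
    StrictPseudofunctor B (Gray A B) :=
  (Factor.Lift.mk (P := wordsProj A B) (fun b => wPt a b) (fun g => wRight a g)
    (fun b => wRight_id a b) (fun g g' => wRight_comp a g g')
    (fun g => (𝟙 a, g)) (fun g => (wordsProjData A B).functor_right a g)
    (fun η => (𝟙 (𝟙 a), η))
    (fun f f' => Prod.ext (Category.id_comp (𝟙 a)).symm rfl)
    (fun f => rfl) (fun η θ => Prod.ext (Category.id_comp _).symm rfl)
    (fun f _ _ η => Prod.ext
      (by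
        simp only [prod_comp₂_fst, prod_eqToHom₂_fst]
        change 𝟙 (𝟙 a) = eqToHom (Category.id_comp (𝟙 a)).symm ≫ 𝟙 a ◁ 𝟙 (𝟙 a) ≫
          eqToHom (Category.id_comp (𝟙 a))
        simp)
      (by simp only [prod_comp₂_snd, prod_eqToHom₂_snd]; change f ◁ η = 𝟙 _ ≫ f ◁ η ≫ 𝟙 _; simp))
    (fun η f => Prod.ext
      (by
        simp only [prod_comp₂_fst, prod_eqToHom₂_fst]
        change 𝟙 (𝟙 a) = eqToHom (Category.id_comp (𝟙 a)).symm ≫ 𝟙 (𝟙 a) ▷ 𝟙 a ≫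
          eqToHom (Category.id_comp (𝟙 a))
        simp)
      (by simp only [prod_comp₂_snd, prod_eqToHom₂_snd]; change η ▷ f = 𝟙 _ ≫ η ▷ f ≫ 𝟙 _; simp)) :
    Factor.Lift (wordsProj A B) B).functor

variable {A' B' : Type u} [Bicategory.{u, u} A'] [Bicategory.{u, u} B'] [Strict A'] [Strict B']

/-- The values of `F ⊗ G` on the basic 1-cells. -/
def mapData (F : StrictPseudofunctor A A') (G : StrictPseudofunctor B B') :
    WordsData A B (Words A' B') where
  obj a b := wPt (F.obj a) (G.obj b)
  left f b := wLeft (F.map f) (G.obj b)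
  right a _ _ g := wRight (F.obj a) (G.map g)
  left_id a b := by rw [F.map_id, wLeft_id]
  left_comp f f' b := by rw [F.map_comp, wLeft_comp]
  right_id a b := by rw [G.map_id, wRight_id]
  right_comp a _ _ _ g g' := by rw [G.map_comp, wRight_comp]

/-- The cartesian product of two 2-functors. -/
def prodFun (F : StrictPseudofunctor A A') (G : StrictPseudofunctor B B') :
    StrictPseudofunctor (A × B) (A' × B') := StrictPseudofunctor.mk''
  { obj := fun x => (F.obj x.1, G.obj x.2)
    map := fun f => (F.map f.1, G.map f.2)
    map₂ := fun η => (F.map₂ η.1, G.map₂ η.2)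
    map₂_id := fun f => Prod.ext (F.map₂_id _) (G.map₂_id _)
    map₂_comp := fun η θ => Prod.ext (F.map₂_comp _ _) (G.map₂_comp _ _)
    map_id := fun x => Prod.ext (F.map_id _) (G.map_id _)
    map_comp := fun f g => Prod.ext (F.map_comp _ _) (G.map_comp _ _)
    map₂_whisker_left := fun f _ _ η => Prod.ext
      (by simp [StrictPseudofunctor.mapComp_eq_eqToIso])
      (by simp [StrictPseudofunctor.mapComp_eq_eqToIso])
    map₂_whisker_right := fun η f => Prod.ext
      (by simp [StrictPseudofunctor.mapComp_eq_eqToIso])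
      (by simp [StrictPseudofunctor.mapComp_eq_eqToIso]) }

lemma prodFun_left (F : StrictPseudofunctor A A') (G : StrictPseudofunctor B B')
    {a a' : A} (f : a ⟶ a') (b : B) :
    ((F.map f, 𝟙 (G.obj b)) : (F.obj a, G.obj b) ⟶ (F.obj a', G.obj b)) =
      (prodFun F G).map ((f, 𝟙 b) : (a, b) ⟶ (a', b)) :=
  Prod.ext rfl (G.map_id b).symm

lemma prodFun_right (F : StrictPseudofunctor A A') (G : StrictPseudofunctor B B')
    (a : A) {b b' : B} (g : b ⟶ b') :
    ((𝟙 (F.obj a), G.map g) : (F.obj a, G.obj b) ⟶ (F.obj a, G.obj b')) =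
      (prodFun F G).map ((𝟙 a, g) : (a, b) ⟶ (a, b')) :=
  Prod.ext (F.map_id a).symm rfl

lemma mapData_proj (F : StrictPseudofunctor A A') (G : StrictPseudofunctor B B')
    {x y : Words A B} (w : x ⟶ y) :
    (wordsProj A' B').map ((mapData F G).functor.map w) =
      (prodFun F G).map ((wordsProj A B).map w) := by
  exact words_eq (D := A' × B') (fun x => (F.obj x.as.fst, G.obj x.as.snd))
    (fun w => (wordsProj A' B').map ((mapData F G).functor.map w))
    (fun w => (prodFun F G).map ((wordsProj A B).map w))
    (fun x => ((mapData F G).functor ⋙ wordsProj A' B').map_id x)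
    (fun x => (wordsProj A B ⋙ (prodFun F G).toFunctor).map_id x)
    (fun v w => ((mapData F G).functor ⋙ wordsProj A' B').map_comp v w)
    (fun v w => (wordsProj A B ⋙ (prodFun F G).toFunctor).map_comp v w)
    (fun f b => (congrArg (wordsProj A' B').map ((mapData F G).functor_left f b)).trans
      (((wordsProjData A' B').functor_left _ _).trans
        ((prodFun_left F G f b).trans
          (congrArg (prodFun F G).map ((wordsProjData A B).functor_left f b)).symm)))
    (fun a _ _ g => (congrArg (wordsProj A' B').map ((mapData F G).functor_right a g)).trans
      (((wordsProjData A' B').functor_right _ _).trans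
        ((prodFun_right F G a g).trans
          (congrArg (prodFun F G).map ((wordsProjData A B).functor_right a g)).symm))) w

/-- The data of the 2-functor `F ⊗ G`. -/
def mapLift (F : StrictPseudofunctor A A') (G : StrictPseudofunctor B B') :
    Factor.Lift (wordsProj A' B') (Gray A B) where
  obj x := (mapData F G).functor.obj x.base
  word f := (mapData F G).functor.map f.word
  word_id _ := (mapData F G).functor.map_id _
  word_comp _ _ := (mapData F G).functor.map_comp _ _
  map f := (prodFun F G).map ((wordsProj A B).map f.word)
  map_eq f := mapData_proj F G f.word
  map₂ η := (prodFun F G).map₂ η.val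
  map_comp f g := (congrArg (prodFun F G).map ((wordsProj A B).map_comp f.word g.word)).trans
      ((prodFun F G).map_comp _ _)
  map₂_id _ := (prodFun F G).map₂_id _
  map₂_comp _ _ := (prodFun F G).map₂_comp _ _
  map₂_left _ _ _ η := strict_map₂_left (prodFun F G) _ η.val _ _
  map₂_right η _ := strict_map₂_right (prodFun F G) η.val _ _ _

/-- The 2-functor `F ⊗ G`. -/
def map (F : StrictPseudofunctor A A') (G : StrictPseudofunctor B B') :
    StrictPseudofunctor (Gray A B) (Gray A' B') :=
  (mapLift F G).functor

/-- The values of the symmetry on the basic 1-cells. -/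
def swapData (A B : Type u) [Bicategory.{u, u} A] [Bicategory.{u, u} B] [Strict A] [Strict B] :
    WordsData A B (Words B A) where
  obj a b := wPt b a
  left f b := wRight b f
  right a _ _ g := wLeft g a
  left_id a b := wRight_id b a
  left_comp f f' b := wRight_comp b f f'
  right_id a b := wLeft_id b a
  right_comp a _ _ _ g g' := wLeft_comp g g' a

lemma swapData_proj {x y : Words A B} (w : x ⟶ y) :
    (wordsProj B A).map ((swapData A B).functor.map w) =
      (Bicategory.Prod.swap A B).map ((wordsProj A B).map w) := by
  exact words_eq (D := B × A) (fun x => (x.as.snd, x.as.fst))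
    (fun w => (wordsProj B A).map ((swapData A B).functor.map w))
    (fun w => (Bicategory.Prod.swap A B).map ((wordsProj A B).map w))
    (fun x => ((swapData A B).functor ⋙ wordsProj B A).map_id x)
    (fun x => (wordsProj A B ⋙ (Bicategory.Prod.swap A B).toFunctor).map_id x)
    (fun v w => ((swapData A B).functor ⋙ wordsProj B A).map_comp v w)
    (fun v w => (wordsProj A B ⋙ (Bicategory.Prod.swap A B).toFunctor).map_comp v w)
    (fun f b => (congrArg (wordsProj B A).map ((swapData A B).functor_left f b)).trans
      (((wordsProjData B A).functor_right _ _).trans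
        (congrArg (Bicategory.Prod.swap A B).map ((wordsProjData A B).functor_left f b)).symm))
    (fun a _ _ g => (congrArg (wordsProj B A).map ((swapData A B).functor_right a g)).trans
      (((wordsProjData B A).functor_left _ _).trans
        (congrArg (Bicategory.Prod.swap A B).map
          ((wordsProjData A B).functor_right a g)).symm)) w

/-- The symmetry `τ`. -/
def swap (A B : Type u) [Bicategory.{u, u} A] [Bicategory.{u, u} B] [Strict A] [Strict B] :
    StrictPseudofunctor (Gray A B) (Gray B A) :=
  (Factor.Lift.mk (P := wordsProj B A) (fun x => (swapData A B).functor.obj x.base)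
    (fun f => (swapData A B).functor.map f.word)
    (fun _ => (swapData A B).functor.map_id _)
    (fun _ _ => (swapData A B).functor.map_comp _ _)
    (fun f => (Bicategory.Prod.swap A B).map ((wordsProj A B).map f.word))
    (fun f => swapData_proj f.word)
    (fun η => (Bicategory.Prod.swap A B).map₂ η.val)
    (fun f g => congrArg (Bicategory.Prod.swap A B).map
      ((wordsProj A B).map_comp f.word g.word))
    (fun _ => rfl)
    (fun _ _ => rfl)
    (fun _ _ _ η => strict_map₂_left (Bicategory.Prod.swap A B) _ η.val _ _)
    (fun η _ => strict_map₂_right (Bicategory.Prod.swap A B) η.val _ _ _) :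
    Factor.Lift (wordsProj B A) (Gray A B)).functor

end Gray
end Gray

/-! ### Associativity of the Gray tensor product -/

section GrayAssoc

namespace Gray

variable (A B C : Type u) [Bicategory.{u, u} A] [Bicategory.{u, u} B] [Bicategory.{u, u} C]
  [Strict A] [Strict B] [Strict C]

variable {C} in
/-- The values of the functor from words in `A` and `B` to words in `A` and `B ⊗ C` given by an
object of `C`. -/
def assocInData (c : C) : WordsData A B (Words A (Gray B C)) where
  obj a b := wPt a (pt b c)
  left f b := wLeft f (pt b c)
  right a _ _ g := wRight a (left g c)
  left_id a b := wLeft_id a _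
  left_comp f f' b := wLeft_comp f f' _
  right_id a b := (congrArg (wRight a) (congrArg Factor.Hom₁.mk (wLeft_id b c))).trans
    (wRight_id a _)
  right_comp a _ _ _ g g' :=
    (congrArg (wRight a) (congrArg Factor.Hom₁.mk (wLeft_comp g g' c))).trans
      (wRight_comp a _ _)

/-- The values of the associativity isomorphism on the basic 1-cells. -/
def assocData : WordsData (Gray A B) C (Words A (Gray B C)) where
  obj x c := wPt x.base.as.fst (pt x.base.as.snd c)
  left f c := (assocInData A B c).functor.map f.word
  right x _ _ h := wRight x.base.as.fst (right x.base.as.snd h)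
  left_id x c := (assocInData A B c).functor.map_id _
  left_comp f f' c := (assocInData A B c).functor.map_comp _ _
  right_id x c := (congrArg (wRight _) (congrArg Factor.Hom₁.mk (wRight_id _ c))).trans
    (wRight_id _ _)
  right_comp x _ _ _ h h' :=
    (congrArg (wRight _) (congrArg Factor.Hom₁.mk (wRight_comp _ h h'))).trans
      (wRight_comp _ _ _)

variable {A B C}

lemma assocIn_fst (c : C) {x y : Words A B} (w : x ⟶ y) :
    ((wordsProj A (Gray B C)).map ((assocInData A B c).functor.map w)).1 =
      ((wordsProj A B).map w).1 :=
  words_eq (D := A) (fun x => x.as.fst)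
    (fun w => ((wordsProj A (Gray B C)).map ((assocInData A B c).functor.map w)).1)
    (fun w => ((wordsProj A B).map w).1)
    (fun _ => rfl) (fun _ => rfl)
    (fun v w => congrArg (fun t => t.1)
      (((assocInData A B c).functor ⋙ wordsProj A (Gray B C)).map_comp v w))
    (fun v w => congrArg (fun t => t.1) ((wordsProj A B).map_comp v w))
    (fun _ _ => rfl) (fun _ _ _ _ => rfl) w

lemma assocIn_snd (c : C) {x y : Words A B} (w : x ⟶ y) :
    (wordsProj B C).map ((wordsProj A (Gray B C)).map ((assocInData A B c).functor.map w)).2.word =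
      (((wordsProj A B).map w).2, 𝟙 c) :=
  words_eq (D := B × C) (fun x => (x.as.snd, c))
    (fun w => (wordsProj B C).map
      ((wordsProj A (Gray B C)).map ((assocInData A B c).functor.map w)).2.word)
    (fun w => (((wordsProj A B).map w).2, 𝟙 c))
    (fun x => (wordsProj B C).map_id _) (fun _ => rfl)
    (fun v w => (congrArg (fun t => (wordsProj B C).map t.2.word)
      (((assocInData A B c).functor ⋙ wordsProj A (Gray B C)).map_comp v w)).trans
        ((wordsProj B C).map_comp _ _))
    (fun v w => Prod.ext (congrArg (fun t => t.2) ((wordsProj A B).map_comp v w))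
      (Category.id_comp (𝟙 c)).symm)
    (fun {a a'} f b => by
      rw [WordsData.functor_left]
      change (wordsProj B C).map ((wordsProj A (Gray B C)).map (wLeft f (pt b c))).2.word = _
      rw [proj_left, proj_left]
      exact (wordsProj B C).map_id _)
    (fun a b b' g => by
      rw [WordsData.functor_right]
      change (wordsProj B C).map ((wordsProj A (Gray B C)).map (wRight a (left g c))).2.word = _
      rw [proj_right, proj_right]
      exact proj_left g c) w

lemma assoc_fst {x y : Words (Gray A B) C} (w : x ⟶ y) :
    ((wordsProj A (Gray B C)).map ((assocData A B C).functor.map w)).1 =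
      ((wordsProj A B).map ((wordsProj (Gray A B) C).map w).1.word).1 :=
  words_eq (D := A) (fun x => x.as.fst.base.as.fst)
    (fun w => ((wordsProj A (Gray B C)).map ((assocData A B C).functor.map w)).1)
    (fun w => ((wordsProj A B).map ((wordsProj (Gray A B) C).map w).1.word).1)
    (fun _ => rfl) (fun _ => rfl)
    (fun v w => congrArg (fun t => t.1)
      (((assocData A B C).functor ⋙ wordsProj A (Gray B C)).map_comp v w))
    (fun v w => (congrArg (fun t => ((wordsProj A B).map t.1.word).1)
      ((wordsProj (Gray A B) C).map_comp v w)).trans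
        (congrArg (fun t => t.1) ((wordsProj A B).map_comp
          ((wordsProj (Gray A B) C).map v).1.word ((wordsProj (Gray A B) C).map w).1.word)))
    (fun f c => (congrArg (fun t => ((wordsProj A (Gray B C)).map t).1)
      ((assocData A B C).functor_left f c)).trans ((assocIn_fst c f.word).trans
        (congrArg (fun t => ((wordsProj A B).map t.1.word).1)
          ((wordsProjData (Gray A B) C).functor_left f c)).symm))
    (fun x c c' h => by
      rw [WordsData.functor_right, proj_right]
      change ((wordsProj A (Gray B C)).map (wRight x.base.as.fst (right x.base.as.snd h))).1 = _
      rw [proj_right]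
      exact (congrArg (fun t => t.1) ((wordsProj A B).map_id x.base)).symm) w

lemma assoc_snd {x y : Words (Gray A B) C} (w : x ⟶ y) :
    (wordsProj B C).map
        ((wordsProj A (Gray B C)).map ((assocData A B C).functor.map w)).2.word =
      (((wordsProj A B).map ((wordsProj (Gray A B) C).map w).1.word).2,
        ((wordsProj (Gray A B) C).map w).2) :=
  words_eq (D := B × C) (fun x => (x.as.fst.base.as.snd, x.as.snd))
    (fun w => (wordsProj B C).map
        ((wordsProj A (Gray B C)).map ((assocData A B C).functor.map w)).2.word)
    (fun w => (((wordsProj A B).map ((wordsProj (Gray A B) C).map w).1.word).2,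
        ((wordsProj (Gray A B) C).map w).2))
    (fun x => (wordsProj B C).map_id _) (fun _ => rfl)
    (fun v w => (congrArg (fun t => (wordsProj B C).map t.2.word)
      (((assocData A B C).functor ⋙ wordsProj A (Gray B C)).map_comp v w)).trans
        ((wordsProj B C).map_comp _ _))
    (fun v w => Prod.ext
      ((congrArg (fun t => ((wordsProj A B).map t.1.word).2)
        ((wordsProj (Gray A B) C).map_comp v w)).trans
          (congrArg (fun t => t.2) ((wordsProj A B).map_comp
          ((wordsProj (Gray A B) C).map v).1.word ((wordsProj (Gray A B) C).map w).1.word)))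
      (congrArg (fun t => t.2) ((wordsProj (Gray A B) C).map_comp v w)))
    (fun f c => (congrArg (fun t => (wordsProj B C).map ((wordsProj A (Gray B C)).map t).2.word)
      ((assocData A B C).functor_left f c)).trans ((assocIn_snd c f.word).trans
        (congrArg (fun t => (((wordsProj A B).map t.1.word).2, t.2))
          ((wordsProjData (Gray A B) C).functor_left f c)).symm))
    (fun x c c' h => by
      rw [WordsData.functor_right, proj_right]
      change (wordsProj B C).map ((wordsProj A (Gray B C)).map
        (wRight x.base.as.fst (right x.base.as.snd h))).2.word = _
      rw [proj_right]
      refine (proj_right _ h).trans (Prod.ext ?_ rfl)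
      exact (congrArg (fun t => t.2) ((wordsProj A B).map_id x.base)).symm) w

variable (A B C) in
/-- The canonical 2-functor from `(A ⊗ B) ⊗ C` to the first factor. -/
def projFst : StrictPseudofunctor (Gray (Gray A B) C) A :=
  ((Factor.proj (wordsProj (Gray A B) C)).comp (Bicategory.Prod.fst (Gray A B) C)).comp
    ((Factor.proj (wordsProj A B)).comp (Bicategory.Prod.fst A B))

variable (A B C) in
/-- The canonical 2-functor from `(A ⊗ B) ⊗ C` to the product of the last two factors. -/
def projSnd : StrictPseudofunctor (Gray (Gray A B) C) (B × C) :=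
  (Factor.proj (wordsProj (Gray A B) C)).comp
    (prodFun ((Factor.proj (wordsProj A B)).comp (Bicategory.Prod.snd A B))
      (StrictPseudofunctor.id C))

variable (A B C) in
/-- The second component of the associativity isomorphism. -/
def assocSnd : StrictPseudofunctor (Gray (Gray A B) C) (Gray B C) :=
  (Factor.Lift.mk (P := wordsProj B C) (fun x => wPt x.base.as.fst.base.as.snd x.base.as.snd)
    (fun f => ((wordsProj A (Gray B C)).map ((assocData A B C).functor.map f.word)).2.word)
    (fun _ => rfl)
    (fun f g => congrArg (fun t => t.2.word)
      (((assocData A B C).functor ⋙ wordsProj A (Gray B C)).map_comp f.word g.word))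
    (fun f => (projSnd A B C).map f)
    (fun f => assoc_snd f.word)
    (fun η => (projSnd A B C).map₂ η)
    (fun f g => (projSnd A B C).map_comp f g)
    (fun f => (projSnd A B C).map₂_id f)
    (fun η θ => (projSnd A B C).map₂_comp η θ)
    (fun f _ _ η => strict_left (projSnd A B C) f η)
    (fun η g => strict_right (projSnd A B C) η g) :
    Factor.Lift (wordsProj B C) (Gray (Gray A B) C)).functor

variable (A B C) in
/-- The associativity isomorphism. -/
def assoc : StrictPseudofunctor (Gray (Gray A B) C) (Gray A (Gray B C)) :=
  (Factor.Lift.mk (P := wordsProj A (Gray B C)) (fun x => (assocData A B C).functor.obj x.base)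
    (fun f => (assocData A B C).functor.map f.word)
    (fun _ => (assocData A B C).functor.map_id _)
    (fun _ _ => (assocData A B C).functor.map_comp _ _)
    (fun f => ((projFst A B C).map f, (assocSnd A B C).map f))
    (fun f => Prod.ext (assoc_fst f.word) rfl)
    (fun η => ((projFst A B C).map₂ η, (assocSnd A B C).map₂ η))
    (fun f g => Prod.ext ((projFst A B C).map_comp f g) ((assocSnd A B C).map_comp f g))
    (fun f => Prod.ext ((projFst A B C).map₂_id f) ((assocSnd A B C).map₂_id f))
    (fun η θ => Prod.ext ((projFst A B C).map₂_comp η θ) ((assocSnd A B C).map₂_comp η θ))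
    (fun f _ _ η => Prod.ext
      ((strict_left (projFst A B C) f η).trans (by
        simp only [prod_comp₂_fst, prod_eqToHom₂_fst]; rfl))
      ((strict_left (assocSnd A B C) f η).trans (by
        simp only [prod_comp₂_snd, prod_eqToHom₂_snd]; rfl)))
    (fun η g => Prod.ext
      ((strict_right (projFst A B C) η g).trans (by
        simp only [prod_comp₂_fst, prod_eqToHom₂_fst]; rfl))
      ((strict_right (assocSnd A B C) η g).trans (by
        simp only [prod_comp₂_snd, prod_eqToHom₂_snd]; rfl))) :
    Factor.Lift (wordsProj A (Gray B C)) (Gray (Gray A B) C)).functor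

end Gray

end GrayAssoc

/-! ### Transformations -/

section Trans

open scoped Pseudofunctor.StrongTrans

section Whisker

variable {A B C : Type u} [Bicategory.{u, u} A] [Bicategory.{u, u} B] [Bicategory.{u, u} C]

lemma whiskerL_id (F : Pseudofunctor A B) {G H : Pseudofunctor B C} (α : G ⟶ H) (a : A) :
    (α.naturality (F.map (𝟙 a))).hom ≫ α.app (F.obj a) ◁ (H.map₂ (F.mapId a).hom ≫
        (H.mapId (F.obj a)).hom) =
      (G.map₂ (F.mapId a).hom ≫ (G.mapId (F.obj a)).hom) ▷ α.app (F.obj a) ≫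
        (λ_ (α.app (F.obj a))).hom ≫ (ρ_ (α.app (F.obj a))).inv := by
  rw [Bicategory.whiskerLeft_comp, ← α.naturality_naturality_assoc, α.naturality_id]
  simp

lemma whiskerL_comp (F : Pseudofunctor A B) {G H : Pseudofunctor B C} (α : G ⟶ H) {a b c : A}
    (f : a ⟶ b) (g : b ⟶ c) :
    (α.naturality (F.map (f ≫ g))).hom ≫ α.app (F.obj a) ◁ (H.map₂ (F.mapComp f g).hom ≫
        (H.mapComp (F.map f) (F.map g)).hom) =
      (G.map₂ (F.mapComp f g).hom ≫ (G.mapComp (F.map f) (F.map g)).hom) ▷ α.app (F.obj c) ≫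
      (α_ (G.map (F.map f)) (G.map (F.map g)) (α.app (F.obj c))).hom ≫
        G.map (F.map f) ◁ (α.naturality (F.map g)).hom ≫
          (α_ (G.map (F.map f)) (α.app (F.obj b)) (H.map (F.map g))).inv ≫
            (α.naturality (F.map f)).hom ▷ H.map (F.map g) ≫
              (α_ (α.app (F.obj a)) (H.map (F.map f)) (H.map (F.map g))).hom := by
  rw [Bicategory.whiskerLeft_comp, ← α.naturality_naturality_assoc, α.naturality_comp]
  simp

/-- The whiskering of a transformation by a pseudofunctor on the side of the source. -/
def whiskerL (F : Pseudofunctor A B) {G H : Pseudofunctor B C} (α : G ⟶ H) :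
    F.comp G ⟶ F.comp H where
  app a := α.app (F.obj a)
  naturality f := α.naturality (F.map f)
  naturality_naturality η := α.naturality_naturality (F.map₂ η)
  naturality_id a := whiskerL_id F α a
  naturality_comp f g := whiskerL_comp F α f g

lemma whiskerR_nat {F G : Pseudofunctor A B} (α : F ⟶ G) (H : Pseudofunctor B C) {a b : A}
    {f g : a ⟶ b} (η : f ⟶ g) :
    H.map₂ (F.map₂ η) ▷ H.map (α.app b) ≫ (H.mapComp (F.map g) (α.app b)).inv ≫
        H.map₂ (α.naturality g).hom ≫ (H.mapComp (α.app a) (G.map g)).hom =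
      ((H.mapComp (F.map f) (α.app b)).inv ≫ H.map₂ (α.naturality f).hom ≫
        (H.mapComp (α.app a) (G.map f)).hom) ≫ H.map (α.app a) ◁ H.map₂ (G.map₂ η) := by
  have h := congrArg (fun t => t ≫ (H.mapComp _ _).hom)
    (congrArg H.map₂ (α.naturality_naturality η))
  simp only [H.map₂_comp, H.map₂_whisker_right, H.map₂_whisker_left, Category.assoc,
    Iso.inv_hom_id, Category.comp_id] at h
  rw [← cancel_epi (H.mapComp (F.map f) (α.app b)).hom]
  simp only [Category.assoc, Iso.hom_inv_id_assoc]
  exact h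

lemma whiskerR_id {F G : Pseudofunctor A B} (α : F ⟶ G) (H : Pseudofunctor B C) (a : A) :
    ((H.mapComp (F.map (𝟙 a)) (α.app a)).inv ≫ H.map₂ (α.naturality (𝟙 a)).hom ≫
        (H.mapComp (α.app a) (G.map (𝟙 a))).hom) ≫
      H.map (α.app a) ◁ (H.map₂ (G.mapId a).hom ≫ (H.mapId (G.obj a)).hom) =
    (H.map₂ (F.mapId a).hom ≫ (H.mapId (F.obj a)).hom) ▷ H.map (α.app a) ≫
      (λ_ (H.map (α.app a))).hom ≫ (ρ_ (H.map (α.app a))).inv := by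
  have h := congrArg (fun t => t ≫ (H.mapComp _ _).hom)
    (congrArg H.map₂ (α.naturality_id a))
  simp only [H.map₂_comp, H.map₂_whisker_right, H.map₂_whisker_left, Category.assoc,
    Iso.inv_hom_id, Category.comp_id] at h
  rw [← cancel_epi (H.mapComp (F.map (𝟙 a)) (α.app a)).hom]
  simp only [Category.assoc, Iso.hom_inv_id_assoc, Bicategory.whiskerLeft_comp]
  rw [reassoc_of% h]
  rw [H.mapComp_id_right_hom, H.mapComp_id_left_inv]
  simp only [Category.assoc, PrelaxFunctor.map₂_inv_hom_assoc, Bicategory.comp_whiskerRight,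
    Bicategory.whiskerLeft_inv_hom, Category.comp_id]

lemma whiskerR_comp {F G : Pseudofunctor A B} (α : F ⟶ G) (H : Pseudofunctor B C) {a b c : A}
    (f : a ⟶ b) (g : b ⟶ c) :
    ((H.mapComp (F.map (f ≫ g)) (α.app c)).inv ≫ H.map₂ (α.naturality (f ≫ g)).hom ≫
        (H.mapComp (α.app a) (G.map (f ≫ g))).hom) ≫
      H.map (α.app a) ◁ (H.map₂ (G.mapComp f g).hom ≫ (H.mapComp (G.map f) (G.map g)).hom) =
    (H.map₂ (F.mapComp f g).hom ≫ (H.mapComp (F.map f) (F.map g)).hom) ▷ H.map (α.app c) ≫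
      (α_ (H.map (F.map f)) (H.map (F.map g)) (H.map (α.app c))).hom ≫
        H.map (F.map f) ◁ ((H.mapComp (F.map g) (α.app c)).inv ≫ H.map₂ (α.naturality g).hom ≫
          (H.mapComp (α.app b) (G.map g)).hom) ≫
          (α_ (H.map (F.map f)) (H.map (α.app b)) (H.map (G.map g))).inv ≫
            ((H.mapComp (F.map f) (α.app b)).inv ≫ H.map₂ (α.naturality f).hom ≫
              (H.mapComp (α.app a) (G.map f)).hom) ▷ H.map (G.map g) ≫
              (α_ (H.map (α.app a)) (H.map (G.map f)) (H.map (G.map g))).hom := by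
  have h := congrArg (fun t => t ≫ (H.mapComp _ _).hom)
    (congrArg H.map₂ (α.naturality_comp f g))
  simp only [H.map₂_comp, H.map₂_whisker_right, H.map₂_whisker_left, Category.assoc,
    Iso.inv_hom_id, Category.comp_id] at h
  rw [← cancel_epi (H.mapComp (F.map (f ≫ g)) (α.app c)).hom]
  simp only [Category.assoc, Iso.hom_inv_id_assoc, Bicategory.whiskerLeft_comp]
  have k : H.map₂ (α_ (F.map f) (α.app b) (G.map g)).inv =
      (H.mapComp _ _).hom ≫ H.map (F.map f) ◁ (H.mapComp _ _).hom ≫ (α_ _ _ _).inv ≫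
        (H.mapComp _ _).inv ▷ H.map (G.map g) ≫ (H.mapComp _ _).inv := by
    rw [← cancel_epi (H.map₂ (α_ (F.map f) (α.app b) (G.map g)).hom),
      PrelaxFunctor.map₂_hom_inv]
    simp
  rw [reassoc_of% h, k]
  simp

/-- The whiskering of a transformation by a pseudofunctor on the side of the target. -/
def whiskerR {F G : Pseudofunctor A B} (α : F ⟶ G) (H : Pseudofunctor B C) :
    F.comp H ⟶ G.comp H where
  app a := H.map (α.app a)
  naturality f := (H.mapComp _ _).symm ≪≫ H.map₂Iso (α.naturality f) ≪≫ H.mapComp _ _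
  naturality_naturality η := whiskerR_nat α H η
  naturality_id a := whiskerR_id α H a
  naturality_comp f g := whiskerR_comp α H f g

end Whisker

end Trans

/-! ### Products and whiskering with equalities -/

section ProdTrans

open scoped Pseudofunctor.StrongTrans

variable {A A' B B' C : Type u} [Bicategory.{u, u} A] [Bicategory.{u, u} A']
  [Bicategory.{u, u} B] [Bicategory.{u, u} B'] [Bicategory.{u, u} C]

/-- The transformation given by an equality of pseudofunctors. -/
def ofEq {F G : Pseudofunctor A B} (h : F = G) : F ⟶ G := eqToHom h

/-- The cartesian product of two pseudofunctors. -/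
def prodMap (F : Pseudofunctor A A') (G : Pseudofunctor B B') :
    Pseudofunctor (A × B) (A' × B') where
  obj x := (F.obj x.1, G.obj x.2)
  map f := (F.map f.1, G.map f.2)
  map₂ η := (F.map₂ η.1, G.map₂ η.2)
  mapId x := Iso.prod (F.mapId x.1) (G.mapId x.2)
  mapComp f g := Iso.prod (F.mapComp f.1 g.1) (G.mapComp f.2 g.2)

/-- The cartesian product of two transformations. -/
def prodTrans {F F' : Pseudofunctor A A'} {G G' : Pseudofunctor B B'} (α : F ⟶ F') (β : G ⟶ G') :
    prodMap F G ⟶ prodMap F' G' where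
  app x := (α.app x.1, β.app x.2)
  naturality f := Iso.prod (α.naturality f.1) (β.naturality f.2)
  naturality_naturality η :=
    Prod.ext (α.naturality_naturality η.1) (β.naturality_naturality η.2)
  naturality_id x := Prod.ext (α.naturality_id x.1) (β.naturality_id x.2)
  naturality_comp f g := Prod.ext (α.naturality_comp f.1 g.1) (β.naturality_comp f.2 g.2)

variable (A B C) in
/-- The associativity of the cartesian product. -/
def prodAssoc : StrictPseudofunctor ((A × B) × C) (A × (B × C)) := .mk'
  { obj x := (x.1.1, (x.1.2, x.2))
    map f := (f.1.1, (f.1.2, f.2))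
    map₂ η := (η.1.1, (η.1.2, η.2)) }

variable (A B C) in
/-- The inverse of the associativity of the cartesian product. -/
def prodAssocInv : StrictPseudofunctor (A × (B × C)) ((A × B) × C) := .mk'
  { obj x := ((x.1, x.2.1), x.2.2)
    map f := ((f.1, f.2.1), f.2.2)
    map₂ η := ((η.1, η.2.1), η.2.2) }

variable (A B C) in
/-- The 2-functor exchanging the first two of three factors. -/
def swapFst : StrictPseudofunctor (A × (B × C)) (B × (A × C)) := .mk'
  { obj x := (x.2.1, (x.1, x.2.2))
    map f := (f.2.1, (f.1, f.2.2))
    map₂ η := (η.2.1, (η.1, η.2.2)) }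

variable (A B C) in
/-- The 2-functor exchanging the last two of three factors. -/
def swapSnd : StrictPseudofunctor ((A × B) × C) ((A × C) × B) := .mk'
  { obj x := ((x.1.1, x.2), x.1.2)
    map f := ((f.1.1, f.2), f.1.2)
    map₂ η := ((η.1.1, η.2), η.1.2) }

lemma pseudofunctor_ext {F G : Pseudofunctor A B} (h : F.toPrelaxFunctor = G.toPrelaxFunctor)
    (hId : ∀ a, HEq (F.mapId a).hom (G.mapId a).hom)
    (hComp : ∀ {a b c : A} (f : a ⟶ b) (g : b ⟶ c),
      HEq (F.mapComp f g).hom (G.mapComp f g).hom) : F = G := by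
  obtain ⟨P, i, m⟩ := F
  obtain ⟨P', i', m'⟩ := G
  subst h
  have e : @i = @i' := by
    funext a; exact Iso.ext (eq_of_heq (hId a))
  have e' : @m = @m' := by
    funext a b c f g; exact Iso.ext (eq_of_heq (hComp f g))
  subst e e'
  rfl

end ProdTrans

/-! ### Identities and pasting -/

section Cells

/-- An arrow which is an identity. -/
inductive IsIdentity {X : Type u} [CategoryStruct.{u} X] : ∀ {a b : X}, (a ⟶ b) → Prop
  | mk (a : X) : IsIdentity (𝟙 a)

/-- A 2-cell which is an identity: its source and its target are equal. -/
def IsId₂ {C : Type u} [Bicategory.{u, u} C] {a b : C} {f g : a ⟶ b} (η : f ⟶ g) : Prop :=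
  ∃ h : f = g, η = eqToHom h

/-- A 2-cell together with its boundary. -/
structure Cell (C : Type u) [Bicategory.{u, u} C] where
  {src : C}
  {tgt : C}
  {dom : src ⟶ tgt}
  {cod : src ⟶ tgt}
  cell : dom ⟶ cod

/-- `IsPasting l ζ` means that `ζ` is the vertical composite of the 2-cells in the nonempty
list `l`, in this order. -/
inductive IsPasting {C : Type u} [Bicategory.{u, u} C] : List (Cell C) → Cell C → Prop
  | single (ζ : Cell C) : IsPasting [ζ] ζ
  | cons {a b : C} {f g h : a ⟶ b} (η : f ⟶ g) (θ : g ⟶ h) (l : List (Cell C)) :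
      IsPasting l ⟨θ⟩ → IsPasting (⟨η⟩ :: l) ⟨η ≫ θ⟩

/-- The two lists of 2-cells can be composed vertically and have the same composite. -/
def PasteEq {C : Type u} [Bicategory.{u, u} C] (l l' : List (Cell C)) : Prop :=
  ∃ ζ : Cell C, IsPasting l ζ ∧ IsPasting l' ζ

/-- The image of a 2-cell. -/
def Cell.map {C D : Type u} [Bicategory.{u, u} C] [Bicategory.{u, u} D] (ζ : Cell C)
    (F : StrictPseudofunctor C D) : Cell D := ⟨F.map₂ ζ.cell⟩

end Cells

/-! ### Cubical functors and the cubical form of Gray-monoids -/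

section Cubical

/-- A pseudofunctor of two variables is cubical if it is strictly unital and the comparison 2-cell
for the composable pair `p`, `q` (first `p`, then `q`) is an identity whenever the second component
of `p` or the first component of `q` is an identity. -/
structure IsCubical {A B D : Type u} [Bicategory.{u, u} A] [Bicategory.{u, u} B]
    [Bicategory.{u, u} D] (F : Pseudofunctor (A × B) D) : Prop where
  mapId (x : A × B) : IsId₂ (F.mapId x).hom
  mapComp {x y z : A × B} (p : x ⟶ y) (q : y ⟶ z) :
    IsIdentity p.2 ∨ IsIdentity q.1 → IsId₂ (F.mapComp p q).hom

/-- A Gray-monoid with cubical multiplication: a cubical functor which is strictly associative and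
strictly unital. -/
structure CubicalMonoid (C : Type u) [Bicategory.{u, u} C] [Strict C] where
  sum : Pseudofunctor (C × C) C
  cubical : IsCubical sum
  unit : C
  assoc : (prodMap sum (Pseudofunctor.id C)).comp sum =
    (prodAssoc C C C).toPseudofunctor.comp ((prodMap (Pseudofunctor.id C) sum).comp sum)
  unit_sum : (Bicategory.Prod.sectR unit C).toPseudofunctor.comp sum = Pseudofunctor.id C
  sum_unit : (Bicategory.Prod.sectL C unit).toPseudofunctor.comp sum = Pseudofunctor.id C

end Cubical

lemma map₂_id_comp {C D : Type u} [Bicategory.{u, u} C] [Bicategory.{u, u} D]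
    (F : Pseudofunctor C D) {a b : C} {f : a ⟶ b} {k : F.obj a ⟶ F.obj b} (t : F.map f ⟶ k) :
    F.map₂ (𝟙 f) ≫ t = t := by
  rw [F.map₂_id, Category.id_comp]

namespace CubicalMonoid

open scoped Pseudofunctor.StrongTrans

variable {C : Type u} [Bicategory.{u, u} C] [Strict C] (M : CubicalMonoid C)

/-- The object `x + y`. -/
abbrev add (x y : C) : C := M.sum.obj (x, y)
/-- The 1-cell `y + f`. -/
abbrev lwh (y : C) {a b : C} (f : a ⟶ b) : M.add y a ⟶ M.add y b := M.sum.map (𝟙 y, f)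
/-- The 1-cell `f + z`. -/
abbrev rwh {a b : C} (f : a ⟶ b) (z : C) : M.add a z ⟶ M.add b z := M.sum.map (f, 𝟙 z)
/-- The 2-cell `y + η`. -/
abbrev lwh₂ (y : C) {a b : C} {f g : a ⟶ b} (η : f ⟶ g) : M.lwh y f ⟶ M.lwh y g :=
  M.sum.map₂ (𝟙 (𝟙 y), η)
/-- The 2-cell `η + z`. -/
abbrev rwh₂ {a b : C} {f g : a ⟶ b} (η : f ⟶ g) (z : C) : M.rwh f z ⟶ M.rwh g z :=
  M.sum.map₂ (η, 𝟙 (𝟙 z))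

/-- The interchange 2-cell `Σ_{f,g}`, obtained from the comparison 2-cells of the sum at
`(1, g)`, `(f, 1)` and at `(f, 1)`, `(1, g)`. -/
def sigma {a a' b b' : C} (f : a ⟶ a') (g : b ⟶ b') :
    M.lwh a g ≫ M.rwh f b' ≅ M.rwh f b ≫ M.lwh a' g :=
  (M.sum.mapComp (a := (a, b)) (b := (a, b')) (c := (a', b')) (𝟙 a, g) (f, 𝟙 b')).symm ≪≫
    M.sum.map₂Iso (eqToIso (by
      change (𝟙 a ≫ f, g ≫ 𝟙 b') = (f ≫ 𝟙 a', 𝟙 b ≫ g)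
      simp only [Strict.id_comp, Strict.comp_id])) ≪≫
    M.sum.mapComp (a := (a, b)) (b := (a', b)) (c := (a', b')) (f, 𝟙 b) (𝟙 a', g)

lemma add_assoc (x y z : C) : M.add (M.add x y) z = M.add x (M.add y z) :=
  congrArg (fun F => F.obj ((x, y), z)) M.assoc

/-- The identity 1-cell `(x + y) + z = x + (y + z)`. -/
def asc (x y z : C) : M.add (M.add x y) z ⟶ M.add x (M.add y z) := eqToHom (M.add_assoc x y z)

/-- The identity 1-cell `x + (y + z) = (x + y) + z`. -/
def ascInv (x y z : C) : M.add x (M.add y z) ⟶ M.add (M.add x y) z :=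
  eqToHom (M.add_assoc x y z).symm

/-- The functor `(x, y) ↦ y + x`. -/
abbrev opSum : Pseudofunctor (C × C) C := (Bicategory.Prod.swap C C).toPseudofunctor.comp M.sum

/-- The functor `(x, (y, z)) ↦ x + (y + z)`. -/
abbrev sumR : Pseudofunctor (C × (C × C)) C := (prodMap (Pseudofunctor.id C) M.sum).comp M.sum

/-- The functor `((x, y), z) ↦ (x + y) + z`. -/
abbrev sumL : Pseudofunctor ((C × C) × C) C := (prodMap M.sum (Pseudofunctor.id C)).comp M.sum

lemma sumL_eq : M.sumL = (prodAssoc C C C).toPseudofunctor.comp M.sumR := M.assoc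

lemma sumR_eq : M.sumR = (prodAssocInv C C C).toPseudofunctor.comp M.sumL := by
  rw [sumL_eq]
  exact pseudofunctor_ext rfl
    (fun a => heq_of_eq ((map₂_id_comp _ _).trans (map₂_id_comp _ _)).symm)
    (fun f g => heq_of_eq ((map₂_id_comp _ _).trans (map₂_id_comp _ _)).symm)

lemma opSum_mapComp {a b c : C × C} (p : a ⟶ b) (q : b ⟶ c) :
    (M.opSum.mapComp p q).hom =
      (M.sum.mapComp ((Bicategory.Prod.swap C C).map p) ((Bicategory.Prod.swap C C).map q)).hom :=
  map₂_id_comp M.sum _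

lemma opSum_mapId (a : C × C) : (M.opSum.mapId a).hom = (M.sum.mapId (a.2, a.1)).hom :=
  map₂_id_comp M.sum _

lemma opSumL_mapComp {a b c : (C × C) × C} (p : a ⟶ b) (q : b ⟶ c) :
    (((prodMap M.opSum (Pseudofunctor.id C)).comp M.sum).mapComp p q).hom =
      (M.sumL.mapComp (((p.1.2, p.1.1), p.2) : ((a.1.2, a.1.1), a.2) ⟶ ((b.1.2, b.1.1), b.2))
        (((q.1.2, q.1.1), q.2) : ((b.1.2, b.1.1), b.2) ⟶ ((c.1.2, c.1.1), c.2))).hom := by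
  have h := M.opSum_mapComp p.1 q.1
  exact congrArg (fun t => M.sum.map₂ (a := (M.add a.1.2 a.1.1, a.2))
    (b := (M.add c.1.2 c.1.1, c.2)) (f := (M.opSum.map (p.1 ≫ q.1), p.2 ≫ q.2))
    (g := (M.opSum.map p.1 ≫ M.opSum.map q.1, p.2 ≫ q.2)) (t, 𝟙 (p.2 ≫ q.2)) ≫
    (M.sum.mapComp (a := (M.add a.1.2 a.1.1, a.2)) (b := (M.add b.1.2 b.1.1, b.2))
    (c := (M.add c.1.2 c.1.1, c.2)) (M.opSum.map p.1, p.2) (M.opSum.map q.1, q.2)).hom) h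

lemma opSumR_mapComp {a b c : C × (C × C)} (p : a ⟶ b) (q : b ⟶ c) :
    (((prodMap (Pseudofunctor.id C) M.opSum).comp M.sum).mapComp p q).hom =
      (M.sumR.mapComp ((p.1, (p.2.2, p.2.1)) : (a.1, (a.2.2, a.2.1)) ⟶ (b.1, (b.2.2, b.2.1)))
        ((q.1, (q.2.2, q.2.1)) : (b.1, (b.2.2, b.2.1)) ⟶ (c.1, (c.2.2, c.2.1)))).hom := by
  have h := M.opSum_mapComp p.2 q.2
  exact congrArg (fun t => M.sum.map₂ (a := (a.1, M.add a.2.2 a.2.1))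
    (b := (c.1, M.add c.2.2 c.2.1)) (f := (p.1 ≫ q.1, M.opSum.map (p.2 ≫ q.2)))
    (g := (p.1 ≫ q.1, M.opSum.map p.2 ≫ M.opSum.map q.2)) (𝟙 (p.1 ≫ q.1), t) ≫
    (M.sum.mapComp (a := (a.1, M.add a.2.2 a.2.1)) (b := (b.1, M.add b.2.2 b.2.1))
    (c := (c.1, M.add c.2.2 c.2.1)) (p.1, M.opSum.map p.2) (q.1, M.opSum.map q.2)).hom) h

lemma opSumL_mapId (a : (C × C) × C) :
    (((prodMap M.opSum (Pseudofunctor.id C)).comp M.sum).mapId a).hom =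
      (M.sumL.mapId ((a.1.2, a.1.1), a.2)).hom := by
  have h := M.opSum_mapId a.1
  exact congrArg (fun t => M.sum.map₂ (a := (M.add a.1.2 a.1.1, a.2))
    (b := (M.add a.1.2 a.1.1, a.2)) (f := (M.opSum.map (𝟙 a.1), 𝟙 a.2))
    (g := (𝟙 (M.add a.1.2 a.1.1), 𝟙 a.2)) (t, 𝟙 (𝟙 a.2)) ≫
    (M.sum.mapId (M.add a.1.2 a.1.1, a.2)).hom) h

lemma opSumR_mapId (a : C × (C × C)) :
    (((prodMap (Pseudofunctor.id C) M.opSum).comp M.sum).mapId a).hom =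
      (M.sumR.mapId (a.1, (a.2.2, a.2.1))).hom := by
  have h := M.opSum_mapId a.2
  exact congrArg (fun t => M.sum.map₂ (a := (a.1, M.add a.2.2 a.2.1))
    (b := (a.1, M.add a.2.2 a.2.1)) (f := (𝟙 a.1, M.opSum.map (𝟙 a.2)))
    (g := (𝟙 a.1, 𝟙 (M.add a.2.2 a.2.1))) (𝟙 (𝟙 a.1), t) ≫
    (M.sum.mapId (a.1, M.add a.2.2 a.2.1)).hom) h

lemma swapFst_eq :
    (prodAssocInv C C C).toPseudofunctor.comp
      ((prodMap M.opSum (Pseudofunctor.id C)).comp M.sum) =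
    (swapFst C C C).toPseudofunctor.comp M.sumR := by
  rw [sumR_eq]
  exact pseudofunctor_ext rfl
    (fun a => heq_of_eq (((map₂_id_comp _ _).trans (M.opSumL_mapId _)).trans
        ((map₂_id_comp _ _).trans (map₂_id_comp _ _)).symm))
    (fun f g => heq_of_eq (((map₂_id_comp _ _).trans (M.opSumL_mapComp _ _)).trans
        ((map₂_id_comp _ _).trans (map₂_id_comp _ _)).symm))

lemma swapSnd_eq :
    (prodAssoc C C C).toPseudofunctor.comp
      ((prodMap (Pseudofunctor.id C) M.opSum).comp M.sum) =
    (swapSnd C C C).toPseudofunctor.comp M.sumL := by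
  rw [sumL_eq]
  exact pseudofunctor_ext rfl
    (fun a => heq_of_eq (((map₂_id_comp _ _).trans (M.opSumR_mapId _)).trans
        ((map₂_id_comp _ _).trans (map₂_id_comp _ _)).symm))
    (fun f g => heq_of_eq (((map₂_id_comp _ _).trans (M.opSumR_mapComp _ _)).trans
        ((map₂_id_comp _ _).trans (map₂_id_comp _ _)).symm))

lemma sumR_opSum :
    (prodMap (Pseudofunctor.id C) M.sum).comp M.opSum =
      (Bicategory.Prod.swap C (C × C)).toPseudofunctor.comp M.sumL :=
  pseudofunctor_ext rfl
    (fun a => heq_of_eq (Eq.trans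
      (b := M.sum.map₂ (a := (M.add a.2.1 a.2.2, a.1)) (b := (M.add a.2.1 a.2.2, a.1))
        (f := (M.sum.map (𝟙 a.2), 𝟙 a.1)) (g := (𝟙 (M.add a.2.1 a.2.2), 𝟙 a.1))
        ((M.sum.mapId a.2).hom, 𝟙 (𝟙 a.1)) ≫ (M.sum.mapId (M.add a.2.1 a.2.2, a.1)).hom)
      (congrArg (fun t => _ ≫ t) (M.opSum_mapId _))
      (map₂_id_comp M.sumL (f := (Bicategory.Prod.swap C (C × C)).map (𝟙 a)) _).symm))
    (fun {a b c} f g => heq_of_eq (Eq.trans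
      (b := M.sum.map₂ (a := (M.add a.2.1 a.2.2, a.1)) (b := (M.add c.2.1 c.2.2, c.1))
        (f := (M.sum.map (f.2 ≫ g.2), f.1 ≫ g.1)) (g := (M.sum.map f.2 ≫ M.sum.map g.2, f.1 ≫ g.1))
        ((M.sum.mapComp f.2 g.2).hom, 𝟙 (f.1 ≫ g.1)) ≫
        (M.sum.mapComp (a := (M.add a.2.1 a.2.2, a.1)) (b := (M.add b.2.1 b.2.2, b.1))
          (c := (M.add c.2.1 c.2.2, c.1)) (M.sum.map f.2, f.1) (M.sum.map g.2, g.1)).hom)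
      (congrArg (fun t => _ ≫ t) (M.opSum_mapComp _ _))
      (map₂_id_comp M.sumL
        (f := (Bicategory.Prod.swap C (C × C)).map (f ≫ g)) _).symm))

lemma rotR_eq :
    (swapFst C C C).toPseudofunctor.comp
      ((prodMap (Pseudofunctor.id C) M.opSum).comp M.sum) =
    (prodMap (Pseudofunctor.id C) M.sum).comp M.opSum := by
  rw [sumR_opSum, sumL_eq]
  exact pseudofunctor_ext rfl
    (fun a => heq_of_eq (((map₂_id_comp _ _).trans (M.opSumR_mapId _)).trans
        ((map₂_id_comp _ _).trans (map₂_id_comp _ _)).symm))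
    (fun f g => heq_of_eq (((map₂_id_comp _ _).trans (M.opSumR_mapComp _ _)).trans
        ((map₂_id_comp _ _).trans (map₂_id_comp _ _)).symm))

lemma sumL_opSum :
    (prodMap M.sum (Pseudofunctor.id C)).comp M.opSum =
      (Bicategory.Prod.swap (C × C) C).toPseudofunctor.comp M.sumR :=
  pseudofunctor_ext rfl
    (fun a => heq_of_eq (Eq.trans
      (b := M.sum.map₂ (a := (a.2, M.add a.1.1 a.1.2)) (b := (a.2, M.add a.1.1 a.1.2))
        (f := (𝟙 a.2, M.sum.map (𝟙 a.1))) (g := (𝟙 a.2, 𝟙 (M.add a.1.1 a.1.2)))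
        (𝟙 (𝟙 a.2), (M.sum.mapId a.1).hom) ≫ (M.sum.mapId (a.2, M.add a.1.1 a.1.2)).hom)
      (congrArg (fun t => _ ≫ t) (M.opSum_mapId _))
      (map₂_id_comp M.sumR (f := (Bicategory.Prod.swap (C × C) C).map (𝟙 a)) _).symm))
    (fun {a b c} f g => heq_of_eq (Eq.trans
      (b := M.sum.map₂ (a := (a.2, M.add a.1.1 a.1.2)) (b := (c.2, M.add c.1.1 c.1.2))
        (f := (f.2 ≫ g.2, M.sum.map (f.1 ≫ g.1))) (g := (f.2 ≫ g.2, M.sum.map f.1 ≫ M.sum.map g.1))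
        (𝟙 (f.2 ≫ g.2), (M.sum.mapComp f.1 g.1).hom) ≫
        (M.sum.mapComp (a := (a.2, M.add a.1.1 a.1.2)) (b := (b.2, M.add b.1.1 b.1.2))
          (c := (c.2, M.add c.1.1 c.1.2)) (f.2, M.sum.map f.1) (g.2, M.sum.map g.1)).hom)
      (congrArg (fun t => _ ≫ t) (M.opSum_mapComp _ _))
      (map₂_id_comp M.sumR
        (f := (Bicategory.Prod.swap (C × C) C).map (f ≫ g)) _).symm))

lemma rotL_eq :
    (swapSnd C C C).toPseudofunctor.comp
      ((prodMap M.opSum (Pseudofunctor.id C)).comp M.sum) =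
    (prodMap M.sum (Pseudofunctor.id C)).comp M.opSum := by
  rw [sumL_opSum, sumR_eq]
  exact pseudofunctor_ext rfl
    (fun a => heq_of_eq (((map₂_id_comp _ _).trans (M.opSumL_mapId _)).trans
        ((map₂_id_comp _ _).trans (map₂_id_comp _ _)).symm))
    (fun f g => heq_of_eq (((map₂_id_comp _ _).trans (M.opSumL_mapComp _ _)).trans
        ((map₂_id_comp _ _).trans (map₂_id_comp _ _)).symm))

lemma swap_opSum :
    (Bicategory.Prod.swap C C).toPseudofunctor.comp M.opSum = M.sum :=
  pseudofunctor_ext rfl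
    (fun a => heq_of_eq ((map₂_id_comp _ _).trans (M.opSum_mapId _)))
    (fun f g => heq_of_eq ((map₂_id_comp _ _).trans (M.opSum_mapComp _ _)))

variable {M} (b : M.sum ⟶ M.opSum)

/-- The transformation with components `b_{x,y} + z` followed by `y + b_{x,z}`. -/
def hexR : M.sumR ⟶ (prodMap (Pseudofunctor.id C) M.sum).comp M.opSum :=
  ofEq M.sumR_eq ≫
    whiskerL (prodAssocInv C C C).toPseudofunctor
      (whiskerR (prodTrans b (𝟙 (Pseudofunctor.id C))) M.sum) ≫
    ofEq M.swapFst_eq ≫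
    whiskerL (swapFst C C C).toPseudofunctor
      (whiskerR (prodTrans (𝟙 (Pseudofunctor.id C)) b) M.sum) ≫
    ofEq M.rotR_eq

/-- The transformation with components `x + b_{y,z}` followed by `b_{x,z} + y`. -/
def hexL : M.sumL ⟶ (prodMap M.sum (Pseudofunctor.id C)).comp M.opSum :=
  ofEq M.sumL_eq ≫
    whiskerL (prodAssoc C C C).toPseudofunctor
      (whiskerR (prodTrans (𝟙 (Pseudofunctor.id C)) b) M.sum) ≫
    ofEq M.swapSnd_eq ≫
    whiskerL (swapSnd C C C).toPseudofunctor
      (whiskerR (prodTrans b (𝟙 (Pseudofunctor.id C))) M.sum) ≫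
    ofEq M.rotL_eq

/-- The transformation with components `b_{x,y}` followed by `b_{y,x}`. -/
def double : M.sum ⟶ M.sum :=
  b ≫ whiskerL (Bicategory.Prod.swap C C).toPseudofunctor b ≫ ofEq M.swap_opSum

end CubicalMonoid

/-! ### Quasi-strict symmetric monoidal 2-categories -/

section QuasiStrict

open scoped Pseudofunctor.StrongTrans

/-- The data of a symmetric structure on a Gray-monoid with cubical multiplication: a
pseudonatural equivalence `b` with components `x + y ⟶ y + x`, and invertible modifications `R₁`
(from `b_{x,y+z}` to `b_{x,y} + z` followed by `y + b_{x,z}`), `R₂` (from `b_{x+y,z}` to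
`x + b_{y,z}` followed by `b_{x,z} + y`) and `v` (from `b_{x,y}` followed by `b_{y,x}` to the
identity). -/
structure SymmetryData {C : Type u} [Bicategory.{u, u} C] [Strict C] (M : CubicalMonoid C) where
  b : M.sum ⟶ M.opSum
  equivalence (x y : C) : ∃ e : M.add x y ≌ M.add y x, e.hom = b.app (x, y)
  R₁ : whiskerL (prodMap (Pseudofunctor.id C) M.sum) b ≅ CubicalMonoid.hexR b
  R₂ : whiskerL (prodMap M.sum (Pseudofunctor.id C)) b ≅ CubicalMonoid.hexL b
  v : CubicalMonoid.double b ≅ 𝟙 M.sum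

namespace SymmetryData

variable {C : Type u} [Bicategory.{u, u} C] [Strict C] {M : CubicalMonoid C} (S : SymmetryData M)

/-- The component `b_{x,y}`. -/
abbrev br (x y : C) : M.add x y ⟶ M.add y x := S.b.app (x, y)

/-- The 1-cell `b_{x,y} + z` followed by `y + b_{x,z}`. -/
abbrev t₁ (x y z : C) : M.add x (M.add y z) ⟶ M.add (M.add y z) x :=
  (CubicalMonoid.hexR S.b).app (x, (y, z))

/-- The 1-cell `x + b_{y,z}` followed by `b_{x,z} + y`. -/
abbrev t₂ (x y z : C) : M.add (M.add x y) z ⟶ M.add z (M.add x y) :=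
  (CubicalMonoid.hexL S.b).app ((x, y), z)

/-- The 1-cell `b_{x,y}` followed by `b_{y,x}`. -/
abbrev dbl (x y : C) : M.add x y ⟶ M.add x y := (CubicalMonoid.double S.b).app (x, y)

/-- The components of `R₁`. -/
def r₁ (x y z : C) : S.br x (M.add y z) ≅ S.t₁ x y z where
  hom := S.R₁.hom.as.app (x, (y, z))
  inv := S.R₁.inv.as.app (x, (y, z))
  hom_inv_id := congrArg (fun m => m.as.app (x, (y, z))) S.R₁.hom_inv_id
  inv_hom_id := congrArg (fun m => m.as.app (x, (y, z))) S.R₁.inv_hom_id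

/-- The components of `R₂`. -/
def r₂ (x y z : C) : S.br (M.add x y) z ≅ S.t₂ x y z where
  hom := S.R₂.hom.as.app ((x, y), z)
  inv := S.R₂.inv.as.app ((x, y), z)
  hom_inv_id := congrArg (fun m => m.as.app ((x, y), z)) S.R₂.hom_inv_id
  inv_hom_id := congrArg (fun m => m.as.app ((x, y), z)) S.R₂.inv_hom_id

/-- The components of `v`. -/
def vc (x y : C) : S.dbl x y ≅ 𝟙 (M.add x y) where
  hom := S.v.hom.as.app (x, y)
  inv := S.v.inv.as.app (x, y)
  hom_inv_id := congrArg (fun m => m.as.app (x, y)) S.v.hom_inv_id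
  inv_hom_id := congrArg (fun m => m.as.app (x, y)) S.v.inv_hom_id

/-- The naturality 2-cell of `b` at `(1, g)`. -/
def natR (x : C) {y y' : C} (g : y ⟶ y') :
    M.lwh x g ≫ S.br x y' ≅ S.br x y ≫ M.rwh g x :=
  S.b.naturality (a := (x, y)) (b := (x, y')) (𝟙 x, g)

/-- The naturality 2-cell of `b` at `(f, 1)`. -/
def natL {x x' : C} (f : x ⟶ x') (y : C) :
    M.rwh f y ≫ S.br x' y ≅ S.br x y ≫ M.lwh y f :=
  S.b.naturality (a := (x, y)) (b := (x', y)) (f, 𝟙 y)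

lemma mid_eq (x y z w : C) : M.add x (M.add (M.add y z) w) = M.add (M.add x y) (M.add z w) := by
  rw [M.add_assoc y z w, M.add_assoc x y]

end SymmetryData

/-- The axioms of a braided and sylleptic structure, the symmetry axiom, and the unit conditions of
a strict structure. -/
structure SymmetryData.IsSymmetric {C : Type u} [Bicategory.{u, u} C] [Strict C]
    {M : CubicalMonoid C} (S : SymmetryData M) : Prop where
  /-- The two 2-cells from `b_{x,y+z+w}` to the composite of `b_{x,y}`, `b_{x,z}` and `b_{x,w}`. -/
  one_three (x y z w : C) : PasteEq
    [⟨(S.r₁ x y (M.add z w)).hom⟩,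
      ⟨(M.rwh (S.br x y) (M.add z w) ≫ M.asc y x (M.add z w)) ◁ M.lwh₂ y (S.r₁ x z w).hom⟩]
    [⟨(S.r₁ x (M.add y z) w).hom⟩,
      ⟨M.rwh₂ (S.r₁ x y z).hom w ▷ (M.asc (M.add y z) x w ≫ M.lwh (M.add y z) (S.br x w))⟩]
  /-- The two 2-cells from `b_{x+y+z,w}` to the composite of `b_{z,w}`, `b_{y,w}` and `b_{x,w}`. -/
  three_one (x y z w : C) : PasteEq
    [⟨(S.r₂ (M.add x y) z w).hom⟩,
      ⟨(M.lwh (M.add x y) (S.br z w) ≫ M.ascInv (M.add x y) w z) ◁ M.rwh₂ (S.r₂ x y w).hom z⟩]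
    [⟨(S.r₂ x (M.add y z) w).hom⟩,
      ⟨M.lwh₂ x (S.r₂ y z w).hom ▷ (M.ascInv x w (M.add y z) ≫ M.rwh (S.br x w) (M.add y z))⟩]
  /-- The two 2-cells from `b_{x+y,z+w}` to the composite of `b_{y,z}`, `b_{x,z}`, `b_{y,w}` and
  `b_{x,w}`, which differ by the interchange of `b_{x,z}` and `b_{y,w}`. -/
  two_two (x y z w : C) : PasteEq
    [⟨(S.r₁ (M.add x y) z w).hom⟩,
      ⟨M.rwh₂ (S.r₂ x y z).hom w ▷ (M.asc z (M.add x y) w ≫ M.lwh z (S.br (M.add x y) w))⟩,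
      ⟨(M.rwh (S.t₂ x y z) w ≫ M.asc z (M.add x y) w) ◁ M.lwh₂ z (S.r₂ x y w).hom⟩]
    [⟨(S.r₂ x y (M.add z w)).hom⟩,
      ⟨M.lwh₂ x (S.r₁ y z w).hom ▷ (M.ascInv x (M.add z w) y ≫ M.rwh (S.br x (M.add z w)) y)⟩,
      ⟨(M.lwh x (S.t₁ y z w) ≫ M.ascInv x (M.add z w) y) ◁ M.rwh₂ (S.r₁ x z w).hom y⟩,
      ⟨(M.lwh x (M.rwh (S.br y z) w) ≫ eqToHom (SymmetryData.mid_eq x z y w)) ◁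
        ((M.sigma (S.br x z) (S.br y w)).hom ▷
          (eqToHom (SymmetryData.mid_eq z x w y).symm ≫ M.lwh z (M.rwh (S.br x w) y)))⟩]
  /-- The two 2-cells between the two composites of `b_{x,y}`, `b_{x,z}` and `b_{y,z}`. -/
  yang_baxter (x y z : C) : PasteEq
    [⟨(S.r₁ x y z).inv ▷ M.rwh (S.br y z) x⟩, ⟨(S.natR x (S.br y z)).inv⟩,
      ⟨M.lwh x (S.br y z) ◁ (S.r₁ x z y).hom⟩]
    [⟨M.rwh (S.br x y) z ◁ (S.r₂ y x z).inv⟩, ⟨(S.natL (S.br x y) z).hom⟩,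
      ⟨(S.r₂ x y z).hom ▷ M.lwh z (S.br x y)⟩]
  /-- Compatibility of `v_{x,y+z}` with `v_{x,y}` and `v_{x,z}`. -/
  syllepsis_one_two (x y z : C) : PasteEq
    [⟨(S.vc x (M.add y z)).hom⟩]
    [⟨(S.r₁ x y z).hom ▷ S.br (M.add y z) x⟩, ⟨S.t₁ x y z ◁ (S.r₂ y z x).hom⟩,
      ⟨(M.rwh (S.br x y) z ≫ M.asc y x z) ◁
        (M.lwh₂ y (S.vc x z).hom ▷ (M.ascInv y x z ≫ M.rwh (S.br y x) z))⟩,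
      ⟨M.rwh₂ (S.vc x y).hom z⟩]
  /-- Compatibility of `v_{x+y,z}` with `v_{x,z}` and `v_{y,z}`. -/
  syllepsis_two_one (x y z : C) : PasteEq
    [⟨(S.vc (M.add x y) z).hom⟩]
    [⟨(S.r₂ x y z).hom ▷ S.br z (M.add x y)⟩, ⟨S.t₂ x y z ◁ (S.r₁ z x y).hom⟩,
      ⟨(M.lwh x (S.br y z) ≫ M.ascInv x z y) ◁
        (M.rwh₂ (S.vc x z).hom y ▷ (M.asc x z y ≫ M.lwh x (S.br z y)))⟩,
      ⟨M.lwh₂ x (S.vc y z).hom⟩]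
  symmetry (x y : C) : PasteEq [⟨(S.vc x y).hom ▷ S.br x y⟩] [⟨S.br x y ◁ (S.vc y x).hom⟩]
  b_unit_left : IsIdentity (whiskerL (Bicategory.Prod.sectR M.unit C).toPseudofunctor S.b)
  b_unit_right : IsIdentity (whiskerL (Bicategory.Prod.sectL C M.unit).toPseudofunctor S.b)
  r₁_unit (x y z : C) (h : x = M.unit ∨ y = M.unit ∨ z = M.unit) : IsId₂ (S.r₁ x y z).hom
  r₂_unit (x y z : C) (h : x = M.unit ∨ y = M.unit ∨ z = M.unit) : IsId₂ (S.r₂ x y z).hom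
  v_unit (x y : C) (h : x = M.unit ∨ y = M.unit) : IsId₂ (S.vc x y).hom

/-- A quasi-strict symmetric monoidal structure on a 2-category: a Gray-monoid with cubical
multiplication and a strict symmetric structure such that the modifications `R₁`, `R₂` and `v` are
identities, the naturality 2-cells `b_{f,1}` and `b_{1,g}` are identities, and the interchange 2-cells
`Σ_{b,g}` and `Σ_{f,b}` are identities. -/
structure QuasiStrict (C : Type u) [Bicategory.{u, u} C] [Strict C] where
  mon : CubicalMonoid C
  sym : SymmetryData mon
  isSymmetric : sym.IsSymmetric
  R₁_id : IsIdentity sym.R₁.hom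
  R₂_id : IsIdentity sym.R₂.hom
  v_id : IsIdentity sym.v.hom
  nat_id_left {x x' : C} (f : x ⟶ x') (y : C) : IsId₂ (sym.natL f y).hom
  nat_id_right (x : C) {y y' : C} (g : y ⟶ y') : IsId₂ (sym.natR x g).hom
  sigma_left (x y : C) {z z' : C} (g : z ⟶ z') : IsId₂ (mon.sigma (sym.br x y) g).hom
  sigma_right {z z' : C} (f : z ⟶ z') (x y : C) : IsId₂ (mon.sigma f (sym.br x y)).hom

end QuasiStrict

/-! ### Tensoring transformations with objects on one side -/

section GrayTrans

open scoped Pseudofunctor.StrongTrans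

namespace Gray

/-- A pair of invertible 2-cells. -/
def isoPair {A B : Type u} [Bicategory.{u, u} A] [Bicategory.{u, u} B] [Strict A] [Strict B]
    {x y : A × B} {f g : x ⟶ y} (e : f.1 ≅ g.1) (e' : f.2 ≅ g.2) : f ≅ g where
  hom := (e.hom, e'.hom)
  inv := (e.inv, e'.inv)
  hom_inv_id := Prod.ext e.hom_inv_id e'.hom_inv_id
  inv_hom_id := Prod.ext e.inv_hom_id e'.inv_hom_id

lemma pair_comp {A B : Type u} [Bicategory.{u, u} A] [Bicategory.{u, u} B] [Strict A] [Strict B]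
    {a b c a' b' c' : A × B} {l : a ⟶ b} {m : b ⟶ c} {n : a' ⟶ b'} {o : b' ⟶ c'} {s : a ⟶ a'}
    {t : b ⟶ b'} {r : c ⟶ c'} {k : a ⟶ c} {j : a' ⟶ c'} (p : l ≫ t ⟶ s ≫ n) (q : m ≫ r ⟶ t ≫ o)
    (w : k ≫ r ⟶ s ≫ j) (i₁ : k ≫ r = l ≫ m ≫ r) (i₂ : (s ≫ n) ≫ o = s ≫ j)
    (h₁ : ∀ (e₁ : k.1 ≫ r.1 = l.1 ≫ m.1 ≫ r.1) (e₂ : l.1 ≫ t.1 ≫ o.1 = (l.1 ≫ t.1) ≫ o.1)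
      (e₃ : (s.1 ≫ n.1) ≫ o.1 = s.1 ≫ j.1),
      w.1 = eqToHom e₁ ≫ l.1 ◁ q.1 ≫ eqToHom e₂ ≫ p.1 ▷ o.1 ≫ eqToHom e₃)
    (h₂ : ∀ (e₁ : k.2 ≫ r.2 = l.2 ≫ m.2 ≫ r.2) (e₂ : l.2 ≫ t.2 ≫ o.2 = (l.2 ≫ t.2) ≫ o.2)
      (e₃ : (s.2 ≫ n.2) ≫ o.2 = s.2 ≫ j.2),
      w.2 = eqToHom e₁ ≫ l.2 ◁ q.2 ≫ eqToHom e₂ ≫ p.2 ▷ o.2 ≫ eqToHom e₃) :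
    w = eqToHom i₁ ≫ l ◁ q ≫ eqToHom (Strict.assoc _ _ _).symm ≫ p ▷ o ≫ eqToHom i₂ :=
  Prod.ext
    ((h₁ (congrArg (fun t => t.1) i₁) (Strict.assoc _ _ _).symm (congrArg (fun t => t.1) i₂)).trans
      (by simp only [prod_comp₂_fst, prod_eqToHom₂_fst]; rfl))
    ((h₂ (congrArg (fun t => t.2) i₁) (Strict.assoc _ _ _).symm (congrArg (fun t => t.2) i₂)).trans
      (by simp only [prod_comp₂_snd, prod_eqToHom₂_snd]; rfl))

section
variable {A A' : Type u} [Bicategory.{u, u} A] [Bicategory.{u, u} A'] [Strict A] [Strict A']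
  {F G : StrictPseudofunctor A A'} (α : F.toPseudofunctor ⟶ G.toPseudofunctor)

lemma eq_of_comp_eqToHom {a b : A} {f g h : a ⟶ b} {n : f ⟶ g} (i : g = h) (j : f = h)
    (e : n ≫ eqToHom i = eqToHom j) (k : f = g) : n = eqToHom k := by
  subst i
  simpa using e

lemma trans_nat_id (a : A) (h : F.map (𝟙 a) ≫ α.app a = α.app a ≫ G.map (𝟙 a)) :
    (α.naturality (𝟙 a)).hom = eqToHom h := by
  have e := α.naturality_id a
  simp only [F.mapId_eq_eqToIso, G.mapId_eq_eqToIso, Strict.leftUnitor_eqToIso,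
      Strict.rightUnitor_eqToIso, eqToIso.hom, eqToIso.inv, whiskerLeft_eqToHom,
      eqToHom_whiskerRight, eqToHom_trans] at e
  exact eq_of_comp_eqToHom _ _ e h

lemma trans_nat_comp {a b c : A} (f : a ⟶ b) (g : b ⟶ c) {k : a ⟶ c} (hk : k = f ≫ g)
    (h₁ : F.map k ≫ α.app c = F.map f ≫ F.map g ≫ α.app c)
    (h₂ : (α.app a ≫ G.map f) ≫ G.map g = α.app a ≫ G.map k) :
    (α.naturality k).hom = eqToHom h₁ ≫ F.map f ◁ (α.naturality g).hom ≫
      eqToHom (Strict.assoc _ _ _).symm ≫ (α.naturality f).hom ▷ G.map g ≫ eqToHom h₂ := by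
  subst hk
  have e := α.naturality_comp f g
  simp only [F.mapComp_eq_eqToIso, G.mapComp_eq_eqToIso, Strict.associator_eqToIso,
      eqToIso.hom, eqToIso.inv, whiskerLeft_eqToHom,
      eqToHom_whiskerRight] at e
  have e' := congrArg (fun t => t ≫ eqToHom (congrArg (α.app a ≫ ·) (G.map_comp f g)).symm) e
  simpa using e'

end

variable {A A' B B' : Type u} [Bicategory.{u, u} A] [Bicategory.{u, u} A'] [Bicategory.{u, u} B]
  [Bicategory.{u, u} B'] [Strict A] [Strict A'] [Strict B] [Strict B']

lemma side_nat {B : Type u} [Bicategory.{u, u} B] [Strict B] {x y : B} {f g : x ⟶ y} (η : f ⟶ g) :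
    η ▷ 𝟙 y ≫ eqToHom ((Strict.comp_id g).trans (Strict.id_comp g).symm) =
      eqToHom ((Strict.comp_id f).trans (Strict.id_comp f).symm) ≫ 𝟙 x ◁ η := by
  simp [id_whisker, whisker_id]

lemma side_comp {B : Type u} [Bicategory.{u, u} B] [Strict B] {x y z : B} (f : x ⟶ y) (g : y ⟶ z) {k : x ⟶ z}
    (h₀ : k ≫ 𝟙 z = 𝟙 x ≫ k) (h₁ : k ≫ 𝟙 z = f ≫ g ≫ 𝟙 z)
    (h₂ : g ≫ 𝟙 z = 𝟙 y ≫ g) (h₃ : f ≫ 𝟙 y ≫ g = (f ≫ 𝟙 y) ≫ g) (h₄ : f ≫ 𝟙 y = 𝟙 x ≫ f)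
    (h₅ : (𝟙 x ≫ f) ≫ g = 𝟙 x ≫ k) :
    eqToHom h₀ = eqToHom h₁ ≫ f ◁ eqToHom h₂ ≫ eqToHom h₃ ≫ eqToHom h₄ ▷ g ≫ eqToHom h₅ := by
  simp

/-- The data of the transformation `α ⊗ B`. -/
def tensorRightData {F G : StrictPseudofunctor A A'} (α : F.toPseudofunctor ⟶ G.toPseudofunctor) :
    (mapLift F (StrictPseudofunctor.id B)).Trans (mapLift G (StrictPseudofunctor.id B)) where
  word x := wLeft (α.app x.base.as.fst) x.base.as.snd
  app x := (α.app x.base.as.fst, 𝟙 x.base.as.snd)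
  app_eq x := proj_left _ _
  nat f := isoPair (α.naturality _) (eqToIso ((Strict.comp_id _).trans (Strict.id_comp _).symm))
  nat_nat η := Prod.ext (α.naturality_naturality _) (side_nat _)
  nat_id x h := Prod.ext
    ((trans_nat_id α _ (congrArg (fun t => t.1) h)).trans (prod_eqToHom₂_fst h).symm)
    (prod_eqToHom₂_snd h).symm
  nat_comp f g := pair_comp _ _ _ _ _
    (fun _ _ _ => trans_nat_comp α ((wordsProj A B).map f.word).1 ((wordsProj A B).map g.word).1
      (congrArg (fun t => t.1) ((wordsProj A B).map_comp f.word g.word)) _ _)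
    (fun _ _ _ => side_comp _ _
      ((Strict.comp_id _).trans (Strict.id_comp _).symm) _
      ((Strict.comp_id _).trans (Strict.id_comp _).symm) _
      ((Strict.comp_id _).trans (Strict.id_comp _).symm) _)

/-- The transformation `α ⊗ B`. -/
def tensorRight {F G : StrictPseudofunctor A A'} (α : F.toPseudofunctor ⟶ G.toPseudofunctor)
    (B : Type u) [Bicategory.{u, u} B] [Strict B] :
    (map F (StrictPseudofunctor.id B)).toPseudofunctor ⟶
      (map G (StrictPseudofunctor.id B)).toPseudofunctor :=
  (tensorRightData α).toTrans

/-- The data of the transformation `A ⊗ α`. -/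
def tensorLeftData {F G : StrictPseudofunctor B B'} (α : F.toPseudofunctor ⟶ G.toPseudofunctor) :
    (mapLift (StrictPseudofunctor.id A) F).Trans (mapLift (StrictPseudofunctor.id A) G) where
  word x := wRight x.base.as.fst (α.app x.base.as.snd)
  app x := (𝟙 x.base.as.fst, α.app x.base.as.snd)
  app_eq x := proj_right _ _
  nat f := isoPair (eqToIso ((Strict.comp_id _).trans (Strict.id_comp _).symm)) (α.naturality _)
  nat_nat η := Prod.ext (side_nat _) (α.naturality_naturality _)
  nat_id x h := Prod.ext (prod_eqToHom₂_fst h).symm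
    ((trans_nat_id α _ (congrArg (fun t => t.2) h)).trans (prod_eqToHom₂_snd h).symm)
  nat_comp f g := pair_comp _ _ _ _ _
    (fun _ _ _ => side_comp _ _
      ((Strict.comp_id _).trans (Strict.id_comp _).symm) _
      ((Strict.comp_id _).trans (Strict.id_comp _).symm) _
      ((Strict.comp_id _).trans (Strict.id_comp _).symm) _)
    (fun _ _ _ => trans_nat_comp α ((wordsProj A B).map f.word).2 ((wordsProj A B).map g.word).2
      (congrArg (fun t => t.2) ((wordsProj A B).map_comp f.word g.word)) _ _)

/-- The transformation `A ⊗ α`. -/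
def tensorLeft (A : Type u) [Bicategory.{u, u} A] [Strict A] {F G : StrictPseudofunctor B B'}
    (α : F.toPseudofunctor ⟶ G.toPseudofunctor) :
    (map (StrictPseudofunctor.id A) F).toPseudofunctor ⟶
      (map (StrictPseudofunctor.id A) G).toPseudofunctor :=
  (tensorLeftData α).toTrans

end Gray

end GrayTrans

/-! ### Permutative Gray-monoids -/

section Permutative

open scoped Pseudofunctor.StrongTrans

/-- `IsComposite p q r` means that `r` is the composite of `p` followed by `q`. -/
inductive IsComposite {X : Type u} [CategoryStruct.{u} X] : ∀ {a b b' c a' c' : X},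
    (a ⟶ b) → (b' ⟶ c) → (a' ⟶ c') → Prop
  | mk {a b c : X} (p : a ⟶ b) (q : b ⟶ c) : IsComposite p q (p ≫ q)

/-- `SameArrow p q` means that `p` and `q` are the same arrow. -/
inductive SameArrow {X : Type u} [CategoryStruct.{u} X] : ∀ {a b a' b' : X},
    (a ⟶ b) → (a' ⟶ b') → Prop
  | mk {a b : X} (p : a ⟶ b) : SameArrow p p

/-- A Gray-monoid: a monoid in the monoidal category of 2-categories with the Gray tensor
product. -/
structure GrayMonoid (C : Type u) [Bicategory.{u, u} C] [Strict C] where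
  sum : StrictPseudofunctor (Gray C C) C
  unit : C
  assoc : (Gray.map sum (StrictPseudofunctor.id C)).comp sum =
    (Gray.assoc C C C).comp ((Gray.map (StrictPseudofunctor.id C) sum).comp sum)
  unit_sum : (Gray.inclRight unit C).comp sum = StrictPseudofunctor.id C
  sum_unit : (Gray.inclLeft C unit).comp sum = StrictPseudofunctor.id C

/-- A permutative structure on a 2-category: a Gray-monoid with a 2-natural isomorphism `β` from
the sum to the sum precomposed with the symmetry, subject to three axioms. -/
structure Permutative (C : Type u) [Bicategory.{u, u} C] [Strict C] where
  mon : GrayMonoid C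
  β : mon.sum.toPseudofunctor ⟶ ((Gray.swap C C).comp mon.sum).toPseudofunctor
  /-- The transformation is 2-natural. -/
  natural {x y : Gray C C} (w : x ⟶ y) : IsId₂ (β.naturality w).hom
  /-- The transformation is an isomorphism. -/
  invertible (x : Gray C C) : ∃ g, β.app x ≫ g = 𝟙 _ ∧ g ≫ β.app x = 𝟙 _
  /-- `β` followed by `β τ` is the identity. -/
  symmetry : IsComposite β (whiskerL (Gray.swap C C).toPseudofunctor β)
    (𝟙 mon.sum.toPseudofunctor)
  /-- `β (e ⊗ id)` is the identity. -/
  unit : IsIdentity (whiskerL (Gray.inclRight mon.unit C).toPseudofunctor β)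
  /-- `β (id ⊗ ⊕)` is the pasting of `β ⊗ id` and `id ⊗ β`. -/
  hexagon : IsComposite
    (whiskerR (Gray.tensorRight β C) mon.sum.toPseudofunctor)
    (whiskerL ((Gray.map (Gray.swap C C) (StrictPseudofunctor.id C)).comp
        (Gray.assoc C C C)).toPseudofunctor
      (whiskerR (Gray.tensorLeft C β) mon.sum.toPseudofunctor))
    (whiskerL ((Gray.assoc C C C).comp
        (Gray.map (StrictPseudofunctor.id C) mon.sum)).toPseudofunctor β)

end Permutative

/-! ### The categories -/

section Categories

lemma strict_ext {A B : Type u} [Bicategory.{u, u} A] [Bicategory.{u, u} B]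
    {F G : StrictPseudofunctor A B} (h : F.toPrelaxFunctor = G.toPrelaxFunctor) : F = G := by
  obtain ⟨⟨⟨P, i, m⟩, hi, hi'⟩, hm, hm'⟩ := F
  obtain ⟨⟨⟨Q, j, n⟩, hj, hj'⟩, hn, hn'⟩ := G
  dsimp only at h
  subst h
  have e : @i = @j := by
    funext a; exact (hi' a).trans (hj' a).symm
  have e' : @m = @n := by
    funext a b c f g; exact (hm' f g).trans (hn' f g).symm
  subst e e'
  rfl

/-- A small 2-category. -/
structure TwoCat where
  carrier : Type u
  [bicategory : Bicategory.{u, u} carrier]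
  [strict : Strict carrier]

attribute [instance] TwoCat.bicategory TwoCat.strict

/-- The category of small 2-categories and 2-functors. -/
instance : Category.{u} TwoCat.{u} where
  Hom C D := StrictPseudofunctor C.carrier D.carrier
  id C := StrictPseudofunctor.id C.carrier
  comp F G := F.comp G
  id_comp F := strict_ext rfl
  comp_id F := strict_ext rfl
  assoc F G H := strict_ext rfl

end Categories

/-! ### Equalities of functors and transformations -/

section Equalities

open scoped Pseudofunctor.StrongTrans

lemma SameArrow.symm {X : Type u} [CategoryStruct.{u} X] {a b a' b' : X} {p : a ⟶ b}
    {q : a' ⟶ b'} (h : SameArrow p q) : SameArrow q p := by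
  cases h; exact .mk _

lemma SameArrow.trans {X : Type u} [CategoryStruct.{u} X] {a b a' b' a'' b'' : X} {p : a ⟶ b}
    {q : a' ⟶ b'} {r : a'' ⟶ b''} (h : SameArrow p q) (h' : SameArrow q r) : SameArrow p r := by
  cases h; exact h'

variable {A B C D : Type u} [Bicategory.{u, u} A] [Bicategory.{u, u} B] [Bicategory.{u, u} C]
  [Bicategory.{u, u} D]

lemma map₂_comp_comp (H : Pseudofunctor A B) {a b : A} {f g h : a ⟶ b} {k : H.obj a ⟶ H.obj b}
    (η : f ⟶ g) (θ : g ⟶ h) (t : H.map h ⟶ k) :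
    H.map₂ (η ≫ θ) ≫ t = H.map₂ η ≫ H.map₂ θ ≫ t := by
  simp

lemma map₂_conj (H : Pseudofunctor A B) {a b : A} {f g h i : a ⟶ b} {k l : H.obj a ⟶ H.obj b}
    (s : k ⟶ H.map f) (η : f ⟶ g) (θ : g ⟶ h) (ι : h ⟶ i) (t : H.map i ⟶ l) :
    (s ≫ H.map₂ η) ≫ H.map₂ θ ≫ H.map₂ ι ≫ t = s ≫ H.map₂ (η ≫ θ ≫ ι) ≫ t := by
  simp

lemma comp_assoc (F : Pseudofunctor A B) (G : Pseudofunctor B C) (H : Pseudofunctor C D) :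
    (F.comp G).comp H = F.comp (G.comp H) :=
  pseudofunctor_ext rfl
    (fun a => heq_of_eq (map₂_comp_comp H _ _ _))
    (fun f g => heq_of_eq (map₂_comp_comp H _ _ _))

lemma id_comp (F : Pseudofunctor A B) : (Pseudofunctor.id A).comp F = F :=
  pseudofunctor_ext rfl (fun a => heq_of_eq (map₂_id_comp F _))
    (fun f g => heq_of_eq (map₂_id_comp F _))

lemma comp_id (F : Pseudofunctor A B) : F.comp (Pseudofunctor.id B) = F :=
  pseudofunctor_ext rfl (fun a => heq_of_eq (Category.comp_id _))
    (fun f g => heq_of_eq (Category.comp_id _))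

lemma sameArrow_of {F G F' G' : Pseudofunctor A B} {α : F ⟶ G} {β : F' ⟶ G'} (hF : F = F')
    (hG : G = G') (app : ∀ a, HEq (α.app a) (β.app a))
    (nat : ∀ {a b : A} (f : a ⟶ b), HEq (α.naturality f).hom (β.naturality f).hom) :
    SameArrow α β := by
  subst hF hG
  obtain ⟨p, m⟩ := α
  obtain ⟨q, n⟩ := β
  have e : @p = @q := by
    funext a; exact eq_of_heq (app a)
  subst e
  have e' : @m = @n := by
    funext a b f; exact Iso.ext (eq_of_heq (nat f))
  subst e'
  exact .mk _

lemma SameArrow.whiskerR {F G F' G' : Pseudofunctor A B} {α : F ⟶ G} {β : F' ⟶ G'}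
    (h : SameArrow α β) (H : Pseudofunctor B C) :
    SameArrow (GrayPerm.whiskerR α H) (GrayPerm.whiskerR β H) := by
  cases h; exact .mk _

lemma SameArrow.whiskerL {F G F' G' : Pseudofunctor B C} {α : F ⟶ G} {β : F' ⟶ G'}
    (h : SameArrow α β) (H : Pseudofunctor A B) :
    SameArrow (GrayPerm.whiskerL H α) (GrayPerm.whiskerL H β) := by
  cases h; exact .mk _

lemma whiskerL_congr {F G : Pseudofunctor B C} (α : F ⟶ G) {H K : Pseudofunctor A B} (h : H = K) :
    SameArrow (whiskerL H α) (whiskerL K α) := by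
  cases h; exact .mk _

lemma whiskerL_comp_same {F G : Pseudofunctor C D} (α : F ⟶ G) (H : Pseudofunctor A B)
    (K : Pseudofunctor B C) : SameArrow (whiskerL (H.comp K) α) (whiskerL H (whiskerL K α)) :=
  sameArrow_of (comp_assoc _ _ _) (comp_assoc _ _ _) (fun _ => HEq.rfl) (fun _ => HEq.rfl)

lemma whiskerR_comp_same {F G : Pseudofunctor A B} (α : F ⟶ G) (H : Pseudofunctor B C)
    (K : Pseudofunctor C D) : SameArrow (whiskerR α (H.comp K)) (whiskerR (whiskerR α H) K) :=
  sameArrow_of (comp_assoc _ _ _).symm (comp_assoc _ _ _).symm (fun _ => HEq.rfl)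
    (fun f => heq_of_eq (map₂_conj K _ _ _ _ _))

lemma whiskerLR_same (H : Pseudofunctor A B) {F G : Pseudofunctor B C} (α : F ⟶ G)
    (K : Pseudofunctor C D) : SameArrow (whiskerR (whiskerL H α) K) (whiskerL H (whiskerR α K)) :=
  sameArrow_of (comp_assoc _ _ _) (comp_assoc _ _ _) (fun _ => HEq.rfl) (fun _ => HEq.rfl)

lemma whiskerL_id_same {F G : Pseudofunctor A B} (α : F ⟶ G) :
    SameArrow (whiskerL (Pseudofunctor.id A) α) α :=
  sameArrow_of (id_comp _) (id_comp _) (fun _ => HEq.rfl) (fun _ => HEq.rfl)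

lemma whiskerR_id_same {F G : Pseudofunctor A B} (α : F ⟶ G) :
    SameArrow (whiskerR α (Pseudofunctor.id B)) α :=
  sameArrow_of (comp_id _) (comp_id _) (fun _ => HEq.rfl)
    (fun f => heq_of_eq ((Category.id_comp _).trans (Category.comp_id _)))

lemma prodMap_id : prodMap (Pseudofunctor.id A) (Pseudofunctor.id B) = Pseudofunctor.id (A × B) :=
  rfl

variable {A' B' A'' B'' : Type u} [Bicategory.{u, u} A'] [Bicategory.{u, u} B']
  [Bicategory.{u, u} A''] [Bicategory.{u, u} B'']

lemma prodMap_comp (F : Pseudofunctor A A') (F' : Pseudofunctor A' A'') (G : Pseudofunctor B B')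
    (G' : Pseudofunctor B' B'') :
    prodMap (F.comp F') (G.comp G') = (prodMap F G).comp (prodMap F' G') :=
  pseudofunctor_ext rfl (fun _ => HEq.rfl) (fun _ _ => HEq.rfl)

lemma prelax_ext {F G : PrelaxFunctor A B} (obj : F.obj = G.obj)
    (map : ∀ {a b : A} (f : a ⟶ b), HEq (F.map f) (G.map f))
    (map₂ : ∀ {a b : A} {f g : a ⟶ b} (η : f ⟶ g), HEq (F.map₂ η) (G.map₂ η)) : F = G := by
  obtain ⟨⟨⟨o, m⟩, n⟩, h, k⟩ := F
  obtain ⟨⟨⟨o', m'⟩, n'⟩, h', k'⟩ := G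
  dsimp only at obj map map₂
  subst obj
  have e : @m = @m' := by
    funext a b f; exact eq_of_heq (map f)
  subst e
  have e' : @n = @n' := by
    funext a b f g η; exact eq_of_heq (map₂ η)
  subst e'
  rfl

lemma strict_ext' {F G : StrictPseudofunctor A B} (obj : F.obj = G.obj)
    (map : ∀ {a b : A} (f : a ⟶ b), HEq (F.map f) (G.map f))
    (map₂ : ∀ {a b : A} {f g : a ⟶ b} (η : f ⟶ g), HEq (F.map₂ η) (G.map₂ η)) : F = G :=
  strict_ext (prelax_ext obj map map₂)

end Equalities

namespace Gray

variable {A A' A'' B B' B'' : Type u} [Bicategory.{u, u} A] [Bicategory.{u, u} A']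
  [Bicategory.{u, u} A''] [Bicategory.{u, u} B] [Bicategory.{u, u} B'] [Bicategory.{u, u} B'']
  [Strict A] [Strict A'] [Strict A''] [Strict B] [Strict B'] [Strict B'']

lemma hom₂_heq {x y : Gray A B} {f f' g g' : x ⟶ y} (hf : f = f') (hg : g = g') {η : f ⟶ g}
    {η' : f' ⟶ g'} (h : HEq η.val η'.val) : HEq η η' := by
  subst hf hg
  exact heq_of_eq (Factor.hom_ext (eq_of_heq h))

lemma conj_heq {x y : A} {f f' g g' : x ⟶ y} (hf : f' = f) (hg : g = g') (η : f ⟶ g) :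
    HEq (eqToHom hf ≫ η ≫ eqToHom hg) η := by
  subst hf hg
  simp

lemma map₂_heq (S : StrictPseudofunctor A A') {x y : A} {f f' g g' : x ⟶ y} (hf : f = f')
    (hg : g = g') {η : f ⟶ g} {η' : f' ⟶ g'} (h : HEq η η') : HEq (S.map₂ η) (S.map₂ η') := by
  subst hf hg
  cases h
  rfl

lemma map_id_word {x y : Words A B} (w : x ⟶ y) :
    (mapData (StrictPseudofunctor.id A) (StrictPseudofunctor.id B)).functor.map w = w :=
  words_eq (D := Words A B) (fun x => x)
    (fun w => (mapData (StrictPseudofunctor.id A) (StrictPseudofunctor.id B)).functor.map w)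
    (fun w => w) (fun x => CategoryTheory.Functor.map_id _ _) (fun _ => rfl) (fun v w => CategoryTheory.Functor.map_comp _ _ _)
    (fun _ _ => rfl) (fun f b => WordsData.functor_left _ f b)
    (fun a _ _ g => WordsData.functor_right _ a g) w

lemma map_id : map (StrictPseudofunctor.id A) (StrictPseudofunctor.id B) =
    StrictPseudofunctor.id (Gray A B) :=
  strict_ext' rfl (fun f => heq_of_eq (congrArg Factor.Hom₁.mk (map_id_word f.word)))
    (fun {a b f g} η => hom₂_heq (congrArg Factor.Hom₁.mk (map_id_word f.word))
      (congrArg Factor.Hom₁.mk (map_id_word g.word)) (conj_heq _ _ η.val))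

lemma map_comp_word (F : StrictPseudofunctor A A') (F' : StrictPseudofunctor A' A'')
    (G : StrictPseudofunctor B B') (G' : StrictPseudofunctor B' B'') {x y : Words A B}
    (w : x ⟶ y) : (mapData (F.comp F') (G.comp G')).functor.map w =
      (mapData F' G').functor.map ((mapData F G).functor.map w) :=
  words_eq (D := Words A'' B'') (fun x => wPt (F'.obj (F.obj x.as.fst)) (G'.obj (G.obj x.as.snd)))
    (fun w => (mapData (F.comp F') (G.comp G')).functor.map w)
    (fun w => (mapData F' G').functor.map ((mapData F G).functor.map w))
    (fun x => CategoryTheory.Functor.map_id _ _)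
    (fun x => ((mapData F G).functor ⋙ (mapData F' G').functor).map_id x)
    (fun v w => CategoryTheory.Functor.map_comp _ _ _)
    (fun v w => ((mapData F G).functor ⋙ (mapData F' G').functor).map_comp v w)
    (fun f b => (WordsData.functor_left _ f b).trans
      ((congrArg (mapData F' G').functor.map (WordsData.functor_left (mapData F G) f b)).trans
        (WordsData.functor_left _ _ _)).symm)
    (fun a _ _ g => (WordsData.functor_right _ a g).trans
      ((congrArg (mapData F' G').functor.map (WordsData.functor_right (mapData F G) a g)).trans
        (WordsData.functor_right _ _ _)).symm) w

lemma map_comp (F : StrictPseudofunctor A A') (F' : StrictPseudofunctor A' A'')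
    (G : StrictPseudofunctor B B') (G' : StrictPseudofunctor B' B'') :
    map (F.comp F') (G.comp G') = (map F G).comp (map F' G') :=
  strict_ext' rfl (fun f => heq_of_eq (congrArg Factor.Hom₁.mk (map_comp_word F F' G G' f.word)))
    (fun {a b f g} η => hom₂_heq (congrArg Factor.Hom₁.mk (map_comp_word F F' G G' f.word))
      (congrArg Factor.Hom₁.mk (map_comp_word F F' G G' g.word))
      ((conj_heq _ _ _).trans (HEq.symm ((conj_heq _ _ _).trans
        (map₂_heq (prodFun F' G') (mapData_proj F G f.word) (mapData_proj F G g.word)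
          (conj_heq _ _ _))))))

end Gray

/-! ### The categories of structured 2-categories -/

section Structured

open scoped Pseudofunctor.StrongTrans

/-- A strict functor of permutative Gray-monoids. -/
structure PermHom {C D : Type u} [Bicategory.{u, u} C] [Bicategory.{u, u} D] [Strict C] [Strict D]
    (P : Permutative C) (Q : Permutative D) where
  functor : StrictPseudofunctor C D
  map_unit : functor.obj P.mon.unit = Q.mon.unit
  map_sum : (Gray.map functor functor).comp Q.mon.sum = P.mon.sum.comp functor
  map_β : SameArrow (whiskerR P.β functor.toPseudofunctor)
    (whiskerL (Gray.map functor functor).toPseudofunctor Q.β)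

/-- A strict functor of quasi-strict symmetric monoidal 2-categories. -/
structure QuasiStrictHom {C D : Type u} [Bicategory.{u, u} C] [Bicategory.{u, u} D] [Strict C]
    [Strict D] (P : QuasiStrict C) (Q : QuasiStrict D) where
  functor : StrictPseudofunctor C D
  map_unit : functor.obj P.mon.unit = Q.mon.unit
  map_sum : (prodMap functor.toPseudofunctor functor.toPseudofunctor).comp Q.mon.sum =
    P.mon.sum.comp functor.toPseudofunctor
  map_b : SameArrow (whiskerR P.sym.b functor.toPseudofunctor)
    (whiskerL (prodMap functor.toPseudofunctor functor.toPseudofunctor) Q.sym.b)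
  map_r₁ (x y z : C) : Cell.map ⟨(P.sym.r₁ x y z).hom⟩ functor =
    ⟨(Q.sym.r₁ (functor.obj x) (functor.obj y) (functor.obj z)).hom⟩
  map_r₂ (x y z : C) : Cell.map ⟨(P.sym.r₂ x y z).hom⟩ functor =
    ⟨(Q.sym.r₂ (functor.obj x) (functor.obj y) (functor.obj z)).hom⟩
  map_v (x y : C) : Cell.map ⟨(P.sym.vc x y).hom⟩ functor =
    ⟨(Q.sym.vc (functor.obj x) (functor.obj y)).hom⟩

lemma strict_assoc {A B C D : Type u} [Bicategory.{u, u} A] [Bicategory.{u, u} B]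
    [Bicategory.{u, u} C] [Bicategory.{u, u} D] (F : StrictPseudofunctor A B)
    (G : StrictPseudofunctor B C) (H : StrictPseudofunctor C D) :
    (F.comp G).comp H = F.comp (G.comp H) := strict_ext rfl

lemma Cell.map_comp {C D E : Type u} [Bicategory.{u, u} C] [Bicategory.{u, u} D]
    [Bicategory.{u, u} E] (ζ : Cell C) (F : StrictPseudofunctor C D)
    (G : StrictPseudofunctor D E) : ζ.map (F.comp G) = (ζ.map F).map G := rfl

lemma Cell.map_id {C : Type u} [Bicategory.{u, u} C] (ζ : Cell C) :
    ζ.map (StrictPseudofunctor.id C) = ζ := rfl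

section Perm

variable {C D E : Type u} [Bicategory.{u, u} C] [Bicategory.{u, u} D] [Bicategory.{u, u} E]
  [Strict C] [Strict D] [Strict E]

@[ext] lemma PermHom.ext {P : Permutative C} {Q : Permutative D} {F G : PermHom P Q}
    (h : F.functor = G.functor) : F = G := by
  cases F; cases G; cases h; rfl

/-- The identity. -/
def PermHom.id (P : Permutative C) : PermHom P P where
  functor := StrictPseudofunctor.id C
  map_unit := rfl
  map_sum := by rw [Gray.map_id]; exact strict_ext rfl
  map_β := (whiskerR_id_same P.β).trans
    ((whiskerL_congr P.β (congrArg (fun F => F.toPseudofunctor) Gray.map_id)).trans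
      (whiskerL_id_same P.β)).symm

/-- The composition. -/
def PermHom.comp {P : Permutative C} {Q : Permutative D} {R : Permutative E} (F : PermHom P Q)
    (G : PermHom Q R) : PermHom P R where
  functor := F.functor.comp G.functor
  map_unit := (congrArg G.functor.obj F.map_unit).trans G.map_unit
  map_sum := by
    rw [Gray.map_comp]
    rw [strict_assoc, G.map_sum, ← strict_assoc, F.map_sum, strict_assoc]
  map_β := (whiskerR_comp_same P.β _ _).trans ((F.map_β.whiskerR _).trans
    ((whiskerLR_same _ _ _).trans ((G.map_β.whiskerL _).trans ((whiskerL_comp_same _ _ _).symm.trans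
      (whiskerL_congr R.β (congrArg (fun F => F.toPseudofunctor)
        (Gray.map_comp F.functor G.functor F.functor G.functor))).symm))))

@[ext] lemma QuasiStrictHom.ext {P : QuasiStrict C} {Q : QuasiStrict D} {F G : QuasiStrictHom P Q}
    (h : F.functor = G.functor) : F = G := by
  cases F; cases G; cases h; rfl

/-- The identity. -/
def QuasiStrictHom.id (P : QuasiStrict C) : QuasiStrictHom P P where
  functor := StrictPseudofunctor.id C
  map_unit := rfl
  map_sum := (id_comp _).trans (comp_id _).symm
  map_b := (whiskerR_id_same P.sym.b).trans (whiskerL_id_same P.sym.b).symm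
  map_r₁ _ _ _ := rfl
  map_r₂ _ _ _ := rfl
  map_v _ _ := rfl

/-- The composition. -/
def QuasiStrictHom.comp {P : QuasiStrict C} {Q : QuasiStrict D} {R : QuasiStrict E}
    (F : QuasiStrictHom P Q) (G : QuasiStrictHom Q R) : QuasiStrictHom P R where
  functor := F.functor.comp G.functor
  map_unit := (congrArg G.functor.obj F.map_unit).trans G.map_unit
  map_sum := by
    refine (congrArg (fun t => t.comp R.mon.sum) (prodMap_comp F.functor.toPseudofunctor
      G.functor.toPseudofunctor F.functor.toPseudofunctor G.functor.toPseudofunctor)).trans ?_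
    rw [comp_assoc, G.map_sum, ← comp_assoc, F.map_sum, comp_assoc]
    rfl
  map_b := (whiskerR_comp_same P.sym.b _ _).trans ((F.map_b.whiskerR _).trans
    ((whiskerLR_same _ _ _).trans ((G.map_b.whiskerL _).trans
      ((whiskerL_comp_same _ _ _).symm.trans
        (whiskerL_congr R.sym.b (prodMap_comp F.functor.toPseudofunctor G.functor.toPseudofunctor
          F.functor.toPseudofunctor G.functor.toPseudofunctor)).symm))))
  map_r₁ x y z := (congrArg (fun t => Cell.map t G.functor) (F.map_r₁ x y z)).trans
    (G.map_r₁ _ _ _)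
  map_r₂ x y z := (congrArg (fun t => Cell.map t G.functor) (F.map_r₂ x y z)).trans
    (G.map_r₂ _ _ _)
  map_v x y := (congrArg (fun t => Cell.map t G.functor) (F.map_v x y)).trans (G.map_v _ _)

end Perm

/-- A permutative Gray-monoid. -/
structure PGM extends TwoCat.{u} where
  str : Permutative carrier

/-- The category of permutative Gray-monoids and strict functors. -/
instance : Category.{u} PGM.{u} where
  Hom C D := PermHom C.str D.str
  id C := PermHom.id C.str
  comp F G := F.comp G
  id_comp F := PermHom.ext (strict_ext rfl)
  comp_id F := PermHom.ext (strict_ext rfl)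
  assoc F G H := PermHom.ext (strict_ext rfl)

/-- The underlying 2-category of a permutative Gray-monoid. -/
def PGM.forget : PGM.{u} ⥤ TwoCat.{u} where
  obj C := C.toTwoCat
  map F := F.functor

/-- A quasi-strict symmetric monoidal 2-category. -/
structure QSSM2Cat extends TwoCat.{u} where
  str : QuasiStrict carrier

/-- The category of quasi-strict symmetric monoidal 2-categories and strict functors. -/
instance : Category.{u} QSSM2Cat.{u} where
  Hom C D := QuasiStrictHom C.str D.str
  id C := QuasiStrictHom.id C.str
  comp F G := F.comp G
  id_comp F := QuasiStrictHom.ext (strict_ext rfl)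
  comp_id F := QuasiStrictHom.ext (strict_ext rfl)
  assoc F G H := QuasiStrictHom.ext (strict_ext rfl)

/-- The underlying 2-category of a quasi-strict symmetric monoidal 2-category. -/
def QSSM2Cat.forget : QSSM2Cat.{u} ⥤ TwoCat.{u} where
  obj C := C.toTwoCat
  map F := F.functor

end Structured

/-! ### The universal property of the Gray tensor product -/

section Universal

namespace Factor

variable {W : Type u} [Category.{u} W] {D : Type u} [Bicategory.{u, u} D] [Strict D]
  {P : W ⥤ D} {X : Type u} [Bicategory.{u, u} X] [Strict X]

variable (P X) in
/-- The data of a pseudofunctor from `X` into the factorisation whose composite with the canonical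
2-functor to `D` is a 2-functor, given by `map` and `map₂`. -/
structure PseudoLift where
  obj : X → W
  word {x y : X} : (x ⟶ y) → (obj x ⟶ obj y)
  map {x y : X} : (x ⟶ y) → (P.obj (obj x) ⟶ P.obj (obj y))
  map_eq {x y : X} (f : x ⟶ y) : P.map (word f) = map f
  map₂ {x y : X} {f g : x ⟶ y} : (f ⟶ g) → (map f ⟶ map g)
  map_id (x : X) : map (𝟙 x) = 𝟙 (P.obj (obj x))
  map_comp {x y z : X} (f : x ⟶ y) (g : y ⟶ z) : map (f ≫ g) = map f ≫ map g
  map₂_id {x y : X} (f : x ⟶ y) : map₂ (𝟙 f) = 𝟙 (map f)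
  map₂_comp {x y : X} {f g h : x ⟶ y} (η : f ⟶ g) (θ : g ⟶ h) :
    map₂ (η ≫ θ) = map₂ η ≫ map₂ θ
  map₂_left {x y z : X} (f : x ⟶ y) {g g' : y ⟶ z} (η : g ⟶ g') :
    map₂ (f ◁ η) = eqToHom (map_comp f g) ≫ map f ◁ map₂ η ≫ eqToHom (map_comp f g').symm
  map₂_right {x y z : X} {f f' : x ⟶ y} (η : f ⟶ f') (g : y ⟶ z) :
    map₂ (η ▷ g) = eqToHom (map_comp f g) ≫ map₂ η ▷ map g ≫ eqToHom (map_comp f' g).symm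

namespace PseudoLift

variable (L : PseudoLift P X)

lemma eq_id (x : X) : P.map (L.word (𝟙 x)) = P.map (𝟙 (L.obj x)) := by
  rw [L.map_eq, L.map_id, P.map_id]

lemma eq_comp {x y z : X} (f : x ⟶ y) (g : y ⟶ z) :
    P.map (L.word (f ≫ g)) = P.map (L.word f ≫ L.word g) := by
  rw [P.map_comp, L.map_eq, L.map_eq, L.map_eq, L.map_comp]

lemma map₂_eqToHom {x y : X} {f g : x ⟶ y} (h : f = g) :
    L.map₂ (eqToHom h) = eqToHom (congrArg L.map h) := by
  cases h; exact L.map₂_id _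

/-- The pseudofunctor into the factorisation with the given data. -/
def functor : Pseudofunctor X (Factor P) where
  obj x := ⟨L.obj x⟩
  map f := ⟨L.word f⟩
  map₂ η := ⟨eqToHom (L.map_eq _) ≫ L.map₂ η ≫ eqToHom (L.map_eq _).symm⟩
  map₂_id f := by ext; simp [L.map₂_id]
  map₂_comp η θ := by ext; simp [L.map₂_comp]
  mapId x := isoMk (eqToIso (L.eq_id x))
  mapComp f g := isoMk (eqToIso (L.eq_comp f g))
  map₂_whisker_left f _ _ η := by
    ext; simp [isoMk, L.map₂_left, congr_whiskerLeft (L.map_eq f)]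
  map₂_whisker_right η g := by
    ext; simp [isoMk, L.map₂_right, whiskerRight_congr (L.map_eq g)]
  map₂_associator f g h := by
    ext; simp [isoMk, Strict.associator_eqToIso, L.map₂_eqToHom]
  map₂_left_unitor f := by
    ext; simp [isoMk, Strict.leftUnitor_eqToIso, L.map₂_eqToHom]
  map₂_right_unitor f := by
    ext; simp [isoMk, Strict.rightUnitor_eqToIso, L.map₂_eqToHom]

end PseudoLift

end Factor

namespace Gray

lemma conj_rfl {C : Type u} [Category.{u} C] {a b : C} (h : a = a) (h' : b = b) (f : a ⟶ b) :
    eqToHom h ≫ f ≫ eqToHom h' = f := by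
  simp

section
variable (A B : Type u) [Bicategory.{u, u} A] [Bicategory.{u, u} B] [Strict A] [Strict B]

/-- The word `f ⊗ 1` followed by `1 ⊗ g`. -/
def cubWord {A B : Type u} [Bicategory.{u, u} A] [Bicategory.{u, u} B] {x y : A × B} (p : x ⟶ y) :
    wPt x.1 x.2 ⟶ wPt y.1 y.2 := wLeft p.1 x.2 ≫ wRight y.1 p.2

variable {A B} in
lemma proj_cubWord {x y : A × B} (p : x ⟶ y) : (wordsProj A B).map (cubWord p) = p := by
  refine ((wordsProj A B).map_comp _ _).trans ?_
  rw [proj_left, proj_right]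
  exact Prod.ext (Strict.comp_id _) (Strict.id_comp _)

/-- The data of the canonical cubical functor. -/
def cubData : Factor.PseudoLift (wordsProj A B) (A × B) where
  obj x := wPt x.1 x.2
  word p := cubWord p
  map p := p
  map_eq p := proj_cubWord p
  map₂ η := η
  map_id _ := rfl
  map_comp _ _ := rfl
  map₂_id _ := rfl
  map₂_comp _ _ := rfl
  map₂_left f _ _ η := (conj_rfl _ _ _).symm
  map₂_right η g := (conj_rfl _ _ _).symm

/-- The canonical cubical functor from the cartesian product. -/
def cub : Pseudofunctor (A × B) (Gray A B) := (cubData A B).functor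

variable {A B}

lemma isId_isoMk {x y : Gray A B} {f g : x ⟶ y} (h : f = g)
    (k : (wordsProj A B).map f.word = (wordsProj A B).map g.word) :
    IsId₂ (Factor.isoMk (eqToIso k)).hom :=
  ⟨h, Factor.hom_ext (Factor.eqToHom_val h).symm⟩

variable (A B) in
lemma cub_isCubical : IsCubical (cub A B) where
  mapId x := isId_isoMk (congrArg Factor.Hom₁.mk (by
    change wLeft (𝟙 x.1) x.2 ≫ wRight x.1 (𝟙 x.2) = 𝟙 _
    rw [wLeft_id, wRight_id, Category.comp_id])) _
  mapComp {x y z} p q h := isId_isoMk (congrArg Factor.Hom₁.mk (by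
    change wLeft (p.1 ≫ q.1) x.2 ≫ wRight z.1 (p.2 ≫ q.2) =
      (wLeft p.1 x.2 ≫ wRight y.1 p.2) ≫ wLeft q.1 y.2 ≫ wRight z.1 q.2
    rw [wLeft_comp, wRight_comp]
    obtain ⟨a, b⟩ := x
    obtain ⟨a', b'⟩ := y
    obtain ⟨a'', b''⟩ := z
    obtain ⟨p₁, p₂⟩ := p
    obtain ⟨q₁, q₂⟩ := q
    dsimp only at p₁ p₂ q₁ q₂ h ⊢
    rcases h with h | h
    · cases h
      rw [wRight_id, wRight_id, Category.comp_id, Category.id_comp, Category.assoc]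
    · cases h
      rw [wLeft_id, wLeft_id, Category.comp_id, Category.id_comp, Category.assoc])) _

end

end Gray

end Universal

section Universal

open scoped Pseudofunctor.StrongTrans

/-! ### Resolutions of 1-cells -/

section Resolution

variable {X D : Type u} [Bicategory.{u, u} X] [Strict X] [Bicategory.{u, u} D] [Strict D]

/-- The objects of `X`. -/
structure Res (F : Pseudofunctor X D) where
  pt : X

namespace Res

/-- A 1-cell `p` of `X` together with a 1-cell of `D` isomorphic to `F p`. -/
structure Mor {F : Pseudofunctor X D} (x y : Res F) where
  p : x.pt ⟶ y.pt
  h : F.obj x.pt ⟶ F.obj y.pt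
  s : h ≅ F.map p

variable {F : Pseudofunctor X D}

lemma mor_ext {x y : Res F} {e e' : Mor x y} (hp : e.p = e'.p) (hh : e.h = e'.h)
    (hs : e.s.hom ≫ F.map₂ (eqToHom hp) = eqToHom hh ≫ e'.s.hom) : e = e' := by
  obtain ⟨p, h, s⟩ := e
  obtain ⟨p', h', s'⟩ := e'
  dsimp only at hp hh
  subst hp hh
  have : s = s' := Iso.ext (by simpa using hs)
  rw [this]

lemma eq_leftUnitor {C : Type u} [Bicategory.{u, u} C] [Strict C] {a b : C} (f : a ⟶ b)
    (h : 𝟙 a ≫ f = f) : eqToHom h = (λ_ f).hom := by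
  rw [Strict.leftUnitor_eqToIso]; rfl

lemma eq_rightUnitor {C : Type u} [Bicategory.{u, u} C] [Strict C] {a b : C} (f : a ⟶ b)
    (h : f ≫ 𝟙 b = f) : eqToHom h = (ρ_ f).hom := by
  rw [Strict.rightUnitor_eqToIso]; rfl

lemma eq_associator {C : Type u} [Bicategory.{u, u} C] [Strict C] {a b c d : C} (f : a ⟶ b)
    (g : b ⟶ c) (k : c ⟶ d) (h : (f ≫ g) ≫ k = f ≫ g ≫ k) : eqToHom h = (α_ f g k).hom := by
  rw [Strict.associator_eqToIso]; rfl

/-- The composite of two isomorphisms. -/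
def comp₂ {x y z : X} {p : x ⟶ y} {q : y ⟶ z} {h : F.obj x ⟶ F.obj y} {k : F.obj y ⟶ F.obj z}
    (s : h ≅ F.map p) (t : k ≅ F.map q) : h ≫ k ≅ F.map (p ≫ q) :=
  whiskerRightIso s k ≪≫ whiskerLeftIso (F.map p) t ≪≫ (F.mapComp p q).symm

lemma id_law {x y : X} {p : x ⟶ y} {h : F.obj x ⟶ F.obj y} (s : h ≅ F.map p) :
    (comp₂ (F.mapId x).symm s).hom ≫ F.map₂ (λ_ p).hom = (λ_ h).hom ≫ s.hom := by
  simp [comp₂, whisker_exchange_assoc]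

lemma law_id {x y : X} {p : x ⟶ y} {h : F.obj x ⟶ F.obj y} (s : h ≅ F.map p) :
    (comp₂ s (F.mapId y).symm).hom ≫ F.map₂ (ρ_ p).hom = (ρ_ h).hom ≫ s.hom := by
  simp [comp₂]

lemma assoc_law {x y z w : X} {p : x ⟶ y} {q : y ⟶ z} {r : z ⟶ w} {h : F.obj x ⟶ F.obj y}
    {k : F.obj y ⟶ F.obj z} {l : F.obj z ⟶ F.obj w} (s : h ≅ F.map p) (t : k ≅ F.map q)
    (u : l ≅ F.map r) :
    (comp₂ (comp₂ s t) u).hom ≫ F.map₂ (α_ p q r).hom =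
      (α_ h k l).hom ≫ (comp₂ s (comp₂ t u)).hom := by
  simp [comp₂, whisker_exchange_assoc]

instance : Category (Res F) where
  Hom x y := Mor x y
  id x := ⟨𝟙 x.pt, 𝟙 _, (F.mapId x.pt).symm⟩
  comp e e' := ⟨e.p ≫ e'.p, e.h ≫ e'.h, comp₂ e.s e'.s⟩
  id_comp e := mor_ext (Strict.id_comp _) (Strict.id_comp _) (by
    rw [eq_leftUnitor, eq_leftUnitor]; exact id_law e.s)
  comp_id e := mor_ext (Strict.comp_id _) (Strict.comp_id _) (by
    rw [eq_rightUnitor, eq_rightUnitor]; exact law_id e.s)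
  assoc e e' e'' := mor_ext (Strict.assoc _ _ _) (Strict.assoc _ _ _) (by
    rw [eq_associator, eq_associator]; exact assoc_law e.s e'.s e''.s)

/-- The morphism given by a 1-cell of `X` and its image. -/
def Mor.of (F : Pseudofunctor X D) {x y : Res F} (p : x.pt ⟶ y.pt) : x ⟶ y :=
  Mor.mk p (F.map p) (Iso.refl _)

lemma mor_comp (F : Pseudofunctor X D) {x y z : Res F} {p : x.pt ⟶ y.pt} {q : y.pt ⟶ z.pt}
    {r : x.pt ⟶ z.pt} (hr : r = p ≫ q) (h : IsId₂ (F.mapComp p q).hom) :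
    (Mor.of F r : x ⟶ z) = (Mor.of F p : x ⟶ y) ≫ (Mor.of F q : y ⟶ z) := by
  subst hr
  obtain ⟨h, e⟩ := h
  refine mor_ext rfl h ?_
  change 𝟙 _ ≫ F.map₂ (𝟙 _) = eqToHom h ≫ (comp₂ (Iso.refl _) (Iso.refl _)).hom
  rw [← e]
  simp [comp₂]

lemma mor_id (F : Pseudofunctor X D) (x : Res F) (h : IsId₂ (F.mapId x.pt).hom) :
    (Mor.of F (𝟙 x.pt) : x ⟶ x) = 𝟙 x := by
  obtain ⟨h, e⟩ := h
  refine mor_ext rfl h ?_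
  change 𝟙 _ ≫ F.map₂ (𝟙 _) = eqToHom h ≫ (F.mapId x.pt).inv
  rw [← e]
  simp

/-- The isomorphism of a morphism, with its target given up to equality. -/
def Mor.iso {x y : Res F} (e : x ⟶ y) {q : x.pt ⟶ y.pt} (hq : e.p = q) : e.h ≅ F.map q :=
  e.s ≪≫ F.map₂Iso (eqToIso hq)

lemma iso_rfl {x y : Res F} (e : x ⟶ y) : Mor.iso e rfl = e.s :=
  Iso.ext ((congrArg (fun t => e.s.hom ≫ t) (F.map₂_id _)).trans (Category.comp_id _))

lemma iso_conj {x y : Res F} {e e' : x ⟶ y} (hq : e.p = e.p) (hq' : e'.p = e'.p)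
    (θ : e.p ⟶ e'.p) :
    (Mor.iso e hq).hom ≫ F.map₂ θ ≫ (Mor.iso e' hq').inv = e.s.hom ≫ F.map₂ θ ≫ e'.s.inv := by
  rw [iso_rfl, iso_rfl]

lemma comp₂_left {x y z : X} {p : x ⟶ y} {q q' : y ⟶ z} {h : F.obj x ⟶ F.obj y}
    {k k' : F.obj y ⟶ F.obj z} (s : h ≅ F.map p) (t : k ≅ F.map q) (t' : k' ≅ F.map q')
    (η : q ⟶ q') : (comp₂ s t).hom ≫ F.map₂ (p ◁ η) ≫ (comp₂ s t').inv =
      h ◁ (t.hom ≫ F.map₂ η ≫ t'.inv) := by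
  simp [comp₂, ← whisker_exchange_assoc]

lemma comp₂_right {x y z : X} {p p' : x ⟶ y} {q : y ⟶ z} {h h' : F.obj x ⟶ F.obj y}
    {k : F.obj y ⟶ F.obj z} (s : h ≅ F.map p) (s' : h' ≅ F.map p') (t : k ≅ F.map q)
    (η : p ⟶ p') : (comp₂ s t).hom ≫ F.map₂ (η ▷ q) ≫ (comp₂ s' t).inv =
      (s.hom ≫ F.map₂ η ≫ s'.inv) ▷ k := by
  simp [comp₂, whisker_exchange_assoc]

lemma conj_id {x y : X} {p : x ⟶ y} {h : F.obj x ⟶ F.obj y} (s : h ≅ F.map p) :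
    s.hom ≫ F.map₂ (𝟙 p) ≫ s.inv = 𝟙 h := by
  simp

lemma conj_comp {x y : X} {p p' p'' : x ⟶ y} {h h' h'' : F.obj x ⟶ F.obj y} (s : h ≅ F.map p)
    (s' : h' ≅ F.map p') (s'' : h'' ≅ F.map p'') (η : p ⟶ p') (θ : p' ⟶ p'') :
    s.hom ≫ F.map₂ (η ≫ θ) ≫ s''.inv = (s.hom ≫ F.map₂ η ≫ s'.inv) ≫
      s'.hom ≫ F.map₂ θ ≫ s''.inv := by
  simp

lemma iso_left {x y z : Res F} {e₁ : x ⟶ y} {e₂ e₂' : y ⟶ z} {e e' : x ⟶ z} (he : e = e₁ ≫ e₂)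
    (he' : e' = e₁ ≫ e₂') {p : x.pt ⟶ y.pt} {q q' : y.pt ⟶ z.pt} {r r' : x.pt ⟶ z.pt}
    (hp : e₁.p = p) (hq : e₂.p = q) (hq' : e₂'.p = q') (hr : e.p = r) (hr' : e'.p = r')
    (η : q ⟶ q') (i : r = p ≫ q) (i' : p ≫ q' = r') (j : e.h = e₁.h ≫ e₂.h)
    (j' : e₁.h ≫ e₂'.h = e'.h) :
    (Mor.iso e hr).hom ≫ F.map₂ (eqToHom i ≫ p ◁ η ≫ eqToHom i') ≫ (Mor.iso e' hr').inv =
      eqToHom j ≫ e₁.h ◁ ((Mor.iso e₂ hq).hom ≫ F.map₂ η ≫ (Mor.iso e₂' hq').inv) ≫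
        eqToHom j' := by
  subst he he' hp hq hq' hr hr'
  rw [iso_rfl, iso_rfl, iso_rfl, iso_rfl]
  exact (congrArg (fun t => _ ≫ F.map₂ t ≫ _) (Gray.conj_rfl i i' _)).trans
    ((comp₂_left e₁.s e₂.s e₂'.s η).trans (Gray.conj_rfl j j' _).symm)

lemma iso_right {x y z : Res F} {e₁ e₁' : x ⟶ y} {e₂ : y ⟶ z} {e e' : x ⟶ z} (he : e = e₁ ≫ e₂)
    (he' : e' = e₁' ≫ e₂) {p p' : x.pt ⟶ y.pt} {q : y.pt ⟶ z.pt} {r r' : x.pt ⟶ z.pt}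
    (hp : e₁.p = p) (hp' : e₁'.p = p') (hq : e₂.p = q) (hr : e.p = r) (hr' : e'.p = r')
    (η : p ⟶ p') (i : r = p ≫ q) (i' : p' ≫ q = r') (j : e.h = e₁.h ≫ e₂.h)
    (j' : e₁'.h ≫ e₂.h = e'.h) :
    (Mor.iso e hr).hom ≫ F.map₂ (eqToHom i ≫ η ▷ q ≫ eqToHom i') ≫ (Mor.iso e' hr').inv =
      eqToHom j ≫ ((Mor.iso e₁ hp).hom ≫ F.map₂ η ≫ (Mor.iso e₁' hp').inv) ▷ e₂.h ≫
        eqToHom j' := by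
  subst he he' hp hp' hq hr hr'
  rw [iso_rfl, iso_rfl, iso_rfl, iso_rfl]
  exact (congrArg (fun t => _ ≫ F.map₂ t ≫ _) (Gray.conj_rfl i i' _)).trans
    ((comp₂_right e₁.s e₁'.s e₂.s η).trans (Gray.conj_rfl j j' _).symm)

lemma of_map₂ {x y : Res F} {e e' : x ⟶ y} {p p' : x.pt ⟶ y.pt} (he : e = Mor.of F p)
    (he' : e' = Mor.of F p') {q q' : x.pt ⟶ y.pt} (hq : e.p = q) (hq' : e'.p = q') (η : p ⟶ p')
    (i : q = p) (i' : p' = q') : HEq ((Mor.iso e hq).hom ≫ F.map₂ (eqToHom i ≫ η ≫ eqToHom i') ≫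
      (Mor.iso e' hq').inv) (F.map₂ η) := by
  subst he he' hq hq'
  rw [iso_rfl, iso_rfl]
  refine heq_of_eq ((congrArg (fun t => _ ≫ F.map₂ t ≫ _) (Gray.conj_rfl i i' _)).trans ?_)
  exact (Category.id_comp _).trans (Category.comp_id _)

lemma of_id {x : Res F} {e e' : x ⟶ x} (he : e = Mor.of F (𝟙 x.pt)) (he' : e' = 𝟙 x)
    {q q' : x.pt ⟶ x.pt} (hq : e.p = q) (hq' : e'.p = q') (i : q = q')
    {k : F.obj x.pt ⟶ F.obj x.pt} (j : e'.h = k) :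
    HEq (((Mor.iso e hq).hom ≫ F.map₂ (eqToHom i) ≫ (Mor.iso e' hq').inv) ≫ eqToHom j)
      (F.mapId x.pt).hom := by
  subst he he' hq hq' j
  rw [iso_rfl, iso_rfl]
  refine heq_of_eq ((Category.comp_id _).trans ((Category.id_comp _).trans ?_))
  exact (congrArg (fun t => t ≫ _) (F.map₂_id _)).trans (Category.id_comp _)

lemma of_comp {x y z : Res F} {e e' : x ⟶ z} {p : x.pt ⟶ y.pt} {q : y.pt ⟶ z.pt}
    (he : e = Mor.of F (p ≫ q)) (he' : e' = (Mor.of F p : x ⟶ y) ≫ Mor.of F q)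
    {r r' : x.pt ⟶ z.pt} (hr : e.p = r) (hr' : e'.p = r') (i : r = r')
    {k : F.obj x.pt ⟶ F.obj z.pt} (j : e'.h = k) :
    HEq (((Mor.iso e hr).hom ≫ F.map₂ (eqToHom i) ≫ (Mor.iso e' hr').inv) ≫ eqToHom j)
      (F.mapComp p q).hom := by
  subst he he' hr hr' j
  rw [iso_rfl, iso_rfl]
  refine heq_of_eq ((Category.comp_id _).trans ((Category.id_comp _).trans ?_))
  refine (congrArg (fun t => t ≫ _) (F.map₂_id _)).trans ((Category.id_comp _).trans ?_)
  change (comp₂ (Iso.refl _) (Iso.refl _)).inv = _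
  simp [comp₂]

section Push

variable {E : Type u} [Bicategory.{u, u} E] [Strict E] {G : Pseudofunctor X E}
  (T : StrictPseudofunctor E D)

/-- The image of a morphism. -/
def Mor.push {x y : X} (e : (⟨x⟩ : Res G) ⟶ ⟨y⟩) : (⟨x⟩ : Res (G.comp T.toPseudofunctor)) ⟶ ⟨y⟩ :=
  Mor.mk e.p (T.map e.h) (T.map₂Iso e.s)

lemma push_comp {x y z : X} (e : (⟨x⟩ : Res G) ⟶ ⟨y⟩) (e' : (⟨y⟩ : Res G) ⟶ ⟨z⟩) :
    Mor.push T (e ≫ e') = Mor.push T e ≫ Mor.push T e' := by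
  refine mor_ext rfl (T.map_comp _ _) ?_
  refine ((congrArg (fun t => _ ≫ t) ((G.comp T.toPseudofunctor).map₂_id _)).trans
    (Category.comp_id _)).trans ?_
  change T.map₂ (e.s.hom ▷ e'.h ≫ G.map e.p ◁ e'.s.hom ≫ (G.mapComp e.p e'.p).inv) =
    eqToHom (T.map_comp _ _) ≫ T.map₂ e.s.hom ▷ T.map e'.h ≫
      T.map (G.map e.p) ◁ T.map₂ e'.s.hom ≫ (T.mapComp (G.map e.p) (G.map e'.p)).inv ≫
        T.map₂ (G.mapComp e.p e'.p).inv
  simp [T.mapComp_eq_eqToIso]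

lemma push_id (x : X) : Mor.push T (𝟙 (⟨x⟩ : Res G)) = 𝟙 _ := by
  refine mor_ext rfl (T.map_id _) ?_
  refine ((congrArg (fun t => _ ≫ t) ((G.comp T.toPseudofunctor).map₂_id _)).trans
    (Category.comp_id _)).trans ?_
  change T.map₂ (G.mapId x).inv = eqToHom (T.map_id _) ≫ (T.mapId (G.obj x)).inv ≫
    T.map₂ (G.mapId x).inv
  simp [T.mapId_eq_eqToIso]

lemma push_of {x y : X} (p : x ⟶ y) : Mor.push T (Mor.of G (x := ⟨x⟩) (y := ⟨y⟩) p) = Mor.of _ p :=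
  mor_ext rfl rfl (by
    change T.map₂ (𝟙 (G.map p)) ≫ T.map₂ (G.map₂ (𝟙 p)) = 𝟙 _ ≫ 𝟙 _
    simp)

end Push

section PseudoLift

variable {W : Type u} [Category.{u} W] {P : W ⥤ D} (L : Factor.PseudoLift P X)

lemma isoMk_comp {x y z : Factor P} {v v' : x ⟶ y} {w w' : y ⟶ z} {r : x ⟶ z}
    (e : P.map (v ≫ w).word = P.map r.word) (hv : P.map v.word = P.map v'.word)
    (hw : P.map w.word = P.map w'.word) (hr : P.map r.word = P.map (v' ≫ w').word) :
    (Factor.isoMk (eqToIso e)).hom = (Factor.isoMk (eqToIso hv)).hom ▷ w ≫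
      v' ◁ (Factor.isoMk (eqToIso hw)).hom ≫ (Factor.isoMk (eqToIso hr)).inv := by
  apply Factor.hom_ext
  simp [Factor.isoMk]

/-- The resolution of a 1-cell of a factorisation. -/
def wordMor {x y : X} (w : L.obj x ⟶ L.obj y) (p : x ⟶ y) (h : P.map w = L.map p) :
    (⟨x⟩ : Res L.functor) ⟶ ⟨y⟩ :=
  Mor.mk p ⟨w⟩ (Factor.isoMk (eqToIso (h.trans (L.map_eq p).symm)))

lemma wordMor_comp {x y z : X} {v : L.obj x ⟶ L.obj y} {w : L.obj y ⟶ L.obj z} {p : x ⟶ y}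
    {q : y ⟶ z} {r : x ⟶ z} (hv : P.map v = L.map p) (hw : P.map w = L.map q) (hr : r = p ≫ q)
    (h : P.map (v ≫ w) = L.map r) :
    wordMor L (v ≫ w) r h = wordMor L v p hv ≫ wordMor L w q hw := by
  subst hr
  refine mor_ext rfl rfl (Eq.trans ?_ (Category.id_comp _).symm)
  refine ((congrArg (fun t => _ ≫ t) (L.functor.map₂_id _)).trans (Category.comp_id _)).trans ?_
  exact isoMk_comp _ _ _ _

lemma wordMor_id {x : X} (h : P.map (𝟙 (L.obj x)) = L.map (𝟙 x)) :
    wordMor L (𝟙 (L.obj x)) (𝟙 x) h = 𝟙 _ := by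
  refine mor_ext rfl rfl (Eq.trans ?_ (Category.id_comp _).symm)
  exact (congrArg (fun t => _ ≫ t) (L.functor.map₂_id _)).trans (Category.comp_id _)

lemma wordMor_of {x y : X} {w : L.obj x ⟶ L.obj y} {p : x ⟶ y} (h : P.map w = L.map p)
    (hw : w = L.word p) : wordMor L w p h = Mor.of L.functor p := by
  subst hw
  refine mor_ext rfl rfl (Eq.trans ?_ (Category.id_comp _).symm)
  exact (congrArg (fun t => _ ≫ t) (L.functor.map₂_id _)).trans (Category.comp_id _)

lemma wordMor_congr {x y : X} {w : L.obj x ⟶ L.obj y} {p p' : x ⟶ y} (hp : p = p')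
    (h : P.map w = L.map p) (h' : P.map w = L.map p') : wordMor L w p h = wordMor L w p' h' := by
  subst hp
  rfl

lemma factor_map₂ {x y : X} {f f' : (⟨L.obj x⟩ : Factor P) ⟶ ⟨L.obj y⟩} {p p' : x ⟶ y}
    (h : P.map f.word = L.map p) (h' : P.map f'.word = L.map p') (η : f ⟶ f') (θ : p ⟶ p')
    (hθ : η.val = eqToHom h ≫ L.map₂ θ ≫ eqToHom h'.symm) :
    η = (wordMor L f.word p h).s.hom ≫ L.functor.map₂ θ ≫ (wordMor L f'.word p' h').s.inv := by
  apply Factor.hom_ext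
  rw [hθ]
  change _ = eqToHom (h.trans (L.map_eq p).symm) ≫ (eqToHom (L.map_eq p) ≫ L.map₂ θ ≫
    eqToHom (L.map_eq p').symm) ≫ eqToHom (h'.trans (L.map_eq p').symm).symm
  simp

variable {E : Type u} [Bicategory.{u, u} E] [Strict E]

lemma push_map₂ (T : StrictPseudofunctor (Factor P) E) {x y : X}
    {f f' : (⟨L.obj x⟩ : Factor P) ⟶ ⟨L.obj y⟩} {p p' : x ⟶ y}
    (h : P.map f.word = L.map p) (h' : P.map f'.word = L.map p')
    {e e' : (⟨x⟩ : Res (L.functor.comp T.toPseudofunctor)) ⟶ ⟨y⟩}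
    (he : e = Mor.push T (wordMor L f.word p h)) (he' : e' = Mor.push T (wordMor L f'.word p' h'))
    (hq : e.p = p) (hq' : e'.p = p') (η : f ⟶ f') (θ : p ⟶ p')
    (hθ : η.val = eqToHom h ≫ L.map₂ θ ≫ eqToHom h'.symm) :
    HEq (T.map₂ η) ((Mor.iso e hq).hom ≫ (L.functor.comp T.toPseudofunctor).map₂ θ ≫
      (Mor.iso e' hq').inv) := by
  subst he he'
  refine heq_of_eq ((congrArg T.map₂ (factor_map₂ L h h' η θ hθ)).trans ?_)
  refine (T.map₂_comp _ _).trans ((congrArg (fun t => _ ≫ t) (T.map₂_comp _ _)).trans ?_)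
  exact (iso_conj (e := Mor.push T (wordMor L f.word p h))
    (e' := Mor.push T (wordMor L f'.word p' h')) hq hq' θ).symm

end PseudoLift

end Res

end Resolution

namespace Gray

variable {A B D : Type u} [Bicategory.{u, u} A] [Bicategory.{u, u} B] [Bicategory.{u, u} D]
  [Strict A] [Strict B] [Strict D] {F : Pseudofunctor (A × B) D}

/-- The resolution of words given by a cubical functor. -/
def resData (hF : IsCubical F) : WordsData A B (Res F) where
  obj a b := ⟨(a, b)⟩
  left f b := Res.Mor.of F (x := ⟨(_, b)⟩) (y := ⟨(_, b)⟩) (f, 𝟙 b)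
  right a _ _ g := Res.Mor.of F (x := ⟨(a, _)⟩) (y := ⟨(a, _)⟩) (𝟙 a, g)
  left_id a b := Res.mor_id F ⟨(a, b)⟩ (hF.mapId _)
  left_comp f f' b := Res.mor_comp F (Prod.ext rfl (Strict.id_comp _).symm)
    (hF.mapComp _ _ (Or.inl (.mk _)))
  right_id a b := Res.mor_id F ⟨(a, b)⟩ (hF.mapId _)
  right_comp a _ _ _ g g' := Res.mor_comp F (Prod.ext (Strict.id_comp _).symm rfl)
    (hF.mapComp _ _ (Or.inr (.mk _)))

/-- The resolution of words given by a cubical functor. -/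
def res (hF : IsCubical F) : Words A B ⥤ Res F := (resData hF).functor

lemma res_p (hF : IsCubical F) {x y : Words A B} (w : x ⟶ y) :
    ((res hF).map w).p = (wordsProj A B).map w :=
  words_eq (D := A × B) (fun x => (x.as.fst, x.as.snd)) (fun w => ((res hF).map w).p)
    (fun w => (wordsProj A B).map w)
    (fun x => congrArg Res.Mor.p ((res hF).map_id x)) (fun x => (wordsProj A B).map_id x)
    (fun v w => congrArg Res.Mor.p ((res hF).map_comp v w))
    (fun v w => (wordsProj A B).map_comp v w)
    (fun f b => (congrArg Res.Mor.p ((resData hF).functor_left f b)).trans (proj_left f b).symm)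
    (fun a _ _ g => (congrArg Res.Mor.p ((resData hF).functor_right a g)).trans
      (proj_right a g).symm) w

/-- The isomorphism between the value of a word and the value of its projection. -/
def resIso (hF : IsCubical F) {x y : Words A B} (w : x ⟶ y) :
    ((res hF).map w).h ≅ F.map ((wordsProj A B).map w) :=
  Res.Mor.iso ((res hF).map w) (res_p hF w)

/-- The 2-functor out of the Gray tensor product given by a cubical functor. -/
def lift (hF : IsCubical F) : StrictPseudofunctor (Gray A B) D := StrictPseudofunctor.mk''
  { obj := fun x => F.obj (x.base.as.fst, x.base.as.snd)
    map := fun f => ((res hF).map f.word).h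
    map₂ := fun {x y f g} η => (resIso hF f.word).hom ≫ F.map₂ η.val ≫ (resIso hF g.word).inv
    map₂_id := fun f => Res.conj_id (resIso hF f.word)
    map₂_comp := fun {x y f g h} η θ => Res.conj_comp (resIso hF f.word) (resIso hF g.word)
      (resIso hF h.word) η.val θ.val
    map_id := fun x => congrArg Res.Mor.h ((res hF).map_id x.base)
    map_comp := fun f g => congrArg Res.Mor.h ((res hF).map_comp f.word g.word)
    map₂_whisker_left := fun f _ _ η => Res.iso_left ((res hF).map_comp _ _)
      ((res hF).map_comp _ _) (res_p hF _) (res_p hF _) (res_p hF _) (res_p hF _) (res_p hF _)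
      η.val _ _ _ _
    map₂_whisker_right := fun η g => Res.iso_right ((res hF).map_comp _ _)
      ((res hF).map_comp _ _) (res_p hF _) (res_p hF _) (res_p hF _) (res_p hF _) (res_p hF _)
      η.val _ _ _ _ }

lemma res_cub {x y : A × B} (hF : IsCubical F) (p : x ⟶ y) :
    (res hF).map (cubWord p) = Res.Mor.of F (x := ⟨x⟩) (y := ⟨y⟩) p :=
  ((res hF).map_comp _ _).trans
    ((congrArg₂ (· ≫ ·) ((resData hF).functor_left _ _) ((resData hF).functor_right _ _)).trans
      (Res.mor_comp F (x := ⟨x⟩) (y := ⟨(y.1, x.2)⟩) (z := ⟨y⟩) (p := (p.1, 𝟙 x.2))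
        (q := (𝟙 y.1, p.2)) (Prod.ext (Strict.comp_id _).symm (Strict.id_comp _).symm)
        (hF.mapComp _ _ (Or.inr (.mk _)))).symm)

lemma cub_lift (hF : IsCubical F) : (cub A B).comp (lift hF).toPseudofunctor = F :=
  pseudofunctor_ext (prelax_ext rfl (fun p => heq_of_eq (congrArg Res.Mor.h (res_cub hF p)))
    (fun {x y p q} η => Res.of_map₂ (x := ⟨x⟩) (y := ⟨y⟩) (res_cub hF p) (res_cub hF q)
      (res_p hF (cubWord p)) (res_p hF (cubWord q)) η (proj_cubWord p) (proj_cubWord q).symm))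
    (fun x => Res.of_id (x := ⟨x⟩) (res_cub hF _) ((res hF).map_id (wPt x.1 x.2)) (res_p hF _) (res_p hF _)
      ((cubData A B).eq_id x) (congrArg Res.Mor.h ((res hF).map_id (wPt x.1 x.2))))
    (fun {x y z} p q => Res.of_comp (x := ⟨x⟩) (y := ⟨y⟩) (z := ⟨z⟩) (res_cub hF _)
      (((res hF).map_comp _ _).trans (congrArg₂ (· ≫ ·) (res_cub hF p) (res_cub hF q)))
      (res_p hF _) (res_p hF _) ((cubData A B).eq_comp p q)
      (congrArg Res.Mor.h ((res hF).map_comp _ _)))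

lemma res_eq (T : StrictPseudofunctor (Gray A B) D)
    (hF : IsCubical ((cub A B).comp T.toPseudofunctor)) {x y : Words A B} (w : x ⟶ y) :
    (res hF).map w = Res.Mor.push T (Res.wordMor (cubData A B)
      (x := (x.as.fst, x.as.snd)) (y := (y.as.fst, y.as.snd)) w ((wordsProj A B).map w) rfl) :=
  words_eq (D := Res ((cub A B).comp T.toPseudofunctor)) (fun x => ⟨(x.as.fst, x.as.snd)⟩)
    (fun w => (res hF).map w)
    (fun {x y} w => Res.Mor.push T (Res.wordMor (cubData A B)
      (x := (x.as.fst, x.as.snd)) (y := (y.as.fst, y.as.snd)) w ((wordsProj A B).map w) rfl))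
    (fun x => (res hF).map_id x)
    (fun x => (congrArg (Res.Mor.push T) (Res.wordMor_id (cubData A B) _)).trans
      (Res.push_id T _))
    (fun v w => (res hF).map_comp v w)
    (fun v w => (congrArg (Res.Mor.push T) (Res.wordMor_comp (cubData A B) _ _
      ((wordsProj A B).map_comp v w) _)).trans (Res.push_comp T _ _))
    (fun f b => ((resData hF).functor_left f b).trans
      ((congrArg (Res.Mor.push T) ((Res.wordMor_congr (cubData A B) (proj_left f b) _
        (proj_left f b)).trans (Res.wordMor_of (cubData A B) _ (by
          change _ = wLeft f b ≫ wRight _ (𝟙 b)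
          rw [wRight_id, Category.comp_id])))).trans (Res.push_of T _)).symm)
    (fun a _ _ g => ((resData hF).functor_right a g).trans
      ((congrArg (Res.Mor.push T) ((Res.wordMor_congr (cubData A B) (proj_right a g) _
        (proj_right a g)).trans (Res.wordMor_of (cubData A B) _ (by
          change _ = wLeft (𝟙 a) _ ≫ wRight a g
          rw [wLeft_id, Category.id_comp])))).trans (Res.push_of T _)).symm) w

lemma eq_lift (hF : IsCubical F) (T : StrictPseudofunctor (Gray A B) D)
    (hT : (cub A B).comp T.toPseudofunctor = F) : T = lift hF := by
  subst hT
  exact strict_ext' rfl (fun f => heq_of_eq (congrArg Res.Mor.h (res_eq T hF f.word)).symm)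
    (fun {x y f g} η => Res.push_map₂ (cubData A B) T (x := (x.base.as.fst, x.base.as.snd))
      (y := (y.base.as.fst, y.base.as.snd)) rfl rfl (res_eq T hF f.word) (res_eq T hF g.word)
      (res_p hF _) (res_p hF _) η η.val (conj_rfl _ _ _).symm)

lemma isId₂_map₂_comp (T : StrictPseudofunctor (Gray A B) D) {x y : Gray A B} {f g : x ⟶ y}
    {k : T.obj x ⟶ T.obj y} {η : f ⟶ g} {θ : T.map g ⟶ k} (hη : IsId₂ η) (hθ : IsId₂ θ) :
    IsId₂ (T.map₂ η ≫ θ) := by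
  obtain ⟨h, rfl⟩ := hη
  obtain ⟨h', rfl⟩ := hθ
  subst h h'
  exact ⟨rfl, by simp⟩

lemma cub_comp_isCubical (T : StrictPseudofunctor (Gray A B) D) :
    IsCubical ((cub A B).comp T.toPseudofunctor) where
  mapId x := isId₂_map₂_comp T ((cub_isCubical A B).mapId x)
    ⟨T.map_id _, congrArg Iso.hom (T.mapId_eq_eqToIso _)⟩
  mapComp p q h := isId₂_map₂_comp T ((cub_isCubical A B).mapComp p q h)
    ⟨T.map_comp _ _, congrArg Iso.hom (T.mapComp_eq_eqToIso _ _)⟩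

variable (A B D) in
/-- The universal property of the Gray tensor product: composition with the canonical cubical
functor is a bijection from the 2-functors on the Gray tensor product to the cubical functors. -/
theorem cub_bijective : Function.Bijective
    (fun T : StrictPseudofunctor (Gray A B) D =>
      (⟨(cub A B).comp T.toPseudofunctor, cub_comp_isCubical T⟩ :
        {F : Pseudofunctor (A × B) D // IsCubical F})) := by
  constructor
  · intro T T' h
    have e := congrArg Subtype.val h
    exact (eq_lift (cub_comp_isCubical T') T e).trans (eq_lift (cub_comp_isCubical T') T' rfl).symm
  · rintro ⟨F, hF⟩
    exact ⟨lift hF, Subtype.ext (cub_lift hF)⟩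

end Gray

end Universal

end GrayPerm

/-!
The objects are compared through an intermediate notion. The universal property of the Gray tensor
product identifies 2-functors on `C ⊗ C` with cubical functors on `C × C`, and therefore
Gray-monoids with Gray-monoids with cubical multiplication (`GrayMonoid.cubical_gray`,
`CubicalMonoid.gray_cubical`). For associativity this is needed for three factors: a locally full
pseudofunctor which is bijective on objects and hits generating 1-cells is epic for 2-functors
(`strict_ext_of_full`), and the canonical pseudofunctor from `(C × C) × C` to `(C ⊗ C) ⊗ C` is one.
The same induction on 2-cells (`cell_induction`) extends a transformation from `C × C` to `C ⊗ C` as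
soon as it is strictly natural in each variable (`Gray.extendBraiding`).

On top of a fixed Gray-monoid, both kinds of structure are equivalent to a transformation `b` with
`CubicalMonoid.IsBraiding b`: it is strictly natural in each variable, it satisfies the symmetry,
unit and hexagon equations on components, and the interchange 2-cells of its components with
arbitrary 1-cells are identities.

* For a quasi-strict structure these are the conditions that the modifications and the naturality
  and interchange 2-cells are identities (`QuasiStrict.isBraiding`). Conversely, the hexagons and
  the symmetry then hold as equations between transformations, the modifications can be taken to be
  identities, and each axiom on pastings compares two pastings of identities of one and the same
  1-cell (`CubicalMonoid.IsBraiding.quasiStrict`). The second hexagon is the first one with all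
  1-cells inverted.
* For a permutative structure the point is the hexagon, an equation between transformations on
  `(C ⊗ C) ⊗ C`. Its left side is 2-natural. The naturality 2-cells of `β_{x,y} ⊕ z` at 1-cells of the
  third variable, and those of `y ⊕ β_{x,z}` at 1-cells of the second variable, are interchange
  2-cells and their inverses (`GrayMonoid.hexFst_trd`, `GrayMonoid.hexSnd_snd`), while each factor
  is strictly natural in the other two variables. Since `β` is invertible, the hexagon forces these
  interchange 2-cells to be identities (`Permutative.isBraiding`). Conversely, if they are
  identities then both sides of the hexagon are 2-natural, and it suffices to compare components
  (`CubicalMonoid.IsBraiding.permutative`).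

A structure of either kind is determined by its Gray-monoid and the components of its braiding, and
a 2-functor is a strict functor as soon as it preserves unit, sum and these components; this yields
the two functors and shows that they are mutually inverse.

Equalities between 1-cells and 2-cells whose boundaries agree only propositionally are expressed
through cells bundled with their boundaries: `idCell f = idCell g` for 1-cells, and
`Cell.mk η = Cell.mk θ` for 2-cells.
-/

namespace GrayPerm

/-! ### Equality of 2-cells with varying boundaries -/

section CellCalculus

variable {C : Type u} [Bicategory.{u, u} C]

/-- The identity 2-cell of a 1-cell, with its boundary. Equality of such cells is equality of
1-cells with varying source and target. -/
def idCell {a b : C} (f : a ⟶ b) : Cell C := ⟨𝟙 f⟩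

lemma idCell_of_cell_dom {a b a' b' : C} {f g : a ⟶ b} {f' g' : a' ⟶ b'} {η : f ⟶ g}
    {η' : f' ⟶ g'} (h : Cell.mk η = Cell.mk η') : idCell f = idCell f' := by
  cases h; rfl

lemma idCell_of_cell_cod {a b a' b' : C} {f g : a ⟶ b} {f' g' : a' ⟶ b'} {η : f ⟶ g}
    {η' : f' ⟶ g'} (h : Cell.mk η = Cell.mk η') : idCell g = idCell g' := by
  cases h; rfl

lemma eq_of_idCell {a b : C} {f g : a ⟶ b} (h : idCell f = idCell g) : f = g := by
  cases h; rfl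

lemma eq_of_cell {a b : C} {f g : a ⟶ b} {η θ : f ⟶ g} (h : Cell.mk η = Cell.mk θ) : η = θ := by
  cases h; rfl

lemma heq_of_cell {a b a' b' : C} {f g : a ⟶ b} {f' g' : a' ⟶ b'} {η : f ⟶ g} {η' : f' ⟶ g'}
    (h : Cell.mk η = Cell.mk η') : HEq η η' := by
  cases h; rfl

lemma heq_of_idCell {a b a' b' : C} {f : a ⟶ b} {f' : a' ⟶ b'} (h : idCell f = idCell f') :
    HEq f f' := by
  cases h; rfl

lemma sameArrow_iff {a b a' b' : C} {f : a ⟶ b} {f' : a' ⟶ b'} :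
    SameArrow f f' ↔ idCell f = idCell f' := by
  constructor <;> intro h <;> cases h
  · rfl
  · exact .mk _

lemma cell_comp {a b a' b' : C} {f g h : a ⟶ b} {f' g' h' : a' ⟶ b'} {η : f ⟶ g} {θ : g ⟶ h}
    {η' : f' ⟶ g'} {θ' : g' ⟶ h'} (hη : Cell.mk η = Cell.mk η') (hθ : Cell.mk θ = Cell.mk θ') :
    Cell.mk (η ≫ θ) = Cell.mk (η' ≫ θ') := by
  cases hη; cases hθ; rfl

lemma idCell_comp {a b c a' b' c' : C} {f : a ⟶ b} {g : b ⟶ c} {f' : a' ⟶ b'} {g' : b' ⟶ c'}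
    (hf : idCell f = idCell f') (hg : idCell g = idCell g') :
    idCell (f ≫ g) = idCell (f' ≫ g') := by
  cases hf; cases hg; rfl

lemma cell_whiskerLeft {a b c a' b' c' : C} {f : a ⟶ b} {g h : b ⟶ c} {f' : a' ⟶ b'}
    {g' h' : b' ⟶ c'} {η : g ⟶ h} {η' : g' ⟶ h'} (hf : idCell f = idCell f')
    (hη : Cell.mk η = Cell.mk η') : Cell.mk (f ◁ η) = Cell.mk (f' ◁ η') := by
  cases hf; cases hη; rfl

lemma cell_whiskerRight {a b c a' b' c' : C} {f g : a ⟶ b} {h : b ⟶ c} {f' g' : a' ⟶ b'}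
    {h' : b' ⟶ c'} {η : f ⟶ g} {η' : f' ⟶ g'} (hη : Cell.mk η = Cell.mk η')
    (hh : idCell h = idCell h') : Cell.mk (η ▷ h) = Cell.mk (η' ▷ h') := by
  cases hh; cases hη; rfl

lemma cell_inv {a b a' b' : C} {f g : a ⟶ b} {f' g' : a' ⟶ b'} {η : f ≅ g} {η' : f' ≅ g'}
    (h : Cell.mk η.hom = Cell.mk η'.hom) : Cell.mk η.inv = Cell.mk η'.inv := by
  obtain ⟨η, θ, h₁, h₂⟩ := η
  obtain ⟨η', θ', h₁', h₂'⟩ := η'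
  dsimp only at h
  cases h
  congr 1
  exact (Category.comp_id _).symm.trans ((congrArg (fun t => θ ≫ t) h₁'.symm).trans
    ((Category.assoc _ _ _).symm.trans
      ((congrArg (fun t => t ≫ θ') h₂).trans (Category.id_comp _))))

lemma cell_eqToHom_comp {a b : C} {f g h : a ⟶ b} (e : f = g) (η : g ⟶ h) :
    Cell.mk (eqToHom e ≫ η) = Cell.mk η := by
  cases e; simp

lemma cell_comp_eqToHom {a b : C} {f g h : a ⟶ b} (η : f ⟶ g) (e : g = h) :
    Cell.mk (η ≫ eqToHom e) = Cell.mk η := by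
  cases e; simp

lemma cell_conj {a b : C} {f g h k : a ⟶ b} (e : f = g) (η : g ⟶ h) (e' : h = k) :
    Cell.mk (eqToHom e ≫ η ≫ eqToHom e') = Cell.mk η := by
  cases e; cases e'; simp

lemma idCell_eqToHom_comp [Strict C] {a b c : C} (e : a = b) (f : b ⟶ c) :
    idCell (eqToHom e ≫ f) = idCell f := by
  cases e; exact congrArg idCell (Strict.id_comp f)

lemma idCell_comp_eqToHom [Strict C] {a b c : C} (f : a ⟶ b) (e : b = c) :
    idCell (f ≫ eqToHom e) = idCell f := by
  cases e; exact congrArg idCell (Strict.comp_id f)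

lemma idCell_eqToHom {a b : C} (e : a = b) : idCell (eqToHom e) = idCell (𝟙 a) := by
  cases e; rfl

lemma whiskerRight_id_cell [Strict C] {a b : C} {f g : a ⟶ b} (η : f ⟶ g) :
    Cell.mk (η ▷ 𝟙 b) = Cell.mk η := by
  rw [whisker_id rfl, cell_conj]

lemma id_whiskerLeft_cell [Strict C] {a b : C} {f g : a ⟶ b} (η : f ⟶ g) :
    Cell.mk (𝟙 a ◁ η) = Cell.mk η := by
  rw [id_whisker rfl, cell_conj]

lemma isId₂_iff {a b : C} {f g : a ⟶ b} {η : f ⟶ g} : IsId₂ η ↔ Cell.mk η = idCell f := by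
  constructor
  · rintro ⟨h, rfl⟩; cases h; rfl
  · intro h
    cases h
    exact ⟨rfl, rfl⟩

lemma isId₂_iff' {a b : C} {f g : a ⟶ b} {η : f ⟶ g} : IsId₂ η ↔ Cell.mk η = idCell g := by
  constructor
  · rintro ⟨h, rfl⟩; cases h; rfl
  · intro h
    have e := idCell_of_cell_dom h
    cases eq_of_idCell e
    exact isId₂_iff.2 h

lemma isId₂_of_cell {a b a' b' : C} {f g : a ⟶ b} {f' g' : a' ⟶ b'} {η : f ⟶ g} {η' : f' ⟶ g'}
    (h : Cell.mk η = Cell.mk η') (hη : IsId₂ η') : IsId₂ η := by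
  cases h; exact hη

lemma isId₂_eqToHom {a b : C} {f g : a ⟶ b} (h : f = g) : IsId₂ (eqToHom h) := ⟨h, rfl⟩

lemma isId₂_id {a b : C} (f : a ⟶ b) : IsId₂ (𝟙 f) := ⟨rfl, rfl⟩

lemma IsId₂.comp {a b : C} {f g h : a ⟶ b} {η : f ⟶ g} {θ : g ⟶ h} (hη : IsId₂ η)
    (hθ : IsId₂ θ) : IsId₂ (η ≫ θ) := by
  obtain ⟨h, rfl⟩ := hη
  obtain ⟨h', rfl⟩ := hθ
  exact ⟨h.trans h', eqToHom_trans _ _⟩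

lemma IsId₂.whiskerLeft {a b c : C} (f : a ⟶ b) {g h : b ⟶ c} {η : g ⟶ h} (hη : IsId₂ η) :
    IsId₂ (f ◁ η) := by
  obtain ⟨h, rfl⟩ := hη
  cases h
  exact ⟨rfl, by simp⟩

lemma IsId₂.whiskerRight {a b c : C} {f g : a ⟶ b} {η : f ⟶ g} (hη : IsId₂ η) (h : b ⟶ c) :
    IsId₂ (η ▷ h) := by
  obtain ⟨h, rfl⟩ := hη
  cases h
  exact ⟨rfl, by simp⟩

lemma IsId₂.inv {a b : C} {f g : a ⟶ b} {η : f ≅ g} (hη : IsId₂ η.hom) : IsId₂ η.inv := by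
  obtain ⟨h, e⟩ := hη
  cases h
  have : η = Iso.refl _ := Iso.ext e
  rw [this]
  exact ⟨rfl, rfl⟩

lemma IsId₂.unique {a b : C} {f g : a ⟶ b} {η θ : f ⟶ g} (hη : IsId₂ η) (hθ : IsId₂ θ) :
    η = θ := by
  obtain ⟨h, rfl⟩ := hη
  obtain ⟨h', rfl⟩ := hθ
  rfl

lemma isId₂_of_comp_left {a b : C} {f g h : a ⟶ b} {η : f ⟶ g} {θ : g ⟶ h} (hη : IsId₂ η)
    (h : IsId₂ (η ≫ θ)) : IsId₂ θ := by
  obtain ⟨e, rfl⟩ := hη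
  cases e
  simpa using h

lemma isId₂_of_comp_right {a b : C} {f g h : a ⟶ b} {η : f ⟶ g} {θ : g ⟶ h} (hθ : IsId₂ θ)
    (h : IsId₂ (η ≫ θ)) : IsId₂ η := by
  obtain ⟨e, rfl⟩ := hθ
  cases e
  simpa using h

variable {D : Type u} [Bicategory.{u, u} D]

lemma IsId₂.map {a b : C} {f g : a ⟶ b} {η : f ⟶ g} (hη : IsId₂ η) (F : Pseudofunctor C D) :
    IsId₂ (F.map₂ η) := by
  obtain ⟨h, rfl⟩ := hη
  cases h
  exact ⟨rfl, by simp⟩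

lemma isId₂_iso_conj {a b : C} {f g h k : a ⟶ b} {s : f ≅ g} {η : f ⟶ h} {t : h ≅ k}
    (hs : IsId₂ s.hom) (ht : IsId₂ t.hom) (h : IsId₂ (s.inv ≫ η ≫ t.hom)) : IsId₂ η :=
  isId₂_of_comp_right ht (isId₂_of_comp_left hs.inv h)

/-- A 2-cell is an identity if its whiskering with a 1-cell with a right inverse is one. -/
lemma isId₂_of_whiskerRight [Strict C] {a b c : C} {f g : a ⟶ b} {η : f ⟶ g} {h : b ⟶ c}
    {k : c ⟶ b} (hk : h ≫ k = 𝟙 b) (hη : IsId₂ (η ▷ h)) : IsId₂ η := by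
  have e : Cell.mk ((η ▷ h) ▷ k) = Cell.mk η := by
    rw [← whiskerRight_id_cell η, ← cell_whiskerRight rfl (congrArg idCell hk),
      whisker_comp rfl, cell_conj]
  exact isId₂_of_cell e.symm (hη.whiskerRight k)

/-- A 2-cell is an identity if its whiskering with a 1-cell with a left inverse is one. -/
lemma isId₂_of_whiskerLeft [Strict C] {a b c : C} {f g : a ⟶ b} {η : f ⟶ g} {h : c ⟶ a}
    {k : a ⟶ c} (hk : k ≫ h = 𝟙 a) (hη : IsId₂ (h ◁ η)) : IsId₂ η := by
  have e : Cell.mk (k ◁ (h ◁ η)) = Cell.mk η := by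
    rw [← id_whiskerLeft_cell η, ← cell_whiskerLeft (congrArg idCell hk) rfl,
      comp_whisker rfl, cell_conj]
  exact isId₂_of_cell e.symm (hη.whiskerLeft k)

lemma cell_map (F : Pseudofunctor C D) {a b a' b' : C} {f g : a ⟶ b} {f' g' : a' ⟶ b'} {η : f ⟶ g}
    {η' : f' ⟶ g'} (h : Cell.mk η = Cell.mk η') : Cell.mk (F.map₂ η) = Cell.mk (F.map₂ η') := by
  cases h; rfl

lemma idCell_map (F : Pseudofunctor C D) {a b a' b' : C} {f : a ⟶ b} {f' : a' ⟶ b'}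
    (h : idCell f = idCell f') : idCell (F.map f) = idCell (F.map f') := by
  cases h; rfl

lemma strict_mapComp (F : StrictPseudofunctor C D) {a b c : C} (f : a ⟶ b) (g : b ⟶ c) :
    IsId₂ (F.mapComp f g).hom := ⟨F.map_comp f g, by rw [F.mapComp_eq_eqToIso]; rfl⟩

lemma strict_mapId (F : StrictPseudofunctor C D) (a : C) : IsId₂ (F.mapId a).hom :=
  ⟨F.map_id a, by rw [F.mapId_eq_eqToIso]; rfl⟩

lemma toPseudofunctor_injective {F G : StrictPseudofunctor C D}
    (h : F.toPseudofunctor = G.toPseudofunctor) : F = G :=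
  strict_ext (congrArg (fun t => t.toPrelaxFunctor) h)

end CellCalculus

/-! ### Transformations determined by their components -/

section TransExt

open scoped Pseudofunctor.StrongTrans

variable {X : Type u} [Bicategory.{u, u} X] {D : Type u} [Bicategory.{u, u} D]

/-- The 1-cells generated by a class of 1-cells. -/
inductive Gen (S : ∀ x y : X, (x ⟶ y) → Prop) : ∀ {x y : X}, (x ⟶ y) → Prop
  | of {x y : X} (f : x ⟶ y) : S x y f → Gen S f
  | id (x : X) : Gen S (𝟙 x)
  | comp {x y z : X} (f : x ⟶ y) (g : y ⟶ z) : Gen S f → Gen S g → Gen S (f ≫ g)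

lemma Gen.of_eq {S : ∀ x y : X, (x ⟶ y) → Prop} {x y z : X} {f : x ⟶ y} {g : y ⟶ z} {h : x ⟶ z}
    (hf : Gen S f) (hg : Gen S g) (e : f ≫ g = h) : Gen S h := e ▸ Gen.comp f g hf hg

/-- Transformations with the same components agree if they agree on generating 1-cells. -/
lemma trans_ext {F G : Pseudofunctor X D} {α β : F ⟶ G} (S : ∀ x y : X, (x ⟶ y) → Prop)
    (hS : ∀ {x y : X} (f : x ⟶ y), Gen S f)
    (hα : ∀ {x y : X} (f : x ⟶ y), S x y f → IsId₂ (α.naturality f).hom)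
    (hβ : ∀ {x y : X} (f : x ⟶ y), S x y f → IsId₂ (β.naturality f).hom)
    (app : ∀ x, α.app x = β.app x) : α = β := by
  obtain ⟨p, m, m₁, m₂, m₃⟩ := α
  obtain ⟨q, n, n₁, n₂, n₃⟩ := β
  have e : p = q := funext app
  subst e
  have e' : @m = @n := by
    funext x y f
    apply Iso.ext
    induction hS f with
    | of f hf => exact (hα f hf).unique (hβ f hf)
    | id x =>
      rw [← cancel_mono (p x ◁ (G.mapId x).hom)]
      exact (m₂ x).trans (n₂ x).symm
    | comp f g _ _ hf hg =>
      rw [← cancel_mono (p _ ◁ (G.mapComp f g).hom)]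
      refine (m₃ f g).trans (Eq.trans ?_ (n₃ f g).symm)
      rw [hf, hg]
  subst e'
  rfl

/-- Transformations between equal pseudofunctors with the same components, both strictly natural on
generating 1-cells, are the same. -/
lemma sameArrow_trans {F G F' G' : Pseudofunctor X D} {α : F ⟶ G} {β : F' ⟶ G'}
    (S : ∀ x y : X, (x ⟶ y) → Prop) (hS : ∀ {x y : X} (f : x ⟶ y), Gen S f)
    (hF : F = F') (hG : G = G')
    (hα : ∀ {x y : X} (f : x ⟶ y), S x y f → IsId₂ (α.naturality f).hom)
    (hβ : ∀ {x y : X} (f : x ⟶ y), S x y f → IsId₂ (β.naturality f).hom)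
    (app : ∀ x, SameArrow (α.app x) (β.app x)) : SameArrow α β := by
  subst hF hG
  have : α = β := trans_ext S hS hα hβ fun x => eq_of_idCell (sameArrow_iff.1 (app x))
  subst this
  exact .mk _

lemma isId₂_comp_naturality [Strict D] {F G H : Pseudofunctor X D} {α : F ⟶ G} {β : G ⟶ H}
    {x y : X} {f : x ⟶ y} (hα : IsId₂ (α.naturality f).hom) (hβ : IsId₂ (β.naturality f).hom) :
    IsId₂ ((α ≫ β).naturality f).hom := by
  rw [Pseudofunctor.StrongTrans.categoryStruct_comp_naturality_hom]
  simp only [Strict.associator_eqToIso, eqToIso.hom, eqToIso.inv]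
  exact (isId₂_eqToHom _).comp ((hα.whiskerRight _).comp ((isId₂_eqToHom _).comp
    ((hβ.whiskerLeft _).comp (isId₂_eqToHom _))))

/-- A transformation is a composite of two others as soon as its components are, if all three are
strictly natural on generating 1-cells. -/
lemma isComposite_trans [Strict D] {F G G' H F' H' : Pseudofunctor X D} {α : F ⟶ G} {β : G' ⟶ H}
    {γ : F' ⟶ H'} (S : ∀ x y : X, (x ⟶ y) → Prop) (hS : ∀ {x y : X} (f : x ⟶ y), Gen S f)
    (hF : F = F') (hG : G = G') (hH : H = H')
    (hα : ∀ {x y : X} (f : x ⟶ y), S x y f → IsId₂ (α.naturality f).hom)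
    (hβ : ∀ {x y : X} (f : x ⟶ y), S x y f → IsId₂ (β.naturality f).hom)
    (hγ : ∀ {x y : X} (f : x ⟶ y), S x y f → IsId₂ (γ.naturality f).hom)
    (app : ∀ x, IsComposite (α.app x) (β.app x) (γ.app x)) : IsComposite α β γ := by
  subst hF hG hH
  have : γ = α ≫ β := trans_ext S hS hγ
    (fun f hf => isId₂_comp_naturality (hα f hf) (hβ f hf)) fun x => by
      have h := app x
      change _ = α.app x ≫ β.app x
      generalize γ.app x = c at h
      cases h
      rfl
  subst this
  exact .mk _ _

lemma isId₂_ofEq [Strict D] {F G : Pseudofunctor X D} (h : F = G) {x y : X} (f : x ⟶ y) :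
    IsId₂ ((ofEq h).naturality f).hom := by
  cases h
  change IsId₂ ((ρ_ (F.map f)).hom ≫ (λ_ (F.map f)).inv)
  rw [Strict.leftUnitor_eqToIso, Strict.rightUnitor_eqToIso]
  exact (isId₂_eqToHom (Strict.comp_id _)).comp (isId₂_eqToHom (Strict.id_comp _).symm)

lemma ofEq_app {F G : Pseudofunctor X D} (h : F = G) (x : X) :
    (ofEq h).app x = eqToHom (congrArg (fun t => t.obj x) h) := by
  cases h; rfl

lemma IsComposite.app {F G G' H F' H' : Pseudofunctor X D} {α : F ⟶ G} {β : G' ⟶ H}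
    {γ : F' ⟶ H'} (h : IsComposite α β γ) (x : X) :
    IsComposite (α.app x) (β.app x) (γ.app x) := by
  cases h; exact .mk _ _

/-- If a composite and its second factor are strictly natural at a 1-cell and the second factor has
invertible components, the first factor is strictly natural. -/
lemma IsComposite.isId₂_left [Strict D] {F G G' H F' H' : Pseudofunctor X D} {α : F ⟶ G}
    {β : G' ⟶ H} {γ : F' ⟶ H'} (h : IsComposite α β γ) {x y : X} {f : x ⟶ y}
    (hβ : IsId₂ (β.naturality f).hom) (hγ : IsId₂ (γ.naturality f).hom)
    (hi : ∃ k, β.app y ≫ k = 𝟙 _) : IsId₂ (α.naturality f).hom := by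
  cases h
  obtain ⟨k, hk⟩ := hi
  refine isId₂_of_whiskerRight hk ?_
  rw [Pseudofunctor.StrongTrans.categoryStruct_comp_naturality_hom] at hγ
  simp only [Strict.associator_eqToIso, eqToIso.hom, eqToIso.inv] at hγ
  exact isId₂_of_comp_right ((isId₂_eqToHom _).comp ((hβ.whiskerLeft _).comp (isId₂_eqToHom _)))
    (isId₂_of_comp_left (isId₂_eqToHom _) hγ)

/-- If a composite and its first factor are strictly natural at a 1-cell and the first factor has
invertible components, the second factor is strictly natural. -/
lemma IsComposite.isId₂_right [Strict D] {F G G' H F' H' : Pseudofunctor X D} {α : F ⟶ G}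
    {β : G' ⟶ H} {γ : F' ⟶ H'} (h : IsComposite α β γ) {x y : X} {f : x ⟶ y}
    (hα : IsId₂ (α.naturality f).hom) (hγ : IsId₂ (γ.naturality f).hom)
    (hi : ∃ k, k ≫ α.app x = 𝟙 _) : IsId₂ (β.naturality f).hom := by
  cases h
  obtain ⟨k, hk⟩ := hi
  refine isId₂_of_whiskerLeft hk ?_
  rw [Pseudofunctor.StrongTrans.categoryStruct_comp_naturality_hom] at hγ
  simp only [Strict.associator_eqToIso, eqToIso.hom, eqToIso.inv] at hγ
  exact isId₂_of_comp_right (isId₂_eqToHom _) (isId₂_of_comp_left (isId₂_eqToHom _)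
    (isId₂_of_comp_left (hα.whiskerRight _) (isId₂_of_comp_left (isId₂_eqToHom _) hγ)))

lemma isId₂_whiskerR {F G : Pseudofunctor X D} {α : F ⟶ G} {E : Type u} [Bicategory.{u, u} E]
    (H : Pseudofunctor D E) {x y : X} {f : x ⟶ y}
    (h₁ : IsId₂ (H.mapComp (F.map f) (α.app y)).hom) (hα : IsId₂ (α.naturality f).hom)
    (h₂ : IsId₂ (H.mapComp (α.app x) (G.map f)).hom) :
    IsId₂ ((whiskerR α H).naturality f).hom :=
  h₁.inv.comp ((hα.map H).comp h₂)

lemma isId₂_whiskerR_strict {F G : Pseudofunctor X D} {α : F ⟶ G} {E : Type u}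
    [Bicategory.{u, u} E] (H : StrictPseudofunctor D E) {x y : X} {f : x ⟶ y}
    (hα : IsId₂ (H.map₂ (α.naturality f).hom)) :
    IsId₂ ((whiskerR α H.toPseudofunctor).naturality f).hom :=
  (strict_mapComp H _ _).inv.comp (hα.comp (strict_mapComp H _ _))

lemma isId₂_of_whiskerR_strict {F G : Pseudofunctor X D} {α : F ⟶ G} {E : Type u}
    [Bicategory.{u, u} E] (H : StrictPseudofunctor D E) {x y : X} {f : x ⟶ y}
    (h : IsId₂ ((whiskerR α H.toPseudofunctor).naturality f).hom) :
    IsId₂ (H.map₂ (α.naturality f).hom) :=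
  isId₂_iso_conj (strict_mapComp H _ _) (strict_mapComp H _ _) h

end TransExt

/-! ### Equality of pseudofunctors into factorisations and Gray tensor products -/

section Ext

variable {X D E : Type u} [Bicategory.{u, u} X] [Bicategory.{u, u} D] [Bicategory.{u, u} E]

lemma src_eq_of_idCell {a b a' b' : D} {f : a ⟶ b} {f' : a' ⟶ b'} (h : idCell f = idCell f') :
    a = a' := by cases h; rfl

lemma prelax_ext_cell {F G : PrelaxFunctor X D}
    (h : ∀ {x y : X} {f g : x ⟶ y} (η : f ⟶ g), Cell.mk (F.map₂ η) = Cell.mk (G.map₂ η)) :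
    F = G :=
  prelax_ext (funext fun x => src_eq_of_idCell (idCell_of_cell_dom (h (𝟙 (𝟙 x)))))
    (fun f => heq_of_idCell (idCell_of_cell_dom (h (𝟙 f)))) (fun η => heq_of_cell (h η))

lemma pseudofunctor_ext_cell {F G : Pseudofunctor X D}
    (h : ∀ {x y : X} {f g : x ⟶ y} (η : f ⟶ g), Cell.mk (F.map₂ η) = Cell.mk (G.map₂ η))
    (hId : ∀ x, Cell.mk (F.mapId x).hom = Cell.mk (G.mapId x).hom)
    (hComp : ∀ {x y z : X} (f : x ⟶ y) (g : y ⟶ z),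
      Cell.mk (F.mapComp f g).hom = Cell.mk (G.mapComp f g).hom) : F = G :=
  pseudofunctor_ext (prelax_ext_cell h) (fun x => heq_of_cell (hId x))
    (fun f g => heq_of_cell (hComp f g))

/-- Two pseudofunctors with identity comparison 2-cells agree if they agree on 2-cells. -/
lemma pseudofunctor_ext_isId {F G : Pseudofunctor X D}
    (hF : ∀ x, IsId₂ (F.mapId x).hom) (hG : ∀ x, IsId₂ (G.mapId x).hom)
    (hF' : ∀ {x y z : X} (f : x ⟶ y) (g : y ⟶ z), IsId₂ (F.mapComp f g).hom)
    (hG' : ∀ {x y z : X} (f : x ⟶ y) (g : y ⟶ z), IsId₂ (G.mapComp f g).hom)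
    (h : ∀ {x y : X} {f g : x ⟶ y} (η : f ⟶ g), Cell.mk (F.map₂ η) = Cell.mk (G.map₂ η)) :
    F = G :=
  pseudofunctor_ext_cell h
    (fun x => (isId₂_iff.1 (hF x)).trans
      ((idCell_of_cell_dom (h (𝟙 (𝟙 x)))).trans (isId₂_iff.1 (hG x)).symm))
    (fun f g => (isId₂_iff.1 (hF' f g)).trans
      ((idCell_of_cell_dom (h (𝟙 (f ≫ g)))).trans (isId₂_iff.1 (hG' f g)).symm))

lemma cell_of_eq {F G : Pseudofunctor X D} (h : F = G) {x y : X} {f g : x ⟶ y} (η : f ⟶ g) :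
    Cell.mk (F.map₂ η) = Cell.mk (G.map₂ η) := by
  cases h; rfl

lemma idCell_of_eq {F G : Pseudofunctor X D} (h : F = G) {x y : X} (f : x ⟶ y) :
    idCell (F.map f) = idCell (G.map f) := by
  cases h; rfl

lemma mapId_cell_of_eq {F G : Pseudofunctor X D} (h : F = G) (x : X) :
    Cell.mk (F.mapId x).hom = Cell.mk (G.mapId x).hom := by
  cases h; rfl

lemma mapComp_cell_of_eq {F G : Pseudofunctor X D} (h : F = G) {x y z : X} (f : x ⟶ y)
    (g : y ⟶ z) : Cell.mk (F.mapComp f g).hom = Cell.mk (G.mapComp f g).hom := by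
  cases h; rfl

lemma comp_mapId_strict (F : Pseudofunctor X D) (G : StrictPseudofunctor D E) (x : X) :
    Cell.mk ((F.comp G.toPseudofunctor).mapId x).hom = Cell.mk (G.map₂ (F.mapId x).hom) := by
  change Cell.mk (G.map₂ (F.mapId x).hom ≫ (G.mapId _).hom) = _
  rw [G.mapId_eq_eqToIso]
  exact cell_comp_eqToHom _ (G.map_id _)

lemma comp_mapComp_strict (F : Pseudofunctor X D) (G : StrictPseudofunctor D E) {x y z : X}
    (f : x ⟶ y) (g : y ⟶ z) : Cell.mk ((F.comp G.toPseudofunctor).mapComp f g).hom =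
      Cell.mk (G.map₂ (F.mapComp f g).hom) := by
  change Cell.mk (G.map₂ (F.mapComp f g).hom ≫ (G.mapComp _ _).hom) = _
  rw [G.mapComp_eq_eqToIso]
  exact cell_comp_eqToHom _ (G.map_comp _ _)

lemma isId₂_comp_mapId {F : Pseudofunctor X D} {G : Pseudofunctor D E} {x : X}
    (hF : IsId₂ (F.mapId x).hom) (hG : IsId₂ (G.mapId (F.obj x)).hom) :
    IsId₂ ((F.comp G).mapId x).hom := (hF.map G).comp hG

lemma isId₂_comp_mapComp {F : Pseudofunctor X D} {G : Pseudofunctor D E} {x y z : X}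
    {f : x ⟶ y} {g : y ⟶ z} (hF : IsId₂ (F.mapComp f g).hom)
    (hG : IsId₂ (G.mapComp (F.map f) (F.map g)).hom) :
    IsId₂ ((F.comp G).mapComp f g).hom := (hF.map G).comp hG

/-- Since the canonical 2-functor from a factorisation is locally fully faithful, a pseudofunctor
into the factorisation is determined by its values on 1-cells and its image. -/
lemma factor_ext {W : Type u} [Category.{u} W] [Strict D] {P : W ⥤ D}
    {S T : Pseudofunctor X (Factor P)}
    (hmap : ∀ {x y : X} (f : x ⟶ y), idCell (S.map f) = idCell (T.map f))
    (h₂ : ∀ {x y : X} {f g : x ⟶ y} (η : f ⟶ g),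
      Cell.mk (S.map₂ η).val = Cell.mk (T.map₂ η).val)
    (hId : ∀ x : X, Cell.mk (S.mapId x).hom.val = Cell.mk (T.mapId x).hom.val)
    (hComp : ∀ {x y z : X} (f : x ⟶ y) (g : y ⟶ z),
      Cell.mk (S.mapComp f g).hom.val = Cell.mk (T.mapComp f g).hom.val) : S = T := by
  have key : ∀ {a b a' b' : Factor P} {f g : a ⟶ b} {f' g' : a' ⟶ b'} (η : f ⟶ g) (η' : f' ⟶ g'),
      idCell f = idCell f' → idCell g = idCell g' → Cell.mk η.val = Cell.mk η'.val →
      Cell.mk η = Cell.mk η' := by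
    intro a b a' b' f g f' g' η η' h₁ h₂ h
    cases h₁
    cases h₂
    rw [Factor.hom_ext (eq_of_cell h)]
  refine pseudofunctor_ext_cell (fun η => key _ _ (hmap _) (hmap _) (h₂ η))
    (fun x => key _ _ (hmap _) ?_ (hId x))
    (fun f g => key _ _ (hmap _) (idCell_comp (hmap _) (hmap _)) (hComp f g))
  have h := src_eq_of_idCell (hmap (𝟙 x))
  change idCell (𝟙 (S.obj x)) = idCell (𝟙 (T.obj x))
  rw [h]

lemma pair_cell {a b a' b' : D × E} {f g : a ⟶ b} {f' g' : a' ⟶ b'} {η : f ⟶ g} {η' : f' ⟶ g'}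
    (h₁ : Cell.mk η.1 = Cell.mk η'.1) (h₂ : Cell.mk η.2 = Cell.mk η'.2) :
    Cell.mk η = Cell.mk η' := by
  obtain ⟨a₁, a₂⟩ := a
  obtain ⟨b₁, b₂⟩ := b
  obtain ⟨a'₁, a'₂⟩ := a'
  obtain ⟨b'₁, b'₂⟩ := b'
  obtain ⟨f₁, f₂⟩ := f
  obtain ⟨g₁, g₂⟩ := g
  obtain ⟨f'₁, f'₂⟩ := f'
  obtain ⟨g'₁, g'₂⟩ := g'
  obtain ⟨η₁, η₂⟩ := η
  obtain ⟨η'₁, η'₂⟩ := η'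
  dsimp only at *
  cases h₁
  cases h₂
  rfl

end Ext

namespace Gray

section Projections

variable (A B : Type u) [Bicategory.{u, u} A] [Bicategory.{u, u} B] [Strict A] [Strict B]

/-- The canonical 2-functor from the Gray tensor product to the first factor. -/
def pfst : StrictPseudofunctor (Gray A B) A :=
  (Factor.proj (wordsProj A B)).comp (Bicategory.Prod.fst A B)

/-- The canonical 2-functor from the Gray tensor product to the second factor. -/
def psnd : StrictPseudofunctor (Gray A B) B :=
  (Factor.proj (wordsProj A B)).comp (Bicategory.Prod.snd A B)

variable {A B} {X : Type u} [Bicategory.{u, u} X]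

/-- A pseudofunctor into a Gray tensor product is determined by its values on 1-cells and its
composites with the two projections. -/
lemma ext_gray {S T : Pseudofunctor X (Gray A B)}
    (hmap : ∀ {x y : X} (f : x ⟶ y), idCell (S.map f) = idCell (T.map f))
    (h₁ : S.comp (pfst A B).toPseudofunctor = T.comp (pfst A B).toPseudofunctor)
    (h₂ : S.comp (psnd A B).toPseudofunctor = T.comp (psnd A B).toPseudofunctor) : S = T :=
  factor_ext hmap (fun η => pair_cell (cell_of_eq h₁ η) (cell_of_eq h₂ η))
    (fun x => pair_cell
      ((comp_mapId_strict S (pfst A B) x).symm.trans ((mapId_cell_of_eq h₁ x).trans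
        (comp_mapId_strict T (pfst A B) x)))
      ((comp_mapId_strict S (psnd A B) x).symm.trans ((mapId_cell_of_eq h₂ x).trans
        (comp_mapId_strict T (psnd A B) x))))
    (fun f g => pair_cell
      ((comp_mapComp_strict S (pfst A B) f g).symm.trans ((mapComp_cell_of_eq h₁ f g).trans
        (comp_mapComp_strict T (pfst A B) f g)))
      ((comp_mapComp_strict S (psnd A B) f g).symm.trans ((mapComp_cell_of_eq h₂ f g).trans
        (comp_mapComp_strict T (psnd A B) f g))))

lemma strict_cell_ext {D : Type u} [Bicategory.{u, u} D] {S T : StrictPseudofunctor X D}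
    (h : ∀ {x y : X} {f g : x ⟶ y} (η : f ⟶ g), Cell.mk (S.map₂ η) = Cell.mk (T.map₂ η)) :
    S = T := strict_ext (prelax_ext_cell h)

lemma ext_gray_strict {S T : StrictPseudofunctor X (Gray A B)}
    (hmap : ∀ {x y : X} (f : x ⟶ y), idCell (S.map f) = idCell (T.map f))
    (h₁ : S.comp (pfst A B) = T.comp (pfst A B))
    (h₂ : S.comp (psnd A B) = T.comp (psnd A B)) : S = T :=
  toPseudofunctor_injective (ext_gray hmap (congrArg (fun t => t.toPseudofunctor) h₁)
    (congrArg (fun t => t.toPseudofunctor) h₂))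

/-- The class of the 1-cells `f ⊗ 1` and `1 ⊗ g`. -/
inductive Basic : ∀ x y : Gray A B, (x ⟶ y) → Prop
  | left {a a' : A} (f : a ⟶ a') (b : B) : Basic (pt a b) (pt a' b) (left f b)
  | right (a : A) {b b' : B} (g : b ⟶ b') : Basic (pt a b) (pt a b') (right a g)

lemma gen_basic {x y : Gray A B} (f : x ⟶ y) : Gen (Basic (A := A) (B := B)) f := by
  obtain ⟨w⟩ := f
  obtain ⟨x⟩ := x
  obtain ⟨y⟩ := y
  dsimp only at w
  induction w using words_induction with
  | id x => exact Gen.id (⟨x⟩ : Gray A B)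
  | @left x a a' b w f ih =>
    exact Gen.comp (⟨w⟩ : (⟨x⟩ : Gray A B) ⟶ pt a b) (left f b) ih (.of _ (.left f b))
  | @right x a b b' w g ih =>
    exact Gen.comp (⟨w⟩ : (⟨x⟩ : Gray A B) ⟶ pt a b) (right a g) ih (.of _ (.right a g))

lemma left_id (a : A) (b : B) : left (𝟙 a) b = 𝟙 (pt a b) := congrArg Factor.Hom₁.mk (wLeft_id a b)
lemma right_id (a : A) (b : B) : right a (𝟙 b) = 𝟙 (pt a b) :=
  congrArg Factor.Hom₁.mk (wRight_id a b)
lemma left_comp {a a' a'' : A} (f : a ⟶ a') (f' : a' ⟶ a'') (b : B) :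
    left (f ≫ f') b = left f b ≫ left f' b := congrArg Factor.Hom₁.mk (wLeft_comp f f' b)
lemma right_comp (a : A) {b b' b'' : B} (g : b ⟶ b') (g' : b' ⟶ b'') :
    right a (g ≫ g') = right a g ≫ right a g' := congrArg Factor.Hom₁.mk (wRight_comp a g g')

/-- 2-functors which agree on basic 1-cells agree on 1-cells. -/
lemma idCell_ext {D : Type u} [Bicategory.{u, u} D] {S T : StrictPseudofunctor (Gray A B) D}
    (hl : ∀ {a a' : A} (f : a ⟶ a') (b : B), idCell (S.map (left f b)) = idCell (T.map (left f b)))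
    (hr : ∀ (a : A) {b b' : B} (g : b ⟶ b'),
      idCell (S.map (right a g)) = idCell (T.map (right a g))) {x y : Gray A B} (f : x ⟶ y) :
    idCell (S.map f) = idCell (T.map f) := by
  induction gen_basic f with
  | of f hf =>
    cases hf with
    | left f b => exact hl f b
    | right a g => exact hr a g
  | id x =>
    obtain ⟨⟨⟨a, b⟩⟩⟩ := x
    have h := hl (𝟙 a) b
    rw [left_id] at h
    exact h
  | comp f g _ _ hf hg =>
    rw [S.map_comp, T.map_comp]
    exact idCell_comp hf hg

lemma cub_map_left {a a' : A} (f : a ⟶ a') (b : B) :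
    (cub A B).map ((f, 𝟙 b) : (a, b) ⟶ (a', b)) = left f b :=
  congrArg Factor.Hom₁.mk ((congrArg (fun t => wLeft f b ≫ t) (wRight_id a' b)).trans
    (Category.comp_id _))

lemma cub_map_right (a : A) {b b' : B} (g : b ⟶ b') :
    (cub A B).map ((𝟙 a, g) : (a, b) ⟶ (a, b')) = right a g :=
  congrArg Factor.Hom₁.mk ((congrArg (fun t => t ≫ wRight a g) (wLeft_id a b)).trans
    (Category.id_comp _))

lemma cub_val {x y : A × B} {f g : x ⟶ y} (η : f ⟶ g) :
    Cell.mk ((cub A B).map₂ η).val = Cell.mk η := cell_conj _ _ _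

lemma cub_mapId_val (x : A × B) : IsId₂ ((cub A B).mapId x).hom.val :=
  isId₂_eqToHom ((cubData A B).eq_id x)
lemma cub_mapComp_val {x y z : A × B} (f : x ⟶ y) (g : y ⟶ z) :
    IsId₂ ((cub A B).mapComp f g).hom.val :=
  isId₂_eqToHom ((cubData A B).eq_comp f g)

lemma IsId₂_fst {x y : A × B} {f g : x ⟶ y} {η : f ⟶ g} (h : IsId₂ η) : IsId₂ η.1 := by
  obtain ⟨h, rfl⟩ := h
  exact ⟨congrArg (fun t => t.1) h, prod_eqToHom₂_fst h⟩

lemma IsId₂_snd {x y : A × B} {f g : x ⟶ y} {η : f ⟶ g} (h : IsId₂ η) : IsId₂ η.2 := by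
  obtain ⟨h, rfl⟩ := h
  exact ⟨congrArg (fun t => t.2) h, prod_eqToHom₂_snd h⟩

lemma cell_fst {a b a' b' : A × B} {f g : a ⟶ b} {f' g' : a' ⟶ b'} {η : f ⟶ g} {η' : f' ⟶ g'}
    (h : Cell.mk η = Cell.mk η') : Cell.mk η.1 = Cell.mk η'.1 := by
  cases h; rfl

lemma cell_snd {a b a' b' : A × B} {f g : a ⟶ b} {f' g' : a' ⟶ b'} {η : f ⟶ g} {η' : f' ⟶ g'}
    (h : Cell.mk η = Cell.mk η') : Cell.mk η.2 = Cell.mk η'.2 := by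
  cases h; rfl

lemma cub_pfst : (cub A B).comp (pfst A B).toPseudofunctor =
    (Bicategory.Prod.fst A B).toPseudofunctor :=
  pseudofunctor_ext_isId
    (fun x => isId₂_of_cell (comp_mapId_strict _ _ _) (IsId₂_fst (cub_mapId_val x)))
    (fun x => isId₂_id _)
    (fun f g => isId₂_of_cell (comp_mapComp_strict _ _ _ _) (IsId₂_fst (cub_mapComp_val f g)))
    (fun f g => isId₂_id _)
    (fun η => cell_fst (cub_val η))

lemma cub_psnd : (cub A B).comp (psnd A B).toPseudofunctor =
    (Bicategory.Prod.snd A B).toPseudofunctor :=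
  pseudofunctor_ext_isId
    (fun x => isId₂_of_cell (comp_mapId_strict _ _ _) (IsId₂_snd (cub_mapId_val x)))
    (fun x => isId₂_id _)
    (fun f g => isId₂_of_cell (comp_mapComp_strict _ _ _ _) (IsId₂_snd (cub_mapComp_val f g)))
    (fun f g => isId₂_id _)
    (fun η => cell_snd (cub_val η))

variable {A' B' : Type u} [Bicategory.{u, u} A'] [Bicategory.{u, u} B'] [Strict A'] [Strict B']

lemma map_pfst (F : StrictPseudofunctor A A') (G : StrictPseudofunctor B B') :
    (map F G).comp (pfst A' B') = (pfst A B).comp F :=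
  strict_cell_ext (fun η => cell_fst (cell_conj _ ((prodFun F G).map₂ η.val) _))

lemma map_psnd (F : StrictPseudofunctor A A') (G : StrictPseudofunctor B B') :
    (map F G).comp (psnd A' B') = (psnd A B).comp G :=
  strict_cell_ext (fun η => cell_snd (cell_conj _ ((prodFun F G).map₂ η.val) _))

lemma swap_pfst : (swap A B).comp (pfst B A) = psnd A B :=
  strict_cell_ext (fun η => cell_fst (cell_conj _ ((Bicategory.Prod.swap A B).map₂ η.val) _))

lemma swap_psnd : (swap A B).comp (psnd B A) = pfst A B :=
  strict_cell_ext (fun η => cell_snd (cell_conj _ ((Bicategory.Prod.swap A B).map₂ η.val) _))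

lemma idCell_word {W D : Type u} [Category.{u} W] [Bicategory.{u, u} D] [Strict D] {P : W ⥤ D}
    {x y : Factor P} {f g : x ⟶ y} (h : f.word = g.word) : idCell f = idCell g := by
  obtain ⟨f⟩ := f
  obtain ⟨g⟩ := g
  cases h
  rfl

lemma comp_idCell {D E : Type u} [Bicategory.{u, u} D] [Bicategory.{u, u} E]
    {S : StrictPseudofunctor X D} {T : StrictPseudofunctor D E} {x y : X} {f : x ⟶ y} {x' y' : D}
    {g : x' ⟶ y'} {x'' y'' : E} {h : x'' ⟶ y''} (hf : idCell (S.map f) = idCell g)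
    (hg : idCell (T.map g) = idCell h) : idCell ((S.comp T).map f) = idCell h :=
  (idCell_map T.toPseudofunctor hf).trans hg

lemma map_left (F : StrictPseudofunctor A A') (G : StrictPseudofunctor B B') {a a' : A}
    (f : a ⟶ a') (b : B) :
    idCell ((map F G).map (left f b)) = idCell (left (F.map f) (G.obj b)) :=
  idCell_word ((mapData F G).functor_left f b)

lemma map_right (F : StrictPseudofunctor A A') (G : StrictPseudofunctor B B') (a : A) {b b' : B}
    (g : b ⟶ b') : idCell ((map F G).map (right a g)) = idCell (right (F.obj a) (G.map g)) :=
  idCell_word ((mapData F G).functor_right a g)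

lemma swap_left {a a' : A} (f : a ⟶ a') (b : B) :
    idCell ((swap A B).map (left f b)) = idCell (right b f) :=
  idCell_word ((swapData A B).functor_left f b)

lemma swap_right (a : A) {b b' : B} (g : b ⟶ b') :
    idCell ((swap A B).map (right a g)) = idCell (left g a) :=
  idCell_word ((swapData A B).functor_right a g)

lemma swap_swap : (swap A B).comp (swap B A) = StrictPseudofunctor.id (Gray A B) := by
  refine ext_gray_strict (idCell_ext
    (fun f b => comp_idCell (swap_left f b) (swap_right b f))
    (fun a _ _ g => comp_idCell (swap_right a g) (swap_left g a))) ?_ ?_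
  · rw [strict_assoc, swap_pfst, swap_psnd]; exact strict_ext rfl
  · rw [strict_assoc, swap_psnd, swap_pfst]; exact strict_ext rfl

lemma map_swap (F : StrictPseudofunctor A A') (G : StrictPseudofunctor B B') :
    (map F G).comp (swap A' B') = (swap A B).comp (map G F) := by
  refine ext_gray_strict (idCell_ext
    (fun f b => (comp_idCell (map_left F G f b) (swap_left _ _)).trans
      (comp_idCell (swap_left f b) (map_right G F b f)).symm)
    (fun a _ _ g => (comp_idCell (map_right F G a g) (swap_right _ _)).trans
      (comp_idCell (swap_right a g) (map_left G F g a)).symm)) ?_ ?_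
  · rw [strict_assoc, strict_assoc, swap_pfst, map_psnd, map_pfst, ← strict_assoc, swap_pfst]
  · rw [strict_assoc, strict_assoc, swap_psnd, map_psnd, map_pfst, ← strict_assoc, swap_psnd]

lemma idCell_map_cub {D : Type u} [Bicategory.{u, u} D] (S : StrictPseudofunctor (Gray A B) D)
    {x y : A × B} (p : x ⟶ y) : idCell (S.map ((cub A B).map p)) =
      idCell (S.map (left p.1 x.2) ≫ S.map (right y.1 p.2)) :=
  congrArg idCell (S.map_comp (left p.1 x.2) (right y.1 p.2))

lemma cub_map (F : StrictPseudofunctor A A') (G : StrictPseudofunctor B B') :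
    (cub A B).comp (map F G).toPseudofunctor =
      (prodMap F.toPseudofunctor G.toPseudofunctor).comp (cub A' B') := by
  refine ext_gray (fun {x y} p => ?_) ?_ ?_
  · exact (idCell_map_cub (map F G) p).trans (idCell_comp (map_left F G _ _) (map_right F G _ _))
  · rw [comp_assoc, comp_assoc, cub_pfst]
    change (cub A B).comp ((map F G).comp (pfst A' B')).toPseudofunctor = _
    rw [map_pfst]
    change (cub A B).comp ((pfst A B).toPseudofunctor.comp F.toPseudofunctor) = _
    rw [← comp_assoc, cub_pfst]
    exact pseudofunctor_ext_cell (fun _ => rfl)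
      (fun x => congrArg Cell.mk ((map₂_id_comp _ _).trans (Category.comp_id _).symm))
      (fun f g => congrArg Cell.mk ((map₂_id_comp _ _).trans (Category.comp_id _).symm))
  · rw [comp_assoc, comp_assoc, cub_psnd]
    change (cub A B).comp ((map F G).comp (psnd A' B')).toPseudofunctor = _
    rw [map_psnd]
    change (cub A B).comp ((psnd A B).toPseudofunctor.comp G.toPseudofunctor) = _
    rw [← comp_assoc, cub_psnd]
    exact pseudofunctor_ext_cell (fun _ => rfl)
      (fun x => congrArg Cell.mk ((map₂_id_comp _ _).trans (Category.comp_id _).symm))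
      (fun f g => congrArg Cell.mk ((map₂_id_comp _ _).trans (Category.comp_id _).symm))

lemma isId₂_pair {x y : A × B} {f g : x ⟶ y} {η : f ⟶ g} (h₁ : IsId₂ η.1) (h₂ : IsId₂ η.2) :
    IsId₂ η := by
  obtain ⟨e₁, h₁⟩ := h₁
  obtain ⟨e₂, h₂⟩ := h₂
  refine ⟨Prod.ext e₁ e₂, Prod.ext ?_ ?_⟩
  · rw [prod_eqToHom₂_fst]; exact h₁
  · rw [prod_eqToHom₂_snd]; exact h₂

lemma sectR_mapComp (a : A) {x y z : B} (f : x ⟶ y) (g : y ⟶ z) :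
    IsId₂ ((Bicategory.Prod.sectR a B).toPseudofunctor.mapComp f g).hom := by
  refine isId₂_pair ?_ (isId₂_id _)
  change IsId₂ (ρ_ (𝟙 a)).inv
  rw [Strict.rightUnitor_eqToIso]
  exact isId₂_eqToHom (Strict.comp_id _).symm

lemma sectL_mapComp (b : B) {x y z : A} (f : x ⟶ y) (g : y ⟶ z) :
    IsId₂ ((Bicategory.Prod.sectL A b).toPseudofunctor.mapComp f g).hom := by
  refine isId₂_pair (isId₂_id _) ?_
  change IsId₂ (λ_ (𝟙 b)).inv
  rw [Strict.leftUnitor_eqToIso]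
  exact isId₂_eqToHom (Strict.id_comp _).symm

lemma cub_inclRight (a : A) :
    (Bicategory.Prod.sectR a B).toPseudofunctor.comp (cub A B) =
      (inclRight a B).toPseudofunctor := by
  refine ext_gray (fun {x y} g => congrArg idCell (cub_map_right a g)) ?_ ?_
  · rw [comp_assoc, cub_pfst]
    refine pseudofunctor_ext_isId (fun x => ?_) (fun x => ?_) (fun f g => ?_) (fun f g => ?_)
      (fun η => (cell_fst (cell_conj _
        ((𝟙 (𝟙 a), η) : ((𝟙 a, _) : (a, _) ⟶ (a, _)) ⟶ (𝟙 a, _)) _)).symm)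
    · exact isId₂_comp_mapId (isId₂_id _) (isId₂_id _)
    · exact isId₂_comp_mapId (strict_mapId (inclRight a B) x) (strict_mapId (pfst A B) _)
    · exact isId₂_comp_mapComp (sectR_mapComp a f g) (isId₂_id _)
    · exact isId₂_comp_mapComp (strict_mapComp (inclRight a B) f g) (strict_mapComp (pfst A B) _ _)
  · rw [comp_assoc, cub_psnd]
    refine pseudofunctor_ext_isId (fun x => ?_) (fun x => ?_) (fun f g => ?_) (fun f g => ?_)
      (fun η => (cell_snd (cell_conj _
        ((𝟙 (𝟙 a), η) : ((𝟙 a, _) : (a, _) ⟶ (a, _)) ⟶ (𝟙 a, _)) _)).symm)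
    · exact isId₂_comp_mapId (isId₂_id _) (isId₂_id _)
    · exact isId₂_comp_mapId (strict_mapId (inclRight a B) x) (strict_mapId (psnd A B) _)
    · exact isId₂_comp_mapComp (sectR_mapComp a f g) (isId₂_id _)
    · exact isId₂_comp_mapComp (strict_mapComp (inclRight a B) f g) (strict_mapComp (psnd A B) _ _)

lemma cub_inclLeft (b : B) :
    (Bicategory.Prod.sectL A b).toPseudofunctor.comp (cub A B) =
      (inclLeft A b).toPseudofunctor := by
  refine ext_gray (fun {x y} f => congrArg idCell (cub_map_left f b)) ?_ ?_
  · rw [comp_assoc, cub_pfst]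
    refine pseudofunctor_ext_isId (fun x => ?_) (fun x => ?_) (fun f g => ?_) (fun f g => ?_)
      (fun η => (cell_fst (cell_conj _ ((η, 𝟙 (𝟙 b)) :
        ((_, 𝟙 b) : (_, b) ⟶ (_, b)) ⟶ (_, 𝟙 b)) _)).symm)
    · exact isId₂_comp_mapId (isId₂_id _) (isId₂_id _)
    · exact isId₂_comp_mapId (strict_mapId (inclLeft A b) x) (strict_mapId (pfst A B) _)
    · exact isId₂_comp_mapComp (sectL_mapComp b f g) (isId₂_id _)
    · exact isId₂_comp_mapComp (strict_mapComp (inclLeft A b) f g) (strict_mapComp (pfst A B) _ _)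
  · rw [comp_assoc, cub_psnd]
    refine pseudofunctor_ext_isId (fun x => ?_) (fun x => ?_) (fun f g => ?_) (fun f g => ?_)
      (fun η => (cell_snd (cell_conj _ ((η, 𝟙 (𝟙 b)) :
        ((_, 𝟙 b) : (_, b) ⟶ (_, b)) ⟶ (_, 𝟙 b)) _)).symm)
    · exact isId₂_comp_mapId (isId₂_id _) (isId₂_id _)
    · exact isId₂_comp_mapId (strict_mapId (inclLeft A b) x) (strict_mapId (psnd A B) _)
    · exact isId₂_comp_mapComp (sectL_mapComp b f g) (isId₂_id _)
    · exact isId₂_comp_mapComp (strict_mapComp (inclLeft A b) f g) (strict_mapComp (psnd A B) _ _)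

lemma prodMap_fst (F : Pseudofunctor A A') (G : Pseudofunctor B B') :
    (prodMap F G).comp (Bicategory.Prod.fst A' B').toPseudofunctor =
      (Bicategory.Prod.fst A B).toPseudofunctor.comp F :=
  pseudofunctor_ext_cell (fun _ => rfl)
    (fun x => congrArg Cell.mk ((Category.comp_id _).trans (map₂_id_comp _ _).symm))
    (fun f g => congrArg Cell.mk ((Category.comp_id _).trans (map₂_id_comp _ _).symm))

lemma prodMap_snd (F : Pseudofunctor A A') (G : Pseudofunctor B B') :
    (prodMap F G).comp (Bicategory.Prod.snd A' B').toPseudofunctor =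
      (Bicategory.Prod.snd A B).toPseudofunctor.comp G :=
  pseudofunctor_ext_cell (fun _ => rfl)
    (fun x => congrArg Cell.mk ((Category.comp_id _).trans (map₂_id_comp _ _).symm))
    (fun f g => congrArg Cell.mk ((Category.comp_id _).trans (map₂_id_comp _ _).symm))

end Projections

end Gray

/-! ### Associativity and symmetry of the Gray tensor product -/

namespace Gray

section Assoc

variable {A B C : Type u} [Bicategory.{u, u} A] [Bicategory.{u, u} B] [Bicategory.{u, u} C]
  [Strict A] [Strict B] [Strict C]

lemma left_congr {a a' a₁ a₁' : A} {f : a ⟶ a'} {f₁ : a₁ ⟶ a₁'} (h : idCell f = idCell f₁) (b : B) :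
    idCell (left f b) = idCell (left f₁ b) := by
  cases h; rfl

lemma right_congr (a : A) {b b' b₁ b₁' : B} {g : b ⟶ b'} {g₁ : b₁ ⟶ b₁'}
    (h : idCell g = idCell g₁) : idCell (right a g) = idCell (right a g₁) := by
  cases h; rfl

lemma assoc_left_left {a a' : A} (f : a ⟶ a') (b : B) (c : C) :
    idCell ((assoc A B C).map (left (left f b) c)) = idCell (left f (pt b c)) :=
  idCell_word (((assocData A B C).functor_left (left f b) c).trans
    ((assocInData A B c).functor_left f b))

lemma assoc_left_right (a : A) {b b' : B} (g : b ⟶ b') (c : C) :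
    idCell ((assoc A B C).map (left (right a g) c)) = idCell (right a (left g c)) :=
  idCell_word (((assocData A B C).functor_left (right a g) c).trans
    ((assocInData A B c).functor_right a g))

lemma assoc_right (a : A) (b : B) {c c' : C} (h : c ⟶ c') :
    idCell ((assoc A B C).map (right (pt a b) h)) = idCell (right a (right b h)) :=
  idCell_word ((assocData A B C).functor_right (pt a b) h)

/-- The class of the 1-cells `(f ⊗ 1) ⊗ 1`, `(1 ⊗ g) ⊗ 1` and `(1 ⊗ 1) ⊗ h`. -/
inductive Basic₃ : ∀ x y : Gray (Gray A B) C, (x ⟶ y) → Prop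
  | fst {a a' : A} (f : a ⟶ a') (b : B) (c : C) :
    Basic₃ (pt (pt a b) c) (pt (pt a' b) c) (left (left f b) c)
  | snd (a : A) {b b' : B} (g : b ⟶ b') (c : C) :
    Basic₃ (pt (pt a b) c) (pt (pt a b') c) (left (right a g) c)
  | trd (a : A) (b : B) {c c' : C} (h : c ⟶ c') :
    Basic₃ (pt (pt a b) c) (pt (pt a b) c') (right (pt a b) h)

lemma gen_basic₃ {x y : Gray (Gray A B) C} (f : x ⟶ y) :
    Gen (Basic₃ (A := A) (B := B) (C := C)) f := by
  induction gen_basic f with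
  | of f hf =>
    cases hf with
    | left f c =>
      induction gen_basic f with
      | of f hf =>
        cases hf with
        | left f b => exact .of _ (.fst f b c)
        | right a g => exact .of _ (.snd a g c)
      | id x =>
        exact (Gen.id (pt x c)).of_eq (Gen.id (pt x c))
          ((Strict.id_comp _).trans (left_id x c).symm)
      | comp f g _ _ hf hg => exact hf.of_eq hg (left_comp f g c).symm
    | right x h => exact .of _ (.trd _ _ h)
  | id x => exact .id x
  | comp f g _ _ hf hg => exact .comp f g hf hg

/-- 2-functors which agree on basic 1-cells agree on 1-cells. -/
lemma idCell_ext₃ {D : Type u} [Bicategory.{u, u} D]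
    {S T : StrictPseudofunctor (Gray (Gray A B) C) D}
    (h₁ : ∀ {a a' : A} (f : a ⟶ a') (b : B) (c : C),
      idCell (S.map (left (left f b) c)) = idCell (T.map (left (left f b) c)))
    (h₂ : ∀ (a : A) {b b' : B} (g : b ⟶ b') (c : C),
      idCell (S.map (left (right a g) c)) = idCell (T.map (left (right a g) c)))
    (h₃ : ∀ (a : A) (b : B) {c c' : C} (h : c ⟶ c'),
      idCell (S.map (right (pt a b) h)) = idCell (T.map (right (pt a b) h)))
    {x y : Gray (Gray A B) C} (f : x ⟶ y) : idCell (S.map f) = idCell (T.map f) := by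
  induction gen_basic₃ f with
  | of f hf =>
    cases hf with
    | fst f b c => exact h₁ f b c
    | snd a g c => exact h₂ a g c
    | trd a b h => exact h₃ a b h
  | id x =>
    obtain ⟨⟨⟨⟨⟨⟨a, b⟩⟩⟩, c⟩⟩⟩ := x
    have h := h₃ a b (𝟙 c)
    rw [right_id] at h
    exact h
  | comp f g _ _ hf hg =>
    rw [S.map_comp, T.map_comp]
    exact idCell_comp hf hg

lemma assoc_val {x y : Gray (Gray A B) C} {f g : x ⟶ y} (η : f ⟶ g) :
    Cell.mk ((assoc A B C).map₂ η).val = Cell.mk (C := A × Gray B C)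
      (src := ((projFst A B C).obj x, (assocSnd A B C).obj x))
      (tgt := ((projFst A B C).obj y, (assocSnd A B C).obj y))
      (dom := ((projFst A B C).map f, (assocSnd A B C).map f))
      (cod := ((projFst A B C).map g, (assocSnd A B C).map g))
      ((projFst A B C).map₂ η, (assocSnd A B C).map₂ η) := cell_conj _ _ _

lemma assoc_pfst : (assoc A B C).comp (pfst A (Gray B C)) = (pfst (Gray A B) C).comp (pfst A B) :=
  strict_cell_ext (fun η => cell_fst (assoc_val η))

lemma assoc_psnd : (assoc A B C).comp (psnd A (Gray B C)) = assocSnd A B C :=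
  strict_cell_ext (fun η => cell_snd (assoc_val η))

lemma assocSnd_pfst : (assocSnd A B C).comp (pfst B C) = (pfst (Gray A B) C).comp (psnd A B) :=
  strict_cell_ext (fun η => cell_fst (cell_conj _ ((projSnd A B C).map₂ η) _))

lemma assocSnd_psnd : (assocSnd A B C).comp (psnd B C) = psnd (Gray A B) C :=
  strict_cell_ext (fun η => cell_snd (cell_conj _ ((projSnd A B C).map₂ η) _))

lemma swapId_left_left {a a' : A} (f : a ⟶ a') (b : B) (c : C) :
    idCell ((map (swap A B) (StrictPseudofunctor.id C)).map (left (left f b) c)) =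
      idCell (left (right b f) c) :=
  (map_left (swap A B) (StrictPseudofunctor.id C) (left f b) c).trans
    (left_congr (swap_left f b) c)

lemma swapId_left_right (a : A) {b b' : B} (g : b ⟶ b') (c : C) :
    idCell ((map (swap A B) (StrictPseudofunctor.id C)).map (left (right a g) c)) =
      idCell (left (left g a) c) :=
  (map_left (swap A B) (StrictPseudofunctor.id C) (right a g) c).trans
    (left_congr (swap_right a g) c)

lemma swapId_right (a : A) (b : B) {c c' : C} (h : c ⟶ c') :
    idCell ((map (swap A B) (StrictPseudofunctor.id C)).map (right (pt a b) h)) =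
      idCell (right (pt b a) h) :=
  map_right (swap A B) (StrictPseudofunctor.id C) (pt a b) h

lemma idSwap_left {a a' : A} (f : a ⟶ a') (b : B) (c : C) :
    idCell ((map (StrictPseudofunctor.id A) (swap B C)).map (left f (pt b c))) =
      idCell (left f (pt c b)) :=
  map_left (StrictPseudofunctor.id A) (swap B C) f (pt b c)

lemma idSwap_right_left (a : A) {b b' : B} (g : b ⟶ b') (c : C) :
    idCell ((map (StrictPseudofunctor.id A) (swap B C)).map (right a (left g c))) =
      idCell (right a (right c g)) :=
  (map_right (StrictPseudofunctor.id A) (swap B C) a (left g c)).trans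
    (right_congr a (swap_left g c))

lemma idSwap_right_right (a : A) (b : B) {c c' : C} (h : c ⟶ c') :
    idCell ((map (StrictPseudofunctor.id A) (swap B C)).map (right a (right b h))) =
      idCell (right a (left h b)) :=
  (map_right (StrictPseudofunctor.id A) (swap B C) a (right b h)).trans
    (right_congr a (swap_right b h))

lemma swap_hexagon_map {x y : Gray (Gray A B) C} (f : x ⟶ y) :
    idCell ((((map (swap A B) (StrictPseudofunctor.id C)).comp (assoc B A C)).comp
      (map (StrictPseudofunctor.id B) (swap A C))).map f) =
    idCell (((assoc A B C).comp ((swap A (Gray B C)).comp (assoc B C A))).map f) := by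
  refine idCell_ext₃ (fun f b c => ?_) (fun a _ _ g c => ?_) (fun a b _ _ h => ?_) f
  · exact (comp_idCell (comp_idCell (swapId_left_left f b c) (assoc_left_right b f c))
      (idSwap_right_left b f c)).trans
      (comp_idCell (assoc_left_left f b c)
        (comp_idCell (swap_left f (pt b c)) (assoc_right b c f))).symm
  · exact (comp_idCell (comp_idCell (swapId_left_right a g c) (assoc_left_left g a c))
      (idSwap_left g a c)).trans
      (comp_idCell (assoc_left_right a g c)
        (comp_idCell (swap_right a (left g c)) (assoc_left_left g c a))).symm
  · exact (comp_idCell (comp_idCell (swapId_right a b h) (assoc_right b a h))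
      (idSwap_right_right b a h)).trans
      (comp_idCell (assoc_right a b h)
        (comp_idCell (swap_right a (right b h)) (assoc_left_right b h a))).symm

/-- The compatibility of the symmetry of the Gray tensor product with its associativity. -/
lemma swap_hexagon : ((map (swap A B) (StrictPseudofunctor.id C)).comp (assoc B A C)).comp
      (map (StrictPseudofunctor.id B) (swap A C)) =
    (assoc A B C).comp ((swap A (Gray B C)).comp (assoc B C A)) := by
  have e₁ : (map (swap A B) (StrictPseudofunctor.id C)).comp ((assocSnd B A C).comp (swap A C)) =
      (assoc A B C).comp ((swap A (Gray B C)).comp (assocSnd B C A)) := by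
    refine ext_gray_strict (fun f => ?_) ?_ ?_
    · have h₁ : (((map (swap A B) (StrictPseudofunctor.id C)).comp (assoc B A C)).comp
          (map (StrictPseudofunctor.id B) (swap A C))).comp (psnd B (Gray C A)) =
          (map (swap A B) (StrictPseudofunctor.id C)).comp ((assocSnd B A C).comp (swap A C)) := by
        rw [strict_assoc, strict_assoc, map_psnd, ← strict_assoc (assoc B A C), assoc_psnd]
      have h₂ : ((assoc A B C).comp ((swap A (Gray B C)).comp (assoc B C A))).comp
          (psnd B (Gray C A)) =
          (assoc A B C).comp ((swap A (Gray B C)).comp (assocSnd B C A)) := by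
        rw [strict_assoc, strict_assoc, assoc_psnd]
      rw [← h₁, ← h₂]
      exact idCell_map (psnd B (Gray C A)).toPseudofunctor (swap_hexagon_map f)
    · rw [strict_assoc, strict_assoc, strict_assoc, strict_assoc, assocSnd_pfst, swap_pfst,
        assocSnd_psnd, map_psnd, ← strict_assoc (swap _ _), swap_pfst, ← strict_assoc (assoc A B C),
        assoc_psnd, assocSnd_psnd]
      exact strict_ext rfl
    · rw [strict_assoc, strict_assoc, strict_assoc, strict_assoc, assocSnd_psnd, swap_psnd,
        assocSnd_pfst, swap_psnd, assoc_pfst, ← strict_assoc, map_pfst, strict_assoc, swap_psnd]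
  refine ext_gray_strict swap_hexagon_map ?_ ?_
  · rw [strict_assoc, strict_assoc, strict_assoc, strict_assoc, map_pfst, assoc_pfst,
      ← strict_assoc (swap _ _), swap_pfst, ← strict_assoc (assoc A B C), assoc_psnd, assocSnd_pfst,
      ← strict_assoc (assoc B A C), assoc_pfst, ← strict_assoc, ← strict_assoc, map_pfst,
      strict_assoc (pfst _ _), swap_pfst]
    exact strict_ext rfl
  · rw [strict_assoc, strict_assoc, map_psnd, ← strict_assoc (assoc B A C), assoc_psnd, e₁,
      strict_assoc, strict_assoc, assoc_psnd]

variable (A B C) in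
/-- The canonical pseudofunctor from the cartesian product of three 2-categories. -/
def cub₃ : Pseudofunctor ((A × B) × C) (Gray (Gray A B) C) :=
  (prodMap (cub A B) (Pseudofunctor.id C)).comp (cub (Gray A B) C)

lemma cub₃_pfst : (cub₃ A B C).comp (pfst (Gray A B) C).toPseudofunctor =
    (Bicategory.Prod.fst (A × B) C).toPseudofunctor.comp (cub A B) := by
  rw [cub₃, comp_assoc, cub_pfst, prodMap_fst]

lemma cub₃_psnd : (cub₃ A B C).comp (psnd (Gray A B) C).toPseudofunctor =
    (Bicategory.Prod.snd (A × B) C).toPseudofunctor := by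
  rw [cub₃, comp_assoc, cub_psnd, prodMap_snd, comp_id]

lemma idCell_cub₃ {D : Type u} [Bicategory.{u, u} D] (S : StrictPseudofunctor (Gray (Gray A B) C) D)
    {x y : (A × B) × C} (p : x ⟶ y) : idCell (S.map ((cub₃ A B C).map p)) =
      idCell ((S.map (left (left p.1.1 x.1.2) x.2) ≫ S.map (left (right y.1.1 p.1.2) x.2)) ≫
        S.map (right (pt y.1.1 y.1.2) p.2)) :=
  (idCell_map_cub S (x := (pt x.1.1 x.1.2, x.2)) (y := (pt y.1.1 y.1.2, y.2))
    ((cub A B).map p.1, p.2)).trans (idCell_comp ((idCell_map S.toPseudofunctor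
      (congrArg idCell (left_comp (left p.1.1 x.1.2) (right y.1.1 p.1.2) x.2))).trans
        (congrArg idCell (S.map_comp _ _))) rfl)

lemma cub₃_assoc : (cub₃ A B C).comp (assoc A B C).toPseudofunctor =
    (prodAssoc A B C).toPseudofunctor.comp
      ((prodMap (Pseudofunctor.id A) (cub B C)).comp (cub A (Gray B C))) := by
  have hm : ∀ {x y : (A × B) × C} (p : x ⟶ y),
      idCell (((cub₃ A B C).comp (assoc A B C).toPseudofunctor).map p) =
        idCell (((prodAssoc A B C).toPseudofunctor.comp
      ((prodMap (Pseudofunctor.id A) (cub B C)).comp (cub A (Gray B C)))).map p) := by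
    intro x y p
    refine (idCell_cub₃ (assoc A B C) p).trans ((idCell_comp (idCell_comp (assoc_left_left _ _ _)
      (assoc_left_right _ _ _)) (assoc_right _ _ _)).trans ?_)
    refine Eq.trans (congrArg idCell (Strict.assoc _ _ _)) ?_
    exact idCell_comp rfl (congrArg idCell (right_comp _ _ _).symm)
  have e : ((cub₃ A B C).comp (assoc A B C).toPseudofunctor).comp
      (psnd A (Gray B C)).toPseudofunctor = (cub₃ A B C).comp (assocSnd A B C).toPseudofunctor :=
    (comp_assoc _ _ _).trans (congrArg (fun t => (cub₃ A B C).comp t.toPseudofunctor) assoc_psnd)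
  have e' : ((prodAssoc A B C).toPseudofunctor.comp
      ((prodMap (Pseudofunctor.id A) (cub B C)).comp (cub A (Gray B C)))).comp
      (psnd A (Gray B C)).toPseudofunctor = (prodAssoc A B C).toPseudofunctor.comp
        ((Bicategory.Prod.snd A (B × C)).toPseudofunctor.comp (cub B C)) := by
    rw [comp_assoc, comp_assoc, cub_psnd, prodMap_snd]
  refine ext_gray hm ?_ (ext_gray
    (fun f => idCell_map (psnd A (Gray B C)).toPseudofunctor (hm f)) ?_ ?_)
  · rw [comp_assoc, comp_assoc, comp_assoc]
    change (cub₃ A B C).comp ((assoc A B C).comp (pfst A (Gray B C))).toPseudofunctor = _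
    rw [assoc_pfst, cub_pfst, prodMap_fst, comp_id]
    change (cub₃ A B C).comp ((pfst (Gray A B) C).toPseudofunctor.comp
      (pfst A B).toPseudofunctor) = _
    rw [← comp_assoc, cub₃_pfst, comp_assoc, cub_pfst]
    exact pseudofunctor_ext_isId
      (fun _ => isId₂_comp_mapId (isId₂_id _) (isId₂_id _))
      (fun _ => isId₂_comp_mapId (isId₂_id _) (isId₂_id _))
      (fun _ _ => isId₂_comp_mapComp (isId₂_id _) (isId₂_id _))
      (fun _ _ => isId₂_comp_mapComp (isId₂_id _) (isId₂_id _)) (fun _ => rfl)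
  · rw [e, e', comp_assoc, comp_assoc, comp_assoc, cub_pfst]
    change (cub₃ A B C).comp ((assocSnd A B C).comp (pfst B C)).toPseudofunctor = _
    rw [assocSnd_pfst]
    change (cub₃ A B C).comp ((pfst (Gray A B) C).toPseudofunctor.comp
      (psnd A B).toPseudofunctor) = _
    rw [← comp_assoc, cub₃_pfst, comp_assoc, cub_psnd]
    exact pseudofunctor_ext_isId
      (fun _ => isId₂_comp_mapId (isId₂_id _) (isId₂_id _))
      (fun _ => isId₂_comp_mapId (isId₂_id _) (isId₂_comp_mapId (isId₂_id _) (isId₂_id _)))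
      (fun _ _ => isId₂_comp_mapComp (isId₂_id _) (isId₂_id _))
      (fun _ _ => isId₂_comp_mapComp (isId₂_id _) (isId₂_comp_mapComp (isId₂_id _) (isId₂_id _)))
      (fun _ => rfl)
  · rw [e, e', comp_assoc, comp_assoc, comp_assoc, cub_psnd]
    change (cub₃ A B C).comp ((assocSnd A B C).comp (psnd B C)).toPseudofunctor = _
    rw [assocSnd_psnd, cub₃_psnd]
    exact pseudofunctor_ext_isId
      (fun _ => isId₂_id _)
      (fun _ => isId₂_comp_mapId (isId₂_id _) (isId₂_comp_mapId (isId₂_id _) (isId₂_id _)))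
      (fun _ _ => isId₂_id _)
      (fun _ _ => isId₂_comp_mapComp (isId₂_id _) (isId₂_comp_mapComp (isId₂_id _) (isId₂_id _)))
      (fun _ => rfl)

end Assoc

end Gray

/-! ### 2-functors determined by a locally full pseudofunctor -/

section Agree

variable {X D : Type u} [Bicategory.{u, u} X] [Bicategory.{u, u} D] {T T' : StrictPseudofunctor X D}

lemma map_comp_agree {a b : X} {f g h : a ⟶ b} {η : f ⟶ g} {θ : g ⟶ h}
    (hη : Cell.mk (T.map₂ η) = Cell.mk (T'.map₂ η))
    (hθ : Cell.mk (T.map₂ θ) = Cell.mk (T'.map₂ θ)) :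
    Cell.mk (T.map₂ (η ≫ θ)) = Cell.mk (T'.map₂ (η ≫ θ)) := by
  rw [T.map₂_comp, T'.map₂_comp]
  exact cell_comp hη hθ

lemma map_inv_agree {a b : X} {f g : a ⟶ b} {η : f ≅ g}
    (hη : Cell.mk (T.map₂ η.hom) = Cell.mk (T'.map₂ η.hom)) :
    Cell.mk (T.map₂ η.inv) = Cell.mk (T'.map₂ η.inv) :=
  cell_inv (η := T.map₂Iso η) (η' := T'.map₂Iso η) hη

variable [Strict X] [Strict D]

/-- The horizontal composite of 2-cells on which two 2-functors agree. -/
lemma map_hcomp_agree {a b c : X} {f f' : a ⟶ b} {g g' : b ⟶ c} {η : f ⟶ f'} {θ : g ⟶ g'}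
    (hη : Cell.mk (T.map₂ η) = Cell.mk (T'.map₂ η))
    (hθ : Cell.mk (T.map₂ θ) = Cell.mk (T'.map₂ θ)) :
    Cell.mk (T.map₂ (η ▷ g ≫ f' ◁ θ)) = Cell.mk (T'.map₂ (η ▷ g ≫ f' ◁ θ)) := by
  refine map_comp_agree ?_ ?_
  · rw [strict_right, strict_right, cell_conj, cell_conj]
    exact cell_whiskerRight hη (idCell_of_cell_dom hθ)
  · rw [strict_left, strict_left, cell_conj, cell_conj]
    exact cell_whiskerLeft (idCell_of_cell_cod hη) hθ

lemma eq_conj_iso {a b : X} {f g f' g' : a ⟶ b} (c : f ≅ f') (d : g ≅ g') {η : f ⟶ g}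
    {θ : f' ⟶ g'} (h : θ = c.inv ≫ η ≫ d.hom) : η = c.hom ≫ θ ≫ d.inv := by
  simp [h]

/-- Let `J` be a locally full pseudofunctor which is bijective on objects and whose image contains
generating 1-cells. Then every 2-cell is obtained from 2-cells in the image of `J` and from the
comparison 2-cells of `J` by composition and inversion. -/
lemma cell_induction {Z : Type u} [Bicategory.{u, u} Z] {J : Pseudofunctor Z X}
    (hi : Function.Injective J.obj) (hs : Function.Surjective J.obj)
    (hf : ∀ {x y : Z} {p q : x ⟶ y} (η : J.map p ⟶ J.map q), ∃ θ, J.map₂ θ = η)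
    {S : ∀ x y : X, (x ⟶ y) → Prop} (hS : ∀ {x y : X} (f : x ⟶ y), Gen S f)
    (hb : ∀ {x y : Z} (f : J.obj x ⟶ J.obj y), S _ _ f → ∃ p, f = J.map p)
    (N : ∀ {a b : X} {f g : a ⟶ b}, (f ⟶ g) → Prop)
    (comp : ∀ {a b : X} {f g h : a ⟶ b} (η : f ⟶ g) (θ : g ⟶ h), N η → N θ → N (η ≫ θ))
    (inv : ∀ {a b : X} {f g : a ⟶ b} (η : f ≅ g), N η.hom → N η.inv)
    (hcomp : ∀ {a b c : X} {f f' : a ⟶ b} {g g' : b ⟶ c} (η : f ⟶ f') (θ : g ⟶ g'), N η → N θ →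
      N (η ▷ g ≫ f' ◁ θ))
    (map₂ : ∀ {x y : Z} {p q : x ⟶ y} (θ : p ⟶ q), N (J.map₂ θ))
    (mapId : ∀ x : Z, N (J.mapId x).hom)
    (mapComp : ∀ {x y z : Z} (p : x ⟶ y) (q : y ⟶ z), N (J.mapComp p q).hom)
    {a b : X} {f g : a ⟶ b} (η : f ⟶ g) : N η := by
  -- Every 1-cell is isomorphic to a value of `J`, by a 2-cell with the property.
  have key : ∀ {a b : X} (f : a ⟶ b) (x y : Z) (hx : J.obj x = a) (hy : J.obj y = b)
      (f' : J.obj x ⟶ J.obj y), HEq f f' → ∃ (p : x ⟶ y) (c : f' ≅ J.map p), N c.hom := by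
    intro a b f
    induction hS f with
    | of f hf =>
      rintro x y rfl rfl _ ⟨⟩
      obtain ⟨p, rfl⟩ := hb f hf
      exact ⟨p, Iso.refl _, by simpa using map₂ (𝟙 p)⟩
    | id a =>
      rintro x y rfl hy f' hf'
      cases hi hy
      cases hf'
      exact ⟨𝟙 _, (J.mapId x).symm, inv _ (mapId x)⟩
    | @comp a b c f g _ _ hf hg =>
      rintro x y rfl rfl _ ⟨⟩
      obtain ⟨z, rfl⟩ := hs b
      obtain ⟨p, c, hc⟩ := hf _ _ rfl rfl _ HEq.rfl
      obtain ⟨q, d, hd⟩ := hg _ _ rfl rfl _ HEq.rfl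
      exact ⟨p ≫ q, (whiskerRightIso c g ≪≫ whiskerLeftIso (J.map p) d) ≪≫ (J.mapComp p q).symm,
        comp _ _ (hcomp _ _ hc hd) (inv _ (mapComp p q))⟩
  obtain ⟨x, rfl⟩ := hs a
  obtain ⟨y, rfl⟩ := hs b
  obtain ⟨p, c, hc⟩ := key f _ _ rfl rfl _ HEq.rfl
  obtain ⟨q, d, hd⟩ := key g _ _ rfl rfl _ HEq.rfl
  obtain ⟨θ, hθ⟩ := hf (c.inv ≫ η ≫ d.hom)
  rw [eq_conj_iso c d hθ]
  exact comp _ _ hc (comp _ _ (map₂ θ) (inv _ hd))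

/-- A locally full pseudofunctor which is bijective on objects, and whose image contains generating
1-cells, is an epimorphism for 2-functors. -/
lemma strict_ext_of_full {Z : Type u} [Bicategory.{u, u} Z] {J : Pseudofunctor Z X}
    (hi : Function.Injective J.obj) (hs : Function.Surjective J.obj)
    (hf : ∀ {x y : Z} {p q : x ⟶ y} (η : J.map p ⟶ J.map q), ∃ θ, J.map₂ θ = η)
    {S : ∀ x y : X, (x ⟶ y) → Prop} (hS : ∀ {x y : X} (f : x ⟶ y), Gen S f)
    (hb : ∀ {x y : Z} (f : J.obj x ⟶ J.obj y), S _ _ f → ∃ p, f = J.map p)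
    (h : J.comp T.toPseudofunctor = J.comp T'.toPseudofunctor) : T = T' :=
  Gray.strict_cell_ext (cell_induction hi hs hf hS hb
    (fun η => Cell.mk (T.map₂ η) = Cell.mk (T'.map₂ η))
    (fun _ _ => map_comp_agree) (fun _ => map_inv_agree) (fun _ _ => map_hcomp_agree)
    (fun θ => cell_of_eq h θ)
    (fun x => (comp_mapId_strict J T x).symm.trans
        ((mapId_cell_of_eq h x).trans (comp_mapId_strict J T' x)))
    (fun p q => (comp_mapComp_strict J T p q).symm.trans
        ((mapComp_cell_of_eq h p q).trans (comp_mapComp_strict J T' p q))))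

end Agree

/-! ### The triple Gray tensor product and the cartesian product -/

namespace Gray

section Triple

variable {A B C : Type u} [Bicategory.{u, u} A] [Bicategory.{u, u} B] [Bicategory.{u, u} C]
  [Strict A] [Strict B] [Strict C]

variable (A B C) in
/-- The canonical 2-functor from the Gray tensor product of three 2-categories to the cartesian
product. -/
def proj₃ : StrictPseudofunctor (Gray (Gray A B) C) ((A × B) × C) :=
  (Factor.proj (wordsProj (Gray A B) C)).comp
    (prodFun (Factor.proj (wordsProj A B)) (StrictPseudofunctor.id C))

lemma proj₃_faithful {x y : Gray (Gray A B) C} {f g : x ⟶ y} {η θ : f ⟶ g}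
    (h : (proj₃ A B C).map₂ η = (proj₃ A B C).map₂ θ) : η = θ :=
  Factor.hom_ext (Prod.ext (Factor.hom_ext (congrArg (fun t => t.1) h))
    (congrArg (fun t => t.2) h))

lemma cub_proj : (cub A B).comp (Factor.proj (wordsProj A B)).toPseudofunctor =
    Pseudofunctor.id (A × B) :=
  pseudofunctor_ext_isId
    (fun x => isId₂_of_cell (comp_mapId_strict _ _ _) (cub_mapId_val x))
    (fun x => isId₂_id _)
    (fun f g => isId₂_of_cell (comp_mapComp_strict _ _ _ _) (cub_mapComp_val f g))
    (fun f g => isId₂_id _)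
    (fun η => cub_val η)

lemma prodFun_eq {A' B' : Type u} [Bicategory.{u, u} A'] [Bicategory.{u, u} B'] [Strict A']
    [Strict B'] (F : StrictPseudofunctor A A') (G : StrictPseudofunctor B B') :
    (prodFun F G).toPseudofunctor = prodMap F.toPseudofunctor G.toPseudofunctor :=
  pseudofunctor_ext_isId (strict_mapId _)
    (fun x => isId₂_pair (strict_mapId F _) (strict_mapId G _)) (strict_mapComp _)
    (fun f g => isId₂_pair (strict_mapComp F _ _) (strict_mapComp G _ _)) (fun _ => rfl)

lemma cub₃_proj₃ : (cub₃ A B C).comp (proj₃ A B C).toPseudofunctor =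
    Pseudofunctor.id ((A × B) × C) := by
  change (cub₃ A B C).comp ((Factor.proj (wordsProj (Gray A B) C)).toPseudofunctor.comp
    (prodFun (Factor.proj (wordsProj A B)) (StrictPseudofunctor.id C)).toPseudofunctor) = _
  rw [cub₃, ← comp_assoc, comp_assoc (prodMap _ _), cub_proj, comp_id, prodFun_eq, ← prodMap_comp,
    cub_proj]
  exact (congrArg (fun t => prodMap (Pseudofunctor.id (A × B)) t) (comp_id _)).trans prodMap_id

/-- The canonical pseudofunctor is locally full. -/
lemma cub₃_full {x y : (A × B) × C} {p q : x ⟶ y}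
    (η : (cub₃ A B C).map p ⟶ (cub₃ A B C).map q) : ∃ θ : p ⟶ q, (cub₃ A B C).map₂ θ = η := by
  have hp : ∀ r : x ⟶ y, (proj₃ A B C).map ((cub₃ A B C).map r) = r := fun r =>
    eq_of_idCell (idCell_of_eq cub₃_proj₃ r)
  refine ⟨eqToHom (hp p).symm ≫ (proj₃ A B C).map₂ η ≫ eqToHom (hp q), proj₃_faithful ?_⟩
  exact eq_of_cell ((cell_of_eq cub₃_proj₃ _).trans (cell_conj _ _ _))

variable {D : Type u} [Bicategory.{u, u} D] [Strict D]

lemma cub₃_basic {x y : Gray (Gray A B) C} {f : x ⟶ y} (h : Basic₃ x y f) :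
    ∃ p : (proj₃ A B C).obj x ⟶ (proj₃ A B C).obj y, f = (cub₃ A B C).map p := by
  cases h with
  | fst f b c =>
    refine ⟨((f, 𝟙 b), 𝟙 c), ?_⟩
    exact (congrArg (fun t => left t c) (cub_map_left f b).symm).trans
      (cub_map_left ((cub A B).map ((f, 𝟙 b) : (_, b) ⟶ (_, b))) c).symm
  | snd a g c =>
    refine ⟨((𝟙 a, g), 𝟙 c), ?_⟩
    exact (congrArg (fun t => left t c) (cub_map_right a g).symm).trans
      (cub_map_left ((cub A B).map ((𝟙 a, g) : (a, _) ⟶ (a, _))) c).symm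
  | trd a b h =>
    refine ⟨((𝟙 a, 𝟙 b), h), ?_⟩
    have e : (cub A B).map (𝟙 (a, b)) = 𝟙 (pt a b) := (cub_map_left (𝟙 a) b).trans (left_id a b)
    exact (cub_map_right (pt a b) h).symm.trans
      (congrArg (fun t => (cub (Gray A B) C).map ((t, h) : (pt a b, _) ⟶ (pt a b, _))) e.symm)

/-- 2-functors on a triple Gray tensor product are determined by their composites with the
canonical pseudofunctor from the cartesian product. -/
lemma cub₃_injective {T T' : StrictPseudofunctor (Gray (Gray A B) C) D}
    (h : (cub₃ A B C).comp T.toPseudofunctor = (cub₃ A B C).comp T'.toPseudofunctor) : T = T' := by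
  refine strict_ext_of_full (fun x y e => ?_) (fun x => ⟨(proj₃ A B C).obj x, rfl⟩) cub₃_full
    gen_basic₃ (fun f hf => cub₃_basic hf) h
  exact congrArg (proj₃ A B C).obj e

end Triple

end Gray

/-! ### Gray-monoids and their cubical form -/

section Monoid

variable {C : Type u} [Bicategory.{u, u} C] [Strict C]

/-- Restriction along the canonical pseudofunctor from the cartesian product identifies the two
meanings of `(x + y) + z`. -/
lemma sumL_cub (T : StrictPseudofunctor (Gray C C) C) :
    (prodMap ((Gray.cub C C).comp T.toPseudofunctor) (Pseudofunctor.id C)).comp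
      ((Gray.cub C C).comp T.toPseudofunctor) =
    (Gray.cub₃ C C C).comp ((Gray.map T (StrictPseudofunctor.id C)).comp T).toPseudofunctor := by
  have e : prodMap ((Gray.cub C C).comp T.toPseudofunctor) (Pseudofunctor.id C) =
      (prodMap (Gray.cub C C) (Pseudofunctor.id C)).comp
        (prodMap T.toPseudofunctor (Pseudofunctor.id C)) :=
    (congrArg (prodMap ((Gray.cub C C).comp T.toPseudofunctor)) (comp_id _).symm).trans
      (prodMap_comp _ _ _ _)
  have e' := Gray.cub_map T (StrictPseudofunctor.id C)
  change _ = (Gray.cub₃ C C C).comp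
    ((Gray.map T (StrictPseudofunctor.id C)).toPseudofunctor.comp T.toPseudofunctor)
  rw [e, comp_assoc, Gray.cub₃, comp_assoc (prodMap (Gray.cub C C) (Pseudofunctor.id C))]
  exact congrArg (fun t => (prodMap (Gray.cub C C) (Pseudofunctor.id C)).comp t)
    ((comp_assoc _ _ _).symm.trans
      ((congrArg (fun t => t.comp T.toPseudofunctor) e'.symm).trans (comp_assoc _ _ _)))

/-- Restriction along the canonical pseudofunctor from the cartesian product identifies the two
meanings of `x + (y + z)`. -/
lemma sumR_cub (T : StrictPseudofunctor (Gray C C) C) :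
    (prodAssoc C C C).toPseudofunctor.comp
      ((prodMap (Pseudofunctor.id C) ((Gray.cub C C).comp T.toPseudofunctor)).comp
        ((Gray.cub C C).comp T.toPseudofunctor)) =
    (Gray.cub₃ C C C).comp ((Gray.assoc C C C).comp
      ((Gray.map (StrictPseudofunctor.id C) T).comp T)).toPseudofunctor := by
  have e : prodMap (Pseudofunctor.id C) ((Gray.cub C C).comp T.toPseudofunctor) =
      (prodMap (Pseudofunctor.id C) (Gray.cub C C)).comp
        (prodMap (Pseudofunctor.id C) T.toPseudofunctor) :=
    (congrArg (fun t => prodMap t ((Gray.cub C C).comp T.toPseudofunctor)) (comp_id _).symm).trans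
      (prodMap_comp _ _ _ _)
  have e' := Gray.cub_map (StrictPseudofunctor.id C) T
  change _ = (Gray.cub₃ C C C).comp
    ((Gray.assoc C C C).toPseudofunctor.comp
      ((Gray.map (StrictPseudofunctor.id C) T).toPseudofunctor.comp T.toPseudofunctor))
  rw [← comp_assoc (Gray.cub₃ C C C), Gray.cub₃_assoc, e, comp_assoc, comp_assoc, comp_assoc,
    ← comp_assoc _ (Gray.cub C C)]
  exact congrArg (fun t => (prodAssoc C C C).toPseudofunctor.comp
    ((prodMap (Pseudofunctor.id C) (Gray.cub C C)).comp t))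
    ((congrArg (fun t => t.comp T.toPseudofunctor) e'.symm).trans (comp_assoc _ _ _))

lemma unit_cub (T : StrictPseudofunctor (Gray C C) C) (e : C) :
    (Bicategory.Prod.sectR e C).toPseudofunctor.comp ((Gray.cub C C).comp T.toPseudofunctor) =
      ((Gray.inclRight e C).comp T).toPseudofunctor := by
  rw [← comp_assoc, Gray.cub_inclRight]
  rfl

lemma cub_unit (T : StrictPseudofunctor (Gray C C) C) (e : C) :
    (Bicategory.Prod.sectL C e).toPseudofunctor.comp ((Gray.cub C C).comp T.toPseudofunctor) =
      ((Gray.inclLeft C e).comp T).toPseudofunctor := by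
  rw [← comp_assoc, Gray.cub_inclLeft]
  rfl

/-- The cubical form of a Gray-monoid. -/
def GrayMonoid.cubical (M : GrayMonoid C) : CubicalMonoid C where
  sum := (Gray.cub C C).comp M.sum.toPseudofunctor
  cubical := Gray.cub_comp_isCubical M.sum
  unit := M.unit
  assoc := (sumL_cub M.sum).trans ((congrArg (fun t => (Gray.cub₃ C C C).comp
    t.toPseudofunctor) M.assoc).trans (sumR_cub M.sum).symm)
  unit_sum := (unit_cub M.sum M.unit).trans (congrArg (fun t => t.toPseudofunctor) M.unit_sum)
  sum_unit := (cub_unit M.sum M.unit).trans (congrArg (fun t => t.toPseudofunctor) M.sum_unit)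

/-- The Gray-monoid with the given cubical form. -/
def CubicalMonoid.gray (M : CubicalMonoid C) : GrayMonoid C where
  sum := Gray.lift M.cubical
  unit := M.unit
  assoc := by
    have h := Gray.cub_lift M.cubical
    refine Gray.cub₃_injective ((sumL_cub _).symm.trans (Eq.trans ?_ (sumR_cub _)))
    rw [h]
    exact M.assoc
  unit_sum := toPseudofunctor_injective ((unit_cub _ _).symm.trans (by
    rw [Gray.cub_lift]
    exact M.unit_sum))
  sum_unit := toPseudofunctor_injective ((cub_unit _ _).symm.trans (by
    rw [Gray.cub_lift]
    exact M.sum_unit))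

lemma CubicalMonoid.ext_sum {M N : CubicalMonoid C} (h : M.sum = N.sum) (h' : M.unit = N.unit) :
    M = N := by
  obtain ⟨s, _, e, _, _, _⟩ := M
  obtain ⟨s', _, e', _, _, _⟩ := N
  cases h
  cases h'
  rfl

lemma GrayMonoid.ext_sum {M N : GrayMonoid C} (h : M.sum = N.sum) (h' : M.unit = N.unit) :
    M = N := by
  obtain ⟨s, e, _, _, _⟩ := M
  obtain ⟨s', e', _, _, _⟩ := N
  cases h
  cases h'
  rfl

lemma CubicalMonoid.gray_cubical (M : CubicalMonoid C) : M.gray.cubical = M :=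
  CubicalMonoid.ext_sum (Gray.cub_lift M.cubical) rfl

lemma GrayMonoid.cubical_gray (M : GrayMonoid C) : M.cubical.gray = M :=
  GrayMonoid.ext_sum (Gray.eq_lift _ M.sum rfl).symm rfl

end Monoid

/-! ### Transformations with identity components -/

section Icon

open scoped Pseudofunctor.StrongTrans

lemma cell_comp_isId {C : Type u} [Bicategory.{u, u} C] {a b : C} {f g h : a ⟶ b} (η : f ⟶ g)
    {θ : g ⟶ h} (hθ : IsId₂ θ) : Cell.mk (η ≫ θ) = Cell.mk η := by
  obtain ⟨e, rfl⟩ := hθ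
  exact cell_comp_eqToHom η e

lemma cell_isId_comp {C : Type u} [Bicategory.{u, u} C] {a b : C} {f g h : a ⟶ b} {η : f ⟶ g}
    (hη : IsId₂ η) (θ : g ⟶ h) : Cell.mk (η ≫ θ) = Cell.mk θ := by
  obtain ⟨e, rfl⟩ := hη
  exact cell_eqToHom_comp e θ

lemma idCell_comp_id {C : Type u} [Bicategory.{u, u} C] [Strict C] {a b c : C} {f : a ⟶ b}
    {g : b ⟶ c} (h : idCell g = idCell (𝟙 b)) : idCell (f ≫ g) = idCell f := by
  cases h
  exact congrArg idCell (Strict.comp_id f)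

lemma idCell_id_comp {C : Type u} [Bicategory.{u, u} C] [Strict C] {a b c : C} {f : a ⟶ b}
    {g : b ⟶ c} (h : idCell f = idCell (𝟙 a)) : idCell (f ≫ g) = idCell g := by
  cases h
  exact congrArg idCell (Strict.id_comp g)

lemma cell_whiskerRight_id {C : Type u} [Bicategory.{u, u} C] [Strict C] {a b c : C} {f g : a ⟶ b}
    {i : b ⟶ c} (h : idCell i = idCell (𝟙 b)) (η : f ⟶ g) : Cell.mk (η ▷ i) = Cell.mk η := by
  cases h
  exact whiskerRight_id_cell η

lemma cell_id_whiskerLeft {C : Type u} [Bicategory.{u, u} C] [Strict C] {a b c : C} {f g : b ⟶ c}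
    {i : a ⟶ b} (h : idCell i = idCell (𝟙 a)) (η : f ⟶ g) : Cell.mk (i ◁ η) = Cell.mk η := by
  cases h
  exact id_whiskerLeft_cell η

lemma cell_strict_right {C D : Type u} [Bicategory.{u, u} C] [Strict C] [Bicategory.{u, u} D]
    (S : StrictPseudofunctor C D) {a b c : C} {f f' : a ⟶ b} (η : f ⟶ f') (g : b ⟶ c) :
    Cell.mk (S.map₂ (η ▷ g)) = Cell.mk (S.map₂ η ▷ S.map g) := by
  rw [strict_right, cell_conj]

lemma cell_strict_left {C D : Type u} [Bicategory.{u, u} C] [Strict C] [Bicategory.{u, u} D]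
    (S : StrictPseudofunctor C D) {a b c : C} (f : a ⟶ b) {g g' : b ⟶ c} (η : g ⟶ g') :
    Cell.mk (S.map₂ (f ◁ η)) = Cell.mk (S.map f ◁ S.map₂ η) := by
  rw [strict_left, cell_conj]

lemma isId₂_strict_right {C D : Type u} [Bicategory.{u, u} C] [Strict C] [Bicategory.{u, u} D]
    (S : StrictPseudofunctor C D) {a b c : C} {f f' : a ⟶ b} (η : f ⟶ f') (g : b ⟶ c)
    (h : IsId₂ (S.map₂ η)) : IsId₂ (S.map₂ (η ▷ g)) := by
  rw [strict_right]
  exact (isId₂_eqToHom _).comp ((h.whiskerRight _).comp (isId₂_eqToHom _))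

lemma isId₂_strict_left {C D : Type u} [Bicategory.{u, u} C] [Strict C] [Bicategory.{u, u} D]
    (S : StrictPseudofunctor C D) {a b c : C} (f : a ⟶ b) {g g' : b ⟶ c} (η : g ⟶ g')
    (h : IsId₂ (S.map₂ η)) : IsId₂ (S.map₂ (f ◁ η)) := by
  rw [strict_left]
  exact (isId₂_eqToHom _).comp ((h.whiskerLeft _).comp (isId₂_eqToHom _))

variable {X D : Type u} [Bicategory.{u, u} X] [Bicategory.{u, u} D] [Strict D]
  {W : Type u} [Category.{u} W] {P : W ⥤ D} {F G : Pseudofunctor X (Factor P)}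

lemma Factor.proj_isId {x y : Factor P} {f g : x ⟶ y} {η θ : f ⟶ g}
    (hη : IsId₂ ((Factor.proj P).map₂ η)) (hθ : IsId₂ ((Factor.proj P).map₂ θ)) : η = θ :=
  Factor.hom_ext (IsId₂.unique hη hθ)

lemma Factor.proj_cell {x y : Factor P} {f g : x ⟶ y} {η θ : f ⟶ g}
    (h : Cell.mk ((Factor.proj P).map₂ η) = Cell.mk ((Factor.proj P).map₂ θ)) : η = θ :=
  Factor.hom_ext (eq_of_cell h)

lemma icon_eq (h : F.comp (Factor.proj P).toPseudofunctor = G.comp (Factor.proj P).toPseudofunctor)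
    (app : ∀ x, F.obj x ⟶ G.obj x)
    (happ : ∀ x, idCell ((Factor.proj P).map (app x)) = idCell (𝟙 ((Factor.proj P).obj (F.obj x))))
    {x y : X} (f : x ⟶ y) :
    P.map (F.map f ≫ app y).word = P.map (app x ≫ G.map f).word := by
  refine eq_of_idCell (C := D) ?_
  refine (congrArg idCell ((Factor.proj P).map_comp (F.map f) (app y))).trans ?_
  refine (idCell_comp_id (happ y)).trans ((idCell_of_eq h f).trans ?_)
  refine Eq.trans ?_ (congrArg idCell ((Factor.proj P).map_comp (app x) (G.map f))).symm
  exact (idCell_id_comp (happ x)).symm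

/-- The transformation between pseudofunctors into a factorisation which have the same image, with
given components lying over identities. -/
def icon (h : F.comp (Factor.proj P).toPseudofunctor = G.comp (Factor.proj P).toPseudofunctor)
    (app : ∀ x, F.obj x ⟶ G.obj x)
    (happ : ∀ x, idCell ((Factor.proj P).map (app x)) = idCell (𝟙 ((Factor.proj P).obj (F.obj x))))
    (hId : ∀ x, IsId₂ ((Factor.proj P).map₂ (F.mapId x).hom))
    (hComp : ∀ {x y z : X} (f : x ⟶ y) (g : y ⟶ z),
      IsId₂ ((Factor.proj P).map₂ (F.mapComp f g).hom)) : F ⟶ G where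
  app := app
  naturality f := Factor.isoMk (eqToIso (icon_eq h app happ f))
  naturality_naturality {x y f g} η := by
    apply Factor.proj_cell
    rw [(Factor.proj P).map₂_comp, (Factor.proj P).map₂_comp]
    have hx : idCell (𝟙 ((Factor.proj P).obj (F.obj x))) =
        idCell (𝟙 ((Factor.proj P).obj (F.obj x))) := rfl
    refine (cell_comp_isId _ (isId₂_eqToHom (icon_eq h app happ g))).trans (Eq.trans ?_
      (cell_isId_comp (isId₂_eqToHom (icon_eq h app happ f)) _).symm)
    exact (cell_strict_right (Factor.proj P) (F.map₂ η) (app y)).trans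
      ((cell_whiskerRight_id (happ y) _).trans ((cell_of_eq h η).trans
      ((cell_id_whiskerLeft ((happ x).trans hx) _).symm.trans
        (cell_strict_left (Factor.proj P) (app x) (G.map₂ η)).symm)))
  naturality_id x := by
    have hG : IsId₂ ((Factor.proj P).map₂ (G.mapId x).hom) :=
      isId₂_of_cell ((comp_mapId_strict _ _ _).symm.trans ((mapId_cell_of_eq h x).symm.trans
        (comp_mapId_strict _ _ _))) (hId x)
    apply Factor.proj_isId
    · rw [(Factor.proj P).map₂_comp]
      exact (isId₂_eqToHom (icon_eq h app happ _)).comp (isId₂_strict_left _ _ _ hG)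
    · rw [(Factor.proj P).map₂_comp, (Factor.proj P).map₂_comp]
      refine (isId₂_strict_right _ _ _ (hId x)).comp (IsId₂.comp ?_ ?_)
      · rw [Strict.leftUnitor_eqToIso]
        exact (isId₂_eqToHom (Strict.id_comp _)).map (Factor.proj P).toPseudofunctor
      · rw [Strict.rightUnitor_eqToIso]
        exact (isId₂_eqToHom (Strict.comp_id _).symm).map (Factor.proj P).toPseudofunctor
  naturality_comp {x y z} f g := by
    have hG : IsId₂ ((Factor.proj P).map₂ (G.mapComp f g).hom) :=
      isId₂_of_cell ((comp_mapComp_strict _ _ _ _).symm.trans ((mapComp_cell_of_eq h f g).symm.trans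
        (comp_mapComp_strict _ _ _ _))) (hComp f g)
    apply Factor.proj_isId
    · rw [(Factor.proj P).map₂_comp]
      exact (isId₂_eqToHom (icon_eq h app happ _)).comp (isId₂_strict_left _ _ _ hG)
    · simp only [(Factor.proj P).map₂_comp, Strict.associator_eqToIso, eqToIso.hom, eqToIso.inv]
      refine (isId₂_strict_right _ _ _ (hComp f g)).comp
        (((isId₂_eqToHom (Strict.assoc _ _ _)).map (Factor.proj P).toPseudofunctor).comp
        (IsId₂.comp (isId₂_strict_left _ _ _ (isId₂_eqToHom (icon_eq h app happ g)))
        (((isId₂_eqToHom (Strict.assoc _ _ _).symm).map (Factor.proj P).toPseudofunctor).comp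
        (IsId₂.comp (isId₂_strict_right _ _ _ (isId₂_eqToHom (icon_eq h app happ f)))
        ((isId₂_eqToHom (Strict.assoc _ _ _)).map (Factor.proj P).toPseudofunctor)))))

lemma icon_isId
    {h : F.comp (Factor.proj P).toPseudofunctor = G.comp (Factor.proj P).toPseudofunctor}
    {app : ∀ x, F.obj x ⟶ G.obj x}
    {happ : ∀ x, idCell ((Factor.proj P).map (app x)) = idCell (𝟙 ((Factor.proj P).obj (F.obj x)))}
    {hId : ∀ x, IsId₂ ((Factor.proj P).map₂ (F.mapId x).hom)}
    {hComp : ∀ {x y z : X} (f : x ⟶ y) (g : y ⟶ z),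
      IsId₂ ((Factor.proj P).map₂ (F.mapComp f g).hom)} {x y : X} {f : x ⟶ y}
    (hf : idCell (F.map f ≫ app y) = idCell (app x ≫ G.map f)) :
    IsId₂ ((icon h app happ hId hComp).naturality f).hom :=
  ⟨eq_of_idCell hf, Factor.hom_ext (Factor.eqToHom_val (eq_of_idCell hf)).symm⟩

end Icon

/-! ### Generating 1-cells of cartesian products -/

section Slice

variable {A B : Type u} [Bicategory.{u, u} A] [Bicategory.{u, u} B]

/-- The 1-cells `(f, 1)` and `(1, g)` of a cartesian product, for `f` and `g` in given classes. -/
inductive Slice (S : ∀ x y : A, (x ⟶ y) → Prop) (S' : ∀ x y : B, (x ⟶ y) → Prop) :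
    ∀ x y : A × B, (x ⟶ y) → Prop
  | left {a a' : A} (f : a ⟶ a') (b : B) : S a a' f → Slice S S' (a, b) (a', b) (f, 𝟙 b)
  | right (a : A) {b b' : B} (g : b ⟶ b') : S' b b' g → Slice S S' (a, b) (a, b') (𝟙 a, g)

/-- The class of all 1-cells. -/
def AllCells (A : Type u) [Bicategory.{u, u} A] (x y : A) (f : x ⟶ y) : Prop := True

lemma gen_all {x y : A} (f : x ⟶ y) : Gen (AllCells A) f := .of f trivial

lemma gen_slice [Strict A] [Strict B] {S : ∀ x y : A, (x ⟶ y) → Prop}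
    {S' : ∀ x y : B, (x ⟶ y) → Prop} (hS : ∀ {x y : A} (f : x ⟶ y), Gen S f)
    (hS' : ∀ {x y : B} (f : x ⟶ y), Gen S' f) {x y : A × B} (f : x ⟶ y) :
    Gen (Slice S S') f := by
  obtain ⟨a, b⟩ := x
  obtain ⟨a', b'⟩ := y
  obtain ⟨f, g⟩ := f
  dsimp only at f g
  have hl : Gen (Slice S S') ((f, 𝟙 b) : (a, b) ⟶ (a', b)) := by
    clear g
    induction hS f with
    | of f hf => exact .of _ (.left f b hf)
    | id a => exact .id (a, b)
    | comp f f' _ _ h h' => exact h.of_eq h' (Prod.ext rfl (Strict.id_comp _))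
  have hr : Gen (Slice S S') ((𝟙 a', g) : (a', b) ⟶ (a', b')) := by
    clear hl f
    induction hS' g with
    | of f hf => exact .of _ (.right a' f hf)
    | id b => exact .id (a', b)
    | comp f f' _ _ h h' => exact h.of_eq h' (Prod.ext (Strict.id_comp _) rfl)
  exact hl.of_eq hr (Prod.ext (Strict.comp_id _) (Strict.id_comp _))

/-- The 1-cells `(f, 1)` and `(1, g)`. -/
abbrev Slice₂ (A B : Type u) [Bicategory.{u, u} A] [Bicategory.{u, u} B] :=
  Slice (AllCells A) (AllCells B)

lemma gen_slice₂ [Strict A] [Strict B] {x y : A × B} (f : x ⟶ y) : Gen (Slice₂ A B) f :=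
  gen_slice gen_all gen_all f

end Slice

/-! ### The symmetry of the cartesian product and of the Gray tensor product -/

namespace Gray

section Swap

open scoped Pseudofunctor.StrongTrans

variable {A B : Type u} [Bicategory.{u, u} A] [Bicategory.{u, u} B] [Strict A] [Strict B]

lemma cub_swap_proj : ((cub A B).comp (swap A B).toPseudofunctor).comp
      (Factor.proj (wordsProj B A)).toPseudofunctor =
    ((Bicategory.Prod.swap A B).toPseudofunctor.comp (cub B A)).comp
      (Factor.proj (wordsProj B A)).toPseudofunctor := by
  have h : (swap A B).comp (Factor.proj (wordsProj B A)) =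
      (Factor.proj (wordsProj A B)).comp (Bicategory.Prod.swap A B) :=
    strict_cell_ext fun η => cell_conj _ ((Bicategory.Prod.swap A B).map₂ η.val) _
  rw [comp_assoc, comp_assoc, cub_proj, comp_id]
  refine (congrArg (fun t => (cub A B).comp t.toPseudofunctor) h).trans ?_
  refine (comp_assoc _ _ _).symm.trans ?_
  rw [cub_proj]
  exact id_comp _

lemma cub_swap_mapId (x : A × B) : IsId₂ ((Factor.proj (wordsProj B A)).map₂
    (((cub A B).comp (swap A B).toPseudofunctor).mapId x).hom) := by
  refine isId₂_of_cell ((comp_mapId_strict _ _ _).symm.trans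
    (mapId_cell_of_eq cub_swap_proj x)) (isId₂_of_cell ?_ (cub_mapId_val (x.2, x.1)))
  refine (comp_mapId_strict _ _ _).trans ?_
  exact congrArg (fun t => Cell.mk t.val) (map₂_id_comp (cub B A) _)

lemma cub_swap_mapComp {x y z : A × B} (f : x ⟶ y) (g : y ⟶ z) :
    IsId₂ ((Factor.proj (wordsProj B A)).map₂
      (((cub A B).comp (swap A B).toPseudofunctor).mapComp f g).hom) := by
  refine isId₂_of_cell ((comp_mapComp_strict _ _ _ _).symm.trans
    (mapComp_cell_of_eq cub_swap_proj f g)) (isId₂_of_cell ?_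
      (cub_mapComp_val (A := B) (B := A) (x := (x.2, x.1)) (y := (y.2, y.1)) (z := (z.2, z.1))
        (f.2, f.1) (g.2, g.1)))
  refine (comp_mapComp_strict _ _ _ _).trans ?_
  exact congrArg (fun t => Cell.mk t.val) (map₂_id_comp (cub B A) _)

lemma swap_cub_mapId (x : A × B) : IsId₂ ((Factor.proj (wordsProj B A)).map₂
    (((Bicategory.Prod.swap A B).toPseudofunctor.comp (cub B A)).mapId x).hom) :=
  isId₂_of_cell ((comp_mapId_strict _ _ _).symm.trans ((mapId_cell_of_eq cub_swap_proj x).symm.trans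
    (comp_mapId_strict _ _ _))) (cub_swap_mapId x)

lemma swap_cub_mapComp {x y z : A × B} (f : x ⟶ y) (g : y ⟶ z) :
    IsId₂ ((Factor.proj (wordsProj B A)).map₂
      (((Bicategory.Prod.swap A B).toPseudofunctor.comp (cub B A)).mapComp f g).hom) :=
  isId₂_of_cell ((comp_mapComp_strict _ _ _ _).symm.trans
    ((mapComp_cell_of_eq cub_swap_proj f g).symm.trans (comp_mapComp_strict _ _ _ _)))
    (cub_swap_mapComp f g)

variable (A B) in
/-- The canonical cubical functor is compatible with the symmetries up to a transformation with
identity components, whose naturality 2-cells are the interchange 2-cells. -/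
def cubSwap : (cub A B).comp (swap A B).toPseudofunctor ⟶
    (Bicategory.Prod.swap A B).toPseudofunctor.comp (cub B A) :=
  icon cub_swap_proj (fun x => 𝟙 (pt x.2 x.1))
    (fun x => congrArg idCell ((Factor.proj (wordsProj B A)).map_id (pt x.2 x.1)))
    cub_swap_mapId cub_swap_mapComp

variable (A B) in
/-- The inverse of the transformation `cubSwap`. -/
def cubSwapInv : (Bicategory.Prod.swap A B).toPseudofunctor.comp (cub B A) ⟶
    (cub A B).comp (swap A B).toPseudofunctor :=
  icon cub_swap_proj.symm (fun x => 𝟙 (pt x.2 x.1))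
    (fun x => congrArg idCell ((Factor.proj (wordsProj B A)).map_id (pt x.2 x.1)))
    swap_cub_mapId swap_cub_mapComp

lemma idCell_swap_cub {x y : A × B} {p : x ⟶ y} (hp : Slice₂ A B x y p) :
    idCell (((cub A B).comp (swap A B).toPseudofunctor).map p) =
      idCell (((Bicategory.Prod.swap A B).toPseudofunctor.comp (cub B A)).map p) := by
  cases hp with
  | left f b =>
    exact (idCell_map (swap A B).toPseudofunctor (congrArg idCell (cub_map_left f b))).trans
      ((swap_left f b).trans (congrArg idCell (cub_map_right b f)).symm)
  | right a g =>
    exact (idCell_map (swap A B).toPseudofunctor (congrArg idCell (cub_map_right a g))).trans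
      ((swap_right a g).trans (congrArg idCell (cub_map_left g a)).symm)

lemma cubSwap_isId {x y : A × B} {p : x ⟶ y} (hp : Slice₂ A B x y p) :
    IsId₂ ((cubSwap A B).naturality p).hom :=
  icon_isId ((idCell_comp_id rfl).trans ((idCell_swap_cub hp).trans (idCell_id_comp rfl).symm))

lemma cubSwapInv_isId {x y : A × B} {p : x ⟶ y} (hp : Slice₂ A B x y p) :
    IsId₂ ((cubSwapInv A B).naturality p).hom :=
  icon_isId ((idCell_comp_id rfl).trans ((idCell_swap_cub hp).symm.trans (idCell_id_comp rfl).symm))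

end Swap

end Gray

/-! ### Extension of transformations along a locally full pseudofunctor -/

section Extend

open scoped Pseudofunctor.StrongTrans

section

variable {D : Type u} [Bicategory.{u, u} D] [Strict D]

lemma cell_whisker_assoc {a b c d : D} (f : a ⟶ b) {g g' : b ⟶ c} (η : g ⟶ g') (h : c ⟶ d) :
    Cell.mk ((f ◁ η) ▷ h) = Cell.mk (f ◁ (η ▷ h)) := by
  rw [Bicategory.whisker_assoc]
  simp only [Strict.associator_eqToIso, eqToIso.hom, eqToIso.inv]
  exact cell_conj (Strict.assoc _ _ _) _ (Strict.assoc _ _ _).symm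

lemma cell_comp_whiskerLeft {a b c d : D} (f : a ⟶ b) (g : b ⟶ c) {h h' : c ⟶ d} (η : h ⟶ h') :
    Cell.mk ((f ≫ g) ◁ η) = Cell.mk (f ◁ g ◁ η) := by
  rw [comp_whisker rfl, cell_conj]

lemma cell_whiskerRight_comp {a b c d : D} {f f' : a ⟶ b} (η : f ⟶ f') (g : b ⟶ c) (h : c ⟶ d) :
    Cell.mk (η ▷ (g ≫ h)) = Cell.mk ((η ▷ g) ▷ h) := by
  rw [whisker_comp rfl, cell_conj]

end

variable {X D Z : Type u} [Bicategory.{u, u} X] [Bicategory.{u, u} D] [Bicategory.{u, u} Z]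
  [Strict X] [Strict D] {S S' : StrictPseudofunctor X D} (app : ∀ a, S.obj a ⟶ S'.obj a)

lemma ofEq_app_id {F G : Pseudofunctor X D} (h : F = G) (x : X) :
    idCell ((ofEq h).app x) = idCell (𝟙 (F.obj x)) := by
  rw [ofEq_app, idCell_eqToHom]

/-- A family of 1-cells between the values of two 2-functors is natural at a 2-cell. -/
def NatAt {a b : X} {f g : a ⟶ b} (η : f ⟶ g) : Prop :=
  Cell.mk (S.map₂ η ▷ app b) = Cell.mk (app a ◁ S'.map₂ η)

variable {app}

lemma NatAt.comp {a b : X} {f g h : a ⟶ b} {η : f ⟶ g} {θ : g ⟶ h} (hη : NatAt app η)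
    (hθ : NatAt app θ) : NatAt app (η ≫ θ) := by
  unfold NatAt
  rw [S.map₂_comp, S'.map₂_comp, Bicategory.comp_whiskerRight, Bicategory.whiskerLeft_comp]
  exact cell_comp hη hθ

lemma NatAt.inv {a b : X} {f g : a ⟶ b} {η : f ≅ g} (hη : NatAt app η.hom) : NatAt app η.inv :=
  cell_inv (η := whiskerRightIso (S.map₂Iso η) (app b))
    (η' := whiskerLeftIso (app a) (S'.map₂Iso η)) hη

lemma NatAt.hcomp {a b c : X} {f f' : a ⟶ b} {g g' : b ⟶ c} {η : f ⟶ f'} {θ : g ⟶ g'}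
    (hη : NatAt app η) (hθ : NatAt app θ) : NatAt app (η ▷ g ≫ f' ◁ θ) := by
  refine NatAt.comp ?_ ?_
  · have h : idCell (S.map g ≫ app c) = idCell (app b ≫ S'.map g) := idCell_of_cell_dom hθ
    calc Cell.mk (S.map₂ (η ▷ g) ▷ app c) = Cell.mk ((S.map₂ η ▷ S.map g) ▷ app c) :=
          cell_whiskerRight (cell_strict_right S η g) rfl
      _ = Cell.mk (S.map₂ η ▷ (S.map g ≫ app c)) := (cell_whiskerRight_comp _ _ _).symm
      _ = Cell.mk (S.map₂ η ▷ (app b ≫ S'.map g)) := cell_whiskerRight rfl h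
      _ = Cell.mk ((S.map₂ η ▷ app b) ▷ S'.map g) := cell_whiskerRight_comp _ _ _
      _ = Cell.mk ((app a ◁ S'.map₂ η) ▷ S'.map g) := cell_whiskerRight hη rfl
      _ = Cell.mk (app a ◁ (S'.map₂ η ▷ S'.map g)) := cell_whisker_assoc _ _ _
      _ = Cell.mk (app a ◁ S'.map₂ (η ▷ g)) := cell_whiskerLeft rfl (cell_strict_right S' η g).symm
  · have h : idCell (S.map f' ≫ app b) = idCell (app a ≫ S'.map f') := idCell_of_cell_cod hη
    calc Cell.mk (S.map₂ (f' ◁ θ) ▷ app c) = Cell.mk ((S.map f' ◁ S.map₂ θ) ▷ app c) :=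
          cell_whiskerRight (cell_strict_left S f' θ) rfl
      _ = Cell.mk (S.map f' ◁ (S.map₂ θ ▷ app c)) := cell_whisker_assoc _ _ _
      _ = Cell.mk (S.map f' ◁ (app b ◁ S'.map₂ θ)) := cell_whiskerLeft rfl hθ
      _ = Cell.mk ((S.map f' ≫ app b) ◁ S'.map₂ θ) := (cell_comp_whiskerLeft _ _ _).symm
      _ = Cell.mk ((app a ≫ S'.map f') ◁ S'.map₂ θ) := cell_whiskerLeft h rfl
      _ = Cell.mk (app a ◁ (S'.map f' ◁ S'.map₂ θ)) := cell_comp_whiskerLeft _ _ _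
      _ = Cell.mk (app a ◁ S'.map₂ (f' ◁ θ)) := cell_whiskerLeft rfl (cell_strict_left S' f' θ).symm

variable {J : Pseudofunctor Z X} {b : J.comp S.toPseudofunctor ⟶ J.comp S'.toPseudofunctor}

lemma natAt_map₂ (hb : ∀ {x y : Z} (p : x ⟶ y), IsId₂ (b.naturality p).hom)
    (happ : ∀ z, b.app z = app (J.obj z)) {x y : Z} {p q : x ⟶ y} (θ : p ⟶ q) :
    NatAt app (J.map₂ θ) := by
  have h := congrArg Cell.mk (b.naturality_naturality θ)
  rw [cell_comp_isId _ (hb q), cell_isId_comp (hb p), happ, happ] at h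
  exact h

lemma natAt_mapId (hb : ∀ {x y : Z} (p : x ⟶ y), IsId₂ (b.naturality p).hom)
    (happ : ∀ z, b.app z = app (J.obj z)) (x : Z) : NatAt app (J.mapId x).hom := by
  have h := congrArg Cell.mk (b.naturality_id x)
  simp only [Strict.leftUnitor_eqToIso, Strict.rightUnitor_eqToIso, eqToIso.hom, eqToIso.inv] at h
  have h' := (cell_isId_comp (hb (𝟙 x)) _).symm.trans (h.trans
    (cell_comp_isId _ ((isId₂_eqToHom (Strict.id_comp _)).comp
      (isId₂_eqToHom (Strict.comp_id _).symm))))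
  exact (cell_whiskerRight (comp_mapId_strict J S x).symm (congrArg idCell (happ x).symm)).trans
    (h'.symm.trans (cell_whiskerLeft (congrArg idCell (happ x)) (comp_mapId_strict J S' x)))

lemma natAt_mapComp (hb : ∀ {x y : Z} (p : x ⟶ y), IsId₂ (b.naturality p).hom)
    (happ : ∀ z, b.app z = app (J.obj z)) {x y z : Z} (p : x ⟶ y) (q : y ⟶ z) :
    NatAt app (J.mapComp p q).hom := by
  have h := congrArg Cell.mk (b.naturality_comp p q)
  simp only [Strict.associator_eqToIso, eqToIso.hom, eqToIso.inv] at h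
  have h' := (cell_isId_comp (hb (p ≫ q)) _).symm.trans (h.trans
    (cell_comp_isId _ ((isId₂_eqToHom (Strict.assoc _ _ _)).comp
      (((hb q).whiskerLeft _).comp
        ((isId₂_eqToHom (Strict.assoc _ _ _).symm).comp
          (((hb p).whiskerRight _).comp (isId₂_eqToHom (Strict.assoc _ _ _))))))))
  exact (cell_whiskerRight (comp_mapComp_strict J S p q).symm
    (congrArg idCell (happ z).symm)).trans (h'.symm.trans
      (cell_whiskerLeft (congrArg idCell (happ x)) (comp_mapComp_strict J S' p q)))

/-- A family of 1-cells which is strictly natural on 1-cells and natural at all 2-cells is a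
2-natural transformation. -/
def natTrans (h : ∀ {a b : X} (f : a ⟶ b), S.map f ≫ app b = app a ≫ S'.map f)
    (h₂ : ∀ {a b : X} {f g : a ⟶ b} (η : f ⟶ g), NatAt app η) :
    S.toPseudofunctor ⟶ S'.toPseudofunctor :=
  strictTrans S S' app (fun f => eqToIso (h f))
    (fun {x y f g} η => eq_of_cell ((cell_comp_eqToHom _ (h g)).trans
      ((h₂ η).trans (cell_eqToHom_comp (h f) _).symm)))
    (fun x => rfl)
    (fun f g => IsId₂.unique (isId₂_eqToHom (h (f ≫ g)))
      ((isId₂_eqToHom _).comp (((isId₂_eqToHom (h g)).whiskerLeft _).comp ((isId₂_eqToHom _).comp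
        (((isId₂_eqToHom (h f)).whiskerRight _).comp (isId₂_eqToHom _))))))

lemma natTrans_isId (h : ∀ {a b : X} (f : a ⟶ b), S.map f ≫ app b = app a ≫ S'.map f)
    (h₂ : ∀ {a b : X} {f g : a ⟶ b} (η : f ⟶ g), NatAt app η) {a b : X} (f : a ⟶ b) :
    IsId₂ ((natTrans h h₂).naturality f).hom := isId₂_eqToHom (h f)

lemma natural_of_gen {Q : ∀ x y : X, (x ⟶ y) → Prop} (hQ : ∀ {x y : X} (f : x ⟶ y), Gen Q f)
    (h : ∀ {x y : X} (f : x ⟶ y), Q x y f → S.map f ≫ app y = app x ≫ S'.map f) {a b : X}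
    (f : a ⟶ b) : S.map f ≫ app b = app a ≫ S'.map f := by
  induction hQ f with
  | of f hf => exact h f hf
  | id a => rw [S.map_id, S'.map_id, Strict.id_comp, Strict.comp_id]
  | comp f g _ _ hf hg =>
    rw [S.map_comp, S'.map_comp, Strict.assoc, hg, ← Strict.assoc, hf, Strict.assoc]

end Extend

namespace Gray

open scoped Pseudofunctor.StrongTrans

section

variable {A B : Type u} [Bicategory.{u, u} A] [Bicategory.{u, u} B] [Strict A] [Strict B]

/-- The canonical cubical functor is locally full. -/
lemma cub_full {x y : A × B} {p q : x ⟶ y}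
    (η : (cub A B).map p ⟶ (cub A B).map q) : ∃ θ : p ⟶ q, (cub A B).map₂ θ = η := by
  refine ⟨eqToHom (proj_cubWord p).symm ≫ η.val ≫ eqToHom (proj_cubWord q), Factor.hom_ext ?_⟩
  exact eq_of_cell ((cub_val _).trans (cell_conj _ _ _))

lemma cub_basic {x y : Gray A B} {f : x ⟶ y} (h : Basic x y f) :
    ∃ p : (x.base.as.fst, x.base.as.snd) ⟶ (y.base.as.fst, y.base.as.snd),
      f = (cub A B).map p := by
  cases h with
  | left f b => exact ⟨(f, 𝟙 b), (cub_map_left f b).symm⟩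
  | right a g => exact ⟨(𝟙 a, g), (cub_map_right a g).symm⟩

variable {D : Type u} [Bicategory.{u, u} D] [Strict D] {S S' : StrictPseudofunctor (Gray A B) D}

/-- The components of a transformation which is given after restriction to the cartesian
product. -/
def extendApp (b : (cub A B).comp S.toPseudofunctor ⟶ (cub A B).comp S'.toPseudofunctor)
    (a : Gray A B) : S.obj a ⟶ S'.obj a := b.app (a.base.as.fst, a.base.as.snd)

variable {b : (cub A B).comp S.toPseudofunctor ⟶ (cub A B).comp S'.toPseudofunctor}

/-- A transformation between cubical functors is strictly natural if it is so at the 1-cells `(f,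
1)` and `(1, g)`: the canonical factorisation of `(f, g)` has identity comparison 2-cells. -/
lemma isId₂_slice (hb : ∀ {x y : A × B} (p : x ⟶ y), Slice₂ A B x y p → IsId₂ (b.naturality p).hom)
    {x y : A × B} (p : x ⟶ y) : IsId₂ (b.naturality p).hom := by
  obtain ⟨a, c⟩ := x
  obtain ⟨a', c'⟩ := y
  obtain ⟨f, g⟩ := p
  have h := b.naturality_comp ((f, 𝟙 c) : (a, c) ⟶ (a', c)) ((𝟙 a', g) : (a', c) ⟶ (a', c'))
  have e : CategoryStruct.comp (X := (a, c)) (Y := (a', c)) (Z := (a', c')) (f, 𝟙 c) (𝟙 a', g) =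
      (f, g) := Prod.ext (Strict.comp_id _) (Strict.id_comp _)
  have k : IsId₂ (b.naturality
      (CategoryStruct.comp (X := (a, c)) (Y := (a', c)) (Z := (a', c'))
        (f, 𝟙 c) (𝟙 a', g))).hom := by
    refine isId₂_of_comp_right (((cub_comp_isCubical S').mapComp _ _
      (Or.inl (.mk _))).whiskerLeft _) (h ▸ ?_)
    simp only [Strict.associator_eqToIso, eqToIso.hom, eqToIso.inv]
    exact (((cub_comp_isCubical S).mapComp _ _ (Or.inl (.mk _))).whiskerRight _).comp
      ((isId₂_eqToHom (Strict.assoc _ _ _)).comp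
      (((hb _ (.right _ _ trivial)).whiskerLeft _).comp
        ((isId₂_eqToHom (Strict.assoc _ _ _).symm).comp
          (((hb _ (.left _ _ trivial)).whiskerRight _).comp (isId₂_eqToHom (Strict.assoc _ _ _))))))
  rw [e] at k
  exact k

lemma extend_map (hb : ∀ {x y : A × B} (p : x ⟶ y), IsId₂ (b.naturality p).hom) {x y : Gray A B}
    (f : x ⟶ y) : S.map f ≫ extendApp b y = extendApp b x ≫ S'.map f := by
  refine natural_of_gen gen_basic (fun {x y} f hf => ?_) f
  obtain ⟨p, rfl⟩ := cub_basic hf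
  exact (hb p).1

/-- The components are natural at all 2-cells of the Gray tensor product, since these are generated
by the values and the comparison 2-cells of the canonical cubical functor; the latter account for
the interchange 2-cells. -/
lemma extend_natAt (hb : ∀ {x y : A × B} (p : x ⟶ y), IsId₂ (b.naturality p).hom) {x y : Gray A B}
    {f g : x ⟶ y} (η : f ⟶ g) : NatAt (extendApp b) η :=
  cell_induction (J := cub A B) (fun x y e => congrArg (Factor.proj (wordsProj A B)).obj e)
    (fun x => ⟨(x.base.as.fst, x.base.as.snd), rfl⟩) cub_full gen_basic (fun f hf => cub_basic hf)
    (NatAt (extendApp b)) (fun _ _ => NatAt.comp) (fun _ => NatAt.inv) (fun _ _ => NatAt.hcomp)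
    (natAt_map₂ hb (fun _ => rfl)) (natAt_mapId hb (fun _ => rfl))
    (natAt_mapComp hb (fun _ => rfl)) η

end

section Braiding

variable {C : Type u} [Bicategory.{u, u} C] [Strict C] {T : StrictPseudofunctor (Gray C C) C}

/-- The restriction of a braiding to the cartesian product. The canonical cubical functor commutes
with the symmetries only up to the transformation `cubSwap`, which has to be inserted. -/
def toCub (β : T.toPseudofunctor ⟶ ((swap C C).comp T).toPseudofunctor) :
    (cub C C).comp T.toPseudofunctor ⟶
      (Bicategory.Prod.swap C C).toPseudofunctor.comp ((cub C C).comp T.toPseudofunctor) :=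
  whiskerL (cub C C) β ≫
    ofEq (comp_assoc (cub C C) (swap C C).toPseudofunctor T.toPseudofunctor).symm ≫
    whiskerR (cubSwap C C) T.toPseudofunctor ≫ ofEq (comp_assoc _ _ _)

/-- The extension of a braiding on the cartesian product, as a transformation on the cartesian
product. -/
def ofCub (b : (cub C C).comp T.toPseudofunctor ⟶
      (Bicategory.Prod.swap C C).toPseudofunctor.comp ((cub C C).comp T.toPseudofunctor)) :
    (cub C C).comp T.toPseudofunctor ⟶ (cub C C).comp ((swap C C).comp T).toPseudofunctor :=
  b ≫ ofEq (comp_assoc _ _ _).symm ≫ whiskerR (cubSwapInv C C) T.toPseudofunctor ≫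
    ofEq (comp_assoc (cub C C) (swap C C).toPseudofunctor T.toPseudofunctor)

lemma toCub_app (β : T.toPseudofunctor ⟶ ((swap C C).comp T).toPseudofunctor) (x y : C) :
    idCell ((toCub β).app (x, y)) = idCell (β.app (pt x y)) := by
  have h : idCell (T.map (𝟙 (pt y x))) = idCell (𝟙 (T.obj (pt y x))) :=
    congrArg idCell (T.map_id _)
  exact idCell_comp_id ((idCell_id_comp (ofEq_app_id _ _)).trans
    ((idCell_comp_id (ofEq_app_id _ _)).trans h))

lemma ofCub_app (b : (cub C C).comp T.toPseudofunctor ⟶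
      (Bicategory.Prod.swap C C).toPseudofunctor.comp ((cub C C).comp T.toPseudofunctor))
    (x y : C) : idCell ((ofCub b).app (x, y)) = idCell (b.app (x, y)) := by
  have h : idCell (T.map (𝟙 (pt y x))) = idCell (𝟙 (T.obj (pt y x))) :=
    congrArg idCell (T.map_id _)
  exact idCell_comp_id ((idCell_id_comp (ofEq_app_id _ _)).trans
    ((idCell_comp_id (ofEq_app_id _ _)).trans h))

lemma toCub_isId {β : T.toPseudofunctor ⟶ ((swap C C).comp T).toPseudofunctor}
    (hβ : ∀ {x y : Gray C C} (w : x ⟶ y), IsId₂ (β.naturality w).hom) {x y : C × C} {p : x ⟶ y}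
    (hp : Slice₂ C C x y p) : IsId₂ ((toCub β).naturality p).hom :=
  isId₂_comp_naturality (hβ ((cub C C).map p)) (isId₂_comp_naturality (isId₂_ofEq _ _)
    (isId₂_comp_naturality (isId₂_whiskerR_strict T ((cubSwap_isId hp).map T.toPseudofunctor))
      (isId₂_ofEq _ _)))

lemma ofCub_isId {b : (cub C C).comp T.toPseudofunctor ⟶
      (Bicategory.Prod.swap C C).toPseudofunctor.comp ((cub C C).comp T.toPseudofunctor)}
    (hb : ∀ {x y : C × C} (p : x ⟶ y), Slice₂ C C x y p → IsId₂ (b.naturality p).hom)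
    {x y : C × C} (p : x ⟶ y) (hp : Slice₂ C C x y p) : IsId₂ ((ofCub b).naturality p).hom :=
  isId₂_comp_naturality (hb p hp) (isId₂_comp_naturality (isId₂_ofEq _ _)
    (isId₂_comp_naturality (isId₂_whiskerR_strict T ((cubSwapInv_isId hp).map T.toPseudofunctor))
      (isId₂_ofEq _ _)))

/-- The extension of a braiding from the cartesian product to the Gray tensor product. -/
def extendBraiding (b : (cub C C).comp T.toPseudofunctor ⟶
      (Bicategory.Prod.swap C C).toPseudofunctor.comp ((cub C C).comp T.toPseudofunctor))
    (hb : ∀ {x y : C × C} (p : x ⟶ y), Slice₂ C C x y p → IsId₂ (b.naturality p).hom) :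
    T.toPseudofunctor ⟶ ((swap C C).comp T).toPseudofunctor :=
  natTrans (app := extendApp (S' := (swap C C).comp T) (ofCub b))
    (extend_map (S' := (swap C C).comp T)
      (isId₂_slice (S' := (swap C C).comp T) (b := ofCub b) (ofCub_isId hb)))
    (extend_natAt (S' := (swap C C).comp T)
      (isId₂_slice (S' := (swap C C).comp T) (b := ofCub b) (ofCub_isId hb)))

lemma extendBraiding_isId (b : (cub C C).comp T.toPseudofunctor ⟶
      (Bicategory.Prod.swap C C).toPseudofunctor.comp ((cub C C).comp T.toPseudofunctor))
    (hb : ∀ {x y : C × C} (p : x ⟶ y), Slice₂ C C x y p → IsId₂ (b.naturality p).hom)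
    {x y : Gray C C} (w : x ⟶ y) : IsId₂ ((extendBraiding b hb).naturality w).hom :=
  natTrans_isId (app := extendApp (S' := (swap C C).comp T) (ofCub b))
    (extend_map (S' := (swap C C).comp T)
      (isId₂_slice (S' := (swap C C).comp T) (b := ofCub b) (ofCub_isId hb)))
    (extend_natAt (S' := (swap C C).comp T)
      (isId₂_slice (S' := (swap C C).comp T) (b := ofCub b) (ofCub_isId hb))) w

lemma extendBraiding_app (b : (cub C C).comp T.toPseudofunctor ⟶
      (Bicategory.Prod.swap C C).toPseudofunctor.comp ((cub C C).comp T.toPseudofunctor))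
    (hb : ∀ {x y : C × C} (p : x ⟶ y), Slice₂ C C x y p → IsId₂ (b.naturality p).hom) (x y : C) :
    idCell ((extendBraiding b hb).app (pt x y)) = idCell (b.app (x, y)) := ofCub_app b x y

end Braiding

end Gray

/-! ### The 1-cells of a cubical monoid -/

namespace CubicalMonoid

open scoped Pseudofunctor.StrongTrans

variable {C : Type u} [Bicategory.{u, u} C] [Strict C] (M : CubicalMonoid C)

lemma map_id_pair (x y : C) : M.sum.map ((𝟙 x, 𝟙 y) : (x, y) ⟶ (x, y)) = 𝟙 (M.add x y) :=
  (M.cubical.mapId (x, y)).1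

lemma lwh_id (x y : C) : M.lwh x (𝟙 y) = 𝟙 (M.add x y) := M.map_id_pair x y
lemma rwh_id (x y : C) : M.rwh (𝟙 x) y = 𝟙 (M.add x y) := M.map_id_pair x y

lemma lwh_comp (x : C) {a b c : C} (f : a ⟶ b) (g : b ⟶ c) :
    M.lwh x (f ≫ g) = M.lwh x f ≫ M.lwh x g := by
  have h := (M.cubical.mapComp ((𝟙 x, f) : (x, a) ⟶ (x, b)) ((𝟙 x, g) : (x, b) ⟶ (x, c))
    (Or.inr (.mk _))).1
  exact (congrArg (fun t => M.sum.map ((t, f ≫ g) : (x, a) ⟶ (x, c)))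
    (Strict.id_comp (𝟙 x)).symm).trans h

lemma rwh_comp {a b c : C} (f : a ⟶ b) (g : b ⟶ c) (x : C) :
    M.rwh (f ≫ g) x = M.rwh f x ≫ M.rwh g x := by
  have h := (M.cubical.mapComp ((f, 𝟙 x) : (a, x) ⟶ (b, x)) ((g, 𝟙 x) : (b, x) ⟶ (c, x))
    (Or.inl (.mk _))).1
  exact (congrArg (fun t => M.sum.map ((f ≫ g, t) : (a, x) ⟶ (c, x)))
    (Strict.id_comp (𝟙 x)).symm).trans h

variable {M}

lemma lwh_congr {x x' : C} (hx : x = x') {a b a' b' : C} {f : a ⟶ b} {f' : a' ⟶ b'}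
    (h : idCell f = idCell f') : idCell (M.lwh x f) = idCell (M.lwh x' f') := by
  cases hx; cases h; rfl

lemma rwh_congr {x x' : C} (hx : x = x') {a b a' b' : C} {f : a ⟶ b} {f' : a' ⟶ b'}
    (h : idCell f = idCell f') : idCell (M.rwh f x) = idCell (M.rwh f' x') := by
  cases hx; cases h; rfl

lemma sum_congr {x y x' y' : C × C} {p : x ⟶ y} {p' : x' ⟶ y'} (h₁ : idCell p.1 = idCell p'.1)
    (h₂ : idCell p.2 = idCell p'.2) : idCell (M.sum.map p) = idCell (M.sum.map p') := by
  obtain ⟨p, q⟩ := p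
  obtain ⟨p', q'⟩ := p'
  obtain ⟨a, c⟩ := x
  obtain ⟨a', c'⟩ := y
  obtain ⟨d, e⟩ := x'
  obtain ⟨d', e'⟩ := y'
  dsimp only at *
  cases h₁
  cases h₂
  rfl

lemma assoc_map {a a' b b' c c' : C} (f : a ⟶ a') (g : b ⟶ b') (h : c ⟶ c') :
    idCell (M.sum.map ((M.sum.map ((f, g) : (a, b) ⟶ (a', b')), h) :
      (M.add a b, c) ⟶ (M.add a' b', c'))) =
    idCell (M.sum.map ((f, M.sum.map ((g, h) : (b, c) ⟶ (b', c'))) :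
      (a, M.add b c) ⟶ (a', M.add b' c'))) :=
  idCell_of_eq M.assoc (x := ((a, b), c)) (y := ((a', b'), c')) ((f, g), h)

lemma lwh_lwh (x y : C) {a b : C} (f : a ⟶ b) :
    idCell (M.lwh (M.add x y) f) = idCell (M.lwh x (M.lwh y f)) :=
  (sum_congr (M := M) (x := (M.add x y, a)) (y := (M.add x y, b)) (x' := (M.add x y, a))
    (y' := (M.add x y, b)) (p := (𝟙 (M.add x y), f)) (p' := (M.sum.map (𝟙 x, 𝟙 y), f))
    (congrArg idCell (M.map_id_pair x y).symm) rfl).trans (assoc_map (M := M) (𝟙 x) (𝟙 y) f)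

lemma rwh_rwh {a b : C} (f : a ⟶ b) (x y : C) :
    idCell (M.rwh (M.rwh f x) y) = idCell (M.rwh f (M.add x y)) :=
  (assoc_map f (𝟙 x) (𝟙 y)).trans (sum_congr (M := M) (x := (a, M.add x y)) (y := (b, M.add x y))
    (x' := (a, M.add x y)) (y' := (b, M.add x y)) (p := (f, M.sum.map (𝟙 x, 𝟙 y)))
    (p' := (f, 𝟙 (M.add x y))) rfl (congrArg idCell (M.map_id_pair x y)))

lemma rwh_lwh (x : C) {a b : C} (f : a ⟶ b) (y : C) :
    idCell (M.rwh (M.lwh x f) y) = idCell (M.lwh x (M.rwh f y)) := assoc_map (𝟙 x) f (𝟙 y)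

lemma idCell_id_add (x y z : C) : idCell (𝟙 (M.add (M.add x y) z)) =
    idCell (𝟙 (M.add x (M.add y z))) := by
  rw [M.add_assoc]

lemma idCell_asc_comp (x y z : C) {a : C} (f : M.add x (M.add y z) ⟶ a) :
    idCell (M.asc x y z ≫ f) = idCell f := idCell_eqToHom_comp _ f

lemma idCell_ascInv_comp (x y z : C) {a : C} (f : M.add (M.add x y) z ⟶ a) :
    idCell (M.ascInv x y z ≫ f) = idCell f := idCell_eqToHom_comp _ f

/-! ### Quasi-strict braidings -/

/-- A transformation `b` with the properties of the braiding of a quasi-strict symmetric monoidal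
2-category, expressed by equations between 1-cells and by identities between 1-cells and 2-cells. -/
structure IsBraiding (b : M.sum ⟶ M.opSum) : Prop where
  nat {x y : C × C} (p : x ⟶ y) : Slice₂ C C x y p → IsId₂ (b.naturality p).hom
  symm (x y : C) : (b.app (x, y) : M.add x y ⟶ M.add y x) ≫ b.app (y, x) = 𝟙 (M.add x y)
  unit (x : C) : idCell (b.app (M.unit, x)) = idCell (𝟙 x)
  hex (x y z : C) : idCell (b.app (x, M.add y z)) =
    idCell (M.rwh (b.app (x, y)) z ≫ M.asc y x z ≫ M.lwh y (b.app (x, z)))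
  sigma_left (x y : C) {z z' : C} (g : z ⟶ z') : IsId₂ (M.sigma (b.app (x, y)) g).hom
  sigma_right {z z' : C} (f : z ⟶ z') (x y : C) : IsId₂ (M.sigma f (b.app (x, y))).hom

/-- 1-cells which have the same inverse, up to varying boundaries, are equal. -/
lemma eq_of_inverse {a a' b b' : C} {f : a ⟶ b} {g : b ⟶ a} {f' : a' ⟶ b'} {g' : b' ⟶ a'}
    (h₁ : g ≫ f = 𝟙 b) (h₂ : f' ≫ g' = 𝟙 a') (h : idCell g = idCell g') :
    idCell f = idCell f' := by
  cases h
  refine congrArg idCell ?_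
  calc f = (f' ≫ g) ≫ f := by rw [h₂, Strict.id_comp]
    _ = f' := by rw [Strict.assoc, h₁, Strict.comp_id]

lemma inverse_composite {v w x y z : C} {p : v ⟶ w} {l : w ⟶ x} {i : x ⟶ y} {r : y ⟶ z}
    {r' : z ⟶ y} {j : y ⟶ x} {l' : x ⟶ w} {q : w ⟶ v} (hr : r ≫ r' = 𝟙 y) (hi : i ≫ j = 𝟙 x)
    (hl : l ≫ l' = 𝟙 w) (hp : p ≫ q = 𝟙 v) :
    (p ≫ l ≫ i ≫ r) ≫ (r' ≫ j ≫ l' ≫ q) = 𝟙 v := by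
  calc (p ≫ l ≫ i ≫ r) ≫ (r' ≫ j ≫ l' ≫ q)
      = p ≫ l ≫ i ≫ (r ≫ r') ≫ j ≫ l' ≫ q := by simp only [Strict.assoc]
    _ = p ≫ l ≫ (i ≫ j) ≫ l' ≫ q := by rw [hr]; simp only [Strict.assoc, Strict.id_comp]
    _ = p ≫ (l ≫ l') ≫ q := by rw [hi]; simp only [Strict.assoc, Strict.id_comp]
    _ = 𝟙 v := by rw [hl, Strict.id_comp, hp]

lemma eqToHom_inverse {x y : C} (h : x = y) : eqToHom h ≫ eqToHom h.symm = 𝟙 x := by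
  cases h
  exact Strict.id_comp _

lemma rwh_inverse {x y : C} {f : x ⟶ y} {g : y ⟶ x} (h : f ≫ g = 𝟙 x) (z : C) :
    M.rwh f z ≫ M.rwh g z = 𝟙 (M.add x z) :=
  (M.rwh_comp f g z).symm.trans ((congrArg (fun t => M.rwh t z) h).trans (M.rwh_id x z))

lemma lwh_inverse {x y : C} {f : x ⟶ y} {g : y ⟶ x} (h : f ≫ g = 𝟙 x) (z : C) :
    M.lwh z f ≫ M.lwh z g = 𝟙 (M.add z x) :=
  (M.lwh_comp z f g).symm.trans ((congrArg (fun t => M.lwh z t) h).trans (M.lwh_id z x))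

section

variable {b : M.sum ⟶ M.opSum}

lemma IsBraiding.unit_right (hb : IsBraiding b) (x : C) :
    idCell (b.app (x, M.unit)) = idCell (𝟙 x) :=
  eq_of_inverse (hb.symm _ _) (Strict.id_comp (𝟙 x)) (hb.unit x)

/-- The hexagon in the first variable is obtained from the one in the second variable by passing to
inverses. -/
lemma IsBraiding.hex₂ (hb : IsBraiding b) (x y z : C) : idCell (b.app (M.add x y, z)) =
    idCell (M.lwh x (b.app (y, z)) ≫ M.ascInv x z y ≫ M.rwh (b.app (x, z)) y) := by
  refine (eq_of_inverse (g := b.app (z, M.add x y)) (f := b.app (M.add x y, z))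
    (f' := M.asc x y z ≫ M.lwh x (b.app (y, z)) ≫ M.ascInv x z y ≫ M.rwh (b.app (x, z)) y)
    (g' := M.rwh (b.app (z, x)) y ≫ M.asc x z y ≫ M.lwh x (b.app (z, y)) ≫ M.ascInv x y z)
    (hb.symm _ _) ?_ ?_).trans (idCell_asc_comp _ _ _ _)
  · exact inverse_composite (rwh_inverse (hb.symm x z) y) (eqToHom_inverse _)
      (lwh_inverse (hb.symm y z) x) (eqToHom_inverse _)
  · exact (hb.hex z x y).trans
      (idCell_comp rfl (idCell_comp rfl (idCell_comp_eqToHom _ _).symm))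

/-- The comparison 2-cell at `(1, g)` followed by `(f, 1)` is an identity if the interchange 2-cell
of `f` and `g` is, since the comparison 2-cell in the other order is an identity. -/
lemma isId₂_mapComp_of_sigma {x y z w : C} {f : x ⟶ y} {g : z ⟶ w}
    (h : IsId₂ (M.sigma f g).hom) {i : x ⟶ x} (hi : i = 𝟙 x) {j : w ⟶ w} (hj : j = 𝟙 w) :
    IsId₂ (M.sum.mapComp (a := (x, z)) (b := (x, w)) (c := (y, w)) (i, g) (f, j)).hom := by
  subst hi hj
  have e : IsId₂ (M.sum.mapComp (a := (x, z)) (b := (x, w)) (c := (y, w)) (𝟙 x, g) (f, 𝟙 w)).inv :=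
    isId₂_of_comp_right (((isId₂_eqToHom (Prod.ext
      ((Strict.id_comp f).trans (Strict.comp_id f).symm)
      ((Strict.comp_id g).trans (Strict.id_comp g).symm))).map M.sum).comp (M.cubical.mapComp _ _
      (Or.inl (.mk _)))) h
  exact IsId₂.inv (η := (M.sum.mapComp (a := (x, z)) (b := (x, w)) (c := (y, w))
    (𝟙 x, g) (f, 𝟙 w)).symm) e

lemma slice_left {x y : C} (f : x ⟶ y) {z : C} {i : z ⟶ z} (hi : i = 𝟙 z) :
    Slice₂ C C (x, z) (y, z) (f, i) := by
  subst hi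
  exact .left f z trivial

lemma slice_right {z : C} {i : z ⟶ z} (hi : i = 𝟙 z) {x y : C} (f : x ⟶ y) :
    Slice₂ C C (z, x) (z, y) (i, f) := by
  subst hi
  exact .right z f trivial

lemma isId₂_id_naturality {X : Type u} [Bicategory.{u, u} X] (F : Pseudofunctor X C) {x y : X}
    (f : x ⟶ y) : IsId₂ ((𝟙 F : F ⟶ F).naturality f).hom := isId₂_ofEq rfl f

/-- The transformation with components `b_{x,y} + z` is strictly natural in each variable. -/
lemma IsBraiding.isId₂_left (hb : IsBraiding b) {x y : (C × C) × C} {p : x ⟶ y}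
    (hp : Slice (Slice₂ C C) (AllCells C) x y p) :
    IsId₂ ((whiskerR (prodTrans b (𝟙 (Pseudofunctor.id C))) M.sum).naturality p).hom := by
  cases hp with
  | left q c hq =>
    exact isId₂_whiskerR M.sum (M.cubical.mapComp _ _ (Or.inl (.mk _)))
      (Gray.isId₂_pair (hb.nat q hq) (isId₂_id_naturality _ _))
      (M.cubical.mapComp _ _ (Or.inl (.mk _)))
  | @right a c c' h =>
    exact isId₂_whiskerR M.sum
      (isId₂_mapComp_of_sigma (hb.sigma_left a.1 a.2 h) (M.map_id_pair a.1 a.2) rfl)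
      (Gray.isId₂_pair (hb.nat (𝟙 a) (Slice.left (𝟙 a.1) a.2 trivial)) (isId₂_id_naturality _ _))
      (M.cubical.mapComp _ _ (Or.inl (.mk _)))

/-- The transformation with components `x + b_{y,z}` is strictly natural in each variable. -/
lemma IsBraiding.isId₂_right (hb : IsBraiding b) {x y : C × (C × C)} {p : x ⟶ y}
    (hp : Slice (AllCells C) (Slice₂ C C) x y p) :
    IsId₂ ((whiskerR (prodTrans (𝟙 (Pseudofunctor.id C)) b) M.sum).naturality p).hom := by
  cases hp with
  | @left c c' f a =>
    exact isId₂_whiskerR M.sum (M.cubical.mapComp _ _ (Or.inr (.mk _)))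
      (Gray.isId₂_pair (isId₂_id_naturality _ _) (hb.nat (𝟙 a) (Slice.left (𝟙 a.1) a.2 trivial)))
      (isId₂_mapComp_of_sigma (hb.sigma_right f a.1 a.2) rfl (M.map_id_pair a.2 a.1))
  | right c q hq =>
    exact isId₂_whiskerR M.sum (M.cubical.mapComp _ _ (Or.inr (.mk _)))
      (Gray.isId₂_pair (isId₂_id_naturality _ _) (hb.nat q hq))
      (M.cubical.mapComp _ _ (Or.inr (.mk _)))

/-- A 1-cell of `C × (C × C)` which varies in one variable only does so after rebracketing and after
exchanging the first two variables. -/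
lemma slices_right {x y : C × (C × C)} {p : x ⟶ y} (hp : Slice (AllCells C) (Slice₂ C C) x y p) :
    Slice (Slice₂ C C) (AllCells C) ((x.1, x.2.1), x.2.2) ((y.1, y.2.1), y.2.2)
        ((p.1, p.2.1), p.2.2) ∧
      Slice (AllCells C) (Slice₂ C C) (x.2.1, (x.1, x.2.2)) (y.2.1, (y.1, y.2.2))
        (p.2.1, (p.1, p.2.2)) := by
  cases hp with
  | @left a a' f c =>
    exact ⟨.left (a := (a, c.1)) (a' := (a', c.1)) (f, 𝟙 c.1) c.2 (.left f c.1 trivial),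
      .right (b := (a, c.2)) (b' := (a', c.2)) c.1 (f, 𝟙 c.2) (.left f c.2 trivial)⟩
  | right c q hq =>
    cases hq with
    | @left a a' f d =>
      exact ⟨.left (a := (c, a)) (a' := (c, a')) (𝟙 c, f) d (.right c f trivial),
        .left f (c, d) trivial⟩
    | @right d a a' g =>
      exact ⟨.right (c, d) g trivial,
        .right (b := (c, a)) (b' := (c, a')) d (𝟙 c, g) (.right c g trivial)⟩

/-- A 1-cell of `(C × C) × C` which varies in one variable only does so after rebracketing and after
exchanging the last two variables. -/
lemma slices_left {x y : (C × C) × C} {p : x ⟶ y} (hp : Slice (Slice₂ C C) (AllCells C) x y p) :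
    Slice (AllCells C) (Slice₂ C C) (x.1.1, (x.1.2, x.2)) (y.1.1, (y.1.2, y.2))
        (p.1.1, (p.1.2, p.2)) ∧
      Slice (Slice₂ C C) (AllCells C) ((x.1.1, x.2), x.1.2) ((y.1.1, y.2), y.1.2)
        ((p.1.1, p.2), p.1.2) := by
  cases hp with
  | @right c a a' g =>
    exact ⟨.right (b := (c.2, a)) (b' := (c.2, a')) c.1 (𝟙 c.2, g) (.right c.2 g trivial),
      .left (a := (c.1, a)) (a' := (c.1, a')) (𝟙 c.1, g) c.2 (.right c.1 g trivial)⟩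
  | left q c hq =>
    cases hq with
    | @left a a' f d =>
      exact ⟨.left f (d, c) trivial,
        .left (a := (a, c)) (a' := (a', c)) (f, 𝟙 c) d (.left f c trivial)⟩
    | @right d a a' g =>
      exact ⟨.right (b := (a, c)) (b' := (a', c)) d (g, 𝟙 c) (.left g c trivial),
        .right (d, c) g trivial⟩

lemma IsBraiding.hexR_isId (hb : IsBraiding b) {x y : C × (C × C)} {p : x ⟶ y}
    (hp : Slice (AllCells C) (Slice₂ C C) x y p) : IsId₂ ((hexR b).naturality p).hom :=
  isId₂_comp_naturality (isId₂_ofEq _ _) (isId₂_comp_naturality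
    (hb.isId₂_left (slices_right hp).1) (isId₂_comp_naturality (isId₂_ofEq _ _)
      (isId₂_comp_naturality (hb.isId₂_right (slices_right hp).2) (isId₂_ofEq _ _))))

lemma IsBraiding.hexL_isId (hb : IsBraiding b) {x y : (C × C) × C} {p : x ⟶ y}
    (hp : Slice (Slice₂ C C) (AllCells C) x y p) : IsId₂ ((hexL b).naturality p).hom :=
  isId₂_comp_naturality (isId₂_ofEq _ _) (isId₂_comp_naturality
    (hb.isId₂_right (slices_left hp).1) (isId₂_comp_naturality (isId₂_ofEq _ _)
      (isId₂_comp_naturality (hb.isId₂_left (slices_left hp).2) (isId₂_ofEq _ _))))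

lemma hexR_app (b : M.sum ⟶ M.opSum) (x y z : C) : idCell ((hexR b).app (x, (y, z))) =
    idCell (M.rwh (b.app (x, y)) z ≫ M.asc y x z ≫ M.lwh y (b.app (x, z))) :=
  (idCell_id_comp (ofEq_app_id _ _)).trans (idCell_comp rfl
    ((idCell_id_comp (ofEq_app_id _ _)).trans ((idCell_comp_id (ofEq_app_id _ _)).trans
      (idCell_asc_comp _ _ _ _).symm)))

lemma hexL_app (b : M.sum ⟶ M.opSum) (x y z : C) : idCell ((hexL b).app ((x, y), z)) =
    idCell (M.lwh x (b.app (y, z)) ≫ M.ascInv x z y ≫ M.rwh (b.app (x, z)) y) :=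
  (idCell_id_comp (ofEq_app_id _ _)).trans (idCell_comp rfl
    ((idCell_id_comp (ofEq_app_id _ _)).trans ((idCell_comp_id (ofEq_app_id _ _)).trans
      (idCell_ascInv_comp _ _ _ _).symm)))

lemma double_app (b : M.sum ⟶ M.opSum) (x y : C) : idCell ((double b).app (x, y)) =
    idCell ((b.app (x, y) : M.add x y ⟶ M.add y x) ≫ b.app (y, x)) :=
  idCell_comp rfl (idCell_comp_id (ofEq_app_id _ _))

/-- The hexagon holds as an equality of transformations, so that `R₁` can be taken to be an
identity. -/
lemma IsBraiding.hexR_eq (hb : IsBraiding b) :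
    whiskerL (prodMap (Pseudofunctor.id C) M.sum) b = hexR b :=
  trans_ext (Slice (AllCells C) (Slice₂ C C)) (gen_slice gen_all gen_slice₂)
    (fun {x y} p hp => hb.nat _ (by
      cases hp with
      | left f c =>
        exact slice_left f (M.map_id_pair c.1 c.2)
      | right c q hq => exact .right c (M.sum.map q) trivial))
    (fun p hp => hb.hexR_isId hp)
    fun x => eq_of_idCell ((hb.hex x.1 x.2.1 x.2.2).trans (hexR_app b x.1 x.2.1 x.2.2).symm)

/-- The second hexagon holds as an equality of transformations, so that `R₂` can be taken to be an
identity. -/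
lemma IsBraiding.hexL_eq (hb : IsBraiding b) :
    whiskerL (prodMap M.sum (Pseudofunctor.id C)) b = hexL b :=
  trans_ext (Slice (Slice₂ C C) (AllCells C)) (gen_slice gen_slice₂ gen_all)
    (fun {x y} p hp => hb.nat _ (by
      cases hp with
      | left q c hq => exact .left (M.sum.map q) c trivial
      | right c g =>
        exact slice_right (M.map_id_pair c.1 c.2) g))
    (fun p hp => hb.hexL_isId hp)
    fun x => eq_of_idCell ((hb.hex₂ x.1.1 x.1.2 x.2).trans (hexL_app b x.1.1 x.1.2 x.2).symm)

/-- The symmetry holds as an equality of transformations, so that `v` can be taken to be an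
identity. -/
lemma IsBraiding.double_eq (hb : IsBraiding b) : double b = 𝟙 M.sum :=
  trans_ext (Slice₂ C C) gen_slice₂
    (fun {x y} p hp => isId₂_comp_naturality (hb.nat p hp)
      (isId₂_comp_naturality (hb.nat _ (by
        cases hp with
        | left f c => exact .right c f trivial
        | right c g => exact .left g c trivial)) (isId₂_ofEq _ _)))
    (fun p hp => isId₂_id_naturality _ _)
    fun x => eq_of_idCell ((double_app b x.1 x.2).trans (congrArg idCell (hb.symm x.1 x.2)))

end

end CubicalMonoid

/-! ### Identities between transformations and pasting of identities -/

section Identities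

lemma isIdentity_eqToHom {X : Type u} [Category.{u} X] {a b : X} (h : a = b) :
    IsIdentity (eqToHom h) := by
  cases h
  exact .mk a

lemma IsIdentity.eq {X : Type u} [CategoryStruct.{u} X] {a b : X} {f : a ⟶ b}
    (h : IsIdentity f) : a = b := by
  cases h
  rfl

lemma isIdentity_of_sameArrow {X : Type u} [CategoryStruct.{u} X] {a b c : X} {f : a ⟶ b}
    (h : SameArrow f (𝟙 c)) : IsIdentity f := by
  cases h
  exact .mk _

lemma IsIdentity.heq {X : Type u} [CategoryStruct.{u} X] {a b a' b' : X} {f : a ⟶ b}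
    {f' : a' ⟶ b'} (h : IsIdentity f) (h' : IsIdentity f') (e : a = a') : HEq f f' := by
  cases h
  cases h'
  cases e
  rfl

section

open scoped Pseudofunctor.StrongTrans

variable {X D : Type u} [Bicategory.{u, u} X] [Bicategory.{u, u} D]

lemma IsIdentity.isId₂_app {F G : Pseudofunctor X D} {α β : F ⟶ G} {m : α ⟶ β}
    (h : IsIdentity m) (x : X) : IsId₂ (m.as.app x) := by
  cases h
  exact isId₂_id _

lemma IsIdentity.app {F G : Pseudofunctor X D} {α : F ⟶ G} (h : IsIdentity α) (x : X) :
    idCell (α.app x) = idCell (𝟙 (F.obj x)) := by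
  cases h
  rfl

end

variable {C : Type u} [Bicategory.{u, u} C]

lemma isPasting_single {a b : C} {f : a ⟶ b} {ζ : Cell C} (h : ζ = idCell f) :
    IsPasting [ζ] (idCell f) := by
  subst h
  exact .single _

/-- A pasting of identity 2-cells of one and the same 1-cell is the identity; the axioms of a
symmetric structure with identity modifications thus reduce to equations between 1-cells. -/
lemma isPasting_cons {a b : C} {f : a ⟶ b} {ζ : Cell C} {l : List (Cell C)} (h : ζ = idCell f)
    (hl : IsPasting l (idCell f)) : IsPasting (ζ :: l) (idCell f) := by
  subst h
  have := IsPasting.cons (𝟙 f) (𝟙 f) l hl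
  rw [Category.id_comp] at this
  exact this

lemma isId₂_dom {a b a' b' : C} {f g : a ⟶ b} {η : f ⟶ g} (h : IsId₂ η) {k : a' ⟶ b'}
    (e : idCell f = idCell k) : Cell.mk η = idCell k := (isId₂_iff.1 h).trans e

lemma isId₂_cod {a b a' b' : C} {f g : a ⟶ b} {η : f ⟶ g} (h : IsId₂ η) {k : a' ⟶ b'}
    (e : idCell g = idCell k) : Cell.mk η = idCell k := (isId₂_iff'.1 h).trans e

lemma IsId₂.idCell_eq {a b : C} {f g : a ⟶ b} {η : f ⟶ g} (h : IsId₂ η) : idCell f = idCell g :=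
  congrArg idCell h.1

lemma idCell_assoc [Strict C] {a b c d : C} (f : a ⟶ b) (g : b ⟶ c) (h : c ⟶ d) :
    idCell ((f ≫ g) ≫ h) = idCell (f ≫ g ≫ h) := congrArg idCell (Strict.assoc f g h)

end Identities

namespace CubicalMonoid

open scoped Pseudofunctor.StrongTrans

variable {C : Type u} [Bicategory.{u, u} C] [Strict C] {M : CubicalMonoid C}

lemma lwh₂_isId (y : C) {a b : C} {f g : a ⟶ b} {η : f ⟶ g} (h : IsId₂ η) :
    IsId₂ (M.lwh₂ y η) := (Gray.isId₂_pair (isId₂_id (𝟙 y)) h).map M.sum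

lemma rwh₂_isId {a b : C} {f g : a ⟶ b} {η : f ⟶ g} (h : IsId₂ η) (z : C) :
    IsId₂ (M.rwh₂ η z) := (Gray.isId₂_pair h (isId₂_id (𝟙 z))).map M.sum

lemma lwh_eqToHom (x : C) {a b : C} (h : a = b) : idCell (M.lwh x (eqToHom h)) =
    idCell (𝟙 (M.add x a)) := by
  cases h
  exact congrArg idCell (M.lwh_id x a)

lemma rwh_eqToHom {a b : C} (h : a = b) (x : C) : idCell (M.rwh (eqToHom h) x) =
    idCell (𝟙 (M.add a x)) := by
  cases h
  exact congrArg idCell (M.rwh_id a x)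

lemma sectR_swap (e : C) : (Bicategory.Prod.sectR e C).toPseudofunctor.comp
      (Bicategory.Prod.swap C C).toPseudofunctor = (Bicategory.Prod.sectL C e).toPseudofunctor :=
  pseudofunctor_ext_isId (fun x => isId₂_comp_mapId (isId₂_id _) (strict_mapId _ _))
    (fun x => isId₂_id _)
    (fun f g => isId₂_comp_mapComp (Gray.sectR_mapComp e f g) (strict_mapComp _ _ _))
    (fun f g => Gray.sectL_mapComp e f g) (fun η => rfl)

lemma sectL_swap (e : C) : (Bicategory.Prod.sectL C e).toPseudofunctor.comp
      (Bicategory.Prod.swap C C).toPseudofunctor = (Bicategory.Prod.sectR e C).toPseudofunctor :=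
  pseudofunctor_ext_isId (fun x => isId₂_comp_mapId (isId₂_id _) (strict_mapId _ _))
    (fun x => isId₂_id _)
    (fun f g => isId₂_comp_mapComp (Gray.sectL_mapComp e f g) (strict_mapComp _ _ _))
    (fun f g => Gray.sectR_mapComp e f g) (fun η => rfl)

lemma sectR_opSum : (Bicategory.Prod.sectR M.unit C).toPseudofunctor.comp M.opSum =
    Pseudofunctor.id C :=
  (comp_assoc _ _ _).symm.trans ((congrArg (fun F => F.comp M.sum) (sectR_swap M.unit)).trans
    M.sum_unit)

lemma sectL_opSum : (Bicategory.Prod.sectL C M.unit).toPseudofunctor.comp M.opSum =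
    Pseudofunctor.id C :=
  (comp_assoc _ _ _).symm.trans ((congrArg (fun F => F.comp M.sum) (sectL_swap M.unit)).trans
    M.unit_sum)

lemma comp_assoc₂₄ {x₁ x₂ x₃ x₄ x₅ x₆ x₇ : C} (f₁ : x₁ ⟶ x₂) (f₂ : x₂ ⟶ x₃) (f₃ : x₃ ⟶ x₄)
    (f₄ : x₄ ⟶ x₅) (f₅ : x₅ ⟶ x₆) (f₆ : x₆ ⟶ x₇) :
    (f₁ ≫ f₂ ≫ f₃) ≫ f₄ ≫ f₅ ≫ f₆ = (f₁ ≫ f₂) ≫ (f₃ ≫ f₄) ≫ f₅ ≫ f₆ := by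
  simp only [Strict.assoc]

lemma comp_assoc₃ {x₁ x₂ x₃ x₄ x₅ x₆ : C} (f₁ : x₁ ⟶ x₂) (f₂ : x₂ ⟶ x₃) (f₃ : x₃ ⟶ x₄)
    (f₄ : x₄ ⟶ x₅) (f₅ : x₅ ⟶ x₆) :
    f₁ ≫ f₂ ≫ f₃ ≫ f₄ ≫ f₅ = (f₁ ≫ f₂ ≫ f₃) ≫ f₄ ≫ f₅ := by
  simp only [Strict.assoc]

lemma lwh_comp₃ (x : C) {a b c d : C} (f : a ⟶ b) (g : b ⟶ c) (h : c ⟶ d) :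
    idCell (M.lwh x (f ≫ g ≫ h)) = idCell (M.lwh x f ≫ M.lwh x g ≫ M.lwh x h) := by
  rw [lwh_comp, lwh_comp]

lemma rwh_comp₃ {a b c d : C} (f : a ⟶ b) (g : b ⟶ c) (h : c ⟶ d) (x : C) :
    idCell (M.rwh (f ≫ g ≫ h) x) = idCell (M.rwh f x ≫ M.rwh g x ≫ M.rwh h x) := by
  rw [rwh_comp, rwh_comp]

end CubicalMonoid

/-! ### The quasi-strict structure of a braiding -/

namespace CubicalMonoid.IsBraiding

open scoped Pseudofunctor.StrongTrans

variable {C : Type u} [Bicategory.{u, u} C] [Strict C] {M : CubicalMonoid C} {b : M.sum ⟶ M.opSum}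

/-- The symmetry data whose modifications are identities. -/
def symmetryData (hb : IsBraiding b) : SymmetryData M where
  b := b
  equivalence x y := ⟨Equivalence.mkOfAdjointifyCounit (f := b.app (x, y)) (g := b.app (y, x))
    (eqToIso (hb.symm x y).symm) (eqToIso (hb.symm y x)), rfl⟩
  R₁ := eqToIso hb.hexR_eq
  R₂ := eqToIso hb.hexL_eq
  v := eqToIso hb.double_eq

lemma r₁_isId (hb : IsBraiding b) (x y z : C) : IsId₂ (hb.symmetryData.r₁ x y z).hom :=
  (isIdentity_eqToHom hb.hexR_eq).isId₂_app _

lemma r₂_isId (hb : IsBraiding b) (x y z : C) : IsId₂ (hb.symmetryData.r₂ x y z).hom :=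
  (isIdentity_eqToHom hb.hexL_eq).isId₂_app _

lemma vc_isId (hb : IsBraiding b) (x y : C) : IsId₂ (hb.symmetryData.vc x y).hom :=
  (isIdentity_eqToHom hb.double_eq).isId₂_app _

lemma one_three (hb : IsBraiding b) (x y z w : C) : PasteEq
    [⟨(hb.symmetryData.r₁ x y (M.add z w)).hom⟩,
      ⟨(M.rwh (hb.symmetryData.br x y) (M.add z w) ≫ M.asc y x (M.add z w)) ◁
        M.lwh₂ y (hb.symmetryData.r₁ x z w).hom⟩]
    [⟨(hb.symmetryData.r₁ x (M.add y z) w).hom⟩,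
      ⟨M.rwh₂ (hb.symmetryData.r₁ x y z).hom w ▷
        (M.asc (M.add y z) x w ≫ M.lwh (M.add y z) (hb.symmetryData.br x w))⟩] := by
  have e : idCell (b.app (x, M.add (M.add y z) w)) = idCell (b.app (x, M.add y (M.add z w))) :=
    congrArg (fun t => idCell (b.app (x, t))) (M.add_assoc y z w)
  exact ⟨idCell (b.app (x, M.add y (M.add z w))),
    isPasting_cons (isId₂_dom (hb.r₁_isId _ _ _) rfl)
      (isPasting_single (isId₂_dom ((lwh₂_isId y (hb.r₁_isId x z w)).whiskerLeft _)
        ((idCell_assoc _ _ _).trans (hb.hex x y (M.add z w)).symm))),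
    isPasting_cons (isId₂_dom (hb.r₁_isId _ _ _) e)
      (isPasting_single (isId₂_dom ((rwh₂_isId (hb.r₁_isId x y z) w).whiskerRight _)
        ((hb.hex x (M.add y z) w).symm.trans e)))⟩

lemma three_one (hb : IsBraiding b) (x y z w : C) : PasteEq
    [⟨(hb.symmetryData.r₂ (M.add x y) z w).hom⟩,
      ⟨(M.lwh (M.add x y) (hb.symmetryData.br z w) ≫ M.ascInv (M.add x y) w z) ◁
        M.rwh₂ (hb.symmetryData.r₂ x y w).hom z⟩]
    [⟨(hb.symmetryData.r₂ x (M.add y z) w).hom⟩,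
      ⟨M.lwh₂ x (hb.symmetryData.r₂ y z w).hom ▷
        (M.ascInv x w (M.add y z) ≫ M.rwh (hb.symmetryData.br x w) (M.add y z))⟩] := by
  have e : idCell (b.app (M.add x (M.add y z), w)) = idCell (b.app (M.add (M.add x y) z, w)) :=
    congrArg (fun t => idCell (b.app (t, w))) (M.add_assoc x y z).symm
  exact ⟨idCell (b.app (M.add (M.add x y) z, w)),
    isPasting_cons (isId₂_dom (hb.r₂_isId _ _ _) rfl)
      (isPasting_single (isId₂_dom ((rwh₂_isId (hb.r₂_isId x y w) z).whiskerLeft _)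
        ((idCell_assoc _ _ _).trans (hb.hex₂ (M.add x y) z w).symm))),
    isPasting_cons (isId₂_dom (hb.r₂_isId _ _ _) e)
      (isPasting_single (isId₂_dom ((lwh₂_isId x (hb.r₂_isId y z w)).whiskerRight _)
        ((hb.hex₂ x (M.add y z) w).symm.trans e)))⟩

/-- The braiding of `x + y` with `z + w` as a composite of four braidings. -/
lemma hex_hex₂ (hb : IsBraiding b) (x y z w : C) : idCell (b.app (M.add x y, M.add z w)) =
    idCell ((M.lwh x (M.rwh (b.app (y, z)) w) ≫ eqToHom (SymmetryData.mid_eq (M := M) x z y w)) ≫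
      (M.lwh (M.add x z) (b.app (y, w)) ≫ M.rwh (b.app (x, z)) (M.add w y)) ≫
        (eqToHom (SymmetryData.mid_eq (M := M) z x w y).symm ≫
          M.lwh z (M.rwh (b.app (x, w)) y))) := by
  have h₁ : idCell (M.lwh x (b.app (y, M.add z w))) = idCell (M.lwh x (M.rwh (b.app (y, z)) w) ≫
      eqToHom (SymmetryData.mid_eq (M := M) x z y w) ≫ M.lwh (M.add x z) (b.app (y, w))) := by
    refine (lwh_congr rfl (hb.hex y z w)).trans ?_
    refine (lwh_comp₃ _ _ _ _).trans (idCell_comp rfl ?_)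
    exact (idCell_id_comp (lwh_eqToHom _ _)).trans ((lwh_lwh _ _ _).symm.trans
      (idCell_eqToHom_comp _ _).symm)
  have h₂ : idCell (M.rwh (b.app (x, M.add z w)) y) =
      idCell (M.rwh (b.app (x, z)) (M.add w y) ≫
        eqToHom (SymmetryData.mid_eq (M := M) z x w y).symm ≫
          M.lwh z (M.rwh (b.app (x, w)) y)) := by
    refine (rwh_congr rfl (hb.hex x z w)).trans ?_
    refine (rwh_comp₃ _ _ _ _).trans (idCell_comp (rwh_rwh _ _ _) ?_)
    exact (idCell_id_comp (rwh_eqToHom _ _)).trans ((rwh_lwh _ _ _).trans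
      (idCell_eqToHom_comp _ _).symm)
  refine (hb.hex₂ x y (M.add z w)).trans ((idCell_comp h₁ ((idCell_ascInv_comp _ _ _ _).trans
    h₂)).trans (congrArg idCell (comp_assoc₂₄ _ _ _ _ _ _)))

lemma two_two (hb : IsBraiding b) (x y z w : C) : PasteEq
    [⟨(hb.symmetryData.r₁ (M.add x y) z w).hom⟩,
      ⟨M.rwh₂ (hb.symmetryData.r₂ x y z).hom w ▷
        (M.asc z (M.add x y) w ≫ M.lwh z (hb.symmetryData.br (M.add x y) w))⟩,
      ⟨(M.rwh (hb.symmetryData.t₂ x y z) w ≫ M.asc z (M.add x y) w) ◁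
        M.lwh₂ z (hb.symmetryData.r₂ x y w).hom⟩]
    [⟨(hb.symmetryData.r₂ x y (M.add z w)).hom⟩,
      ⟨M.lwh₂ x (hb.symmetryData.r₁ y z w).hom ▷
        (M.ascInv x (M.add z w) y ≫ M.rwh (hb.symmetryData.br x (M.add z w)) y)⟩,
      ⟨(M.lwh x (hb.symmetryData.t₁ y z w) ≫ M.ascInv x (M.add z w) y) ◁
        M.rwh₂ (hb.symmetryData.r₁ x z w).hom y⟩,
      ⟨(M.lwh x (M.rwh (hb.symmetryData.br y z) w) ≫
          eqToHom (SymmetryData.mid_eq x z y w)) ◁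
        ((M.sigma (hb.symmetryData.br x z) (hb.symmetryData.br y w)).hom ▷
          (eqToHom (SymmetryData.mid_eq z x w y).symm ≫
            M.lwh z (M.rwh (hb.symmetryData.br x w) y)))⟩] := by
  exact ⟨idCell (b.app (M.add x y, M.add z w)),
    isPasting_cons (isId₂_dom (hb.r₁_isId _ _ _) rfl)
      (isPasting_cons (isId₂_dom ((rwh₂_isId (hb.r₂_isId x y z) w).whiskerRight _)
        (hb.hex (M.add x y) z w).symm)
      (isPasting_single (isId₂_dom ((lwh₂_isId z (hb.r₂_isId x y w)).whiskerLeft _)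
        ((idCell_assoc _ _ _).trans ((idCell_comp (rwh_congr rfl (hb.r₂_isId x y z).idCell_eq.symm)
          rfl).trans (hb.hex (M.add x y) z w).symm))))),
    isPasting_cons (isId₂_dom (hb.r₂_isId _ _ _) rfl)
      (isPasting_cons (isId₂_dom ((lwh₂_isId x (hb.r₁_isId y z w)).whiskerRight _)
        (hb.hex₂ x y (M.add z w)).symm)
      (isPasting_cons (isId₂_dom ((rwh₂_isId (hb.r₁_isId x z w) y).whiskerLeft _)
        ((idCell_assoc _ _ _).trans ((idCell_comp (lwh_congr rfl (hb.r₁_isId y z w).idCell_eq.symm)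
          rfl).trans (hb.hex₂ x y (M.add z w)).symm)))
      (isPasting_single (isId₂_dom (((hb.sigma_left x z _).whiskerRight _).whiskerLeft _)
        (hb.hex_hex₂ x y z w).symm))))⟩

lemma natR_isId (hb : IsBraiding b) (x : C) {y y' : C} (g : y ⟶ y') :
    IsId₂ (hb.symmetryData.natR x g).hom := hb.nat _ (.right x g trivial)

lemma natL_isId (hb : IsBraiding b) {x x' : C} (f : x ⟶ x') (y : C) :
    IsId₂ (hb.symmetryData.natL f y).hom := hb.nat _ (.left f y trivial)

lemma yang_baxter (hb : IsBraiding b) (x y z : C) : PasteEq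
    [⟨(hb.symmetryData.r₁ x y z).inv ▷ M.rwh (hb.symmetryData.br y z) x⟩,
      ⟨(hb.symmetryData.natR x (hb.symmetryData.br y z)).inv⟩,
      ⟨M.lwh x (hb.symmetryData.br y z) ◁ (hb.symmetryData.r₁ x z y).hom⟩]
    [⟨M.rwh (hb.symmetryData.br x y) z ◁ (hb.symmetryData.r₂ y x z).inv⟩,
      ⟨(hb.symmetryData.natL (hb.symmetryData.br x y) z).hom⟩,
      ⟨(hb.symmetryData.r₂ x y z).hom ▷ M.lwh z (hb.symmetryData.br x y)⟩] := by
  have e : idCell (M.rwh (b.app (x, y)) z ≫ b.app (M.add y x, z)) =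
      idCell (b.app (x, M.add y z) ≫ M.rwh (b.app (y, z)) x) := by
    refine (idCell_comp rfl ((hb.hex₂ y x z).trans (idCell_asc_comp _ _ _ _).symm)).trans
      ((congrArg idCell (comp_assoc₃ _ _ _ _ _)).trans (idCell_comp (hb.hex x y z)
        (idCell_ascInv_comp _ _ _ _).symm).symm)
  exact ⟨idCell (b.app (x, M.add y z) ≫ M.rwh (b.app (y, z)) x),
    isPasting_cons (isId₂_cod ((hb.r₁_isId x y z).inv.whiskerRight _) rfl)
      (isPasting_cons (isId₂_dom (hb.natR_isId _ _).inv rfl)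
      (isPasting_single (isId₂_dom ((hb.r₁_isId x z y).whiskerLeft _)
        (hb.natR_isId x (b.app (y, z))).idCell_eq))),
    isPasting_cons (isId₂_cod ((hb.r₂_isId y x z).inv.whiskerLeft _) e)
      (isPasting_cons (isId₂_dom (hb.natL_isId _ _) e)
      (isPasting_single (isId₂_dom ((hb.r₂_isId x y z).whiskerRight _)
        ((hb.natL_isId (b.app (x, y)) z).idCell_eq.symm.trans e))))⟩

lemma syllepsis_one_two (hb : IsBraiding b) (x y z : C) : PasteEq
    [⟨(hb.symmetryData.vc x (M.add y z)).hom⟩]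
    [⟨(hb.symmetryData.r₁ x y z).hom ▷ hb.symmetryData.br (M.add y z) x⟩,
      ⟨hb.symmetryData.t₁ x y z ◁ (hb.symmetryData.r₂ y z x).hom⟩,
      ⟨(M.rwh (hb.symmetryData.br x y) z ≫ M.asc y x z) ◁
        (M.lwh₂ y (hb.symmetryData.vc x z).hom ▷
          (M.ascInv y x z ≫ M.rwh (hb.symmetryData.br y x) z))⟩,
      ⟨M.rwh₂ (hb.symmetryData.vc x y).hom z⟩] := by
  have e : idCell ((M.rwh (b.app (x, y)) z ≫ M.asc y x z) ≫ (M.lwh y (𝟙 (M.add x z)) ≫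
      (M.ascInv y x z ≫ M.rwh (b.app (y, x)) z))) = idCell (𝟙 (M.add x (M.add y z))) := by
    refine (idCell_assoc _ _ _).trans ((idCell_comp rfl ((idCell_asc_comp _ _ _ _).trans
      ((idCell_id_comp (congrArg idCell (M.lwh_id _ _))).trans
        (idCell_ascInv_comp _ _ _ _)))).trans ?_)
    exact (congrArg idCell (rwh_inverse (hb.symm x y) z)).trans (idCell_id_add _ _ _)
  exact ⟨idCell (𝟙 (M.add x (M.add y z))),
    isPasting_single (isId₂_cod (hb.vc_isId _ _) rfl),
    isPasting_cons (isId₂_dom ((hb.r₁_isId x y z).whiskerRight _)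
        (congrArg idCell (hb.symm x (M.add y z))))
      (isPasting_cons (isId₂_dom ((hb.r₂_isId y z x).whiskerLeft _)
        ((idCell_comp (hb.r₁_isId x y z).idCell_eq.symm rfl).trans
          (congrArg idCell (hb.symm x (M.add y z)))))
      (isPasting_cons (isId₂_cod (((lwh₂_isId y (hb.vc_isId x z)).whiskerRight _).whiskerLeft _) e)
      (isPasting_single (isId₂_cod (rwh₂_isId (hb.vc_isId x y) z)
        ((congrArg idCell (M.rwh_id _ _)).trans (idCell_id_add _ _ _))))))⟩

lemma syllepsis_two_one (hb : IsBraiding b) (x y z : C) : PasteEq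
    [⟨(hb.symmetryData.vc (M.add x y) z).hom⟩]
    [⟨(hb.symmetryData.r₂ x y z).hom ▷ hb.symmetryData.br z (M.add x y)⟩,
      ⟨hb.symmetryData.t₂ x y z ◁ (hb.symmetryData.r₁ z x y).hom⟩,
      ⟨(M.lwh x (hb.symmetryData.br y z) ≫ M.ascInv x z y) ◁
        (M.rwh₂ (hb.symmetryData.vc x z).hom y ▷
          (M.asc x z y ≫ M.lwh x (hb.symmetryData.br z y)))⟩,
      ⟨M.lwh₂ x (hb.symmetryData.vc y z).hom⟩] := by
  have e : idCell ((M.lwh x (b.app (y, z)) ≫ M.ascInv x z y) ≫ (M.rwh (𝟙 (M.add x z)) y ≫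
      (M.asc x z y ≫ M.lwh x (b.app (z, y))))) = idCell (𝟙 (M.add (M.add x y) z)) := by
    refine (idCell_assoc _ _ _).trans ((idCell_comp rfl ((idCell_ascInv_comp _ _ _ _).trans
      ((idCell_id_comp (congrArg idCell (M.rwh_id _ _))).trans
        (idCell_asc_comp _ _ _ _)))).trans ?_)
    exact (congrArg idCell (lwh_inverse (hb.symm y z) x)).trans (idCell_id_add _ _ _).symm
  exact ⟨idCell (𝟙 (M.add (M.add x y) z)),
    isPasting_single (isId₂_cod (hb.vc_isId _ _) rfl),
    isPasting_cons (isId₂_dom ((hb.r₂_isId x y z).whiskerRight _)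
        (congrArg idCell (hb.symm (M.add x y) z)))
      (isPasting_cons (isId₂_dom ((hb.r₁_isId z x y).whiskerLeft _)
        ((idCell_comp (hb.r₂_isId x y z).idCell_eq.symm rfl).trans
          (congrArg idCell (hb.symm (M.add x y) z))))
      (isPasting_cons (isId₂_cod (((rwh₂_isId (hb.vc_isId x z) y).whiskerRight _).whiskerLeft _) e)
      (isPasting_single (isId₂_cod (lwh₂_isId x (hb.vc_isId y z))
        ((congrArg idCell (M.lwh_id _ _)).trans (idCell_id_add _ _ _).symm)))))⟩

lemma isSymmetric (hb : IsBraiding b) : hb.symmetryData.IsSymmetric where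
  one_three := hb.one_three
  three_one := hb.three_one
  two_two := hb.two_two
  yang_baxter := hb.yang_baxter
  syllepsis_one_two := hb.syllepsis_one_two
  syllepsis_two_one := hb.syllepsis_two_one
  symmetry x y := ⟨idCell (b.app (x, y)),
    isPasting_single (isId₂_cod ((hb.vc_isId x y).whiskerRight _)
      (congrArg idCell (Strict.id_comp _))),
    isPasting_single (isId₂_cod ((hb.vc_isId y x).whiskerLeft _)
      (congrArg idCell (Strict.comp_id _)))⟩
  b_unit_left := isIdentity_of_sameArrow (sameArrow_trans (AllCells C) gen_all rfl
    (sectR_opSum.trans M.unit_sum.symm) (fun f _ => hb.nat _ (.right M.unit f trivial))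
    (fun f _ => isId₂_id_naturality _ f) fun x => sameArrow_iff.2 ((hb.unit x).trans
      (congrArg (fun F => idCell (𝟙 (F.obj x))) M.unit_sum).symm))
  b_unit_right := isIdentity_of_sameArrow (sameArrow_trans (AllCells C) gen_all rfl
    (sectL_opSum.trans M.sum_unit.symm) (fun f _ => hb.nat _ (.left f M.unit trivial))
    (fun f _ => isId₂_id_naturality _ f) fun x => sameArrow_iff.2 ((hb.unit_right x).trans
      (congrArg (fun F => idCell (𝟙 (F.obj x))) M.sum_unit).symm))
  r₁_unit x y z _ := hb.r₁_isId x y z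
  r₂_unit x y z _ := hb.r₂_isId x y z
  v_unit x y _ := hb.vc_isId x y

/-- The quasi-strict symmetric monoidal structure of a braiding. -/
def quasiStrict (hb : IsBraiding b) : QuasiStrict C where
  mon := M
  sym := hb.symmetryData
  isSymmetric := hb.isSymmetric
  R₁_id := isIdentity_eqToHom hb.hexR_eq
  R₂_id := isIdentity_eqToHom hb.hexL_eq
  v_id := isIdentity_eqToHom hb.double_eq
  nat_id_left f y := hb.natL_isId f y
  nat_id_right x _ _ g := hb.natR_isId x g
  sigma_left x y _ _ g := hb.sigma_left x y g
  sigma_right f x y := hb.sigma_right f x y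

end CubicalMonoid.IsBraiding

/-! ### The braiding of a quasi-strict structure -/

section OfQuasiStrict

open scoped Pseudofunctor.StrongTrans

variable {C : Type u} [Bicategory.{u, u} C] [Strict C]

/-- The braiding of a quasi-strict structure. The equations between 1-cells are read off from the
components of `v`, of the unit condition and of `R₁`, which are identities. -/
lemma QuasiStrict.isBraiding (Q : QuasiStrict C) : CubicalMonoid.IsBraiding Q.sym.b where
  nat p hp := by
    cases hp with
    | left f c => exact Q.nat_id_left f c
    | right c g => exact Q.nat_id_right c g
  symm x y := eq_of_idCell ((CubicalMonoid.double_app Q.sym.b x y).symm.trans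
    (congrArg (fun α => idCell (α.app (x, y))) Q.v_id.eq))
  unit x := (Q.isSymmetric.b_unit_left.app x).trans
    (congrArg (fun F => idCell (𝟙 (F.obj x))) Q.mon.unit_sum)
  hex x y z := (congrArg (fun α => idCell (α.app (x, (y, z)))) Q.R₁_id.eq).trans
    (CubicalMonoid.hexR_app Q.sym.b x y z)
  sigma_left x y _ _ g := Q.sigma_left x y g
  sigma_right f x y := Q.sigma_right f x y

lemma iso_ext_isIdentity {X : Type u} [Category.{u} X] {a b : X} {e e' : a ≅ b}
    (h : IsIdentity e.hom) (h' : IsIdentity e'.hom) : e = e' :=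
  Iso.ext (eq_of_heq (h.heq h' rfl))

/-- A quasi-strict structure is determined by its multiplication and the components of its
braiding. -/
lemma QuasiStrict.ext_app {P Q : QuasiStrict C} (hm : P.mon = Q.mon)
    (h : ∀ x y : C, idCell (P.sym.b.app (x, y)) = idCell (Q.sym.b.app (x, y))) : P = Q := by
  have hP := fun {x y} (p : x ⟶ y) => P.isBraiding.nat p
  have hQ := fun {x y} (p : x ⟶ y) => Q.isBraiding.nat p
  obtain ⟨M, ⟨b, e, R₁, R₂, v⟩, s, i₁, i₂, i₃, n₁, n₂, n₃, n₄⟩ := P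
  obtain ⟨M', ⟨b', e', R₁', R₂', v'⟩, s', i₁', i₂', i₃', n₁', n₂', n₃', n₄'⟩ := Q
  dsimp only at hm
  subst hm
  have hb : b = b' := trans_ext (Slice₂ C C) gen_slice₂ hP hQ fun x => eq_of_idCell (h x.1 x.2)
  subst hb
  have h₁ : R₁ = R₁' := iso_ext_isIdentity i₁ i₁'
  have h₂ : R₂ = R₂' := iso_ext_isIdentity i₂ i₂'
  have h₃ : v = v' := iso_ext_isIdentity i₃ i₃'
  subst h₁ h₂ h₃
  rfl

end OfQuasiStrict

/-! ### Tensored transformations and interchange -/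

namespace Gray

open scoped Pseudofunctor.StrongTrans

section Interchange

variable {A B : Type u} [Bicategory.{u, u} A] [Bicategory.{u, u} B] [Strict A] [Strict B]

lemma isId₂_of_val {x y : Gray A B} {f g : x ⟶ y} {η : f ⟶ g} (h : f = g) (hη : IsId₂ η.val) :
    IsId₂ η :=
  ⟨h, Factor.proj_isId hη ((isId₂_eqToHom h).map (Factor.proj _).toPseudofunctor)⟩

lemma cell_of_val {x y x' y' : Gray A B} {f g : x ⟶ y} {f' g' : x' ⟶ y'} {η : f ⟶ g}
    {η' : f' ⟶ g'} (h : idCell f = idCell f') (h' : idCell g = idCell g') (hη : IsId₂ η.val)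
    (hη' : IsId₂ η'.val) : Cell.mk η = Cell.mk η' := by
  cases h
  cases eq_of_idCell h'
  exact congrArg Cell.mk (Factor.proj_isId hη hη')

lemma exchange_eq {a a' : A} {b b' : B} (f : a ⟶ a') (g : b ⟶ b') :
    CategoryStruct.comp (X := (a, b)) (Y := (a, b')) (Z := (a', b')) (𝟙 a, g) (f, 𝟙 b') =
      CategoryStruct.comp (X := (a, b)) (Y := (a', b)) (Z := (a', b')) (f, 𝟙 b) (𝟙 a', g) :=
  Prod.ext ((Strict.id_comp f).trans (Strict.comp_id f).symm)
    ((Strict.comp_id g).trans (Strict.id_comp g).symm)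

lemma interchange_eq {a a' : A} {b b' : B} (f : a ⟶ a') (g : b ⟶ b') :
    (wordsProj A B).map (right a g ≫ left f b').word =
      (wordsProj A B).map (left f b ≫ right a' g).word :=
  ((wordsProj A B).map_comp (wRight a g) (wLeft f b')).trans
    ((congrArg₂ (· ≫ ·) (proj_right a g) (proj_left f b')).trans
      ((exchange_eq f g).trans ((congrArg₂ (· ≫ ·) (proj_left f b) (proj_right a' g)).symm.trans
        ((wordsProj A B).map_comp (wLeft f b) (wRight a' g)).symm)))

/-- The interchange 2-cell of the Gray tensor product. -/
def interchange {a a' : A} {b b' : B} (f : a ⟶ a') (g : b ⟶ b') :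
    right a g ≫ left f b' ≅ left f b ≫ right a' g :=
  Factor.isoMk (eqToIso (interchange_eq f g))

lemma interchange_hom_val {a a' : A} {b b' : B} (f : a ⟶ a') (g : b ⟶ b') :
    IsId₂ (interchange f g).hom.val := isId₂_eqToHom (interchange_eq f g)

lemma interchange_inv_val {a a' : A} {b b' : B} (f : a ⟶ a') (g : b ⟶ b') :
    IsId₂ (interchange f g).inv.val := isId₂_eqToHom (interchange_eq f g).symm

lemma comp_val_isId {x y : Gray A B} {f g h : x ⟶ y} {η : f ⟶ g} {θ : g ⟶ h} (hη : IsId₂ η.val)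
    (hθ : IsId₂ θ.val) : IsId₂ (η ≫ θ).val := hη.comp hθ

end Interchange

section Tensor

variable {A A' B : Type u} [Bicategory.{u, u} A] [Bicategory.{u, u} A'] [Bicategory.{u, u} B]
  [Strict A] [Strict A'] [Strict B] {F G : StrictPseudofunctor A A'}
  {α : F.toPseudofunctor ⟶ G.toPseudofunctor}

lemma tensorRight_val (hα : ∀ {x y : A} (f : x ⟶ y), IsId₂ (α.naturality f).hom) {x y : Gray A B}
    (w : x ⟶ y) : IsId₂ ((tensorRight α B).naturality w).hom.val :=
  (isId₂_eqToHom ((tensorRightData α).src_eq w)).comp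
    ((isId₂_pair (hα _)
      (isId₂_eqToHom ((Strict.comp_id _).trans (Strict.id_comp _).symm))).comp
        (isId₂_eqToHom ((tensorRightData α).tgt_eq w)))

lemma tensorLeft_val (hα : ∀ {x y : A} (f : x ⟶ y), IsId₂ (α.naturality f).hom) {x y : Gray B A}
    (w : x ⟶ y) : IsId₂ ((tensorLeft B α).naturality w).hom.val :=
  (isId₂_eqToHom ((tensorLeftData α).src_eq w)).comp
    ((isId₂_pair
      (isId₂_eqToHom ((Strict.comp_id _).trans (Strict.id_comp _).symm)) (hα _)).comp
        (isId₂_eqToHom ((tensorLeftData α).tgt_eq w)))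

/-- The naturality 2-cells of `α ⊗ B` at the 1-cells `f ⊗ 1` are identities. -/
lemma tensorRight_left (hα : ∀ {x y : A} (f : x ⟶ y), IsId₂ (α.naturality f).hom) {x y : A}
    (f : x ⟶ y) (z : B) : IsId₂ ((tensorRight α B).naturality (left f z)).hom := by
  refine isId₂_of_val (eq_of_idCell ?_) (tensorRight_val hα _)
  refine (idCell_comp (g' := left (α.app y) z) (map_left F _ f z) rfl).trans (Eq.trans ?_
    (idCell_comp (f' := left (α.app x) z) rfl (map_left G _ f z)).symm)
  exact congrArg idCell ((left_comp _ _ _).symm.trans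
    ((congrArg (fun t => left t z) (hα f).1).trans (left_comp _ _ _)))

/-- The naturality 2-cells of `B ⊗ α` at the 1-cells `1 ⊗ f` are identities. -/
lemma tensorLeft_right (hα : ∀ {x y : A} (f : x ⟶ y), IsId₂ (α.naturality f).hom) (z : B) {x y : A}
    (f : x ⟶ y) : IsId₂ ((tensorLeft B α).naturality (right z f)).hom := by
  refine isId₂_of_val (eq_of_idCell ?_) (tensorLeft_val hα _)
  refine (idCell_comp (g' := right z (α.app y)) (map_right _ F z f) rfl).trans (Eq.trans ?_
    (idCell_comp (f' := right z (α.app x)) rfl (map_right _ G z f)).symm)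
  exact congrArg idCell ((right_comp _ _ _).symm.trans
    ((congrArg (fun t => right z t) (hα f).1).trans (right_comp _ _ _)))

/-- The naturality 2-cells of `α ⊗ B` at the 1-cells `1 ⊗ g` are interchange 2-cells. -/
lemma tensorRight_right (hα : ∀ {x y : A} (f : x ⟶ y), IsId₂ (α.naturality f).hom) (x : A)
    {z z' : B} (g : z ⟶ z') : Cell.mk ((tensorRight α B).naturality (right x g)).hom =
      Cell.mk (interchange (α.app x) g).hom :=
  cell_of_val (idCell_comp (g' := left (α.app x) z') (map_right F _ x g) rfl)
    (idCell_comp (f' := left (α.app x) z) rfl (map_right G _ x g)) (tensorRight_val hα _)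
    (interchange_hom_val _ _)

/-- The naturality 2-cells of `B ⊗ α` at the 1-cells `f ⊗ 1` are inverse interchange 2-cells. -/
lemma tensorLeft_left (hα : ∀ {x y : A} (f : x ⟶ y), IsId₂ (α.naturality f).hom) {z z' : B}
    (f : z ⟶ z') (x : A) : Cell.mk ((tensorLeft B α).naturality (left f x)).hom =
      Cell.mk (interchange f (α.app x)).inv :=
  cell_of_val (idCell_comp (g' := right z' (α.app x)) (map_left _ F f x) rfl)
    (idCell_comp (f' := right z (α.app x)) rfl (map_left _ G f x)) (tensorLeft_val hα _)
    (interchange_inv_val _ _)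

end Tensor

end Gray

section Sigma

variable {C : Type u} [Bicategory.{u, u} C] [Strict C] (N : GrayMonoid C)

lemma GrayMonoid.sigma_cell {a a' b b' : C} (f : a ⟶ a') (g : b ⟶ b') :
    Cell.mk (N.cubical.sigma f g).hom = Cell.mk (N.sum.map₂ (Gray.interchange f g).hom) := by
  have h : Cell.mk (((Gray.cub C C).mapComp (a := (a, b)) (b := (a, b')) (c := (a', b'))
      (𝟙 a, g) (f, 𝟙 b')).inv ≫ (Gray.cub C C).map₂ (eqToHom (Gray.exchange_eq f g)) ≫
      ((Gray.cub C C).mapComp (a := (a, b)) (b := (a', b)) (c := (a', b')) (f, 𝟙 b)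
        (𝟙 a', g)).hom) = Cell.mk (Gray.interchange f g).hom :=
    Gray.cell_of_val
      (idCell_comp (congrArg idCell (Gray.cub_map_right a g))
        (congrArg idCell (Gray.cub_map_left f b')))
      (idCell_comp (congrArg idCell (Gray.cub_map_left f b))
        (congrArg idCell (Gray.cub_map_right a' g)))
      (Gray.comp_val_isId (isId₂_eqToHom ((Gray.cubData C C).eq_comp (x := (a, b)) (y := (a, b'))
        (z := (a', b')) (𝟙 a, g) (f, 𝟙 b')).symm) (Gray.comp_val_isId
        (isId₂_of_cell (Gray.cub_val _) (isId₂_eqToHom (Gray.exchange_eq f g)))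
        (Gray.cub_mapComp_val _ _)))
      (Gray.interchange_hom_val f g)
  refine Eq.trans ?_ (cell_map N.sum.toPseudofunctor h)
  refine Eq.trans ?_ (congrArg Cell.mk ((N.sum.map₂_comp _ _).trans
    (congrArg (fun t => _ ≫ t) (N.sum.map₂_comp _ _))).symm)
  exact cell_comp (cell_inv (η' := N.sum.map₂Iso _) (comp_mapComp_strict _ _ _ _))
    (cell_comp rfl (comp_mapComp_strict _ _ _ _))

lemma GrayMonoid.sigma_cell_inv {a a' b b' : C} (f : a ⟶ a') (g : b ⟶ b') :
    Cell.mk (N.cubical.sigma f g).inv = Cell.mk (N.sum.map₂ (Gray.interchange f g).inv) :=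
  cell_inv (η' := N.sum.map₂Iso (Gray.interchange f g)) (N.sigma_cell f g)

lemma GrayMonoid.rwh_cell {a b : C} (f : a ⟶ b) (z : C) :
    idCell (N.cubical.rwh f z) = idCell (N.sum.map (Gray.left f z)) :=
  idCell_map N.sum.toPseudofunctor (congrArg idCell (Gray.cub_map_left f z))

lemma GrayMonoid.lwh_cell (z : C) {a b : C} (f : a ⟶ b) :
    idCell (N.cubical.lwh z f) = idCell (N.sum.map (Gray.right z f)) :=
  idCell_map N.sum.toPseudofunctor (congrArg idCell (Gray.cub_map_right z f))

end Sigma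

/-! ### The braiding of a permutative structure -/

open scoped Pseudofunctor.StrongTrans

section Composite

variable {C : Type u} [Bicategory.{u, u} C] [Strict C]

lemma IsComposite.idCell {a b b' c a' c' : C} {p : a ⟶ b} {q : b' ⟶ c} {r : a' ⟶ c'}
    (h : IsComposite p q r) (e : b = b') : idCell r = idCell (p ≫ eqToHom e ≫ q) := by
  cases h
  exact idCell_comp rfl (congrArg GrayPerm.idCell (Strict.id_comp q).symm)

lemma isComposite_of_idCell {a b b' c a' c' : C} {p : a ⟶ b} {q : b' ⟶ c} {r : a' ⟶ c'}
    (e : b = b') (h : idCell r = idCell (p ≫ eqToHom e ≫ q)) : IsComposite p q r := by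
  subst e
  have h' : idCell r = idCell (p ≫ q) :=
    h.trans (idCell_comp rfl (congrArg GrayPerm.idCell (Strict.id_comp q)))
  cases h'
  exact .mk p q

end Composite

section Naturality

variable {X D : Type u} [Bicategory.{u, u} X] [Bicategory.{u, u} D] {F G : Pseudofunctor X D}
  {α : F ⟶ G}

lemma isId₂_naturality_of_eq {x y : X} {p p' : x ⟶ y} (h : p = p')
    (hp : IsId₂ (α.naturality p').hom) : IsId₂ (α.naturality p).hom := by
  subst h
  exact hp

end Naturality

namespace Gray

variable {C : Type u} [Bicategory.{u, u} C] [Strict C] (T : StrictPseudofunctor (Gray C C) C)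

lemma map_left_inverse {a b : C} {f : a ⟶ b} {g : b ⟶ a} (h : f ≫ g = 𝟙 a) (z : C) :
    T.map (left f z) ≫ T.map (left g z) = 𝟙 (T.obj (pt a z)) :=
  (T.map_comp _ _).symm.trans ((congrArg T.map ((left_comp f g z).symm.trans
    ((congrArg (fun t => left t z) h).trans (left_id a z)))).trans (T.map_id _))

lemma map_right_inverse (z : C) {a b : C} {f : a ⟶ b} {g : b ⟶ a} (h : f ≫ g = 𝟙 a) :
    T.map (right z f) ≫ T.map (right z g) = 𝟙 (T.obj (pt z a)) :=
  (T.map_comp _ _).symm.trans ((congrArg T.map ((right_comp z f g).symm.trans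
    ((congrArg (fun t => right z t) h).trans (right_id z a)))).trans (T.map_id _))

variable (C) in
/-- The 2-functor with values `y ⊗ (x ⊗ z)` at `(x ⊗ y) ⊗ z`. -/
abbrev rotate : StrictPseudofunctor (Gray (Gray C C) C) (Gray C (Gray C C)) :=
  (map (swap C C) (StrictPseudofunctor.id C)).comp (assoc C C C)

lemma rotate_fst {x x' : C} (f : x ⟶ x') (y z : C) :
    (rotate C).map (left (left f y) z) = right y (left f z) :=
  eq_of_idCell (comp_idCell (swapId_left_left f y z) (assoc_left_right y f z))

lemma rotate_snd (x : C) {y y' : C} (g : y ⟶ y') (z : C) :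
    (rotate C).map (left (right x g) z) = left g (pt x z) :=
  eq_of_idCell (comp_idCell (swapId_left_right x g z) (assoc_left_left g x z))

lemma rotate_trd (x y : C) {z z' : C} (h : z ⟶ z') :
    (rotate C).map (right (pt x y) h) = right y (right x h) :=
  eq_of_idCell (comp_idCell (swapId_right x y h) (assoc_right y x h))

variable {T} {β : T.toPseudofunctor ⟶ ((swap C C).comp T).toPseudofunctor}

variable (β) in
/-- The transformation with components `β_{x,y} ⊕ z`. -/
abbrev hexFst := whiskerR (tensorRight β C) T.toPseudofunctor

variable (β) in
/-- The transformation with components `y ⊕ β_{x,z}`. -/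
abbrev hexSnd := whiskerL (rotate C).toPseudofunctor (whiskerR (tensorLeft C β) T.toPseudofunctor)

/-- `β ⊕ z` is strictly natural in the first two variables. -/
lemma hexFst_left (hβ : ∀ {x y : Gray C C} (w : x ⟶ y), IsId₂ (β.naturality w).hom)
    {x y : Gray C C} (f : x ⟶ y) (z : C) : IsId₂ ((hexFst β).naturality (left f z)).hom :=
  isId₂_whiskerR_strict T ((tensorRight_left hβ f z).map T.toPseudofunctor)

/-- `y ⊕ β_{x,z}` is strictly natural in `x`. -/
lemma hexSnd_fst (hβ : ∀ {x y : Gray C C} (w : x ⟶ y), IsId₂ (β.naturality w).hom)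
    {x x' : C} (f : x ⟶ x') (y z : C) :
    IsId₂ ((hexSnd β).naturality (left (left f y) z)).hom :=
  isId₂_naturality_of_eq (α := whiskerR (tensorLeft C β) T.toPseudofunctor) (rotate_fst f y z)
    (isId₂_whiskerR_strict T ((tensorLeft_right hβ y (left f z)).map T.toPseudofunctor))

/-- `y ⊕ β_{x,z}` is strictly natural in `z`. -/
lemma hexSnd_trd (hβ : ∀ {x y : Gray C C} (w : x ⟶ y), IsId₂ (β.naturality w).hom)
    (x y : C) {z z' : C} (h : z ⟶ z') :
    IsId₂ ((hexSnd β).naturality (right (pt x y) h)).hom :=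
  isId₂_naturality_of_eq (α := whiskerR (tensorLeft C β) T.toPseudofunctor) (rotate_trd x y h)
    (isId₂_whiskerR_strict T ((tensorLeft_right hβ y (right x h)).map T.toPseudofunctor))

end Gray

namespace GrayMonoid

variable {C : Type u} [Bicategory.{u, u} C] [Strict C] {N : GrayMonoid C}
  {β : N.sum.toPseudofunctor ⟶ ((Gray.swap C C).comp N.sum).toPseudofunctor}

/-- `β_{x,y} ⊕ z` is strictly natural in `z` if and only if the interchange 2-cells of `β_{x,y}` and
the 1-cells of the third variable are identities. -/
lemma hexFst_trd (hβ : ∀ {x y : Gray C C} (w : x ⟶ y), IsId₂ (β.naturality w).hom) (x y : C)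
    {z z' : C} (h : z ⟶ z') : IsId₂ ((Gray.hexFst β).naturality (Gray.right (Gray.pt x y) h)).hom ↔
      IsId₂ (N.cubical.sigma (β.app (Gray.pt x y)) h).hom := by
  have e := (N.sigma_cell (β.app (Gray.pt x y)) h).trans
    (cell_map N.sum.toPseudofunctor (Gray.tensorRight_right hβ (Gray.pt x y) h)).symm
  exact ⟨fun k => isId₂_of_cell e (isId₂_of_whiskerR_strict N.sum k),
    fun k => isId₂_whiskerR_strict N.sum (isId₂_of_cell e.symm k)⟩

/-- `y ⊕ β_{x,z}` is strictly natural in `y` if and only if the interchange 2-cells of the 1-cells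
of the second variable and `β_{x,z}` are identities. -/
lemma hexSnd_snd (hβ : ∀ {x y : Gray C C} (w : x ⟶ y), IsId₂ (β.naturality w).hom) (x : C)
    {y y' : C} (g : y ⟶ y') (z : C) :
    IsId₂ ((Gray.hexSnd β).naturality (Gray.left (Gray.right x g) z)).hom ↔
      IsId₂ (N.cubical.sigma g (β.app (Gray.pt x z))).hom := by
  have e := (N.sigma_cell_inv g (β.app (Gray.pt x z))).trans
    (cell_map N.sum.toPseudofunctor (Gray.tensorLeft_left hβ g (Gray.pt x z))).symm
  constructor
  · intro k
    have k' : IsId₂ ((whiskerR (Gray.tensorLeft C β) N.sum.toPseudofunctor).naturality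
        (Gray.left g (Gray.pt x z))).hom := isId₂_naturality_of_eq
          (α := whiskerR (Gray.tensorLeft C β) N.sum.toPseudofunctor)
          (Gray.rotate_snd x g z).symm k
    exact (isId₂_of_cell e (isId₂_of_whiskerR_strict N.sum k')).inv
      (η := (N.cubical.sigma g (β.app (Gray.pt x z))).symm)
  · intro k
    exact isId₂_naturality_of_eq (α := whiskerR (Gray.tensorLeft C β) N.sum.toPseudofunctor)
      (Gray.rotate_snd x g z) (isId₂_whiskerR_strict N.sum (isId₂_of_cell e.symm k.inv))

end GrayMonoid

namespace Permutative

variable {C : Type u} [Bicategory.{u, u} C] [Strict C] (P : Permutative C)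

/-- The braiding on the cartesian product. -/
abbrev braid : P.mon.cubical.sum ⟶ P.mon.cubical.opSum := Gray.toCub P.β

lemma braid_app (x y : C) : idCell (P.braid.app (x, y)) = idCell (P.β.app (Gray.pt x y)) :=
  Gray.toCub_app P.β x y

lemma hex (x y z : C) : idCell (P.β.app (Gray.pt x (P.mon.cubical.add y z))) =
    idCell (P.mon.cubical.rwh (P.β.app (Gray.pt x y)) z ≫ P.mon.cubical.asc y x z ≫
      P.mon.cubical.lwh y (P.β.app (Gray.pt x z))) := by
  refine ((P.hexagon.app (Gray.pt (Gray.pt x y) z)).idCell (P.mon.cubical.add_assoc y x z)).trans ?_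
  exact idCell_comp (P.mon.rwh_cell _ _).symm (idCell_comp rfl (P.mon.lwh_cell _ _).symm)

/-- In the hexagon, `β (id ⊗ ⊕)` and `y ⊕ β_{x,z}` are strictly natural in `z`, and the latter is
invertible; hence so is `β_{x,y} ⊕ z`, whose naturality 2-cell is the interchange 2-cell. -/
lemma isId₂_sigma_left (x y : C) {z z' : C} (h : z ⟶ z') :
    IsId₂ (P.mon.cubical.sigma (P.β.app (Gray.pt x y)) h).hom := by
  obtain ⟨k, hk, _⟩ := P.invertible (Gray.pt x z')
  exact (GrayMonoid.hexFst_trd P.natural x y h).1 (P.hexagon.isId₂_left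
    (Gray.hexSnd_trd P.natural x y h) (P.natural _)
    ⟨_, Gray.map_right_inverse P.mon.sum y hk⟩)

/-- In the hexagon, `β (id ⊗ ⊕)` and `β_{x,y} ⊕ z` are strictly natural in `y`, and the latter is
invertible; hence so is `y ⊕ β_{x,z}`, whose naturality 2-cell is the inverse interchange 2-cell. -/
lemma isId₂_sigma_right {y y' : C} (g : y ⟶ y') (x z : C) :
    IsId₂ (P.mon.cubical.sigma g (P.β.app (Gray.pt x z))).hom := by
  obtain ⟨k, _, hk⟩ := P.invertible (Gray.pt x y)
  exact (GrayMonoid.hexSnd_snd P.natural x g z).1 (P.hexagon.isId₂_right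
    (Gray.hexFst_left P.natural (Gray.right x g) z) (P.natural _)
    ⟨_, Gray.map_left_inverse P.mon.sum hk z⟩)

/-- The restriction of a permutative braiding to the cartesian product is quasi-strict. -/
lemma isBraiding : CubicalMonoid.IsBraiding P.braid where
  nat p hp := Gray.toCub_isId P.natural hp
  symm x y := eq_of_idCell ((idCell_comp (P.braid_app x y) (P.braid_app y x)).trans
    (((P.symmetry.app (Gray.pt x y)).idCell rfl).trans
      (idCell_comp rfl (congrArg idCell (Strict.id_comp _)))).symm)
  unit x := (P.braid_app _ _).trans ((P.unit.app x).trans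
    (congrArg (fun F => idCell (𝟙 (F.obj x))) P.mon.unit_sum))
  hex x y z := (P.braid_app _ _).trans ((P.hex x y z).trans
    (idCell_comp (CubicalMonoid.rwh_congr rfl (P.braid_app x y)).symm
      (idCell_comp rfl (CubicalMonoid.lwh_congr rfl (P.braid_app x z)).symm)))
  sigma_left x y _ _ h := by
    have e : P.braid.app (x, y) = P.β.app (Gray.pt x y) := eq_of_idCell (P.braid_app x y)
    rw [e]
    exact P.isId₂_sigma_left x y h
  sigma_right g x y := by
    have e : P.braid.app (x, y) = P.β.app (Gray.pt x y) := eq_of_idCell (P.braid_app x y)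
    rw [e]
    exact P.isId₂_sigma_right g x y

end Permutative

/-! ### The permutative structure of a braiding -/

namespace GrayMonoid

variable {C : Type u} [Bicategory.{u, u} C] [Strict C] (N : GrayMonoid C)

lemma inclRight_swap_sum : (Gray.inclRight N.unit C).comp ((Gray.swap C C).comp N.sum) =
    StrictPseudofunctor.id C := by
  have e : (Gray.inclRight N.unit C).comp (Gray.swap C C) = Gray.inclLeft C N.unit := by
    refine Gray.ext_gray_strict (fun f => Gray.swap_right N.unit f) ?_ ?_
    · rw [strict_assoc, Gray.swap_pfst]
      exact Gray.strict_cell_ext fun {x y f g} η => (Gray.cell_snd (cell_conj _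
        ((𝟙 (𝟙 N.unit), η) : ((𝟙 N.unit, f) : (N.unit, x) ⟶ (N.unit, y)) ⟶ (𝟙 N.unit, g)) _)).trans
        (Gray.cell_fst (cell_conj _
          ((η, 𝟙 (𝟙 N.unit)) : ((f, 𝟙 N.unit) : (x, N.unit) ⟶ (y, N.unit)) ⟶ (g, 𝟙 N.unit)) _)).symm
    · rw [strict_assoc, Gray.swap_psnd]
      exact Gray.strict_cell_ext fun {x y f g} η => (Gray.cell_fst (cell_conj _
        ((𝟙 (𝟙 N.unit), η) : ((𝟙 N.unit, f) : (N.unit, x) ⟶ (N.unit, y)) ⟶ (𝟙 N.unit, g)) _)).trans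
        (Gray.cell_snd (cell_conj _
          ((η, 𝟙 (𝟙 N.unit)) : ((f, 𝟙 N.unit) : (x, N.unit) ⟶ (y, N.unit)) ⟶ (g, 𝟙 N.unit)) _)).symm
  rw [← strict_assoc, e, N.sum_unit]

lemma swap_swap_sum : (Gray.swap C C).comp ((Gray.swap C C).comp N.sum) = N.sum := by
  rw [← strict_assoc, Gray.swap_swap]
  exact strict_ext rfl

lemma mapSum_sum : (Gray.map N.sum (StrictPseudofunctor.id C)).comp N.sum =
    ((Gray.assoc C C C).comp (Gray.map (StrictPseudofunctor.id C) N.sum)).comp N.sum :=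
  N.assoc.trans (strict_assoc _ _ _).symm

lemma mapOpSum_sum : (Gray.map ((Gray.swap C C).comp N.sum) (StrictPseudofunctor.id C)).comp N.sum =
    (Gray.rotate C).comp ((Gray.map (StrictPseudofunctor.id C) N.sum).comp N.sum) := by
  have e : Gray.map ((Gray.swap C C).comp N.sum) (StrictPseudofunctor.id C) =
      (Gray.map (Gray.swap C C) (StrictPseudofunctor.id C)).comp
        (Gray.map N.sum (StrictPseudofunctor.id C)) :=
    Gray.map_comp (Gray.swap C C) N.sum (StrictPseudofunctor.id C) (StrictPseudofunctor.id C)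
  rw [e, strict_assoc, N.assoc, strict_assoc]

/-- The hexagon of the symmetry and associativity identify the sums `y ⊕ (z ⊕ x)` and `(y ⊕ z) ⊕ x`,
as 2-functors of `(x ⊗ y) ⊗ z`. -/
lemma rotate_mapOpSum_sum : (Gray.rotate C).comp
      ((Gray.map (StrictPseudofunctor.id C) ((Gray.swap C C).comp N.sum)).comp N.sum) =
    ((Gray.assoc C C C).comp (Gray.map (StrictPseudofunctor.id C) N.sum)).comp
      ((Gray.swap C C).comp N.sum) := by
  have e : Gray.map (StrictPseudofunctor.id C) ((Gray.swap C C).comp N.sum) =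
      (Gray.map (StrictPseudofunctor.id C) (Gray.swap C C)).comp
        (Gray.map (StrictPseudofunctor.id C) N.sum) :=
    Gray.map_comp (StrictPseudofunctor.id C) (StrictPseudofunctor.id C) (Gray.swap C C) N.sum
  rw [e, ← strict_assoc, ← strict_assoc, Gray.swap_hexagon, strict_assoc, strict_assoc,
    strict_assoc, ← N.assoc,
    ← strict_assoc (Gray.swap C (Gray C C)), ← Gray.map_swap, strict_assoc, strict_assoc]

end GrayMonoid

namespace CubicalMonoid.IsBraiding

variable {C : Type u} [Bicategory.{u, u} C] [Strict C] {N : GrayMonoid C}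
  {b : N.cubical.sum ⟶ N.cubical.opSum} (hb : IsBraiding b)

/-- The 2-natural isomorphism on the Gray tensor product of a braiding. -/
abbrev extend : N.sum.toPseudofunctor ⟶ ((Gray.swap C C).comp N.sum).toPseudofunctor :=
  Gray.extendBraiding b hb.nat

lemma extend_isId {x y : Gray C C} (w : x ⟶ y) : IsId₂ (hb.extend.naturality w).hom :=
  Gray.extendBraiding_isId b hb.nat w

lemma extend_app (x y : C) : idCell (hb.extend.app (Gray.pt x y)) = idCell (b.app (x, y)) :=
  Gray.extendBraiding_app b hb.nat x y

lemma extend_symm (x y : C) :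
    idCell (hb.extend.app (Gray.pt x y) ≫ hb.extend.app (Gray.pt y x)) =
      idCell (𝟙 (N.sum.obj (Gray.pt x y))) :=
  (idCell_comp (hb.extend_app x y) (hb.extend_app y x)).trans (congrArg idCell (hb.symm x y))

lemma extend_hex (x y z : C) : idCell (hb.extend.app (Gray.pt x (N.cubical.add y z))) =
    idCell (N.sum.map (Gray.left (hb.extend.app (Gray.pt x y)) z) ≫ N.cubical.asc y x z ≫
      N.sum.map (Gray.right y (hb.extend.app (Gray.pt x z)))) :=
  (hb.extend_app _ _).trans ((hb.hex x y z).trans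
    (idCell_comp ((rwh_congr rfl (hb.extend_app x y).symm).trans (N.rwh_cell _ _))
      (idCell_comp rfl ((lwh_congr rfl (hb.extend_app x z).symm).trans (N.lwh_cell _ _)))))

/-- The first factor of the hexagon is strictly natural. In the third variable this is the vanishing
of the interchange 2-cells of `b` on the left. -/
lemma hexFst_isId {x y : Gray (Gray C C) C} {w : x ⟶ y} (hw : Gray.Basic₃ x y w) :
    IsId₂ ((Gray.hexFst hb.extend).naturality w).hom := by
  cases hw with
  | fst f y z => exact Gray.hexFst_left hb.extend_isId _ _
  | snd x g z => exact Gray.hexFst_left hb.extend_isId _ _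
  | trd x y h =>
    refine (GrayMonoid.hexFst_trd hb.extend_isId x y h).2 ?_
    have e : hb.extend.app (Gray.pt x y) = b.app (x, y) := eq_of_idCell (hb.extend_app x y)
    rw [e]
    exact hb.sigma_left x y h

/-- The second factor of the hexagon is strictly natural. In the second variable this is the
vanishing of the interchange 2-cells of `b` on the right. -/
lemma hexSnd_isId {x y : Gray (Gray C C) C} {w : x ⟶ y} (hw : Gray.Basic₃ x y w) :
    IsId₂ ((Gray.hexSnd hb.extend).naturality w).hom := by
  cases hw with
  | fst f y z => exact Gray.hexSnd_fst hb.extend_isId f y z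
  | snd x g z =>
    refine (GrayMonoid.hexSnd_snd hb.extend_isId x g z).2 ?_
    have e : hb.extend.app (Gray.pt x z) = b.app (x, z) := eq_of_idCell (hb.extend_app x z)
    rw [e]
    exact hb.sigma_right g x z
  | trd x y h => exact Gray.hexSnd_trd hb.extend_isId x y h

/-- The permutative structure of a braiding. -/
def permutative : Permutative C where
  mon := N
  β := hb.extend
  natural w := hb.extend_isId w
  invertible := by
    rintro ⟨⟨⟨x, y⟩⟩⟩
    exact ⟨hb.extend.app (Gray.pt y x), eq_of_idCell (hb.extend_symm x y),
      eq_of_idCell (hb.extend_symm y x)⟩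
  symmetry := isComposite_trans (AllCells _) gen_all rfl rfl
    (congrArg (fun T => T.toPseudofunctor) N.swap_swap_sum)
    (fun w _ => hb.extend_isId w) (fun w _ => hb.extend_isId ((Gray.swap C C).map w))
    (fun w _ => isId₂_ofEq rfl w)
    (by
      rintro ⟨⟨⟨x, y⟩⟩⟩
      exact isComposite_of_idCell rfl ((hb.extend_symm x y).symm.trans
        (idCell_comp rfl (idCell_eqToHom_comp rfl _).symm)))
  unit := isIdentity_of_sameArrow (c := (StrictPseudofunctor.id C).toPseudofunctor)
    (sameArrow_trans (AllCells C) gen_all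
      (congrArg (fun T => T.toPseudofunctor) N.unit_sum)
      (congrArg (fun T => T.toPseudofunctor) N.inclRight_swap_sum)
      (fun f _ => hb.extend_isId ((Gray.inclRight N.unit C).map f)) (fun f _ => isId₂_ofEq rfl f)
      fun x => sameArrow_iff.2 ((hb.extend_app N.unit x).trans (hb.unit x)))
  hexagon := isComposite_trans Gray.Basic₃ Gray.gen_basic₃
    (congrArg (fun T => T.toPseudofunctor) N.mapSum_sum)
    (congrArg (fun T => T.toPseudofunctor) N.mapOpSum_sum)
    (congrArg (fun T => T.toPseudofunctor) N.rotate_mapOpSum_sum)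
    (fun w hw => hb.hexFst_isId hw) (fun w hw => hb.hexSnd_isId hw)
    (fun w _ => hb.extend_isId
      (((Gray.assoc C C C).comp (Gray.map (StrictPseudofunctor.id C) N.sum)).map w))
    (by
      rintro ⟨⟨⟨⟨⟨⟨x, y⟩⟩⟩, z⟩⟩⟩
      exact isComposite_of_idCell (N.cubical.add_assoc y x z) (hb.extend_hex x y z))

end CubicalMonoid.IsBraiding

namespace Permutative

variable {C : Type u} [Bicategory.{u, u} C] [Strict C]

/-- A permutative structure is determined by its multiplication and the components of its
braiding. -/
lemma ext_app {P Q : Permutative C} (hm : P.mon = Q.mon)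
    (h : ∀ x y : C, idCell (P.β.app (Gray.pt x y)) = idCell (Q.β.app (Gray.pt x y))) : P = Q := by
  have hP := fun {x y} (p : x ⟶ y) => P.natural p
  have hQ := fun {x y} (p : x ⟶ y) => Q.natural p
  obtain ⟨M, β, _, _, _, _, _⟩ := P
  obtain ⟨M', β', _, _, _, _, _⟩ := Q
  dsimp only at hm
  subst hm
  have hb : β = β' := trans_ext (AllCells _) gen_all (fun w _ => hP w) (fun w _ => hQ w) (by
    rintro ⟨⟨⟨x, y⟩⟩⟩
    exact eq_of_idCell (h x y))
  subst hb
  rfl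

end Permutative

/-! ### The correspondence of structures -/

section Structures

variable {C : Type u} [Bicategory.{u, u} C] [Strict C]

namespace CubicalMonoid

variable {M M' : CubicalMonoid C}

/-- The transport of a transformation along an equality of cubical monoids. -/
def castBraiding (e : M = M') (b : M.sum ⟶ M.opSum) : M'.sum ⟶ M'.opSum := e ▸ b

lemma castBraiding_app (e : M = M') (b : M.sum ⟶ M.opSum) (x y : C) :
    idCell ((castBraiding e b).app (x, y)) = idCell (b.app (x, y)) := by
  cases e
  rfl

lemma IsBraiding.cast (e : M = M') {b : M.sum ⟶ M.opSum} (hb : IsBraiding b) :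
    IsBraiding (castBraiding e b) := by
  cases e
  exact hb

end CubicalMonoid

/-- The quasi-strict structure of a permutative structure. -/
def Permutative.quasiStrict (P : Permutative C) : QuasiStrict C := P.isBraiding.quasiStrict

/-- The permutative structure of a quasi-strict structure. The cubical form of the Gray-monoid of a
cubical monoid `M` is equal to `M`, but not by definition, and the braiding is transported. -/
def QuasiStrict.permutative (Q : QuasiStrict C) : Permutative C :=
  CubicalMonoid.IsBraiding.permutative (N := Q.mon.gray)
    (Q.isBraiding.cast Q.mon.gray_cubical.symm)

lemma Permutative.quasiStrict_app (P : Permutative C) (x y : C) :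
    idCell (P.quasiStrict.sym.b.app (x, y)) = idCell (P.β.app (Gray.pt x y)) := P.braid_app x y

lemma QuasiStrict.permutative_app (Q : QuasiStrict C) (x y : C) :
    idCell (Q.permutative.β.app (Gray.pt x y)) = idCell (Q.sym.b.app (x, y)) :=
  (CubicalMonoid.IsBraiding.extend_app (N := Q.mon.gray)
    (Q.isBraiding.cast Q.mon.gray_cubical.symm) x y).trans
    (CubicalMonoid.castBraiding_app Q.mon.gray_cubical.symm Q.sym.b x y)

lemma Permutative.quasiStrict_permutative (P : Permutative C) : P.quasiStrict.permutative = P :=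
  Permutative.ext_app P.mon.cubical_gray fun x y =>
    (P.quasiStrict.permutative_app x y).trans (P.quasiStrict_app x y)

lemma QuasiStrict.permutative_quasiStrict (Q : QuasiStrict C) : Q.permutative.quasiStrict = Q :=
  QuasiStrict.ext_app Q.mon.gray_cubical fun x y =>
    (Q.permutative.quasiStrict_app x y).trans (Q.permutative_app x y)

end Structures

/-! ### The correspondence of strict functors -/

section Functors

lemma SameArrow.app {X D : Type u} [Bicategory.{u, u} X] [Bicategory.{u, u} D]
    {F G F' G' : Pseudofunctor X D} {α : F ⟶ G} {β : F' ⟶ G'} (h : SameArrow α β) (x : X) :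
    SameArrow (α.app x) (β.app x) := by
  cases h
  exact .mk _

variable {C D : Type u} [Bicategory.{u, u} C] [Bicategory.{u, u} D] [Strict C] [Strict D]

/-- A 2-functor preserves a sum on Gray tensor products if and only if it preserves the
corresponding cubical functor. -/
lemma Gray.map_comp_iff (H : StrictPseudofunctor C D) (T : StrictPseudofunctor (Gray C C) C)
    (T' : StrictPseudofunctor (Gray D D) D) :
    (Gray.map H H).comp T' = T.comp H ↔
      (prodMap H.toPseudofunctor H.toPseudofunctor).comp ((Gray.cub D D).comp T'.toPseudofunctor) =
        ((Gray.cub C C).comp T.toPseudofunctor).comp H.toPseudofunctor := by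
  have e : (prodMap H.toPseudofunctor H.toPseudofunctor).comp
      ((Gray.cub D D).comp T'.toPseudofunctor) =
      (Gray.cub C C).comp ((Gray.map H H).comp T').toPseudofunctor := by
    rw [← comp_assoc, ← Gray.cub_map]
    exact comp_assoc _ _ _
  have e' : ((Gray.cub C C).comp T.toPseudofunctor).comp H.toPseudofunctor =
      (Gray.cub C C).comp (T.comp H).toPseudofunctor := comp_assoc _ _ _
  rw [e, e']
  exact ⟨fun h => by rw [h], fun h => (Gray.cub_bijective C C D).1 (Subtype.ext h)⟩

lemma prodMap_swap (H : StrictPseudofunctor C D) :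
    (prodMap H.toPseudofunctor H.toPseudofunctor).comp
      (Bicategory.Prod.swap D D).toPseudofunctor =
    (Bicategory.Prod.swap C C).toPseudofunctor.comp
      (prodMap H.toPseudofunctor H.toPseudofunctor) :=
  pseudofunctor_ext_cell (fun _ => rfl)
    (fun x => congrArg Cell.mk ((Category.comp_id _).trans
      (map₂_id_comp (prodMap H.toPseudofunctor H.toPseudofunctor)
        ((prodMap H.toPseudofunctor H.toPseudofunctor).mapId
          ((Bicategory.Prod.swap C C).obj x)).hom).symm))
    (fun f g => congrArg Cell.mk ((Category.comp_id _).trans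
      (map₂_id_comp (prodMap H.toPseudofunctor H.toPseudofunctor)
        ((prodMap H.toPseudofunctor H.toPseudofunctor).mapComp
          ((Bicategory.Prod.swap C C).map f) ((Bicategory.Prod.swap C C).map g)).hom).symm))

lemma cell_eq_of_isId₂ {a b a' b' : C} {f g : a ⟶ b} {f' g' : a' ⟶ b'} {η : f ⟶ g} {η' : f' ⟶ g'}
    (h : IsId₂ η) (h' : IsId₂ η') (e : idCell f = idCell f') : Cell.mk η = Cell.mk η' := by
  obtain ⟨rfl, rfl⟩ := h
  obtain ⟨rfl, rfl⟩ := h'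
  exact e

/-- A 2-functor which preserves the unit and the sum of quasi-strict structures is a strict functor
as soon as it preserves the components of the braidings. -/
def QuasiStrictHom.ofComponents {P : QuasiStrict C} {Q : QuasiStrict D}
    (H : StrictPseudofunctor C D) (hu : H.obj P.mon.unit = Q.mon.unit)
    (hs : (prodMap H.toPseudofunctor H.toPseudofunctor).comp Q.mon.sum =
      P.mon.sum.comp H.toPseudofunctor)
    (hb : ∀ x y, idCell (H.map (P.sym.b.app (x, y))) =
      idCell (Q.sym.b.app (H.obj x, H.obj y))) : QuasiStrictHom P Q where
  functor := H
  map_unit := hu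
  map_sum := hs
  map_b := sameArrow_trans (Slice₂ C C) gen_slice₂ hs.symm
    (by
      rw [comp_assoc, ← hs, ← comp_assoc, ← prodMap_swap, comp_assoc])
    (fun p hp => isId₂_whiskerR_strict H ((P.isBraiding.nat p hp).map H.toPseudofunctor))
    (fun p hp => by
      refine Q.isBraiding.nat _ ?_
      cases hp with
      | left f c => exact CubicalMonoid.slice_left (H.map f) (H.map_id c)
      | right c g => exact CubicalMonoid.slice_right (H.map_id c) (H.map g))
    fun x => sameArrow_iff.2 (hb x.1 x.2)
  map_r₁ x y z := cell_eq_of_isId₂ ((P.R₁_id.isId₂_app _).map H.toPseudofunctor)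
    (Q.R₁_id.isId₂_app _) ((hb _ _).trans
      (congrArg (fun F : Pseudofunctor (C × C) D => idCell (Q.sym.b.app (H.obj x, F.obj (y, z))))
        hs.symm))
  map_r₂ x y z := cell_eq_of_isId₂ ((P.R₂_id.isId₂_app _).map H.toPseudofunctor)
    (Q.R₂_id.isId₂_app _) ((hb _ _).trans
      (congrArg (fun F : Pseudofunctor (C × C) D => idCell (Q.sym.b.app (F.obj (x, y), H.obj z)))
        hs.symm))
  map_v x y := cell_eq_of_isId₂ ((P.v_id.isId₂_app _).map H.toPseudofunctor)
    (Q.v_id.isId₂_app _) ((idCell_map H.toPseudofunctor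
      (CubicalMonoid.double_app P.sym.b x y)).trans
      ((congrArg idCell (H.map_comp _ _)).trans ((idCell_comp (hb x y) (hb y x)).trans
        (CubicalMonoid.double_app Q.sym.b _ _).symm)))

/-- A 2-functor which preserves the unit and the sum of permutative structures is a strict functor
as soon as it preserves the components of the braidings. -/
def PermHom.ofComponents {P : Permutative C} {Q : Permutative D} (H : StrictPseudofunctor C D)
    (hu : H.obj P.mon.unit = Q.mon.unit)
    (hs : (Gray.map H H).comp Q.mon.sum = P.mon.sum.comp H)
    (hb : ∀ x y, idCell (H.map (P.β.app (Gray.pt x y))) =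
      idCell (Q.β.app (Gray.pt (H.obj x) (H.obj y)))) : PermHom P Q where
  functor := H
  map_unit := hu
  map_sum := hs
  map_β := sameArrow_trans (AllCells _) gen_all (congrArg (fun T => T.toPseudofunctor) hs.symm)
    (congrArg (fun T => T.toPseudofunctor) (show ((Gray.swap C C).comp P.mon.sum).comp H =
        (Gray.map H H).comp ((Gray.swap D D).comp Q.mon.sum) by
      rw [strict_assoc, ← hs, ← strict_assoc, ← Gray.map_swap, strict_assoc]))
    (fun w _ => isId₂_whiskerR_strict H ((P.natural w).map H.toPseudofunctor))
    (fun w _ => Q.natural ((Gray.map H H).map w))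
    (by
      rintro ⟨⟨⟨x, y⟩⟩⟩
      exact sameArrow_iff.2 (hb x y))

/-- The strict functor of quasi-strict structures of a strict functor of permutative structures. -/
def PermHom.quasiStrict {P : Permutative C} {Q : Permutative D} (F : PermHom P Q) :
    QuasiStrictHom P.quasiStrict Q.quasiStrict :=
  .ofComponents F.functor F.map_unit ((Gray.map_comp_iff _ _ _).1 F.map_sum) fun x y =>
    (idCell_map F.functor.toPseudofunctor (P.quasiStrict_app x y)).trans
      ((sameArrow_iff.1 (F.map_β.app (Gray.pt x y))).trans (Q.quasiStrict_app _ _).symm)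

/-- The strict functor of permutative structures of a strict functor of quasi-strict structures. -/
def QuasiStrictHom.permutative {P : QuasiStrict C} {Q : QuasiStrict D} (F : QuasiStrictHom P Q) :
    PermHom P.permutative Q.permutative :=
  .ofComponents F.functor F.map_unit ((Gray.map_comp_iff _ _ _).2 (by
    have h := F.map_sum
    -- The sums have to be displayed as restrictions of the sums on the Gray tensor products.
    rw [← Gray.cub_lift P.mon.cubical, ← Gray.cub_lift Q.mon.cubical] at h
    exact h)) fun x y =>
    (idCell_map F.functor.toPseudofunctor (P.permutative_app x y)).trans
      ((sameArrow_iff.1 (F.map_b.app (x, y))).trans (Q.permutative_app _ _).symm)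

lemma PermHom.heq {P P' : Permutative C} {Q Q' : Permutative D} (hP : P = P') (hQ : Q = Q')
    {F : PermHom P Q} {F' : PermHom P' Q'} (h : F.functor = F'.functor) : HEq F F' := by
  subst hP hQ
  exact heq_of_eq (PermHom.ext h)

lemma QuasiStrictHom.heq {P P' : QuasiStrict C} {Q Q' : QuasiStrict D} (hP : P = P') (hQ : Q = Q')
    {F : QuasiStrictHom P Q} {F' : QuasiStrictHom P' Q'} (h : F.functor = F'.functor) :
    HEq F F' := by
  subst hP hQ
  exact heq_of_eq (QuasiStrictHom.ext h)

end Functors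

/-! ### The isomorphism of categories -/

/-- The functor from permutative Gray-monoids to quasi-strict symmetric monoidal 2-categories. -/
def PGM.toQSSM2Cat : PGM.{u} ⥤ QSSM2Cat.{u} where
  obj C := { toTwoCat := C.toTwoCat, str := C.str.quasiStrict }
  map {C D} F := PermHom.quasiStrict (P := C.str) (Q := D.str) F
  map_id _ := QuasiStrictHom.ext rfl
  map_comp _ _ := QuasiStrictHom.ext rfl

/-- The functor from quasi-strict symmetric monoidal 2-categories to permutative Gray-monoids. -/
def QSSM2Cat.toPGM : QSSM2Cat.{u} ⥤ PGM.{u} where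
  obj C := { toTwoCat := C.toTwoCat, str := C.str.permutative }
  map {C D} F := QuasiStrictHom.permutative (P := C.str) (Q := D.str) F
  map_id _ := PermHom.ext rfl
  map_comp _ _ := PermHom.ext rfl

lemma PGM.toQSSM2Cat_toPGM : PGM.toQSSM2Cat.{u} ⋙ QSSM2Cat.toPGM.{u} = 𝟭 PGM.{u} :=
  CategoryTheory.Functor.hext
    (fun C => congrArg (fun s => ({ toTwoCat := C.toTwoCat, str := s } : PGM.{u}))
      C.str.quasiStrict_permutative)
    fun C D F => PermHom.heq C.str.quasiStrict_permutative D.str.quasiStrict_permutative rfl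

lemma QSSM2Cat.toPGM_toQSSM2Cat :
    QSSM2Cat.toPGM.{u} ⋙ PGM.toQSSM2Cat.{u} = 𝟭 QSSM2Cat.{u} :=
  CategoryTheory.Functor.hext
    (fun C => congrArg (fun s => ({ toTwoCat := C.toTwoCat, str := s } : QSSM2Cat.{u}))
      C.str.permutative_quasiStrict)
    fun C D F => QuasiStrictHom.heq C.str.permutative_quasiStrict D.str.permutative_quasiStrict rfl

end GrayPerm

theorem mainTheorem9 :
    ∃ (Φ : GrayPerm.PGM.{u} ⥤ GrayPerm.QSSM2Cat.{u}) (Ψ : GrayPerm.QSSM2Cat.{u} ⥤ GrayPerm.PGM.{u}),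
      Φ ⋙ Ψ = 𝟭 GrayPerm.PGM.{u} ∧ Ψ ⋙ Φ = 𝟭 GrayPerm.QSSM2Cat.{u} ∧
        Φ ⋙ GrayPerm.QSSM2Cat.forget = GrayPerm.PGM.forget :=
  ⟨GrayPerm.PGM.toQSSM2Cat, GrayPerm.QSSM2Cat.toPGM, GrayPerm.PGM.toQSSM2Cat_toPGM,
    GrayPerm.QSSM2Cat.toPGM_toQSSM2Cat, rfl⟩
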